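/- Let $d\ge 3$, $N=2^{\lfloor (d+1)/2\rfloor}$, and let $\alpha_1,\dots,\alpha_d,\beta$ be Hermitian $N\times N$ matrices with $\alpha_j\alpha_k+\alpha_k\alpha_j=2\delta_{jk}I$, $\alpha_j\beta+\beta\alpha_j=0$, $\beta^2=I$. Let $H_D=-i\sum_{j=1}^d\alpha_j\partial_j$ be the massless ($m=0$) Dirac operator in $L^2(\mathbb R^d;\mathbb C^N)$. Matrices carry the operator norm $|\cdot|$, and for a $d$-tuple $B=(B_1,\dots,B_d)$ of $N\times N$ matrices $|B|$ denotes the norm of the operator $\mathbb C^N\to\mathbb C^d\otimes\mathbb C^N$, $v\mapsto (B_1v,\dots,B_dv)$; in particular $|\nabla V|=|(\partial_1V,\dots,\partial_dV)|$. Say that $V:\mathbb R^d\to\mathbb C^{N\times N}$ satisfies (HS) if $V$ is Hermitian-valued, $V\in C^\infty(\mathbb R^d\setminus\{0\})$, $V$ is bounded outside any ball centred at the origin, $H_D+V$ maps $C_c^\infty(\mathbb R^d;\mathbb C^N)$ into $L^2$ and is essentially self-adjoint there, and the domain of its self-adjoint closure, again denoted $H_D+V$, is contained in $H^1(\mathbb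 R^d;\mathbb C^N)$. (a) Let $V$ satisfy (HS), and suppose that there are constants $C_1,C_2>0$ such that, for all $x\neq0$ and all $j=1,\dots,d$, $$|\nabla V(x)|\le\frac{C_1}{|x|^2},\qquad |[\alpha_j,V(x)]|\le\frac{C_2}{|x|},\qquad \frac{4C_1}{d-2}+C_2<1 .$$ If $d$ is odd and $d\ge5$, suppose in addition that at least one of the following holds: $V(x)$ tends to a constant multiple of the identity matrix as $|x|\to\infty$; or the tuple of commutators satisfies $|([\alpha_1,V(x)],\dots,[\alpha_d,V(x)])|\le C_2/|x|$ for all $x\ne0$. Then the point spectrum is empty: $\sigma_p(H_D+V)=\varnothing$. (b) Electrostatic Coulomb potentials $V(x)=-\frac{\nu}{|x|}I$ with $\nu\in\mathbb R$ are covered when $\frac{4|\nu|}{d-2}<1$: they satisfy (HS), $|\nabla V(x)|\le|\nu|/|x|^2$ and $[\alpha_j,V(x)]=0$ for all $x\neq0$ and all $j$, and $\sigma_p(H_D+V)=\varnothing$. -/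

import Mathlib

open MeasureTheory Filter Topology Bornology
open scoped ContDiff

noncomputable section

/-- Physical space `ℝ^d` with its Euclidean norm. -/
abbrev Space (d : ℕ) : Type := EuclideanSpace ℝ (Fin d)

/-- The number `N = 2^⌊(d+1)/2⌋` of spinor components. -/
abbrev spinorDim (d : ℕ) : ℕ := 2 ^ ((d + 1) / 2)

/-- The space `ℂ^N` of spinors with its Hermitian norm. -/
abbrev Spinor (d : ℕ) : Type := EuclideanSpace ℂ (Fin (spinorDim d))

/-- Complex `N × N` matrices. -/
abbrev SpinMatrix (d : ℕ) : Type := Matrix (Fin (spinorDim d)) (Fin (spinorDim d)) ℂ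

/-- The Hilbert space `L²(ℝ^d; ℂ^N)`. -/
abbrev SpinorL2 (d : ℕ) : Type := Lp (Spinor d) 2 (volume : Measure (Space d))

/-- The `j`-th vector of the standard basis of `ℝ^d`. -/
def coordVec {d : ℕ} (j : Fin d) : Space d := EuclideanSpace.single j 1

/-- `α_1, …, α_d, β` are Hermitian matrices on `ℂ^N` satisfying the Clifford relations
`{α_j, α_k} = 2 δ_{jk}`, `{α_j, β} = 0`, `β² = 1`. -/
structure IsDiracMatrices {d : ℕ} (α : Fin d → SpinMatrix d) (β : SpinMatrix d) : Prop where
  hermitian_alpha : ∀ j, (α j).IsHermitian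
  hermitian_beta : β.IsHermitian
  anticomm : ∀ j k, α j * α k + α k * α j = if j = k then 2 else 0
  anticomm_beta : ∀ j, α j * β + β * α j = 0
  beta_sq : β * β = 1

/-- The test spinors `C_c^∞(ℝ^d; ℂ^N)`. -/
def IsTestSpinor {d : ℕ} (ψ : Space d → Spinor d) : Prop :=
  ContDiff ℝ ∞ ψ ∧ HasCompactSupport ψ

/-- The differential expression `(H_D + V) ψ = -i ∑_j α_j ∂_j ψ + m β ψ + V ψ`, evaluated
pointwise. -/
def diracExpr {d : ℕ} (α : Fin d → SpinMatrix d) (β : SpinMatrix d) (m : ℝ)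
    (V : Space d → SpinMatrix d) (ψ : Space d → Spinor d) (x : Space d) : Spinor d :=
  (-Complex.I) • (∑ j, Matrix.toEuclideanLin (α j) (fderiv ℝ ψ x (coordVec j)))
    + (m : ℂ) • Matrix.toEuclideanLin β (ψ x) + Matrix.toEuclideanLin (V x) (ψ x)

lemma IsTestSpinor.zero {d : ℕ} : IsTestSpinor (0 : Space d → Spinor d) :=
  ⟨contDiff_const, HasCompactSupport.zero⟩

lemma IsTestSpinor.add {d : ℕ} {ψ φ : Space d → Spinor d} (hψ : IsTestSpinor ψ)
    (hφ : IsTestSpinor φ) : IsTestSpinor (ψ + φ) :=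
  ⟨hψ.1.add hφ.1, hψ.2.add hφ.2⟩

lemma IsTestSpinor.smul {d : ℕ} {ψ : Space d → Spinor d} (c : ℂ) (hψ : IsTestSpinor ψ) :
    IsTestSpinor (c • ψ) :=
  ⟨hψ.1.const_smul c, hψ.2.smul_left (f := fun _ => c)⟩

lemma IsTestSpinor.differentiable {d : ℕ} {ψ : Space d → Spinor d} (hψ : IsTestSpinor ψ) :
    Differentiable ℝ ψ :=
  hψ.1.differentiable (by simp)

lemma diracExpr_zero {d : ℕ} (α : Fin d → SpinMatrix d) (β : SpinMatrix d) (m : ℝ)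
    (V : Space d → SpinMatrix d) : diracExpr α β m V 0 = 0 := by
  funext x
  simp [diracExpr]

lemma diracExpr_add {d : ℕ} (α : Fin d → SpinMatrix d) (β : SpinMatrix d) (m : ℝ)
    (V : Space d → SpinMatrix d) {ψ φ : Space d → Spinor d} (hψ : IsTestSpinor ψ)
    (hφ : IsTestSpinor φ) :
    diracExpr α β m V (ψ + φ) = diracExpr α β m V ψ + diracExpr α β m V φ := by
  funext x
  simp only [diracExpr, Pi.add_apply, fderiv_add (hψ.differentiable x) (hφ.differentiable x),
    add_apply, map_add, Finset.sum_add_distrib, smul_add]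
  abel

lemma diracExpr_smul {d : ℕ} (α : Fin d → SpinMatrix d) (β : SpinMatrix d) (m : ℝ)
    (V : Space d → SpinMatrix d) (c : ℂ) {ψ : Space d → Spinor d} (hψ : IsTestSpinor ψ) :
    diracExpr α β m V (c • ψ) = c • diracExpr α β m V ψ := by
  funext x
  simp only [diracExpr, Pi.smul_apply, fderiv_const_smul (hψ.differentiable x) c,
    smul_apply, map_smul, ← Finset.smul_sum, smul_add]
  rw [smul_comm c (-Complex.I), smul_comm c (m : ℂ)]

/-- The graph of `H_D + V` on test spinors: the pairs in `L² × L²` that are the classes of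
`ψ` and `(H_D + V) ψ` for some test spinor `ψ`. -/
def diracMinimalGraph {d : ℕ} (α : Fin d → SpinMatrix d) (β : SpinMatrix d) (m : ℝ)
    (V : Space d → SpinMatrix d) : Submodule ℂ (SpinorL2 d × SpinorL2 d) where
  carrier := {p | ∃ ψ : Space d → Spinor d, IsTestSpinor ψ ∧
    p.1 =ᵐ[volume] ψ ∧ p.2 =ᵐ[volume] diracExpr α β m V ψ}
  zero_mem' := ⟨0, IsTestSpinor.zero, Lp.coeFn_zero _ _ _, by
    rw [diracExpr_zero]; exact Lp.coeFn_zero _ _ _⟩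
  add_mem' := by
    rintro p q ⟨ψ, hψ, h1, h2⟩ ⟨φ, hφ, h3, h4⟩
    refine ⟨ψ + φ, hψ.add hφ, (Lp.coeFn_add _ _).trans (h1.add h3), ?_⟩
    rw [diracExpr_add α β m V hψ hφ]
    exact (Lp.coeFn_add _ _).trans (h2.add h4)
  smul_mem' := by
    rintro c p ⟨ψ, hψ, h1, h2⟩
    refine ⟨c • ψ, hψ.smul c, (Lp.coeFn_smul _ _).trans (h1.const_smul c), ?_⟩
    rw [diracExpr_smul α β m V c hψ]
    exact (Lp.coeFn_smul _ _).trans (h2.const_smul c)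

/-- The relation `diracMinimalGraph` is single valued, so that it is the graph of an operator. -/
lemma diracMinimalGraph_functional {d : ℕ} (α : Fin d → SpinMatrix d) (β : SpinMatrix d) (m : ℝ)
    (V : Space d → SpinMatrix d) (p : SpinorL2 d × SpinorL2 d)
    (hp : p ∈ diracMinimalGraph α β m V) (h0 : p.1 = 0) : p.2 = 0 := by
  obtain ⟨ψ, hψ, h1, h2⟩ := hp
  rw [h0] at h1
  have hz : ψ = 0 :=
    (Continuous.ae_eq_iff_eq volume hψ.1.continuous continuous_zero).1
      (h1.symm.trans (Lp.coeFn_zero _ _ _))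
  rw [hz, diracExpr_zero] at h2
  exact Lp.ext (h2.trans (Lp.coeFn_zero _ _ _).symm)

/-- `H_D + V` as an unbounded operator in `L²(ℝ^d; ℂ^N)` with domain the test spinors. -/
def diracMinimal {d : ℕ} (α : Fin d → SpinMatrix d) (β : SpinMatrix d) (m : ℝ)
    (V : Space d → SpinMatrix d) : SpinorL2 d →ₗ.[ℂ] SpinorL2 d :=
  (diracMinimalGraph α β m V).toLinearPMap

/-- The Hamiltonian `H = H_D + V`: the closure of its restriction to test spinors. When that
restriction is essentially self-adjoint, this is its unique self-adjoint extension. -/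
def diracHamiltonian {d : ℕ} (α : Fin d → SpinMatrix d) (β : SpinMatrix d) (m : ℝ)
    (V : Space d → SpinMatrix d) : SpinorL2 d →ₗ.[ℂ] SpinorL2 d :=
  (diracMinimal α β m V).closure

/-- The Sobolev space `H¹(ℝ^d; ℂ^N)`: the classes in `L²` whose weak first order partial
derivatives are in `L²`. -/
def MemH1 {d : ℕ} (f : SpinorL2 d) : Prop :=
  ∀ j : Fin d, ∃ g : SpinorL2 d, ∀ η : Space d → ℂ, ContDiff ℝ ∞ η → HasCompactSupport η →
    ∫ x, fderiv ℝ η x (coordVec j) • f x = -∫ x, η x • g x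

/-- The standing assumption in the stationary setting: `V` is a Hermitian matrix potential, smooth
away from the origin and bounded outside any ball containing the origin, `H_D + V` is an operator
in `L²` with domain the test spinors, it is essentially self-adjoint there, and the domain of its
self-adjoint closure is contained in `H¹`. -/
structure StationaryAssumption {d : ℕ} (α : Fin d → SpinMatrix d) (β : SpinMatrix d) (m : ℝ)
    (V : Space d → SpinMatrix d) : Prop where
  hermitian : ∀ x, (V x).IsHermitian
  smooth : ∀ i k, ContDiffOn ℝ ∞ (fun x => V x i k) {0}ᶜ
  bounded : ∀ r : ℝ, 0 < r → ∃ C : ℝ, ∀ x, r ≤ ‖x‖ → ∀ i k, ‖V x i k‖ ≤ C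
  maps_test : ∀ ψ, IsTestSpinor ψ → MemLp (diracExpr α β m V ψ) 2 volume
  closable : (diracMinimal α β m V).IsClosable
  selfAdjoint : IsSelfAdjoint (diracHamiltonian α β m V)
  domain_le : ∀ f ∈ (diracHamiltonian α β m V).domain, MemH1 f

/-- The point spectrum (set of eigenvalues) of an unbounded operator. -/
def pointSpectrum {E : Type*} [AddCommGroup E] [Module ℂ E] (A : E →ₗ.[ℂ] E) : Set ℂ :=
  {z | ∃ ψ : A.domain, (ψ : E) ≠ 0 ∧ A ψ = z • (ψ : E)}

/-- The operator norm of a complex matrix for the Hermitian norms. -/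
def opNorm {ι κ : Type*} [Fintype ι] [Fintype κ] [DecidableEq κ]
    (A : Matrix ι κ ℂ) : ℝ :=
  ‖LinearMap.toContinuousLinearMap (Matrix.toEuclideanLin A)‖

/-- The norm of a `d`-tuple of matrices, as the operator
`ℂ^N → ℂ^d ⊗ ℂ^N`, `v ↦ (B_1 v, …, B_d v)`. -/
def tupleNorm {d : ℕ} (B : Fin d → SpinMatrix d) : ℝ :=
  opNorm (Matrix.of fun (p : Fin d × Fin (spinorDim d)) k => B p.1 p.2 k)

/-- The gradient `∇V(x) = (∂_1 V(x), …, ∂_d V(x))`, a tuple of matrices. -/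
def gradMatrix {d : ℕ} (V : Space d → SpinMatrix d) (x : Space d) : Fin d → SpinMatrix d :=
  fun j => Matrix.of fun i k => fderiv ℝ (fun y => V y i k) x (coordVec j)

/-- The commutator `[A, B] = AB - BA`. -/
def matrixComm {d : ℕ} (A B : SpinMatrix d) : SpinMatrix d := A * B - B * A

/-- The electrostatic Coulomb potential `-ν / |x|` times the identity matrix. -/
def coulombPotential {d : ℕ} (ν : ℝ) (x : Space d) : SpinMatrix d :=
  ((-ν / ‖x‖ : ℝ) : ℂ) • (1 : SpinMatrix d)

/-- `V(x)` tends, as `|x| → ∞`, to a constant multiple of the identity matrix. -/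
def HasScalarLimit {d : ℕ} (V : Space d → SpinMatrix d) : Prop :=
  ∃ c : ℂ, ∀ i k, Tendsto (fun x => V x i k) (cobounded (Space d))
    (𝓝 ((c • (1 : SpinMatrix d)) i k))

end

open scoped RealInnerProductSpace
open Finset (sum_insert sum_sub_distrib sum_neg_distrib univ sum_congr sum_comm sum_add_distrib
  sum_ite_eq mem_univ smul_sum mul_sum sum_const_zero sum_mul_sq_le_sq_mul_sq sum_nonneg sum_le_sum
  sum_mul single_le_sum sum_const card_univ sum_range_succ sum_le_card_nsmul)
open Real (sqrt_sq norm_eq_abs sqrt_nonneg sqrt_pos sqrt_le_sqrt sq_sqrt norm_ofNat sqrt_mul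
  sqrt_le_iff norm_of_nonneg hasDerivAt_sqrt contDiffAt_sqrt sqrt_le_left abs_exp exp_le_exp
  exp_nat_mul sum_mul_le_sqrt_mul_sqrt)

noncomputable section

notation:max "κ[" d "]" => ((d : ℝ) - 2) / 2
notation:max "ε[" n "]" => 1 / ((n : ℝ) + 1)

section TestFunctions

variable {d : ℕ} {F G : Type*} [NormedAddCommGroup F] [NormedSpace ℝ F]
  [NormedAddCommGroup G] [NormedSpace ℝ G]
  {φ : Space d → F} {m : Space d → F →L[ℝ] G} {x : Space d}

/-- Smooth compactly supported functions. -/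
structure IsTest (φ : Space d → F) : Prop where
  smooth : ContDiff ℝ ∞ φ
  compact : HasCompactSupport φ

/-- The partial derivative in the `j`-th coordinate direction. -/
def pd (j : Fin d) (φ : Space d → F) (x : Space d) : F := fderiv ℝ φ x (coordVec j)

/-- The radial derivative `x · ∇`. -/
def rd (φ : Space d → F) (x : Space d) : F := fderiv ℝ φ x x

lemma sum_coordVec (x : Space d) : ∑ j, x j • coordVec j = x := by
  ext i; simp [coordVec, Pi.single_apply]

lemma rd_eq_sum (φ : Space d → F) (x : Space d) : rd φ x = ∑ j, x j • pd j φ x := by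
  simp only [rd, pd]
  conv_lhs => rw [← sum_coordVec x, map_sum]
  simp [sum_coordVec]

namespace IsTest

lemma differentiable (h : IsTest φ) : Differentiable ℝ φ := h.smooth.differentiable (by simp)

lemma continuous (h : IsTest φ) : Continuous φ := h.smooth.continuous

lemma add {ψ : Space d → F} (h : IsTest φ) (k : IsTest ψ) : IsTest (fun x => φ x + ψ x) :=
  ⟨h.smooth.add k.smooth, h.compact.add k.compact⟩

lemma smul_left {m : Space d → ℝ} (hm : ContDiff ℝ ∞ m) (h : IsTest φ) :
    IsTest (fun x => m x • φ x) :=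
  ⟨hm.smul h.smooth, h.compact.smul_left⟩

lemma clm (A : F →L[ℝ] G) (h : IsTest φ) : IsTest (fun x => A (φ x)) :=
  ⟨A.contDiff.comp h.smooth, h.compact.comp_left (map_zero A)⟩

lemma fderiv_apply (h : IsTest φ) {v : Space d → Space d}
    (hv : ContDiff ℝ ∞ v) : IsTest (fun x => fderiv ℝ φ x (v x)) := by
  refine ⟨(h.smooth.fderiv_right (m := ∞) (by simp)).clm_apply hv, ?_⟩
  refine (h.compact.fderiv (𝕜 := ℝ)).mono' fun x hx => ?_
  apply subset_tsupport; simp only [Function.mem_support] at hx ⊢; intro h0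
  exact hx (by simp [h0])

lemma pd (h : IsTest φ) (j : Fin d) : IsTest (pd j φ) := h.fderiv_apply contDiff_const

lemma rd (h : IsTest φ) : IsTest (rd φ) := h.fderiv_apply contDiff_id

lemma sum {ι : Type*} {s : Finset ι} {φ : ι → Space d → F} (h : ∀ i ∈ s, IsTest (φ i)) :
    IsTest (fun x => ∑ i ∈ s, φ i x) := by
  classical
  induction s using Finset.induction_on with
  | empty => exact ⟨by simpa using contDiff_const, (HasCompactSupport.zero : HasCompactSupport (0 : Space d → F))⟩
  | insert a s ha ih =>
    simp only [sum_insert ha]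
    exact (h a (by simp)).add (ih fun i hi => h i (by simp [hi]))

lemma apply_clm [FiniteDimensional ℝ F]
    (hm : ContDiff ℝ ∞ m) (h : IsTest φ) : IsTest (fun x => m x (φ x)) := by
  refine ⟨hm.clm_apply h.smooth, h.compact.mono' fun x hx => subset_tsupport _ ?_⟩
  simp only [Function.mem_support] at hx ⊢; intro h0; exact hx (by simp [h0])

lemma memLp (h : IsTest φ) (p : ENNReal) : MemLp φ p volume :=
  h.continuous.memLp_of_hasCompactSupport h.compact

end IsTest

lemma pd_smul {m : Space d → ℝ} (j : Fin d)
    (hm : DifferentiableAt ℝ m x) (hφ : DifferentiableAt ℝ φ x) :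
    pd j (fun y => m y • φ y) x = m x • pd j φ x + pd j m x • φ x := by
  simp only [pd]; rw [fderiv_fun_smul hm hφ]
  simp

lemma rd_smul {m : Space d → ℝ} (hm : DifferentiableAt ℝ m x) (hφ : DifferentiableAt ℝ φ x) :
    rd (fun y => m y • φ y) x = m x • rd φ x + rd m x • φ x := by
  simp only [rd]; rw [fderiv_fun_smul hm hφ]
  simp

lemma pd_clm_apply (j : Fin d) (hm : DifferentiableAt ℝ m x) (hφ : DifferentiableAt ℝ φ x) :
    pd j (fun y => m y (φ y)) x = m x (pd j φ x) + pd j m x (φ x) := by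
  simp only [pd]; rw [fderiv_clm_apply hm hφ]; simp

lemma rd_clm_apply (hm : DifferentiableAt ℝ m x) (hφ : DifferentiableAt ℝ φ x) :
    rd (fun y => m y (φ y)) x = m x (rd φ x) + rd m x (φ x) := by
  simp only [rd]; rw [fderiv_clm_apply hm hφ]; simp

lemma pd_add {ξ : Space d → F} (j : Fin d)
    (h1 : DifferentiableAt ℝ φ x) (h2 : DifferentiableAt ℝ ξ x) :
    pd j (fun y => φ y + ξ y) x = pd j φ x + pd j ξ x := by
  simp only [pd]; rw [fderiv_fun_add h1 h2]
  simp

lemma pd_const_clm (A : F →L[ℝ] G) (j : Fin d)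
    (h : DifferentiableAt ℝ φ x) : pd j (fun y => A (φ y)) x = A (pd j φ x) := by
  simp only [pd]; rw [fderiv_fun_comp x A.differentiableAt h]
  simp

lemma pd_sum {ι : Type*} {s : Finset ι} {φ : ι → Space d → F} (j : Fin d)
    (h : ∀ i ∈ s, DifferentiableAt ℝ (φ i) x) :
    pd j (fun y => ∑ i ∈ s, φ i y) x = ∑ i ∈ s, pd j (φ i) x := by
  simp only [pd]; rw [fderiv_fun_sum h]
  simp

lemma hasFDerivAt_coord (i : Fin d) (x : Space d) :
    HasFDerivAt (fun y : Space d => y i) (EuclideanSpace.proj i : Space d →L[ℝ] ℝ) x :=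
  (EuclideanSpace.proj i : Space d →L[ℝ] ℝ).hasFDerivAt

lemma pd_coord (i j : Fin d) (x : Space d) :
    pd j (fun y : Space d => y i) x = if i = j then 1 else 0 := by
  simp [pd, (hasFDerivAt_coord i x).fderiv, coordVec, Pi.single_apply]

lemma contDiff_coord (i : Fin d) {n : WithTop ℕ∞} : ContDiff ℝ n (fun y : Space d => y i) :=
  (EuclideanSpace.proj i : Space d →L[ℝ] ℝ).contDiff

end TestFunctions

section InnerTest

variable {d : ℕ} {F : Type*} [NormedAddCommGroup F] [InnerProductSpace ℝ F]
  {φ ξ : Space d → F}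

lemma integrable_inner_compact (hφ : Continuous φ) (hξ : Continuous ξ)
    (h : HasCompactSupport φ ∨ HasCompactSupport ξ) :
    Integrable (fun x => ⟪φ x, ξ x⟫) := by
  refine (hφ.inner hξ).integrable_of_hasCompactSupport ?_
  rcases h with h | h
  · refine h.mono' fun x hx => subset_tsupport _ ?_
    simp only [Function.mem_support] at hx ⊢; intro h0; exact hx (by simp [h0])
  · refine h.mono' fun x hx => subset_tsupport _ ?_
    simp only [Function.mem_support] at hx ⊢; intro h0; exact hx (by simp [h0])

lemma IsTest.integrable_left (hφ : IsTest φ) (hξ : Continuous ξ) : Integrable (fun x => ⟪φ x, ξ x⟫) :=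
  integrable_inner_compact hφ.continuous hξ (Or.inl hφ.compact)

lemma IsTest.integrable_right (hξ : IsTest ξ) (hφ : Continuous φ) : Integrable (fun x => ⟪φ x, ξ x⟫) :=
  integrable_inner_compact hφ hξ.continuous (Or.inr hξ.compact)

lemma integral_inner_pd (hφ : ContDiff ℝ 1 φ) (hξ : ContDiff ℝ 1 ξ)
    (h : HasCompactSupport φ ∨ HasCompactSupport ξ) (j : Fin d) :
    ∫ x, ⟪φ x, pd j ξ x⟫ = -∫ x, ⟪pd j φ x, ξ x⟫ := by
  have c1 : Continuous (fun x => fderiv ℝ φ x (coordVec j)) :=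
    (hφ.continuous_fderiv (by simp)).clm_apply continuous_const
  have c2 : Continuous (fun x => fderiv ℝ ξ x (coordVec j)) :=
    (hξ.continuous_fderiv (by simp)).clm_apply continuous_const
  have s1 : HasCompactSupport φ → HasCompactSupport (fun x => fderiv ℝ φ x (coordVec j)) :=
    fun h => h.fderiv_apply ℝ (coordVec j)
  have s2 : HasCompactSupport ξ → HasCompactSupport (fun x => fderiv ℝ ξ x (coordVec j)) :=
    fun h => h.fderiv_apply ℝ (coordVec j)
  exact integral_bilinear_fderiv_right_eq_neg_left_of_integrable (B := innerSL ℝ)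
    (integrable_inner_compact c1 hξ.continuous (h.imp_left s1))
    (integrable_inner_compact hφ.continuous c2 (h.imp_right s2))
    (integrable_inner_compact hφ.continuous hξ.continuous h)
    (fun x _ => hφ.differentiable (by simp) x) (fun x _ => hξ.differentiable (by simp) x)

lemma integral_inner_rd (hφ : ContDiff ℝ 1 φ) (hξ : ContDiff ℝ 1 ξ)
    (h : HasCompactSupport φ ∨ HasCompactSupport ξ) :
    ∫ x, ⟪φ x, rd ξ x⟫ = -(∫ x, ⟪rd φ x, ξ x⟫) - d * ∫ x, ⟪φ x, ξ x⟫ := by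
  have c1 (j) : Continuous (pd j φ) := (hφ.continuous_fderiv (by simp)).clm_apply continuous_const
  have c2 (j) : Continuous (pd j ξ) := (hξ.continuous_fderiv (by simp)).clm_apply continuous_const
  have s1 (j) : HasCompactSupport φ → HasCompactSupport (pd j φ) :=
    fun h => h.fderiv_apply ℝ (coordVec j)
  have s2 (j) : HasCompactSupport ξ → HasCompactSupport (pd j ξ) :=
    fun h => h.fderiv_apply ℝ (coordVec j)
  have cc (j : Fin d) : Continuous (fun x : Space d => x j) := (contDiff_coord j (n := 0)).continuous
  have i1 (j : Fin d) : Integrable (fun x => x j * ⟪φ x, pd j ξ x⟫) := by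
    have := integrable_inner_compact (φ := fun x => x j • φ x) ((cc j).smul hφ.continuous) (c2 j)
      (h.imp (fun h => h.smul_left) (s2 j))
    simpa [real_inner_smul_left] using this
  have i2 (j : Fin d) : Integrable (fun x => x j * ⟪pd j φ x, ξ x⟫) := by
    have := integrable_inner_compact (φ := fun x => x j • pd j φ x) ((cc j).smul (c1 j))
      hξ.continuous (h.imp_left fun h => (s1 j h).smul_left)
    simpa [real_inner_smul_left] using this
  have i3 : Integrable (fun x => ⟪φ x, ξ x⟫) :=
    integrable_inner_compact hφ.continuous hξ.continuous h
  have key (j : Fin d) : ∫ x, x j * ⟪φ x, pd j ξ x⟫ =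
      -(∫ x, x j * ⟪pd j φ x, ξ x⟫) - ∫ x, ⟪φ x, ξ x⟫ := by
    have := integral_inner_pd (φ := fun x => x j • φ x) (ξ := ξ) ((contDiff_coord j).smul hφ) hξ
      (h.imp_left fun h => h.smul_left) j
    have e : ∀ x, pd j (fun y : Space d => y j • φ y) x = x j • pd j φ x + φ x := by
      intro x
      rw [pd_smul j (hasFDerivAt_coord j x).differentiableAt (hφ.differentiable (by simp) x)]
      simp [pd_coord]
    simp only [e, real_inner_smul_left, inner_add_left] at this
    rw [integral_add (i2 j) i3] at this; rw [this]; ring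
  have e1 : ∀ x, ⟪φ x, rd ξ x⟫ = ∑ j, x j * ⟪φ x, pd j ξ x⟫ := by
    intro x; simp [rd_eq_sum, inner_sum, real_inner_smul_right]
  have e2 : ∀ x, ⟪rd φ x, ξ x⟫ = ∑ j, x j * ⟪pd j φ x, ξ x⟫ := by
    intro x; simp [rd_eq_sum, sum_inner, real_inner_smul_left]
  simp only [e1, e2]
  rw [integral_finsetSum _ fun j _ => i1 j, integral_finsetSum _ fun j _ => i2 j]
  simp only [key, sum_sub_distrib, sum_neg_distrib]; simp

lemma contDiff_of_contDiffAt_tsupport {E G : Type*} [NormedAddCommGroup E] [NormedSpace ℝ E]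
    [NormedAddCommGroup G] [NormedSpace ℝ G] {f : E → G} {n : WithTop ℕ∞}
    (h : ∀ x ∈ tsupport f, ContDiffAt ℝ n f x) : ContDiff ℝ n f := by
  rw [contDiff_iff_contDiffAt]; intro x
  by_cases hx : x ∈ tsupport f
  · exact h x hx
  · exact (contDiffAt_const (c := (0 : G))).congr_of_eventuallyEq (notMem_tsupport_iff_eventuallyEq.mp hx)

variable {γ : Fin d → F →L[ℝ] F}

/-- Skew operators `γ_j` with `γ_j γ_k + γ_k γ_j = -2 δ_{jk}`. -/
structure IsClifford (γ : Fin d → F →L[ℝ] F) : Prop where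
  skew : ∀ j x y, ⟪γ j x, y⟫ = -⟪x, γ j y⟫
  anticomm : ∀ j k x, γ j (γ k x) + γ k (γ j x) = if j = k then -(2 : ℝ) • x else 0

/-- The Dirac operator `∑ γ_j ∂_j` in terms of a gradient. -/
def diracG (γ : Fin d → F →L[ℝ] F) (g : Fin d → Space d → F) (x : Space d) : F := ∑ j, γ j (g j x)

/-- The Dirac operator `∑ γ_j ∂_j`. -/
def dirac (γ : Fin d → F →L[ℝ] F) (φ : Space d → F) : Space d → F := diracG γ (fun j => pd j φ)

lemma IsTest.dirac (γ : Fin d → F →L[ℝ] F) (h : IsTest φ) : IsTest (dirac γ φ) :=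
  IsTest.sum (s := univ) (φ := fun j x => γ j (_root_.pd j φ x)) fun j _ => (h.pd j).clm (γ j)

lemma pd_comm (h : ContDiff ℝ 2 φ) (j k : Fin d) (x : Space d) :
    pd j (pd k φ) x = pd k (pd j φ) x := by
  have h1 : Differentiable ℝ (fderiv ℝ φ) :=
    (h.fderiv_right (m := 1) (by norm_num)).differentiable (by simp)
  have e : ∀ i l, pd i (pd l φ) x = fderiv ℝ (fderiv ℝ φ) x (coordVec i) (coordVec l) := by
    intro i l
    change fderiv ℝ (fun y => fderiv ℝ φ y (coordVec l)) x (coordVec i) = _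
    rw [fderiv_clm_apply (h1 x) (differentiableAt_const _)]; simp
  rw [e, e]; exact (h.contDiffAt.isSymmSndFDerivAt (by simp)).eq _ _

lemma dirac_dirac (hγ : IsClifford γ)
    (h : IsTest φ) (x : Space d) : dirac γ (dirac γ φ) x = -∑ j, pd j (pd j φ) x := by
  have e : ∀ j, pd j (dirac γ φ) x = ∑ k, γ k (pd j (pd k φ) x) := by
    intro j
    have := pd_sum (s := univ) (φ := fun k y => γ k (pd k φ y)) (x := x) j
      (fun k _ => (((h.pd k).clm (γ k)).differentiable x))
    refine this.trans (sum_congr rfl fun k _ => ?_)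
    exact pd_const_clm (γ k) j ((h.pd k).differentiable x)
  have hs : ∑ j, ∑ k, γ j (γ k (pd j (pd k φ) x)) = ∑ j, ∑ k, γ k (γ j (pd j (pd k φ) x)) := by
    rw [sum_comm]
    refine sum_congr rfl fun j _ => sum_congr rfl fun k _ => ?_
    rw [pd_comm (h.smooth.of_le (by norm_cast))]
  have e2 : dirac γ (dirac γ φ) x = ∑ j, ∑ k, γ j (γ k (pd j (pd k φ) x)) := by
    simp only [dirac, diracG] at e ⊢
    refine sum_congr rfl fun j _ => ?_
    rw [e j, map_sum]
  have h2 : (2 : ℝ) • dirac γ (dirac γ φ) x = -((2 : ℝ) • ∑ j, pd j (pd j φ) x) := by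
    rw [two_smul]
    nth_rw 2 [e2]; rw [hs, e2, ← sum_add_distrib]
    simp only [← sum_add_distrib, hγ.anticomm, sum_ite_eq, mem_univ, if_true]
    simp [smul_sum]
  rw [← smul_neg] at h2; exact smul_right_injective F (two_ne_zero (α := ℝ)) h2

lemma integral_inner_dirac (hγ : IsClifford γ) {ξ : Space d → F}
    (hφ : IsTest φ) (hξ : ContDiff ℝ ∞ ξ) :
    ∫ x, ⟪dirac γ φ x, ξ x⟫ = ∫ x, ⟪φ x, dirac γ ξ x⟫ := by
  have c2 (j) : Continuous (pd j ξ) := (hξ.continuous_fderiv (by simp)).clm_apply continuous_const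
  simp only [dirac, diracG, sum_inner, inner_sum]
  rw [integral_finsetSum, integral_finsetSum]
  · refine sum_congr rfl fun j _ => ?_
    have := integral_inner_pd (φ := fun x => γ j (φ x)) (ξ := ξ)
      ((hφ.clm (γ j)).smooth.of_le (by simp)) (hξ.of_le (by simp)) (Or.inl (hφ.clm (γ j)).compact) j
    have e : ∀ x, pd j (fun y => γ j (φ y)) x = γ j (pd j φ x) := fun x =>
      pd_const_clm (γ j) j (hφ.differentiable x)
    simp only [e, hγ.skew j (φ _), integral_neg] at this; linarith
  · intro j _; exact hφ.integrable_left ((γ j).continuous.comp (c2 j))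
  · intro j _; exact ((hφ.pd j).clm (γ j)).integrable_left hξ.continuous

lemma integral_inner_laplacian {ξ : Space d → F} (hφ : IsTest φ) (hξ : IsTest ξ) :
    ∫ x, ⟪(-∑ j, pd j (pd j φ) x), ξ x⟫ = ∑ j, ∫ x, ⟪pd j φ x, pd j ξ x⟫ := by
  have e : ∀ x, ⟪(-∑ j, pd j (pd j φ) x), ξ x⟫ = ∑ j, -⟪pd j (pd j φ) x, ξ x⟫ := by
    intro x; simp [sum_inner, inner_neg_left]
  simp only [e]
  rw [integral_finsetSum]
  · refine sum_congr rfl fun j _ => ?_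
    rw [integral_neg]
    exact (integral_inner_pd ((hφ.pd j).smooth.of_le (by simp)) (hξ.smooth.of_le (by simp))
      (Or.inl (hφ.pd j).compact) j).symm
  · intro j _; exact (hξ.integrable_right ((hφ.pd j).pd j).continuous).neg

lemma integral_dirac_sq (hγ : IsClifford γ)
    (hφ : IsTest φ) : ∫ x, ‖dirac γ φ x‖ ^ 2 = ∑ j, ∫ x, ‖pd j φ x‖ ^ 2 := by
  simp only [← real_inner_self_eq_norm_sq]
  rw [integral_inner_dirac hγ hφ (hφ.dirac γ).smooth, ← integral_inner_laplacian hφ hφ]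
  refine integral_congr_ae (.of_forall fun x => ?_)
  simp only; rw [dirac_dirac hγ hφ, real_inner_comm]

lemma integral_weight_rd (hφ : IsTest φ) {m : Space d → ℝ} (hm : ContDiff ℝ ∞ m) :
    2 * ∫ x, m x * ⟪rd φ x, φ x⟫ = -∫ x, (d * m x + rd m x) * ‖φ x‖ ^ 2 := by
  have hmφ : IsTest (fun x => m x • φ x) := hφ.smul_left hm
  have := integral_inner_rd (φ := φ) (ξ := fun x => m x • φ x) (hφ.smooth.of_le (by simp))
    (hmφ.smooth.of_le (by simp)) (Or.inl hφ.compact)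
  have e : ∀ x, rd (fun y => m y • φ y) x = m x • rd φ x + rd m x • φ x := fun x =>
    rd_smul (hm.differentiable (by simp) x) (hφ.differentiable x)
  have cm : Continuous (rd m) := (hm.continuous_fderiv (by simp)).clm_apply continuous_id
  have i1 : Integrable (fun x => m x * ⟪rd φ x, φ x⟫) := by
    have := hφ.integrable_right (φ := fun x => m x • rd φ x) (hφ.rd.smul_left hm).continuous
    simpa [real_inner_smul_left] using this
  have i2 : Integrable (fun x => rd m x * ‖φ x‖ ^ 2) := by
    have := hφ.integrable_right (φ := fun x => rd m x • φ x) (cm.smul hφ.continuous)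
    simpa [real_inner_smul_left] using this
  have i3 : Integrable (fun x => m x * ‖φ x‖ ^ 2) := by
    have := hφ.integrable_right (φ := fun x => m x • φ x) hmφ.continuous
    simpa [real_inner_smul_left] using this
  simp only [e, inner_add_right, real_inner_smul_right, real_inner_self_eq_norm_sq] at this
  have c : ∀ x, ⟪φ x, rd φ x⟫ = ⟪rd φ x, φ x⟫ := fun x => real_inner_comm _ _
  simp only [c] at this; rw [integral_add i1 i2] at this
  have e3 : ∀ x, (d * m x + rd m x) * ‖φ x‖ ^ 2 = d * (m x * ‖φ x‖ ^ 2) + rd m x * ‖φ x‖ ^ 2 := by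
    intro x; ring
  simp only [e3]; rw [integral_add (i3.const_mul _) i2, integral_const_mul]; linarith

lemma pd_rd (hφ : IsTest φ) (j : Fin d) (x : Space d) :
    pd j (rd φ) x = rd (pd j φ) x + pd j φ x := by
  have h1 : Differentiable ℝ (fderiv ℝ φ) :=
    (hφ.smooth.fderiv_right (m := ∞) (by simp)).differentiable (by simp)
  change fderiv ℝ (fun y => fderiv ℝ φ y y) x (coordVec j) =
    fderiv ℝ (fun y => fderiv ℝ φ y (coordVec j)) x x + _
  rw [fderiv_clm_apply (h1 x) differentiableAt_fun_id,
    fderiv_clm_apply (h1 x) (differentiableAt_const _)]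
  have hsym := ((hφ.smooth.of_le (by norm_cast : (2 : WithTop ℕ∞) ≤ ∞)).contDiffAt (x := x).isSymmSndFDerivAt (by simp)).eq (coordVec j) x
  simp [hsym, add_comm, pd]

lemma contDiff_smul_of_notMem {G : Type*} [NormedAddCommGroup G] [NormedSpace ℝ G]
    {W : Space d → G} {η : Space d → ℝ} (hη : ContDiff ℝ ∞ η)
    (hW : ContDiffOn ℝ ∞ W {0}ᶜ) (h0 : (0 : Space d) ∉ tsupport η) :
    ContDiff ℝ ∞ (fun x => η x • W x) := by
  refine contDiff_of_contDiffAt_tsupport fun x hx => ?_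
  have hx0 : x ≠ 0 := by rintro rfl; exact h0 (tsupport_smul_subset_left η W hx)
  exact hη.contDiffAt.smul (hW.contDiffAt (compl_singleton_mem_nhds hx0))

lemma integral_dirac_virial (hγ : IsClifford γ)
    (hφ : IsTest φ) {η : Space d → ℝ} (hη : ContDiff ℝ ∞ η) :
    2 * ∫ x, ⟪dirac γ φ x, η x • rd φ x + ((d * η x + rd η x) / 2) • φ x⟫ =
      ∫ x, (η x * ⟪φ x, dirac γ φ x⟫ + ⟪φ x, (∑ j, pd j η x • γ j (rd φ x))⟫) := by
  set b : Space d → ℝ := fun x => (d * η x + rd η x) / 2 with hb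
  have hrη : ContDiff ℝ ∞ (rd η) := (hη.fderiv_right (m := ∞) (by simp)).clm_apply contDiff_id
  have hbs : ContDiff ℝ ∞ b := by
    simp only [hb]; exact ((contDiff_const.mul hη).add hrη).div_const _
  -- the cut-off dilation and its skewness
  have skewT : ∀ u v : Space d → F, IsTest u → IsTest v → ∫ x, ⟪u x, η x • rd v x + b x • v x⟫ =
        -∫ x, ⟪η x • rd u x + b x • u x, v x⟫ := by
    intro u v hu hv
    have h1 := integral_inner_rd (φ := fun x => η x • u x) (ξ := v)
      ((hu.smul_left hη).smooth.of_le (by simp)) (hv.smooth.of_le (by simp)) (Or.inr hv.compact)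
    have e : ∀ x, rd (fun y => η y • u y) x = η x • rd u x + rd η x • u x := fun x =>
      rd_smul (hη.differentiable (by simp) x) (hu.differentiable x)
    have i1 : Integrable (fun x => ⟪η x • u x, rd v x⟫) :=
      (hu.smul_left hη).integrable_left hv.rd.continuous
    have i2 : Integrable (fun x => ⟪η x • rd u x, v x⟫) :=
      hv.integrable_right (hu.rd.smul_left hη).continuous
    have i3 : Integrable (fun x => ⟪rd η x • u x, v x⟫) :=
      hv.integrable_right (hu.smul_left hrη).continuous
    have i4 : Integrable (fun x => ⟪η x • u x, v x⟫) :=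
      hv.integrable_right (hu.smul_left hη).continuous
    have i5 : Integrable (fun x => ⟪b x • u x, v x⟫) :=
      hv.integrable_right (hu.smul_left hbs).continuous
    have eb : ∀ x, ⟪b x • u x, v x⟫ =
        (d / 2 : ℝ) * ⟪η x • u x, v x⟫ + (1 / 2) * ⟪rd η x • u x, v x⟫ := by
      intro x; simp only [hb, real_inner_smul_left]; ring
    have e5 : ∫ x, ⟪b x • u x, v x⟫ =
        (d / 2 : ℝ) * (∫ x, ⟪η x • u x, v x⟫) + (1 / 2) * ∫ x, ⟪rd η x • u x, v x⟫ := by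
      simp only [eb]
      rw [integral_add (i4.const_mul _) (i3.const_mul _), integral_const_mul, integral_const_mul]
    have l : ∫ x, ⟪u x, η x • rd v x + b x • v x⟫ =
        (∫ x, ⟪η x • u x, rd v x⟫) + ∫ x, ⟪b x • u x, v x⟫ := by
      rw [← integral_add i1 i5]
      congr 1; funext x
      simp [inner_add_right, real_inner_smul_left, real_inner_smul_right]
    have r : ∫ x, ⟪η x • rd u x + b x • u x, v x⟫ =
        (∫ x, ⟪η x • rd u x, v x⟫) + ∫ x, ⟪b x • u x, v x⟫ := by
      rw [← integral_add i2 i5]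
      congr 1; funext x
      simp [inner_add_left]
    simp only [e, inner_add_left] at h1; rw [integral_add i2 i3] at h1
    rw [l, r, h1, e5]; ring
  set T : Space d → F := fun x => η x • rd φ x + b x • φ x with hT
  have tT : IsTest T := (hφ.rd.smul_left hη).add (hφ.smul_left hbs)
  have tDφ : IsTest (dirac γ φ) := hφ.dirac γ
  -- commutator of the Dirac operator with the dilation
  have comm : ∀ x, ⟪φ x, dirac γ T x⟫ = ⟪φ x, η x • rd (dirac γ φ) x + b x • dirac γ φ x⟫ +
        (η x * ⟪φ x, dirac γ φ x⟫ + ⟪φ x, (∑ j, pd j η x • γ j (rd φ x))⟫) := by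
    intro x
    have z : ∀ j, ⟪φ x, γ j (φ x)⟫ = 0 := by
      intro j
      have := hγ.skew j (φ x) (φ x); rw [real_inner_comm] at this; linarith
    have e1 : ∀ j, pd j T x = η x • pd j (rd φ) x + pd j η x • rd φ x +
        (b x • pd j φ x + pd j b x • φ x) := by
      intro j
      rw [hT, pd_add j ((hφ.rd.smul_left hη).differentiable x) ((hφ.smul_left hbs).differentiable x),
        pd_smul j (hη.differentiable (by simp) x) (hφ.rd.differentiable x),
        pd_smul j (hbs.differentiable (by simp) x) (hφ.differentiable x)]
    have e3 : rd (dirac γ φ) x = ∑ j, γ j (rd (pd j φ) x) := by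
      change fderiv ℝ (fun y => ∑ j, γ j (pd j φ y)) x x = _
      rw [fderiv_fun_sum fun j _ => ((hφ.pd j).clm (γ j)).differentiable x]
      rw [sum_apply]
      refine sum_congr rfl fun j _ => ?_
      rw [fderiv_fun_comp x (γ j).differentiableAt ((hφ.pd j).differentiable x)]
      simp [rd]
    rw [e3]
    simp only [dirac, diracG, e1, pd_rd hφ, map_add, map_smul, inner_sum, inner_add_right,
      real_inner_smul_right, z, mul_zero, add_zero, sum_add_distrib, mul_sum, mul_add,
      sum_const_zero]
    ring
  have i1 : Integrable (fun x => ⟪φ x, η x • rd (dirac γ φ) x + b x • dirac γ φ x⟫) :=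
    hφ.integrable_left ((tDφ.rd.smul_left hη).add (tDφ.smul_left hbs)).continuous
  have i2 : Integrable (fun x => η x * ⟪φ x, dirac γ φ x⟫ +
      ⟪φ x, (∑ j, pd j η x • γ j (rd φ x))⟫) := by
    have hs : ContDiff ℝ ∞ (fun x => ∑ j, pd j η x • γ j (rd φ x)) :=
      ContDiff.sum fun j _ => ((hη.fderiv_right (m := ∞) (by simp)).clm_apply contDiff_const).smul
        ((hφ.rd.clm (γ j)).smooth)
    have a1 := tDφ.integrable_right (φ := fun x => η x • φ x) (hφ.smul_left hη).continuous
    simp only [real_inner_smul_left] at a1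
    exact a1.add (hφ.integrable_left hs.continuous)
  have h0 := skewT (dirac γ φ) φ tDφ hφ
  have h1 := integral_inner_dirac hγ hφ tT.smooth
  have h2 := skewT φ (dirac γ φ) hφ tDφ
  have h3 : ∫ x, ⟪φ x, dirac γ T x⟫ = (∫ x, ⟪φ x, η x • rd (dirac γ φ) x + b x • dirac γ φ x⟫) +
      ∫ x, (η x * ⟪φ x, dirac γ φ x⟫ + ⟪φ x, (∑ j, pd j η x • γ j (rd φ x))⟫) := by
    rw [← integral_add i1 i2]; exact integral_congr_ae (.of_forall comm)
  have h4 : ∫ x, ⟪η x • rd φ x + b x • φ x, dirac γ φ x⟫ = ∫ x, ⟪dirac γ φ x, T x⟫ := by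
    congr 1; funext x; exact real_inner_comm _ _
  have h5 : ∫ x, ⟪dirac γ φ x, η x • rd φ x + b x • φ x⟫ = ∫ x, ⟪dirac γ φ x, T x⟫ := rfl
  rw [h5]; linarith

lemma integral_potential_virial {χ : Space d → F} (hφ : IsTest φ) (hχ : IsTest χ)
    {W : Space d → F →L[ℝ] F} {η : Space d → ℝ} (hη : ContDiff ℝ ∞ η)
    (hW : ContDiffOn ℝ ∞ W {0}ᶜ) (h0 : (0 : Space d) ∉ tsupport η) :
    ∫ x, (η x * ⟪rd φ x, W x (χ x)⟫ + η x * ⟪φ x, W x (rd χ x)⟫ +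
      η x * ⟪φ x, rd W x (χ x)⟫ + (d * η x + rd η x) * ⟪φ x, W x (χ x)⟫) = 0 := by
  set M : Space d → F →L[ℝ] F := fun x => η x • W x with hM
  have hMs : ContDiff ℝ ∞ M := contDiff_smul_of_notMem hη hW h0
  have hMW : ∀ x v, rd M x v = η x • rd W x v + rd η x • W x v := by
    intro x v
    by_cases hx : x ∈ tsupport η
    · have hx0 : x ≠ 0 := by rintro rfl; exact h0 hx
      rw [hM, rd_smul (hη.differentiable (by simp) x)
        ((hW.contDiffAt (compl_singleton_mem_nhds hx0)).differentiableAt (by simp))]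
      simp
    · have e1 : η =ᶠ[𝓝 x] 0 := notMem_tsupport_iff_eventuallyEq.mp hx
      have e2 : M =ᶠ[𝓝 x] fun _ => 0 := by filter_upwards [e1] with y hy; simp [hM, hy]
      simp [rd, e2.fderiv_eq, e1.fderiv_eq, e1.eq_of_nhds]
  have hMχ : IsTest (fun x => M x (χ x)) :=
    ⟨hMs.clm_apply hχ.smooth, hχ.compact.mono' fun x hx => subset_tsupport _ (by
      simp only [Function.mem_support] at hx ⊢; intro h; exact hx (by simp [h]))⟩
  have h1 := integral_inner_rd (φ := φ) (ξ := fun x => M x (χ x)) (hφ.smooth.of_le (by simp))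
    (hMχ.smooth.of_le (by simp)) (Or.inl hφ.compact)
  have i1 : Integrable (fun x => ⟪φ x, rd (fun x => M x (χ x)) x⟫) :=
    hφ.integrable_left hMχ.rd.continuous
  have i2 : Integrable (fun x => ⟪rd φ x, M x (χ x)⟫) := hMχ.integrable_right hφ.rd.continuous
  have i3 : Integrable (fun x => ⟪φ x, M x (χ x)⟫) := hφ.integrable_left hMχ.continuous
  have h2 : ∫ x, (⟪φ x, rd (fun x => M x (χ x)) x⟫ + ⟪rd φ x, M x (χ x)⟫ +
      d * ⟪φ x, M x (χ x)⟫) = 0 := by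
    have i12 : Integrable (fun x => ⟪φ x, rd (fun x => M x (χ x)) x⟫ +
      ⟪rd φ x, M x (χ x)⟫) := i1.add i2
    rw [integral_add i12 (i3.const_mul _), integral_add i1 i2, integral_const_mul, h1]
    ring
  rw [← h2]
  congr 1; funext x
  rw [rd_clm_apply (hMs.differentiable (by simp) x) (hχ.differentiable x)]; rw [hMW]
  simp only [hM, FunLike.coe_smul, Pi.smul_apply, inner_add_right, real_inner_smul_right]
  ring

end InnerTest

section L2Convergence

variable {d : ℕ} {F G : Type*} [NormedAddCommGroup F] [InnerProductSpace ℝ F]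
  [NormedAddCommGroup G] [InnerProductSpace ℝ G]
  {g g' u v : Space d → F} {f f' : ℕ → Space d → F}

/-- Convergence in `L²` of a sequence of functions. -/
structure L2Conv (f : ℕ → Space d → F) (g : Space d → F) : Prop where
  memLp : ∀ n, MemLp (f n) 2
  memLp_lim : MemLp g 2
  tendsto : Tendsto (fun n => eLpNorm (fun x => f n x - g x) 2 volume) atTop (𝓝 0)

namespace L2Conv

lemma const (h : MemLp g 2) : L2Conv (fun _ => g) g := ⟨fun _ => h, h, by simp⟩

lemma tendsto_toLp (h : L2Conv f g) :
    Tendsto (fun n => (h.memLp n).toLp (f n)) atTop (𝓝 (h.memLp_lim.toLp g)) := by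
  rw [Lp.tendsto_Lp_iff_tendsto_eLpNorm'']; exact h.tendsto

lemma of_tendsto_toLp (h1 : ∀ n, MemLp (f n) 2) (h2 : MemLp g 2)
    (h : Tendsto (fun n => (h1 n).toLp (f n)) atTop (𝓝 (h2.toLp g))) : L2Conv f g := by
  rw [Lp.tendsto_Lp_iff_tendsto_eLpNorm''] at h; exact ⟨h1, h2, h⟩

lemma of_bound {f' : ℕ → Space d → G} {g' : Space d → G}
    (h : L2Conv f g) (C : ℝ) (hf : ∀ n, MemLp (f' n) 2) (hg : MemLp g' 2)
    (hb : ∀ n, ∀ᵐ x, ‖f' n x - g' x‖ ≤ C * ‖f n x - g x‖) : L2Conv f' g' := by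
  refine ⟨hf, hg, ?_⟩
  have : Tendsto (fun n => ENNReal.ofReal C * eLpNorm (fun x => f n x - g x) 2 volume) atTop
      (𝓝 (ENNReal.ofReal C * 0)) := ENNReal.Tendsto.const_mul h.tendsto (Or.inr ENNReal.ofReal_ne_top)
  rw [mul_zero] at this
  exact tendsto_of_tendsto_of_tendsto_of_le_of_le tendsto_const_nhds this (fun _ => zero_le)
    fun n => eLpNorm_le_mul_eLpNorm_of_ae_le_mul (hb n) 2

lemma apply_bdd (h : L2Conv f g)
    {A : Space d → F →L[ℝ] G} (hA : AEStronglyMeasurable A) {C : ℝ} (hC : ∀ x, ‖A x‖ ≤ C) :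
    L2Conv (fun n x => A x (f n x)) (fun x => A x (g x)) := by
  have hb : ∀ (u : Space d → F), MemLp u 2 → MemLp (fun x => A x (u x)) 2 := by
    intro u hu
    have hm : AEStronglyMeasurable (fun x => A x (u x)) :=
      (ContinuousLinearMap.apply ℝ G : F →L[ℝ] (F →L[ℝ] G) →L[ℝ] G).flip.aestronglyMeasurable_comp₂
        hA hu.1
    exact hu.of_le_mul (c := C) hm (.of_forall fun x =>
      (A x).le_of_opNorm_le (hC x) (u x))
  refine h.of_bound C (fun n => hb _ (h.memLp n)) (hb _ h.memLp_lim) fun n =>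
    .of_forall fun x => ?_
  rw [← map_sub]; exact (A x).le_of_opNorm_le (hC x) _

lemma clm (h : L2Conv f g) (A : F →L[ℝ] G) : L2Conv (fun n x => A (f n x)) (fun x => A (g x)) :=
  h.apply_bdd (A := fun _ => A) aestronglyMeasurable_const (C := ‖A‖) fun _ => le_rfl

lemma smul_bdd (h : L2Conv f g)
    {m : Space d → ℝ} (hm : AEStronglyMeasurable m) {C : ℝ} (hC : ∀ x, |m x| ≤ C) :
    L2Conv (fun n x => m x • f n x) (fun x => m x • g x) := by
  have hb : ∀ (u : Space d → F), MemLp u 2 → MemLp (fun x => m x • u x) 2 := by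
    intro u hu; refine hu.of_le_mul (c := C) (hm.smul hu.1) (.of_forall fun x => ?_)
    rw [norm_smul]; exact mul_le_mul_of_nonneg_right (hC x) (norm_nonneg _)
  refine h.of_bound C (fun n => hb _ (h.memLp n)) (hb _ h.memLp_lim) fun n =>
    .of_forall fun x => ?_
  rw [← smul_sub, norm_smul]; exact mul_le_mul_of_nonneg_right (hC x) (norm_nonneg _)

lemma smul_compact (h : L2Conv f g)
    {m : Space d → ℝ} (hm : Continuous m) (hc : HasCompactSupport m) :
    L2Conv (fun n x => m x • f n x) (fun x => m x • g x) := by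
  obtain ⟨C, hC⟩ := hc.exists_bound_of_continuous hm
  exact h.smul_bdd hm.aestronglyMeasurable hC

lemma apply_compact (h : L2Conv f g)
    {A : Space d → F →L[ℝ] G} (hm : Continuous A) (hc : HasCompactSupport A) :
    L2Conv (fun n x => A x (f n x)) (fun x => A x (g x)) := by
  obtain ⟨C, hC⟩ := hc.exists_bound_of_continuous hm
  exact h.apply_bdd hm.aestronglyMeasurable hC

lemma add (h : L2Conv f g) (h' : L2Conv f' g') :
    L2Conv (fun n x => f n x + f' n x) (fun x => g x + g' x) := by
  refine of_tendsto_toLp (fun n => (h.memLp n).add (h'.memLp n)) (h.memLp_lim.add h'.memLp_lim) ?_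
  exact h.tendsto_toLp.add h'.tendsto_toLp

lemma neg (h : L2Conv f g) : L2Conv (fun n x => -f n x) (fun x => -g x) := by
  refine h.of_bound 1 (fun n => (h.memLp n).neg) h.memLp_lim.neg fun n =>
    .of_forall fun x => ?_
  rw [one_mul, ← norm_neg]; exact le_of_eq (congrArg _ (by abel))

lemma sub (h : L2Conv f g) (h' : L2Conv f' g') :
    L2Conv (fun n x => f n x - f' n x) (fun x => g x - g' x) := by
  simpa only [sub_eq_add_neg] using h.add h'.neg

lemma const_smul (h : L2Conv f g) (c : ℝ) : L2Conv (fun n x => c • f n x) (fun x => c • g x) :=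
  h.smul_bdd (m := fun _ => c) aestronglyMeasurable_const (C := |c|) fun _ => le_rfl

lemma zero : L2Conv (fun (_ : ℕ) (_ : Space d) => (0 : F)) (fun _ => 0) :=
  const (MemLp.zero' (μ := volume))

lemma sum {ι : Type*} {s : Finset ι} {f : ι → ℕ → Space d → F} {g : ι → Space d → F}
    (h : ∀ i ∈ s, L2Conv (f i) (g i)) :
    L2Conv (fun n x => ∑ i ∈ s, f i n x) (fun x => ∑ i ∈ s, g i x) := by
  classical
  induction s using Finset.induction_on with
  | empty => simpa using zero
  | insert a s ha ih =>
    simp only [sum_insert ha]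
    exact (h a (by simp)).add (ih fun i hi => h i (by simp [hi]))

lemma congr (h : L2Conv f g)
    (h1 : ∀ n, f n =ᵐ[volume] f' n) (h2 : g =ᵐ[volume] g') : L2Conv f' g' := by
  refine h.of_bound 1 (fun n => (memLp_congr_ae (h1 n)).1 (h.memLp n))
    ((memLp_congr_ae h2).1 h.memLp_lim) fun n => ?_
  filter_upwards [h1 n, h2] with x e1 e2; rw [e1, e2, one_mul]

lemma inner_eq_toLp (hu : MemLp u 2) (hv : MemLp v 2) :
    ∫ x, ⟪u x, v x⟫ = ⟪hu.toLp u, hv.toLp v⟫ := by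
  rw [L2.inner_def]
  refine integral_congr_ae ?_
  filter_upwards [hu.coeFn_toLp, hv.coeFn_toLp] with x e1 e2; rw [e1, e2]

lemma inner (h : L2Conv f g) (h' : L2Conv f' g') :
    Tendsto (fun n => ∫ x, ⟪f n x, f' n x⟫) atTop (𝓝 (∫ x, ⟪g x, g' x⟫)) := by
  rw [inner_eq_toLp h.memLp_lim h'.memLp_lim]
  simp only [inner_eq_toLp (h.memLp _) (h'.memLp _)]
  exact h.tendsto_toLp.inner h'.tendsto_toLp

lemma norm_sq (h : L2Conv f g) :
    Tendsto (fun n => ∫ x, ‖f n x‖ ^ 2) atTop (𝓝 (∫ x, ‖g x‖ ^ 2)) := by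
  simpa only [real_inner_self_eq_norm_sq] using h.inner h

lemma comp (h : L2Conv f g) {k : ℕ → ℕ}
    (hk : Tendsto k atTop atTop) : L2Conv (fun n => f (k n)) g :=
  ⟨fun n => h.memLp _, h.memLp_lim, h.tendsto.comp hk⟩

lemma unique (h : L2Conv f g) (h' : L2Conv f g') : g =ᵐ[volume] g' := by
  have := tendsto_nhds_unique h.tendsto_toLp h'.tendsto_toLp
  exact (MemLp.toLp_eq_toLp_iff h.memLp_lim h'.memLp_lim).1 this

lemma toLp_norm_sq (hu : MemLp u 2) : ‖hu.toLp u‖ ^ 2 = ∫ x, ‖u x‖ ^ 2 := by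
  rw [← real_inner_self_eq_norm_sq, ← inner_eq_toLp hu hu]
  simp only [real_inner_self_eq_norm_sq]

lemma exists_of_le [CompleteSpace F] {f' : ℕ → Space d → G}
    {g' : Space d → G} (h : L2Conv f' g') (hf : ∀ n, MemLp (f n) 2)
    (hle : ∀ m n, ∫ x, ‖f m x - f n x‖ ^ 2 ≤ ∫ x, ‖f' m x - f' n x‖ ^ 2) :
    ∃ g, L2Conv f g := by
  have hd : ∀ m n, dist ((hf m).toLp (f m)) ((hf n).toLp (f n)) ≤
      dist ((h.memLp m).toLp (f' m)) ((h.memLp n).toLp (f' n)) := by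
    intro m n; rw [dist_eq_norm, dist_eq_norm, ← MemLp.toLp_sub, ← MemLp.toLp_sub]
    refine le_of_sq_le_sq ?_ (norm_nonneg _)
    rw [toLp_norm_sq, toLp_norm_sq]; exact hle m n
  have hc : CauchySeq (fun n => (hf n).toLp (f n)) := by
    have := h.tendsto_toLp.cauchySeq; rw [Metric.cauchySeq_iff] at this ⊢; intro ε hε
    obtain ⟨N, hN⟩ := this ε hε
    exact ⟨N, fun m hm n hn => (hd m n).trans_lt (hN m hm n hn)⟩
  obtain ⟨g, hg⟩ := cauchySeq_tendsto_of_complete hc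
  refine ⟨g, of_tendsto_toLp hf (Lp.memLp g) ?_⟩
  simpa using hg

end L2Conv

lemma integrable_inner (hu : MemLp u 2) (hv : MemLp v 2) : Integrable (fun x => ⟪u x, v x⟫) := by
  have := L2.integrable_inner (𝕜 := ℝ) (hu.toLp u) (hv.toLp v)
  refine this.congr ?_
  filter_upwards [hu.coeFn_toLp, hv.coeFn_toLp] with x e1 e2; rw [e1, e2]

lemma integrable_norm_sq (hu : MemLp u 2) : Integrable (fun x => ‖u x‖ ^ 2) := by
  simpa only [real_inner_self_eq_norm_sq] using integrable_inner hu hu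

lemma memLp_two_of_integrable (hm : AEStronglyMeasurable u)
    (hu : Integrable (fun x => ‖u x‖ ^ 2)) : MemLp u 2 :=
  (memLp_two_iff_integrable_sq_norm hm).2 hu

lemma abs_integral_inner_le (hu : MemLp u 2) (hv : MemLp v 2) :
    |∫ x, inner ℝ (u x) (v x)| ≤ √(∫ x, ‖u x‖ ^ 2) * √(∫ x, ‖v x‖ ^ 2) := by
  rw [L2Conv.inner_eq_toLp hu hv, ← L2Conv.toLp_norm_sq hu, ← L2Conv.toLp_norm_sq hv,
    sqrt_sq (norm_nonneg _), sqrt_sq (norm_nonneg _)]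
  exact abs_real_inner_le_norm _ _

lemma sqrt_integral_norm_add_sq_le (hu : MemLp u 2) (hv : MemLp v 2) :
    √(∫ x, ‖u x + v x‖ ^ 2) ≤ √(∫ x, ‖u x‖ ^ 2) + √(∫ x, ‖v x‖ ^ 2) := by
  have e : ∫ x, ‖u x + v x‖ ^ 2 = ‖(hu.add hv).toLp (u + v)‖ ^ 2 := (L2Conv.toLp_norm_sq _).symm
  rw [e, ← L2Conv.toLp_norm_sq hu, ← L2Conv.toLp_norm_sq hv,
    sqrt_sq (norm_nonneg _), sqrt_sq (norm_nonneg _), sqrt_sq (norm_nonneg _),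
    MemLp.toLp_add]
  exact norm_add_le _ _

/-- Test functions converging to `ψ` in `L²` together with their partial derivatives. -/
structure H1Approx (φ : ℕ → Space d → F) (ψ : Space d → F) (g : Fin d → Space d → F) : Prop where
  test : ∀ n, IsTest (φ n)
  conv : L2Conv φ ψ
  conv_pd : ∀ j, L2Conv (fun n => pd j (φ n)) (g j)

/-- The radial derivative in terms of a gradient. -/
def rdG (g : Fin d → Space d → F) (x : Space d) : F := ∑ j, x j • g j x

lemma rd_eq_rdG (φ : Space d → F) (x : Space d) : rd φ x = rdG (fun j => pd j φ) x := rd_eq_sum φ x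

lemma isTest_dilation {η : Space d → ℝ} (hη : IsTest η) :
    IsTest (fun x => (d * η x + rd η x) / 2) := by
  have e : (fun x => (d * η x + rd η x) / 2) = fun x => (d / 2 : ℝ) • η x + (1 / 2 : ℝ) • rd η x := by
    funext x; simp only [smul_eq_mul]; ring
  rw [e]; exact (hη.smul_left contDiff_const).add (hη.rd.smul_left contDiff_const)

namespace H1Approx

variable {φ : ℕ → Space d → F} {ψ : Space d → F} {g : Fin d → Space d → F}

lemma clm (h : H1Approx φ ψ g) (A : F →L[ℝ] G) :
    H1Approx (fun n x => A (φ n x)) (fun x => A (ψ x)) (fun j x => A (g j x)) := by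
  refine ⟨fun n => (h.test n).clm A, h.conv.clm A, fun j => ?_⟩
  have : (fun n => pd j (fun x => A (φ n x))) = fun n x => A (pd j (φ n) x) := by
    funext n x
    exact pd_const_clm A j ((h.test n).differentiable x)
  rw [this]; exact (h.conv_pd j).clm A

lemma conv_dirac (h : H1Approx φ ψ g) (γ : Fin d → F →L[ℝ] F) :
    L2Conv (fun n => dirac γ (φ n)) (diracG γ g) :=
  L2Conv.sum (s := univ) (f := fun j n x => γ j (pd j (φ n) x)) fun j _ =>
    (h.conv_pd j).clm (γ j)

lemma conv_smul_rd (h : H1Approx φ ψ g) {m : Space d → ℝ} (hm : Continuous m)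
    {C : ℝ} (hC : ∀ x, |m x| * ‖x‖ ≤ C) :
    L2Conv (fun n x => m x • rd (φ n) x) (fun x => m x • rdG g x) := by
  have : ∀ (k : Fin d → Space d → F) (x : Space d), m x • rdG k x = ∑ j, (m x * x j) • k j x := by
    intro k x; simp [rdG, smul_sum, smul_smul]
  simp only [rd_eq_rdG, this]
  refine L2Conv.sum fun j _ => (h.conv_pd j).smul_bdd
    (hm.mul (contDiff_coord j (n := 0)).continuous).aestronglyMeasurable (C := C) fun x => ?_
  rw [abs_mul]
  exact (mul_le_mul_of_nonneg_left (by simpa using PiLp.norm_apply_le x j) (abs_nonneg _)).trans (hC x)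

lemma conv_test_smul_rd (h : H1Approx φ ψ g) {m : Space d → ℝ} (hm : IsTest m) :
    L2Conv (fun n x => m x • rd (φ n) x) (fun x => m x • rdG g x) := by
  obtain ⟨C, hC⟩ := (hm.compact.mul_right (f' := fun x => ‖x‖)).exists_bound_of_continuous
    (hm.continuous.mul continuous_norm)
  refine h.conv_smul_rd hm.continuous (C := C) fun x => ?_
  simpa using hC x

lemma integral_dirac_sq (h : H1Approx φ ψ g) {γ : Fin d → F →L[ℝ] F} (hγ : IsClifford γ) :
    ∫ x, ‖diracG γ g x‖ ^ 2 = ∑ j, ∫ x, ‖g j x‖ ^ 2 := by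
  refine tendsto_nhds_unique (h.conv_dirac γ).norm_sq ?_
  simp only [_root_.integral_dirac_sq hγ (h.test _)]
  exact tendsto_finsetSum _ fun j _ => (h.conv_pd j).norm_sq

lemma dirac_virial (h : H1Approx φ ψ g) {γ : Fin d → F →L[ℝ] F} (hγ : IsClifford γ)
    {η : Space d → ℝ} (hη : IsTest η) :
    2 * ∫ x, ⟪diracG γ g x, η x • rdG g x + ((d * η x + rd η x) / 2) • ψ x⟫ =
      (∫ x, ⟪η x • ψ x, diracG γ g x⟫) + ∑ j, ∫ x, ⟪ψ x, γ j (pd j η x • rdG g x)⟫ := by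
  have hb := isTest_dilation hη
  have l := ((h.conv_dirac γ).inner ((h.conv_test_smul_rd hη).add
    (h.conv.smul_compact hb.continuous hb.compact))).const_mul 2
  have r1 := (h.conv.smul_compact hη.continuous hη.compact).inner (h.conv_dirac γ)
  have r2 := fun j => h.conv.inner ((h.conv_test_smul_rd (hη.pd j)).clm (γ j))
  refine tendsto_nhds_unique l ((r1.add (tendsto_finsetSum _ fun j _ => r2 j)).congr fun n => ?_)
  have t := h.test n
  have i : ∀ j ∈ univ, Integrable (fun x => ⟪φ n x, γ j (pd j η x • rd (φ n) x)⟫) := fun j _ =>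
    t.integrable_left ((γ j).continuous.comp ((hη.pd j).continuous.smul t.rd.continuous))
  rw [integral_dirac_virial hγ t hη.smooth, ← integral_finsetSum, ← integral_add]
  · congr 1; funext x
    simp [real_inner_smul_left, inner_sum]
  · exact (t.dirac γ).integrable_right (t.smul_left hη.smooth).continuous
  · exact integrable_finsetSum _ i
  · exact i

end H1Approx
end L2Convergence

lemma ae_ne_zero {d : ℕ} (hd : 0 < d) : ∀ᵐ x : Space d, x ≠ 0 := by
  have : Nonempty (Fin d) := ⟨⟨0, hd⟩⟩
  exact compl_mem_ae_iff.2 (measure_singleton (0 : Space d))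

lemma integrable_fun_sub {X : Type*} [MeasurableSpace X] {μ : Measure X} {f g : X → ℝ}
    (hf : Integrable f μ) (hg : Integrable g μ) : Integrable (fun x => f x - g x) μ := hf.sub hg

section DiracVirial

variable {d : ℕ} {F : Type*} [NormedAddCommGroup F] [InnerProductSpace ℝ F]
  {η : Space d → ℝ}

lemma ContDiffOn.rd {G : Type*} [NormedAddCommGroup G] [NormedSpace ℝ G]
    {W : Space d → G} (hW : ContDiffOn ℝ ∞ W {0}ᶜ) : ContDiffOn ℝ ∞ (rd W) {0}ᶜ := by
  have := hW.fderiv_of_isOpen isOpen_compl_singleton (m := ∞) (by simp)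
  exact this.clm_apply contDiffOn_id

lemma IsTest.tsupport_rd : tsupport (_root_.rd η) ⊆ tsupport η := by
  refine closure_minimal (fun x hx => ?_) (isClosed_tsupport _)
  by_contra h
  refine hx ?_
  have := (notMem_tsupport_iff_eventuallyEq.mp h).fderiv_eq (𝕜 := ℝ)
  simp [_root_.rd, this]

namespace H1Approx

variable {φ φ' : ℕ → Space d → F} {ψ ψ' : Space d → F} {g g' : Fin d → Space d → F}

lemma conv_apply_rd (h : H1Approx φ ψ g) {K : Space d → F →L[ℝ] F} (hK : Continuous K)
    (hc : HasCompactSupport K) :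
    L2Conv (fun n x => K x (rd (φ n) x)) (fun x => K x (rdG g x)) := by
  have : ∀ (k : Fin d → Space d → F) (x : Space d), K x (rdG k x) = ∑ j, (x j • K x) (k j x) := by
    intro k x; simp [rdG]
  simp only [rd_eq_rdG, this]
  exact L2Conv.sum fun j _ => (h.conv_pd j).apply_compact
    ((contDiff_coord j (n := 0)).continuous.smul hK) (hc.smul_left (f := fun x : Space d => x j))

lemma tendsto_inner_rd (h : H1Approx φ ψ g) (h' : L2Conv φ' ψ') {K : Space d → F →L[ℝ] F}
    (hK : Continuous K) (hc : HasCompactSupport K) :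
    Tendsto (fun n => ∫ x, ⟪rd (φ n) x, K x (φ' n x)⟫) atTop (𝓝 (∫ x, ⟪rdG g x, K x (ψ' x)⟫)) ∧
      Integrable (fun x => ⟪rdG g x, K x (ψ' x)⟫) := by
  have c : ∀ j, L2Conv (fun n x => (x j • K x) (φ' n x)) (fun x => (x j • K x) (ψ' x)) :=
    fun j => h'.apply_compact ((contDiff_coord j (n := 0)).continuous.smul hK)
      (hc.smul_left (f := fun x : Space d => x j))
  have e : ∀ (k : Fin d → Space d → F) (x : Space d) (v : F), ⟪rdG k x, K x v⟫ =
      ∑ j, ⟪k j x, (x j • K x) v⟫ := by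
    intro k x v; simp [rdG, sum_inner, real_inner_smul_left, real_inner_smul_right]
  simp only [rd_eq_rdG, e]
  have i : ∀ j ∈ univ, Integrable (fun x => ⟪g j x, (x j • K x) (ψ' x)⟫) := fun j _ =>
    integrable_inner (h.conv_pd j).memLp_lim (c j).memLp_lim
  refine ⟨?_, integrable_finsetSum _ i⟩
  rw [integral_finsetSum _ i]
  refine (tendsto_finsetSum _ fun j _ => (h.conv_pd j).inner (c j)).congr fun n => ?_
  rw [integral_finsetSum]
  exact fun j _ => integrable_inner ((h.conv_pd j).memLp n) ((c j).memLp n)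

lemma potential_virial (h : H1Approx φ ψ g) (h' : H1Approx φ' ψ' g')
    {W : Space d → F →L[ℝ] F} (hη : IsTest η)
    (hW : ContDiffOn ℝ ∞ W {0}ᶜ) (h0 : (0 : Space d) ∉ tsupport η) :
    Integrable (fun x => η x * ⟪rdG g x, W x (ψ' x)⟫ +
      η x * ⟪ψ x, W x (rdG g' x)⟫ + η x * ⟪ψ x, rd W x (ψ' x)⟫ +
      (d * η x + rd η x) * ⟪ψ x, W x (ψ' x)⟫) ∧
    ∫ x, (η x * ⟪rdG g x, W x (ψ' x)⟫ + η x * ⟪ψ x, W x (rdG g' x)⟫ + η x * ⟪ψ x, rd W x (ψ' x)⟫ +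
      (d * η x + rd η x) * ⟪ψ x, W x (ψ' x)⟫) = 0 := by
  have hK : ∀ (m : Space d → ℝ) (V : Space d → F →L[ℝ] F), IsTest m → ContDiffOn ℝ ∞ V {0}ᶜ →
      (0 : Space d) ∉ tsupport m → Continuous (fun x => m x • V x) ∧
        HasCompactSupport (fun x => m x • V x) := fun m V h1 h2 h3 =>
    ⟨(contDiff_smul_of_notMem h1.smooth h2 h3).continuous, h1.compact.smul_right⟩
  have h0' : (0 : Space d) ∉ tsupport (rd η) := fun h => h0 (IsTest.tsupport_rd h)
  obtain ⟨k1, k1c⟩ := hK η W hη hW h0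
  obtain ⟨k2, k2c⟩ := hK η (rd W) hη hW.rd h0
  obtain ⟨k3, k3c⟩ := hK (rd η) W hη.rd hW h0'
  obtain ⟨t1, i1⟩ := h.tendsto_inner_rd h'.conv k1 k1c
  have c2 := h'.conv_apply_rd k1 k1c
  have c3 := h'.conv.apply_compact k2 k2c
  have c4 := h'.conv.apply_compact k1 k1c
  have c5 := h'.conv.apply_compact k3 k3c
  have i2 := integrable_inner h.conv.memLp_lim c2.memLp_lim
  have i3 := integrable_inner h.conv.memLp_lim c3.memLp_lim
  have i4 := integrable_inner h.conv.memLp_lim c4.memLp_lim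
  have i5 := integrable_inner h.conv.memLp_lim c5.memLp_lim
  have key : ∀ (ψ ψ' R R' : Space d → F) (x : Space d), η x * ⟪R x, W x (ψ' x)⟫ +
      η x * ⟪ψ x, W x (R' x)⟫ + η x * ⟪ψ x, rd W x (ψ' x)⟫ +
      (d * η x + rd η x) * ⟪ψ x, W x (ψ' x)⟫ =
      ⟪R x, (η x • W x) (ψ' x)⟫ + (⟪ψ x, (η x • W x) (R' x)⟫ +
      (⟪ψ x, (η x • rd W x) (ψ' x)⟫ + (d * ⟪ψ x, (η x • W x) (ψ' x)⟫ +
       ⟪ψ x, (rd η x • W x) (ψ' x)⟫))) := by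
    intro ψ ψ' R R' x; simp only [FunLike.coe_smul, Pi.smul_apply, real_inner_smul_right]
    ring
  have j4 := i4.const_mul (d : ℝ)
  have j45 := j4.fun_add i5
  have j3 := i3.fun_add j45
  have j2 := i2.fun_add j3
  simp only [key ψ ψ' (rdG g) (rdG g')]; refine ⟨i1.add j2, ?_⟩
  rw [integral_add i1 j2, integral_add i2 j3, integral_add i3 j45, integral_add j4 i5,
    integral_const_mul]
  have T := t1.add ((h.conv.inner c2).add ((h.conv.inner c3).add
    (((h.conv.inner c4).const_mul (d : ℝ)).add (h.conv.inner c5))))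
  refine tendsto_nhds_unique T (tendsto_const_nhds.congr fun n => ?_)
  have t := h.test n
  have t' := h'.test n; rw [← integral_potential_virial t t' hη.smooth hW h0]
  simp only [key (φ n) (φ' n) (rd (φ n)) (rd (φ' n))]
  have f : ∀ (m : Space d → ℝ) (V : Space d → F →L[ℝ] F) (u v : Space d → F),
      Continuous (fun x => m x • V x) → IsTest u → IsTest v →
      Integrable (fun x => ⟪u x, (m x • V x) (v x)⟫) := fun m V u v h1 h2 h3 =>
    h2.integrable_left (h1.clm_apply h3.continuous)
  have i1 := f η W _ _ k1 t.rd t'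
  have i2 := f η W _ _ k1 t t'.rd
  have i3 := f η (rd W) _ _ k2 t t'
  have j4 := (f η W _ _ k1 t t').const_mul (d : ℝ)
  have i5 := f (rd η) W _ _ k3 t t'
  have j45 := j4.fun_add i5
  have j3 := i3.fun_add j45
  have j2 := i2.fun_add j3
  rw [integral_add i1 j2, integral_add i2 j3, integral_add i3 j45, integral_add j4 i5,
    integral_const_mul]

lemma dirac_virial_integrand (h : H1Approx φ ψ g) {γ : Fin d → F →L[ℝ] F} (hγ : IsClifford γ)
    (hη : IsTest η) :
    Integrable (fun x => 2 * ⟪diracG γ g x, η x • rdG g x + ((d * η x + rd η x) / 2) • ψ x⟫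
      - η x * ⟪ψ x, diracG γ g x⟫ - ∑ j, pd j η x * ⟪ψ x, γ j (rdG g x)⟫) ∧
    ∫ x, (2 * ⟪diracG γ g x, η x • rdG g x + ((d * η x + rd η x) / 2) • ψ x⟫
      - η x * ⟪ψ x, diracG γ g x⟫ - ∑ j, pd j η x * ⟪ψ x, γ j (rdG g x)⟫) = 0 := by
  have hb := isTest_dilation hη
  have i1 := (integrable_inner (h.conv_dirac γ).memLp_lim ((h.conv_test_smul_rd hη).add
    (h.conv.smul_compact hb.continuous hb.compact)).memLp_lim).const_mul 2
  have i2 := integrable_inner (h.conv.smul_compact hη.continuous hη.compact).memLp_lim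
    (h.conv_dirac γ).memLp_lim
  have i3 : ∀ j ∈ univ, _ := fun j (_ : j ∈ univ) => integrable_inner h.conv.memLp_lim
    ((h.conv_test_smul_rd (hη.pd j)).clm (γ j)).memLp_lim
  have := h.dirac_virial hγ hη
  rw [← integral_const_mul, ← integral_finsetSum _ i3] at this
  have i4 := integrable_finsetSum _ i3
  simp only [map_smul, real_inner_smul_right, real_inner_smul_left] at this i1 i2 i4
  refine ⟨(integrable_fun_sub i1 i2).sub i4, ?_⟩
  rw [integral_sub (integrable_fun_sub i1 i2) i4, integral_sub i1 i2, this]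
  ring

end H1Approx

/-- The assumptions on the decaying part of the potential. -/
structure IsDecaying (W : Space d → F →L[ℝ] F) (C : ℝ) : Prop where
  smooth : ContDiffOn ℝ ∞ W {0}ᶜ
  symm : ∀ x u v, ⟪W x u, v⟫ = ⟪u, W x v⟫
  bound : ∀ x ≠ 0, ‖W x‖ ≤ C / ‖x‖
  bound_rd : ∀ x ≠ 0, ‖rd W x‖ ≤ C / ‖x‖

/-- A symmetric operator commuting with the Clifford generators. -/
structure CommutesClifford (γ : Fin d → F →L[ℝ] F) (e : F →L[ℝ] F) : Prop where
  symm : ∀ u v, ⟪e u, v⟫ = ⟪u, e v⟫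
  comm : ∀ j u, e (γ j u) = γ j (e u)

lemma H1Approx.cutoff_virial (hd : 0 < d) {φ : ℕ → Space d → F} {ψ : Space d → F} {g : Fin d → Space d → F}
    (h : H1Approx φ ψ g)
    {γ : Fin d → F →L[ℝ] F} (hγ : IsClifford γ) {W : Space d → F →L[ℝ] F} {C : ℝ}
    (hW : IsDecaying W C) {e M : F →L[ℝ] F} (he : CommutesClifford γ e) (hM : CommutesClifford γ M)
    (hMM : ∀ v, M (M v) = M v) (heM : ∀ v, e (M v) = M (e v))
    (heq : ∀ᵐ x, diracG γ g x = e (ψ x) - W x (ψ x))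
    (hη : IsTest η) (h0 : (0 : Space d) ∉ tsupport η) :
    Integrable (fun x => η x * ⟪M (ψ x), diracG γ g x⟫ + ∑ j, pd j η x * ⟪M (ψ x), γ j (rdG g x)⟫
      - η x * ⟪M (ψ x), rd W x (M (ψ x) + (2 : ℝ) • (ψ x - M (ψ x)))⟫
      - 2 * inner ℝ (M (ψ x)) (W x (η x • (rdG g x - M (rdG g x)) +
        ((d * η x + rd η x) / 2) • (ψ x - M (ψ x))))) ∧
    ∫ x, (η x * ⟪M (ψ x), diracG γ g x⟫ + ∑ j, pd j η x * ⟪M (ψ x), γ j (rdG g x)⟫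
      - η x * ⟪M (ψ x), rd W x (M (ψ x) + (2 : ℝ) • (ψ x - M (ψ x)))⟫
      - 2 * inner ℝ (M (ψ x)) (W x (η x • (rdG g x - M (rdG g x)) +
        ((d * η x + rd η x) / 2) • (ψ x - M (ψ x))))) = 0 := by
  set P : F →L[ℝ] F := ContinuousLinearMap.id ℝ F - M with hP
  have hm := h.clm M
  have hp := h.clm P
  have rM : ∀ x, rdG (fun j x => M (g j x)) x = M (rdG g x) := fun x => by simp [rdG]
  have rP : ∀ x, rdG (fun j x => P (g j x)) x = rdG g x - M (rdG g x) := fun x => by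
    simp [rdG, hP, smul_sub]
  have dM : ∀ x, diracG γ (fun j x => M (g j x)) x = M (diracG γ g x) := fun x => by
    simp [diracG, hM.comm]
  obtain ⟨i1, e1⟩ := hm.dirac_virial_integrand hγ hη
  obtain ⟨i2, e2⟩ := hm.potential_virial hm (W := fun x => e - W x) hη
    (contDiffOn_const.sub hW.smooth) h0
  obtain ⟨i3, e3⟩ := hm.potential_virial hp hη hW.smooth h0
  have rW : ∀ x, x ≠ 0 → rd (fun x => e - W x) x = -rd W x := by
    intro x hx; simp [rd, fderiv_const_sub]
  have hint := ((integrable_fun_sub i1 i2).fun_add (i3.const_mul 2)).fun_neg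
  have key : (∫ x, ((2 * inner ℝ (diracG γ (fun j x => M (g j x)) x) (η x • rdG (fun j x => M (g j x)) x
      + ((d * η x + rd η x) / 2) • M (ψ x))
      - η x * ⟪M (ψ x), diracG γ (fun j x => M (g j x)) x⟫
      - ∑ j, pd j η x * ⟪M (ψ x), γ j (rdG (fun j x => M (g j x)) x)⟫)
      - (η x * ⟪rdG (fun j x => M (g j x)) x, (e - W x) (M (ψ x))⟫ +
      η x * ⟪M (ψ x), (e - W x) (rdG (fun j x => M (g j x)) x)⟫ +
      η x * ⟪M (ψ x), rd (fun x => e - W x) x (M (ψ x))⟫ +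
      (d * η x + rd η x) * ⟪M (ψ x), (e - W x) (M (ψ x))⟫)
      + 2 * (η x * ⟪rdG (fun j x => M (g j x)) x, W x (P (ψ x))⟫ +
      η x * ⟪M (ψ x), W x (rdG (fun j x => P (g j x)) x)⟫ +
      η x * ⟪M (ψ x), rd W x (P (ψ x))⟫ +
      (d * η x + rd η x) * ⟪M (ψ x), W x (P (ψ x))⟫))) = 0 := by
    rw [integral_add (integrable_fun_sub i1 i2) (i3.const_mul 2), integral_sub i1 i2, integral_const_mul, e1, e2, e3]
    ring
  rw [← neg_eq_zero, ← integral_neg] at key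
  refine (fun hae => ⟨hint.congr hae, (integral_congr_ae hae).symm.trans key⟩) ?_
  filter_upwards [heq, ae_ne_zero hd] with x hx hx0; rw [rW x hx0, rM, rP, dM]
  have a1 : ∀ u v, ⟪M u, M v⟫ = ⟪M u, v⟫ := fun u v => by rw [← hM.symm, hMM]
  have a2 : ∀ u, ⟪M (ψ x), γ u (M (rdG g x))⟫ = ⟪M (ψ x), γ u (rdG g x)⟫ := by
    intro u; rw [← hM.comm, a1]
  have a3 : ∀ v, ⟪M (diracG γ g x), M v⟫ =
      ⟪M v, e (M (ψ x))⟫ - ⟪M v, W x (M (ψ x))⟫ - ⟪M v, W x (P (ψ x))⟫ := by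
    intro v; rw [real_inner_comm, a1, hx]
    have : ⟪M v, e (ψ x)⟫ = ⟪M v, e (M (ψ x))⟫ := by rw [heM, a1]
    rw [inner_sub_right, this, sub_sub, ← inner_add_right, ← map_add]; simp [hP]
  have a4 : ⟪M (ψ x), e (M (rdG g x))⟫ = ⟪M (rdG g x), e (M (ψ x))⟫ := by
    rw [← he.symm, real_inner_comm]
  have a5 : ⟪M (ψ x), W x (M (rdG g x))⟫ = ⟪M (rdG g x), W x (M (ψ x))⟫ := by
    rw [← hW.symm, real_inner_comm]
  have a6 : ⟪M (ψ x), M (diracG γ g x)⟫ = ⟪M (ψ x), diracG γ g x⟫ := a1 _ _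
  have hPx : P (ψ x) = ψ x - M (ψ x) := by simp [hP]
  simp only [inner_add_right, real_inner_smul_right, a2, a3, a6, map_add, map_smul,
    sub_apply, inner_sub_right, a4, a5, neg_apply, inner_neg_right, hPx, map_sub]
  ring

variable {ε : ℝ} {φ : Space d → F}

lemma contDiff_norm_sq_add_inv (hε : 0 < ε) : ContDiff ℝ ∞ (fun x : Space d => (‖x‖ ^ 2 + ε)⁻¹) :=
  ((contDiff_norm_sq ℝ).add contDiff_const).inv fun x => by positivity

lemma hasFDerivAt_norm_sq_add_inv (hε : 0 < ε) (x : Space d) :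
    HasFDerivAt (fun x : Space d => (‖x‖ ^ 2 + ε)⁻¹)
      (-((‖x‖ ^ 2 + ε) ^ 2)⁻¹ • ((2 : ℝ) • (innerSL ℝ x))) x := by
  have h1 : HasFDerivAt (fun x : Space d => ‖x‖ ^ 2 + ε) ((2 : ℝ) • (innerSL ℝ x)) x := by
    have := (hasStrictFDerivAt_norm_sq x).hasFDerivAt
    rw [← Nat.cast_smul_eq_nsmul ℝ] at this; exact this.add_const ε
  exact (hasDerivAt_inv (by positivity : ‖x‖ ^ 2 + ε ≠ 0)).comp_hasFDerivAt x h1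

lemma rd_norm_sq_add_inv (hε : 0 < ε) (x : Space d) :
    rd (fun x : Space d => (‖x‖ ^ 2 + ε)⁻¹) x = -2 * ‖x‖ ^ 2 * ((‖x‖ ^ 2 + ε)⁻¹) ^ 2 := by
  simp [rd, (hasFDerivAt_norm_sq_add_inv hε x).fderiv]; ring

lemma rd_norm_le (φ : Space d → F) (x : Space d) :
    ‖rd φ x‖ ^ 2 ≤ ‖x‖ ^ 2 * ∑ j, ‖pd j φ x‖ ^ 2 := by
  have h : ‖rd φ x‖ ≤ ∑ j, |x j| * ‖pd j φ x‖ := by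
    rw [rd_eq_sum]; exact (norm_sum_le _ _).trans (le_of_eq (by simp [norm_smul]))
  calc ‖rd φ x‖ ^ 2 ≤ (∑ j, |x j| * ‖pd j φ x‖) ^ 2 := by gcongr
    _ ≤ (∑ j, |x j| ^ 2) * ∑ j, ‖pd j φ x‖ ^ 2 := sum_mul_sq_le_sq_mul_sq _ _ _
    _ = _ := by rw [EuclideanSpace.norm_sq_eq]; simp

lemma IsTest.integrable_mul_norm_sq (hφ : IsTest φ) {m : Space d → ℝ}
    (hm : Continuous m) : Integrable (fun x => m x * ‖φ x‖ ^ 2) := by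
  have := hφ.integrable_right (φ := fun x => m x • φ x) (hm.smul hφ.continuous)
  simpa [real_inner_smul_left] using this

lemma IsTest.integrable_mul_inner_rd (hφ : IsTest φ) {m : Space d → ℝ}
    (hm : Continuous m) : Integrable (fun x => m x * ⟪_root_.rd φ x, φ x⟫) := by
  have := hφ.integrable_right (φ := fun x => m x • _root_.rd φ x) (hm.smul hφ.rd.continuous)
  simpa [real_inner_smul_left] using this

lemma hardy_eps (hφ : IsTest φ) (hd : 2 ≤ d) (hε : 0 < ε) :
    κ[d] ^ 2 * ∫ x, (‖x‖ ^ 2 + ε)⁻¹ * ‖φ x‖ ^ 2 ≤ ∑ j, ∫ x, ‖pd j φ x‖ ^ 2 := by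
  set c : ℝ := κ[d] with hc
  have hc0 : 0 ≤ c := by
    have : (2 : ℝ) ≤ d := by exact_mod_cast hd
    rw [hc]; linarith
  have hdc : (d : ℝ) = 2 * c + 2 := by rw [hc]; ring
  set m : Space d → ℝ := fun x => (‖x‖ ^ 2 + ε)⁻¹ with hm
  have hms : ContDiff ℝ ∞ m := contDiff_norm_sq_add_inv hε
  have w := integral_weight_rd hφ hms
  have im := hφ.integrable_mul_norm_sq hms.continuous
  have ip : ∀ j, Integrable (fun x => ‖pd j φ x‖ ^ 2) := fun j =>
    integrable_norm_sq ((hφ.pd j).memLp 2)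
  have ir := hφ.integrable_mul_inner_rd hms.continuous
  have iq := hφ.integrable_mul_norm_sq (m := fun x => ‖x‖ ^ 2 * m x ^ 2)
    ((continuous_norm.pow 2).mul (hms.continuous.pow 2))
  have expand : ∀ x, ∑ j, ‖pd j φ x + (c * m x * x j) • φ x‖ ^ 2 =
      ∑ j, ‖pd j φ x‖ ^ 2 + 2 * c * (m x * ⟪rd φ x, φ x⟫) +
        c ^ 2 * (‖x‖ ^ 2 * m x ^ 2 * ‖φ x‖ ^ 2) := by
    intro x
    have e : ∀ j, ‖pd j φ x + (c * m x * x j) • φ x‖ ^ 2 = ‖pd j φ x‖ ^ 2 +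
        2 * c * m x * (x j * ⟪pd j φ x, φ x⟫) + c ^ 2 * m x ^ 2 * ‖φ x‖ ^ 2 * x j ^ 2 := by
      intro j
      rw [norm_add_sq_real, norm_smul, real_inner_smul_right, mul_pow, norm_eq_abs, sq_abs]
      ring
    simp only [e, sum_add_distrib, ← mul_sum]
    rw [rd_eq_sum, sum_inner, EuclideanSpace.norm_sq_eq]
    simp only [real_inner_smul_left, norm_eq_abs, sq_abs]; ring
  have h0 : 0 ≤ ∫ x, (∑ j, ‖pd j φ x‖ ^ 2 + 2 * c * (m x * ⟪rd φ x, φ x⟫) +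
        c ^ 2 * (‖x‖ ^ 2 * m x ^ 2 * ‖φ x‖ ^ 2)) := by
    refine integral_nonneg fun x => ?_
    simp only [Pi.zero_apply]; rw [← expand]; positivity
  have is := integrable_finsetSum univ fun j _ => ip j
  rw [integral_add (is.fun_add (ir.const_mul _)) (iq.const_mul _),
    integral_add is (ir.const_mul _), integral_finsetSum _ fun j _ => ip j,
    integral_const_mul, integral_const_mul] at h0
  have w2 : ∀ x, (d * m x + rd m x) * ‖φ x‖ ^ 2 =
      d * (m x * ‖φ x‖ ^ 2) - 2 * (‖x‖ ^ 2 * m x ^ 2 * ‖φ x‖ ^ 2) := by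
    intro x; rw [hm, rd_norm_sq_add_inv hε]; ring
  simp only [w2] at w
  rw [integral_sub (im.const_mul _) (iq.const_mul _), integral_const_mul, integral_const_mul] at w
  have hle : ∫ x, ‖x‖ ^ 2 * m x ^ 2 * ‖φ x‖ ^ 2 ≤ ∫ x, m x * ‖φ x‖ ^ 2 := by
    refine integral_mono iq im fun x => ?_
    simp only; refine mul_le_mul_of_nonneg_right ?_ (sq_nonneg _)
    have hm1 : m x * (‖x‖ ^ 2 + ε) = 1 := inv_mul_cancel₀ (by positivity)
    have hm0 : 0 < m x := by simp only [hm]; positivity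
    nlinarith [mul_pos (mul_pos hm0 hm0) hε]
  have hq : 0 ≤ (2 * c + c ^ 2) * ((∫ x, m x * ‖φ x‖ ^ 2) - ∫ x, ‖x‖ ^ 2 * m x ^ 2 * ‖φ x‖ ^ 2) :=
    mul_nonneg (by positivity) (by linarith)
  have w' : 2 * c * ∫ x, m x * ⟪rd φ x, φ x⟫ = c * (-(d * (∫ x, m x * ‖φ x‖ ^ 2) -
      2 * ∫ x, ‖x‖ ^ 2 * m x ^ 2 * ‖φ x‖ ^ 2)) := by rw [← w]; ring
  rw [w', hdc] at h0; nlinarith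

lemma integral_div_sq_le (hd : 0 < d) {f : Space d → ℝ} (hf : AEStronglyMeasurable f)
    (hf0 : ∀ x, 0 ≤ f x) {K : ℕ → ℝ} {k : ℝ} (hK : Tendsto K atTop (𝓝 k))
    (hi : ∀ n : ℕ, Integrable (fun x => (‖x‖ ^ 2 + ε[n])⁻¹ * f x))
    (hle : ∀ n : ℕ, ∫ x, (‖x‖ ^ 2 + ε[n])⁻¹ * f x ≤ K n) :
    Integrable (fun x => (‖x‖ ^ 2)⁻¹ * f x) ∧ ∫ x, (‖x‖ ^ 2)⁻¹ * f x ≤ k := by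
  have hm : AEStronglyMeasurable (fun x => (‖x‖ ^ 2)⁻¹ * f x) :=
    ((measurable_norm.pow_const 2).inv.aestronglyMeasurable).mul hf
  have h0 : ∀ x, 0 ≤ (‖x‖ ^ 2)⁻¹ * f x := fun x => mul_nonneg (by positivity) (hf0 x)
  have hpt : ∀ᵐ x : Space d, ENNReal.ofReal ((‖x‖ ^ 2)⁻¹ * f x) =
      liminf (fun n : ℕ => ENNReal.ofReal ((‖x‖ ^ 2 + ε[n])⁻¹ * f x)) atTop := by
    filter_upwards [ae_ne_zero hd] with x hx; refine (Tendsto.liminf_eq ?_).symm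
    refine ENNReal.tendsto_ofReal (Tendsto.mul_const _ (Tendsto.inv₀ ?_ (by positivity)))
    simpa using tendsto_const_nhds.add (tendsto_one_div_add_atTop_nhds_zero_nat (𝕜 := ℝ))
  have hk : ∫⁻ x, ENNReal.ofReal ((‖x‖ ^ 2)⁻¹ * f x) ≤ ENNReal.ofReal k := by
    rw [lintegral_congr_ae hpt]
    refine (lintegral_liminf_le' fun n => (hi n).1.aemeasurable.ennreal_ofReal).trans ?_
    rw [← (ENNReal.tendsto_ofReal hK).liminf_eq]
    refine liminf_le_liminf (.of_forall fun n => ?_)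
    rw [← ofReal_integral_eq_lintegral_ofReal (hi n)
      (.of_forall fun x => mul_nonneg (by positivity) (hf0 x))]
    exact ENNReal.ofReal_le_ofReal (hle n)
  have hint : Integrable (fun x => (‖x‖ ^ 2)⁻¹ * f x) := by
    refine ⟨hm, ?_⟩
    rw [hasFiniteIntegral_iff_ofReal (.of_forall h0)]
    exact hk.trans_lt ENNReal.ofReal_lt_top
  refine ⟨hint, ?_⟩
  have hk0 : 0 ≤ k := ge_of_tendsto' hK fun n => le_trans
    (integral_nonneg fun x => mul_nonneg (by positivity) (hf0 x)) (hle n)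
  rw [← ofReal_integral_eq_lintegral_ofReal hint (.of_forall h0)] at hk
  exact (ENNReal.ofReal_le_ofReal_iff hk0).1 hk

lemma norm_sq_add_inv_le (hε : 0 < ε) (x : Space d) : |(‖x‖ ^ 2 + ε)⁻¹| ≤ ε⁻¹ := by
  rw [abs_of_nonneg (by positivity)]; exact inv_anti₀ hε (by nlinarith [sq_nonneg ‖x‖])

lemma sqrt_norm_sq_add_inv_mul_le (hε : 0 < ε) (x : Space d) :
    |√((‖x‖ ^ 2 + ε)⁻¹)| * ‖x‖ ≤ 1 := by
  rw [abs_of_nonneg (sqrt_nonneg _), Real.sqrt_inv, inv_mul_le_iff₀ (Real.sqrt_pos.2 (by positivity)),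
    mul_one]
  exact Real.le_sqrt_of_sq_le (by linarith)

lemma abs_sub_le_mul {D q m K : ℝ} (hD : 0 ≤ D) (hq : 0 ≤ q) (hm : 0 ≤ m) (hqm : q ≤ m) (hK : m ≤ K) :
    |D * q - D ^ 2 / 4 * m| ≤ (D + D ^ 2 / 4) * K := by
  rw [abs_le]
  have h := mul_nonneg (sq_nonneg D) (hm.trans hK)
  constructor
  · nlinarith [mul_nonneg hD hq, mul_nonneg hD (hm.trans hK), mul_nonneg (sq_nonneg D) (sub_nonneg.2 hK)]
  · nlinarith [mul_nonneg hD (sub_nonneg.2 (hqm.trans hK)), mul_nonneg (sq_nonneg D) hm]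

namespace H1Approx

variable {φ : ℕ → Space d → F} {ψ : Space d → F} {g : Fin d → Space d → F}

lemma conv_weight (h : L2Conv φ ψ) (hε : 0 < ε) :
    Tendsto (fun n => ∫ x, (‖x‖ ^ 2 + ε)⁻¹ * ‖φ n x‖ ^ 2) atTop
      (𝓝 (∫ x, (‖x‖ ^ 2 + ε)⁻¹ * ‖ψ x‖ ^ 2)) ∧
      Integrable (fun x => (‖x‖ ^ 2 + ε)⁻¹ * ‖ψ x‖ ^ 2) := by
  have c := h.smul_bdd (contDiff_norm_sq_add_inv hε).continuous.aestronglyMeasurable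
    (norm_sq_add_inv_le hε)
  have := c.inner h
  have i := integrable_inner c.memLp_lim h.memLp_lim
  simp only [real_inner_smul_left, real_inner_self_eq_norm_sq] at this i; exact ⟨this, i⟩

lemma hardy (h : H1Approx φ ψ g) (hd : 3 ≤ d) : Integrable (fun x => (‖x‖ ^ 2)⁻¹ * ‖ψ x‖ ^ 2) ∧
      κ[d] ^ 2 * ∫ x, (‖x‖ ^ 2)⁻¹ * ‖ψ x‖ ^ 2 ≤ ∑ j, ∫ x, ‖g j x‖ ^ 2 := by
  have hc : 0 < κ[d] ^ 2 := by
    have : (3 : ℝ) ≤ d := by exact_mod_cast hd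
    have : 0 < κ[d] := by linarith
    positivity
  have hp : ∀ n : ℕ, (0 : ℝ) < ε[n] := fun n => by positivity
  have := integral_div_sq_le (d := d) (by omega) (f := fun x => ‖ψ x‖ ^ 2)
    (h.conv.memLp_lim.1.norm.pow 2) (fun x => sq_nonneg _)
    (tendsto_const_nhds (x := (∑ j, ∫ x, ‖g j x‖ ^ 2) / κ[d] ^ 2))
    (fun n => (conv_weight h.conv (hp n)).2) (fun n => by
      rw [le_div_iff₀' hc]
      exact le_of_tendsto_of_tendsto' ((conv_weight h.conv (hp n)).1.const_mul _)
        (tendsto_finsetSum _ fun j _ => (h.conv_pd j).norm_sq)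
        fun k => hardy_eps (h.test k) (by omega) (hp n))
  refine ⟨this.1, ?_⟩
  have h2 := this.2; rwa [le_div_iff₀' hc] at h2

lemma memLp_inv_smul (h : H1Approx φ ψ g) (hd : 3 ≤ d) : MemLp (fun x => ‖x‖⁻¹ • ψ x) 2 := by
  refine memLp_two_of_integrable (measurable_norm.inv.aestronglyMeasurable.smul h.conv.memLp_lim.1) ?_
  refine (h.hardy hd).1.congr (.of_forall fun x => ?_)
  simp [norm_smul, mul_pow]

lemma hardy_norm (h : H1Approx φ ψ g) (hd : 3 ≤ d) :
    κ[d] ^ 2 * ∫ x, ‖‖x‖⁻¹ • ψ x‖ ^ 2 ≤ ∑ j, ∫ x, ‖g j x‖ ^ 2 := by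
  simpa [norm_smul, mul_pow] using (h.hardy hd).2

lemma dilation_bound (h : H1Approx φ ψ g) (hd : 3 ≤ d) :
    MemLp (fun x => ‖x‖⁻¹ • (rdG g x + ((d : ℝ) / 2) • ψ x)) 2 volume ∧
    ∫ x, ‖‖x‖⁻¹ • (rdG g x + ((d : ℝ) / 2) • ψ x)‖ ^ 2 ≤
      (∑ j, ∫ x, ‖g j x‖ ^ 2) + (1 - κ[d] ^ 2) * ∫ x, ‖‖x‖⁻¹ • ψ x‖ ^ 2 := by
  have hmeas : AEStronglyMeasurable (rdG g) := Finset.aestronglyMeasurable_fun_sum _ fun j _ =>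
      (contDiff_coord j (n := 0)).continuous.aestronglyMeasurable.smul (h.conv_pd j).memLp_lim.1
  have hTm : AEStronglyMeasurable (fun x => rdG g x + ((d : ℝ) / 2) • ψ x) volume :=
    hmeas.add (h.conv.memLp_lim.1.const_smul _)
  set m : ℝ → Space d → ℝ := fun ε x => (‖x‖ ^ 2 + ε)⁻¹ with hm
  have hp : ∀ n : ℕ, (0 : ℝ) < ε[n] := fun n => by positivity
  -- regularised identity on test functions
  have test : ∀ ε : ℝ, 0 < ε → ∀ n, ∫ x, m ε x * ‖rd (φ n) x + ((d : ℝ) / 2) • φ n x‖ ^ 2 ≤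
      (∑ j, ∫ x, ‖pd j (φ n) x‖ ^ 2) +
        ∫ x, (d * (‖x‖ ^ 2 * m ε x ^ 2) - (d : ℝ) ^ 2 / 4 * m ε x) * ‖φ n x‖ ^ 2 := by
    intro ε hε n
    have t := h.test n
    have hms : ContDiff ℝ ∞ (m ε) := contDiff_norm_sq_add_inv hε
    have w := integral_weight_rd t hms
    have im := t.integrable_mul_norm_sq hms.continuous
    have ir := t.integrable_mul_inner_rd hms.continuous
    have iq := t.integrable_mul_norm_sq (m := fun x => ‖x‖ ^ 2 * m ε x ^ 2)
      ((continuous_norm.pow 2).mul (hms.continuous.pow 2))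
    have id := t.rd.integrable_mul_norm_sq hms.continuous
    have ip : ∀ j, Integrable (fun x => ‖pd j (φ n) x‖ ^ 2) := fun j =>
      integrable_norm_sq ((t.pd j).memLp 2)
    have e : ∀ x, m ε x * ‖rd (φ n) x + ((d : ℝ) / 2) • φ n x‖ ^ 2 = m ε x * ‖rd (φ n) x‖ ^ 2 +
        d * (m ε x * ⟪rd (φ n) x, φ n x⟫) + (d : ℝ) ^ 2 / 4 * (m ε x * ‖φ n x‖ ^ 2) := by
      intro x
      rw [norm_add_sq_real, norm_smul, real_inner_smul_right, mul_pow, norm_eq_abs, sq_abs]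
      ring
    have w2 : ∀ x, (d * m ε x + rd (m ε) x) * ‖φ n x‖ ^ 2 =
        d * (m ε x * ‖φ n x‖ ^ 2) - 2 * (‖x‖ ^ 2 * m ε x ^ 2 * ‖φ n x‖ ^ 2) := by
      intro x; rw [hm, rd_norm_sq_add_inv hε]; ring
    simp only [w2] at w
    rw [integral_sub (im.const_mul _) (iq.const_mul _), integral_const_mul, integral_const_mul] at w
    simp only [e]
    rw [integral_add (id.fun_add (ir.const_mul _)) (im.const_mul _), integral_add id (ir.const_mul _),
      integral_const_mul, integral_const_mul]
    have r : ∀ x, (d * (‖x‖ ^ 2 * m ε x ^ 2) - (d : ℝ) ^ 2 / 4 * m ε x) * ‖φ n x‖ ^ 2 =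
      d * (‖x‖ ^ 2 * m ε x ^ 2 * ‖φ n x‖ ^ 2) - (d : ℝ) ^ 2 / 4 * (m ε x * ‖φ n x‖ ^ 2) := by
      intro x; ring
    simp only [r]
    rw [integral_sub (iq.const_mul _) (im.const_mul _), integral_const_mul, integral_const_mul]
    have hle : ∫ x, m ε x * ‖rd (φ n) x‖ ^ 2 ≤ ∑ j, ∫ x, ‖pd j (φ n) x‖ ^ 2 := by
      rw [← integral_finsetSum _ fun j _ => ip j]
      refine integral_mono id (integrable_finsetSum _ fun j _ => ip j) fun x => ?_
      simp only [hm]; rw [inv_mul_le_iff₀ (by positivity)]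
      refine (rd_norm_le (φ n) x).trans (mul_le_mul_of_nonneg_right (by linarith) (by positivity))
    linear_combination hle + (d : ℝ) / 2 * w
  have qb : ∀ ε : ℝ, 0 < ε → ∀ x : Space d, ‖x‖ ^ 2 * m ε x ^ 2 ≤ m ε x := by
    intro ε hε x
    have hm1 : m ε x * (‖x‖ ^ 2 + ε) = 1 := inv_mul_cancel₀ (by positivity)
    have hm0 : 0 < m ε x := by simp only [hm]; positivity
    nlinarith [mul_pos (mul_pos hm0 hm0) hε]
  -- regularised inequality in `H¹`
  have lim : ∀ ε : ℝ, 0 < ε → Integrable (fun x => m ε x * ‖rdG g x + ((d : ℝ) / 2) • ψ x‖ ^ 2) ∧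
      ∫ x, m ε x * ‖rdG g x + ((d : ℝ) / 2) • ψ x‖ ^ 2 ≤
      (∑ j, ∫ x, ‖g j x‖ ^ 2) +
        ∫ x, (d * (‖x‖ ^ 2 * m ε x ^ 2) - (d : ℝ) ^ 2 / 4 * m ε x) * ‖ψ x‖ ^ 2 := by
    intro ε hε
    have hms : ContDiff ℝ ∞ (m ε) := contDiff_norm_sq_add_inv hε
    have hsc : Continuous (fun x => √(m ε x)) := hms.continuous.sqrt
    have c1 : L2Conv (fun n x => √(m ε x) • (rd (φ n) x + ((d : ℝ) / 2) • φ n x))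
        (fun x => √(m ε x) • (rdG g x + ((d : ℝ) / 2) • ψ x)) := by
      simp only [smul_add]
      refine (h.conv_smul_rd hsc (sqrt_norm_sq_add_inv_mul_le hε)).add
        ((h.conv.const_smul _).smul_bdd hsc.aestronglyMeasurable (C := √(ε⁻¹)) fun x => ?_)
      rw [abs_of_nonneg (sqrt_nonneg _)]
      exact sqrt_le_sqrt ((le_abs_self _).trans (norm_sq_add_inv_le hε x))
    have ns : ∀ (x : Space d) (v : F), ‖√(m ε x) • v‖ ^ 2 = m ε x * ‖v‖ ^ 2 := by
      intro x v; rw [norm_smul, mul_pow, norm_eq_abs, sq_abs, sq_sqrt]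
      simp only [hm]; positivity
    have c1n := c1.norm_sq
    have c1i := integrable_norm_sq c1.memLp_lim; simp only [ns] at c1n c1i
    refine ⟨c1i, ?_⟩
    have cw : Continuous (fun x => d * (‖x‖ ^ 2 * m ε x ^ 2) - (d : ℝ) ^ 2 / 4 * m ε x) := by
      have := hms.continuous; fun_prop
    have c2 := (h.conv.smul_bdd cw.aestronglyMeasurable (C := (d + (d : ℝ) ^ 2 / 4) * ε⁻¹) fun x => by
      have h1 : m ε x ≤ ε⁻¹ := (le_abs_self _).trans (norm_sq_add_inv_le hε x)
      have h2 := qb ε hε x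
      have h3 : 0 ≤ ‖x‖ ^ 2 * m ε x ^ 2 := by positivity
      have h4 : 0 ≤ m ε x := by simp only [hm]; positivity
      exact abs_sub_le_mul d.cast_nonneg h3 h4 h2 h1).inner h.conv
    simp only [real_inner_smul_left, real_inner_self_eq_norm_sq] at c2
    exact le_of_tendsto_of_tendsto' c1n
      ((tendsto_finsetSum _ fun j _ => (h.conv_pd j).norm_sq).add c2) (test ε hε)
  have hH := (h.hardy hd).1
  have hlim : Tendsto (fun n : ℕ => ∫ x, (d * (‖x‖ ^ 2 * m ε[n] x ^ 2) -
      (d : ℝ) ^ 2 / 4 * m ε[n] x) * ‖ψ x‖ ^ 2) atTop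
      (𝓝 (∫ x, (1 - κ[d] ^ 2) * ((‖x‖ ^ 2)⁻¹ * ‖ψ x‖ ^ 2))) := by
    refine tendsto_integral_of_dominated_convergence
      (fun x => (d + (d : ℝ) ^ 2 / 4) * ((‖x‖ ^ 2)⁻¹ * ‖ψ x‖ ^ 2)) ?_ (hH.const_mul _) ?_ ?_
    · intro n
      have := (contDiff_norm_sq_add_inv (d := d) (hp n)).continuous
      have cw : Continuous (fun x => d * (‖x‖ ^ 2 * m ε[n] x ^ 2) -
        (d : ℝ) ^ 2 / 4 * m ε[n] x) := by
        simp only [hm]; fun_prop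
      exact cw.aestronglyMeasurable.mul (h.conv.memLp_lim.1.norm.pow 2)
    · intro n
      filter_upwards [ae_ne_zero (d := d) (by omega)] with x hx
      have hx' : 0 < ‖x‖ ^ 2 := by positivity
      have h1 : m ε[n] x ≤ (‖x‖ ^ 2)⁻¹ := inv_anti₀ hx' (by linarith [hp n])
      have h2 := qb _ (hp n) x
      have h3 : 0 ≤ ‖x‖ ^ 2 * m ε[n] x ^ 2 := by positivity
      have h4 : 0 ≤ m ε[n] x := by simp only [hm]; have := hp n; positivity
      rw [norm_eq_abs, abs_mul, abs_of_nonneg (sq_nonneg ‖ψ x‖), ← mul_assoc _ _ (‖ψ x‖ ^ 2)]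
      refine mul_le_mul_of_nonneg_right ?_ (sq_nonneg ‖ψ x‖)
      exact abs_sub_le_mul d.cast_nonneg h3 h4 h2 h1
    · filter_upwards [ae_ne_zero (d := d) (by omega)] with x hx
      have hx' : ‖x‖ ^ 2 ≠ 0 := by positivity
      have hm' : Tendsto (fun n : ℕ => m ε[n] x) atTop (𝓝 (‖x‖ ^ 2)⁻¹) := by
        refine Tendsto.inv₀ ?_ hx'
        simpa using tendsto_const_nhds.add (tendsto_one_div_add_atTop_nhds_zero_nat (𝕜 := ℝ))
      have e : (1 - κ[d] ^ 2) * ((‖x‖ ^ 2)⁻¹ * ‖ψ x‖ ^ 2) =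
          (d * (‖x‖ ^ 2 * ((‖x‖ ^ 2)⁻¹) ^ 2) - (d : ℝ) ^ 2 / 4 * (‖x‖ ^ 2)⁻¹) * ‖ψ x‖ ^ 2 := by
        field_simp; ring
      rw [e]
      exact (((hm'.pow 2).const_mul _).const_mul _ |>.sub (hm'.const_mul _)).mul_const _
  have := integral_div_sq_le (d := d) (by omega) (f := fun x => ‖rdG g x + ((d : ℝ) / 2) • ψ x‖ ^ 2)
    (hTm.norm.pow 2) (fun x => by positivity) (hlim.const_add (∑ j, ∫ x, ‖g j x‖ ^ 2))
    (fun n => (lim _ (hp n)).1) (fun n => (lim _ (hp n)).2)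
  have ns : ∀ (x : Space d) (v : F), ‖‖x‖⁻¹ • v‖ ^ 2 = (‖x‖ ^ 2)⁻¹ * ‖v‖ ^ 2 := by
    intro x v; simp [norm_smul, mul_pow]
  simp only [ns]
  refine ⟨memLp_two_of_integrable (measurable_norm.inv.aestronglyMeasurable.smul hTm) ?_, ?_⟩
  · simpa only [ns] using this.1
  · rw [← integral_const_mul]; exact this.2

end H1Approx

variable {x : Space d}

/-- A smooth bump at unit scale, rescaled. -/
def bump (d : ℕ) (c : ℝ) (x : Space d) : ℝ :=
  (⟨1, 2, one_pos, one_lt_two⟩ : ContDiffBump (0 : Space d)) (c • x)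

lemma bump_contDiff (c : ℝ) : ContDiff ℝ ∞ (bump d c) :=
  (ContDiffBump.contDiff _).comp (contDiff_const_smul c)

lemma bump_nonneg (c : ℝ) (x : Space d) : 0 ≤ bump d c x := ContDiffBump.nonneg _

lemma bump_le_one (c : ℝ) (x : Space d) : bump d c x ≤ 1 := ContDiffBump.le_one _

lemma bump_eq_one {c : ℝ} (h : |c| * ‖x‖ ≤ 1) : bump d c x = 1 := by
  refine ContDiffBump.one_of_mem_closedBall _ ?_
  simpa [norm_smul] using h

lemma bump_eq_zero {c : ℝ} (h : 2 ≤ |c| * ‖x‖) : bump d c x = 0 := by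
  refine ContDiffBump.zero_of_le_dist _ ?_
  simpa [norm_smul] using h

lemma bump_compact {c : ℝ} (hc : c ≠ 0) : HasCompactSupport (bump d c) := by
  refine HasCompactSupport.of_support_subset_isCompact (isCompact_closedBall (0 : Space d) (2 / |c|))
    fun x hx => ?_
  have hc' : 0 < |c| := abs_pos.2 hc
  by_contra h
  simp only [Metric.mem_closedBall, dist_zero_right, not_le, div_lt_iff₀' hc'] at h
  exact hx (bump_eq_zero h.le)

lemma fderiv_bump (c : ℝ) (x : Space d) :
    fderiv ℝ (bump d c) x = c • fderiv ℝ (bump d 1) (c • x) := by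
  have e : bump d c = fun x => bump d 1 (c • x) := by funext x; simp [bump]
  rw [e, fderiv_comp_smul]

lemma exists_fderiv_bump_bound (d : ℕ) :
    ∃ K : ℝ, ∀ (c : ℝ) (x : Space d), ‖fderiv ℝ (bump d c) x‖ * ‖x‖ ≤ K := by
  have h1 : Continuous (fun x => ‖fderiv ℝ (bump d 1) x‖) :=
    ((bump_contDiff 1).continuous_fderiv (by simp)).norm
  have h2 : HasCompactSupport (fun x => ‖fderiv ℝ (bump d 1) x‖) :=
    ((bump_compact one_ne_zero).fderiv (𝕜 := ℝ)).norm
  obtain ⟨K, hK⟩ := (h2.mul_right (f' := fun x => ‖x‖)).exists_bound_of_continuous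
    (h1.mul continuous_norm)
  refine ⟨K, fun c x => ?_⟩
  have := hK (c • x); rw [fderiv_bump, norm_smul]
  simp only [Pi.mul_apply, norm_mul, norm_norm, norm_smul] at this; linarith

/-- Cut-off functions supported in annuli exhausting the punctured space. -/
def annulus (d : ℕ) (n : ℕ) (x : Space d) : ℝ := bump d ε[n] x * (1 - bump d ((n : ℝ) + 1) x)

lemma annulus_isTest (n : ℕ) : IsTest (annulus d n) :=
  ⟨(bump_contDiff _).mul (contDiff_const.sub (bump_contDiff _)),
    (bump_compact (by positivity)).mul_right⟩

lemma annulus_notMem (n : ℕ) : (0 : Space d) ∉ tsupport (annulus d n) := by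
  rw [notMem_tsupport_iff_eventuallyEq]
  have : Metric.ball (0 : Space d) ε[n] ∈ 𝓝 (0 : Space d) := Metric.ball_mem_nhds _ (by positivity)
  filter_upwards [this] with x hx
  have hx' : ‖x‖ < ε[n] := by simpa using hx
  rw [annulus, bump_eq_one (c := (n : ℝ) + 1)]
  · simp
  · rw [abs_of_pos (by positivity)]; rw [lt_div_iff₀' (by positivity)] at hx'
    exact hx'.le

lemma annulus_abs_le (n : ℕ) (x : Space d) : |annulus d n x| ≤ 1 := by
  have h1 := bump_nonneg (d := d) ε[n] x
  have h2 := bump_le_one (d := d) ε[n] x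
  have h3 := bump_nonneg (d := d) ((n : ℝ) + 1) x
  have h4 := bump_le_one (d := d) ((n : ℝ) + 1) x
  rw [annulus, abs_of_nonneg (mul_nonneg h1 (by linarith))]; nlinarith

lemma exists_fderiv_annulus_bound (d : ℕ) :
    ∃ K : ℝ, 0 ≤ K ∧ ∀ (n : ℕ) (x : Space d), ‖fderiv ℝ (annulus d n) x‖ * ‖x‖ ≤ K := by
  obtain ⟨K, hK⟩ := exists_fderiv_bump_bound d
  have hK0 : 0 ≤ K := le_trans (by positivity) (hK 1 0)
  refine ⟨2 * K, by positivity, fun n x => ?_⟩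
  set a : Space d → ℝ := bump d ε[n]
  set b : Space d → ℝ := bump d ((n : ℝ) + 1)
  have ha : DifferentiableAt ℝ a x := (bump_contDiff _).differentiable (by simp) x
  have hb : DifferentiableAt ℝ b x := (bump_contDiff _).differentiable (by simp) x
  have e : fderiv ℝ (annulus d n) x = a x • (-fderiv ℝ b x) + (1 - b x) • fderiv ℝ a x := by
    change fderiv ℝ (fun y => a y * (1 - b y)) x = _
    rw [fderiv_fun_mul ha (hb.const_sub 1), fderiv_const_sub]
  have h1 : |a x| ≤ 1 := abs_le.2 ⟨by linarith [bump_nonneg (d := d) ε[n] x], bump_le_one _ _⟩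
  have h2 : |1 - b x| ≤ 1 := abs_le.2 ⟨by linarith [bump_le_one (d := d) ((n : ℝ) + 1) x],
    by linarith [bump_nonneg (d := d) ((n : ℝ) + 1) x]⟩
  have h3 : ‖fderiv ℝ (annulus d n) x‖ ≤ ‖fderiv ℝ b x‖ + ‖fderiv ℝ a x‖ := by
    rw [e]
    refine (norm_add_le _ _).trans (add_le_add ?_ ?_)
    · rw [norm_smul, norm_neg]; exact mul_le_of_le_one_left (norm_nonneg _) h1
    · rw [norm_smul]; exact mul_le_of_le_one_left (norm_nonneg _) h2
  calc _ ≤ (‖fderiv ℝ b x‖ + ‖fderiv ℝ a x‖) * ‖x‖ := by gcongr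
    _ ≤ 2 * K := by
      have := hK ε[n] x
      have := hK ((n : ℝ) + 1) x; rw [add_mul]; linarith

lemma annulus_eventually (hx : x ≠ 0) : ∀ᶠ n : ℕ in atTop, annulus d n =ᶠ[𝓝 x] fun _ => 1 := by
  have hx' : 0 < ‖x‖ := norm_pos_iff.2 hx
  have t : Tendsto (fun n : ℕ => (n : ℝ) + 1) atTop atTop :=
    tendsto_atTop_add_const_right _ _ tendsto_natCast_atTop_atTop
  filter_upwards [t.eventually_ge_atTop (2 * ‖x‖), t.eventually_ge_atTop (4 / ‖x‖)] with n h1 h2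
  have hb : Metric.ball x (‖x‖ / 2) ∈ 𝓝 x := Metric.ball_mem_nhds _ (by positivity)
  filter_upwards [hb] with y hy
  have hy' : ‖y - x‖ < ‖x‖ / 2 := by simpa [dist_eq_norm] using hy
  have u1 : ‖y‖ ≤ 2 * ‖x‖ := by
    have := norm_le_norm_add_norm_sub x y; rw [norm_sub_rev] at this; linarith
  have u2 : ‖x‖ / 2 ≤ ‖y‖ := by have := norm_le_norm_add_norm_sub y x; linarith
  have hp : (0 : ℝ) < (n : ℝ) + 1 := by positivity
  rw [annulus, bump_eq_one, bump_eq_zero]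
  · simp
  · rw [abs_of_pos hp]; rw [div_le_iff₀ hx'] at h2; nlinarith
  · rw [abs_of_pos (by positivity), one_div, inv_mul_le_iff₀ hp]; linarith

lemma annulus_eventually_eq (hx : x ≠ 0) :
    ∀ᶠ n : ℕ in atTop, annulus d n x = 1 ∧ fderiv ℝ (annulus d n) x = 0 := by
  filter_upwards [annulus_eventually hx] with n hn
  exact ⟨hn.eq_of_nhds, by rw [hn.fderiv_eq]; simp⟩

lemma aesm_of_contDiffOn (hd : 0 < d) {G : Type*} [NormedAddCommGroup G]
    [NormedSpace ℝ G] {W : Space d → G} (hW : ContDiffOn ℝ ∞ W {0}ᶜ) :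
    AEStronglyMeasurable W := by
  have h := hW.continuousOn.aestronglyMeasurable (μ := (volume : Measure (Space d)))
    (measurableSet_singleton _).compl
  rwa [Measure.restrict_eq_self_of_ae_mem] at h; exact ae_ne_zero hd

lemma memLp_apply_of_bound (hd : 0 < d) {A : Space d → F →L[ℝ] F}
    (hA : AEStronglyMeasurable A) {C : ℝ} (hC : ∀ x ≠ 0, ‖A x‖ ≤ C / ‖x‖) {v : Space d → F}
    (hv : AEStronglyMeasurable v) (h : MemLp (fun x => ‖x‖⁻¹ • v x) 2) :
    MemLp (fun x => A x (v x)) 2 ∧ ∫ x, ‖A x (v x)‖ ^ 2 ≤ C ^ 2 * ∫ x, ‖‖x‖⁻¹ • v x‖ ^ 2 := by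
  have hm : AEStronglyMeasurable (fun x => A x (v x)) :=
    (ContinuousLinearMap.apply ℝ F : F →L[ℝ] (F →L[ℝ] F) →L[ℝ] F).flip.aestronglyMeasurable_comp₂
      hA hv
  have hb : ∀ᵐ x, ‖A x (v x)‖ ≤ C * ‖‖x‖⁻¹ • v x‖ := by
    filter_upwards [ae_ne_zero hd] with x hx
    refine ((A x).le_of_opNorm_le (hC x hx) (v x)).trans (le_of_eq ?_)
    simp [norm_smul, div_eq_mul_inv, mul_assoc]
  have hm2 := h.of_le_mul hm hb; refine ⟨hm2, ?_⟩; rw [← integral_const_mul]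
  refine integral_mono_ae (integrable_norm_sq hm2) ((integrable_norm_sq h).const_mul _) ?_
  filter_upwards [hb] with x hx; rw [← mul_pow]; gcongr

lemma H1Approx.virial (hd : 3 ≤ d) {φ : ℕ → Space d → F} {ψ : Space d → F}
    {g : Fin d → Space d → F} (h : H1Approx φ ψ g)
    {γ : Fin d → F →L[ℝ] F} (hγ : IsClifford γ) {W : Space d → F →L[ℝ] F} {C : ℝ}
    (hW : IsDecaying W C) {e M : F →L[ℝ] F} (he : CommutesClifford γ e) (hM : CommutesClifford γ M)
    (hMM : ∀ v, M (M v) = M v) (heM : ∀ v, e (M v) = M (e v))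
    (heq : ∀ᵐ x, diracG γ g x = e (ψ x) - W x (ψ x)) :
    ∫ x, (⟪M (ψ x), diracG γ g x⟫ - ⟪M (ψ x), rd W x (M (ψ x) + (2 : ℝ) • (ψ x - M (ψ x)))⟫
      - 2 * inner ℝ (M (ψ x)) (W x ((rdG g x - M (rdG g x)) +
        ((d : ℝ) / 2) • (ψ x - M (ψ x))))) = 0 := by
  have hd0 : 0 < d := by omega
  obtain ⟨K, hK0, hK⟩ := exists_fderiv_annulus_bound d
  have key := fun n => h.cutoff_virial hd0 hγ hW he hM hMM heM heq (annulus_isTest n)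
    (annulus_notMem n)
  have hcoord : ∀ (j : Fin d), ‖(coordVec j : Space d)‖ = 1 := fun j => by simp [coordVec]
  set s : Space d → ℝ := fun x => ‖ψ x‖ + ‖‖x‖⁻¹ • ψ x‖ + ∑ j, ‖g j x‖ with hs
  have hsL : MemLp s 2 := (h.conv.memLp_lim.norm.add (h.memLp_inv_smul hd).norm).add
    (memLp_finsetSum _ fun j _ => (h.conv_pd j).memLp_lim.norm)
  have hs2 : Integrable (fun x => s x ^ 2) := by simpa using integrable_norm_sq hsL
  set Γ : ℝ := ∑ j, ‖γ j‖ with hΓ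
  set m : ℝ := ‖M‖ with hm
  set B : ℝ := m * Γ + K * Γ * m + m * |C| * (m + 2 * (1 + m)) +
    2 * m * |C| * ((1 + m) + (d + K) / 2 * (1 + m)) with hB
  refine tendsto_nhds_unique (f := fun _ : ℕ => (0 : ℝ)) (l := atTop) ?_ tendsto_const_nhds
  refine (tendsto_integral_of_dominated_convergence (fun x => B * s x ^ 2) (fun n => (key n).1.1)
    (hs2.const_mul B) ?_ ?_).congr fun n => (key n).2
  · intro n
    filter_upwards [ae_ne_zero hd0] with x hx
    have hx' : 0 < ‖x‖ := norm_pos_iff.2 hx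
    have hm0 : 0 ≤ m := norm_nonneg _
    have hΓ0 : 0 ≤ Γ := sum_nonneg fun j _ => norm_nonneg _
    set S := ∑ j, ‖g j x‖ with hS
    have hS0 : 0 ≤ S := sum_nonneg fun j _ => norm_nonneg _
    have q1 : ‖ψ x‖ ≤ s x := by simp only [hs]; have := norm_nonneg (‖x‖⁻¹ • ψ x); linarith
    have q2 : ‖ψ x‖ / ‖x‖ ≤ s x := by
      have : ‖ψ x‖ / ‖x‖ = ‖‖x‖⁻¹ • ψ x‖ := by simp [norm_smul, div_eq_inv_mul]
      rw [this]; simp only [hs]; have := norm_nonneg (ψ x); linarith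
    have q3 : S ≤ s x := by
      simp only [hs]; have := norm_nonneg (ψ x); have := norm_nonneg (‖x‖⁻¹ • ψ x); linarith
    have hs0 : 0 ≤ s x := (norm_nonneg _).trans q1
    have η1 := annulus_abs_le n x
    have η2 : |rd (annulus d n) x| ≤ K := ((fderiv ℝ (annulus d n) x).le_opNorm x).trans (hK n x)
    have η3 : ∀ j, |pd j (annulus d n) x| * ‖x‖ ≤ K := fun j => by
      refine le_trans ?_ (hK n x)
      gcongr
      have := (fderiv ℝ (annulus d n) x).le_opNorm (coordVec j)
      rwa [hcoord, mul_one] at this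
    have Mle : ∀ v, ‖M v‖ ≤ m * ‖v‖ := M.le_opNorm
    have Ple : ∀ v, ‖v - M v‖ ≤ (1 + m) * ‖v‖ := fun v =>
      (norm_sub_le _ _).trans (by linarith [Mle v])
    have Rle : ‖rdG g x‖ ≤ ‖x‖ * S := by
      refine (norm_sum_le _ _).trans ?_
      rw [hS, mul_sum]
      refine sum_le_sum fun j _ => ?_
      rw [norm_smul]; gcongr; simpa using PiLp.norm_apply_le x j
    have Wle : ∀ v, ‖W x v‖ ≤ |C| / ‖x‖ * ‖v‖ := fun v => (W x).le_of_opNorm_le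
      ((hW.bound x hx).trans (by gcongr; exact le_abs_self C)) v
    have Zle : ∀ v, ‖rd W x v‖ ≤ |C| / ‖x‖ * ‖v‖ := fun v => (rd W x).le_of_opNorm_le
      ((hW.bound_rd x hx).trans (by gcongr; exact le_abs_self C)) v
    have Dle : ‖diracG γ g x‖ ≤ Γ * s x := by
      refine (norm_sum_le _ _).trans ?_
      rw [hΓ, sum_mul]
      refine sum_le_sum fun j _ => ((γ j).le_opNorm _).trans ?_
      gcongr
      exact (single_le_sum (f := fun j => ‖g j x‖) (fun j _ => norm_nonneg _) (mem_univ j)).trans q3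
    have t1 : |annulus d n x * inner ℝ (M (ψ x)) (diracG γ g x)| ≤ m * Γ * s x ^ 2 := by
      rw [abs_mul]
      calc _ ≤ 1 * (‖M (ψ x)‖ * ‖diracG γ g x‖) := by gcongr; exact abs_real_inner_le_norm _ _
        _ ≤ 1 * ((m * s x) * (Γ * s x)) := by gcongr; exact (Mle _).trans (by gcongr)
        _ = _ := by ring
    have t2 : |∑ j, pd j (annulus d n) x * inner ℝ (M (ψ x)) (γ j (rdG g x))| ≤
        K * Γ * m * s x ^ 2 := by
      refine (Finset.abs_sum_le_sum_abs _ _).trans ?_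
      have : K * Γ * m * s x ^ 2 = ∑ j, K * ‖γ j‖ * m * s x ^ 2 := by
        rw [hΓ, mul_sum, sum_mul, sum_mul]
      rw [this]
      refine sum_le_sum fun j _ => ?_
      rw [abs_mul]
      calc _ ≤ |pd j (annulus d n) x| * (‖M (ψ x)‖ * ‖γ j (rdG g x)‖) := by
            gcongr; exact abs_real_inner_le_norm _ _
        _ ≤ |pd j (annulus d n) x| * ((m * s x) * (‖γ j‖ * (‖x‖ * s x))) := by
            gcongr
            · exact (Mle _).trans (by gcongr)
            · exact ((γ j).le_opNorm _).trans (by gcongr; exact Rle.trans (by gcongr))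
        _ = (|pd j (annulus d n) x| * ‖x‖) * (‖γ j‖ * m * s x ^ 2) := by ring
        _ ≤ K * (‖γ j‖ * m * s x ^ 2) := by gcongr; exact η3 j
        _ = _ := by ring
    have t3 : |annulus d n x * inner ℝ (M (ψ x))
        (rd W x (M (ψ x) + (2 : ℝ) • (ψ x - M (ψ x))))| ≤ m * |C| * (m + 2 * (1 + m)) * s x ^ 2 := by
      rw [abs_mul]
      have v1 : ‖M (ψ x) + (2 : ℝ) • (ψ x - M (ψ x))‖ ≤ (m + 2 * (1 + m)) * ‖ψ x‖ := by
        refine (norm_add_le _ _).trans ?_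
        rw [norm_smul, norm_ofNat]; linarith [Mle (ψ x), Ple (ψ x)]
      calc _ ≤ 1 * (‖M (ψ x)‖ * ‖rd W x (M (ψ x) + (2 : ℝ) • (ψ x - M (ψ x)))‖) := by
            gcongr; exact abs_real_inner_le_norm _ _
        _ ≤ 1 * ((m * s x) * (|C| / ‖x‖ * ((m + 2 * (1 + m)) * ‖ψ x‖))) := by
            gcongr
            · exact (Mle _).trans (by gcongr)
            · exact (Zle _).trans (by gcongr)
        _ = (m * s x) * |C| * (m + 2 * (1 + m)) * (‖ψ x‖ / ‖x‖) := by ring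
        _ ≤ (m * s x) * |C| * (m + 2 * (1 + m)) * s x := by gcongr
        _ = _ := by ring
    have t4 : |2 * inner ℝ (M (ψ x)) (W x (annulus d n x • (rdG g x - M (rdG g x)) +
        ((d * annulus d n x + rd (annulus d n) x) / 2) • (ψ x - M (ψ x))))| ≤
        2 * m * |C| * ((1 + m) + (d + K) / 2 * (1 + m)) * s x ^ 2 := by
      rw [abs_mul, abs_two]
      have v1 : ‖annulus d n x • (rdG g x - M (rdG g x)) +
        ((d * annulus d n x + rd (annulus d n) x) / 2) • (ψ x - M (ψ x))‖ ≤
          (1 + m) * (‖x‖ * S) + (d + K) / 2 * ((1 + m) * ‖ψ x‖) := by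
        refine (norm_add_le _ _).trans (add_le_add ?_ ?_)
        · rw [norm_smul, norm_eq_abs]
          calc _ ≤ 1 * ((1 + m) * ‖rdG g x‖) := by gcongr; exact Ple _
            _ ≤ _ := by rw [one_mul]; gcongr
        · rw [norm_smul, norm_eq_abs]
          refine mul_le_mul ?_ (Ple _) (norm_nonneg _) (by positivity)
          rw [abs_div, abs_two]; gcongr; refine (abs_add_le _ _).trans (add_le_add ?_ η2)
          rw [abs_mul, Nat.abs_cast]; exact mul_le_of_le_one_right (by positivity) η1
      calc _ ≤ 2 * ((m * s x) * (|C| / ‖x‖ * ((1 + m) * (‖x‖ * S) + (d + K) / 2 * ((1 + m) * ‖ψ x‖)))) := by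
            gcongr
            refine (abs_real_inner_le_norm _ _).trans ?_
            gcongr
            · exact (Mle _).trans (by gcongr)
            · exact (Wle _).trans (by gcongr)
        _ = 2 * (m * s x) * |C| * ((1 + m) * S + (d + K) / 2 * (1 + m) * (‖ψ x‖ / ‖x‖)) := by
            field_simp
        _ ≤ 2 * (m * s x) * |C| * ((1 + m) * s x + (d + K) / 2 * (1 + m) * s x) := by gcongr
        _ = _ := by ring
    rw [norm_eq_abs]
    refine (abs_sub _ _).trans ((add_le_add ((abs_sub _ _).trans (add_le_add
      ((abs_add_le _ _).trans (add_le_add t1 t2)) t3)) t4).trans (le_of_eq ?_))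
    rw [hB]; ring
  · filter_upwards [ae_ne_zero hd0] with x hx
    refine tendsto_const_nhds.congr' ?_
    filter_upwards [annulus_eventually_eq hx] with n hn; simp [rd, pd, hn.1, hn.2]

variable {φ : ℕ → Space d → F} {ψ : Space d → F} {g : Fin d → Space d → F}

lemma norm_coordVec (j : Fin d) : ‖(coordVec j : Space d)‖ = 1 := by simp [coordVec]

lemma abs_pd_le (g : Space d → ℝ) (j : Fin d) (x : Space d) : |pd j g x| ≤ ‖fderiv ℝ g x‖ := by
  have := (fderiv ℝ g x).le_opNorm (coordVec j); rwa [norm_coordVec, mul_one] at this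

lemma sum_pd_sq (g : Space d → ℝ) (x : Space d) : ∑ j, pd j g x ^ 2 = ‖fderiv ℝ g x‖ ^ 2 := by
  set v := (InnerProductSpace.toDual ℝ (Space d)).symm (fderiv ℝ g x) with hv
  have h1 : ∀ y, fderiv ℝ g x y = ⟪v, y⟫ := fun y => by rw [hv, InnerProductSpace.toDual_symm_apply]
  have h2 : ‖fderiv ℝ g x‖ = ‖v‖ := by rw [hv, LinearIsometryEquiv.norm_map]
  rw [h2, EuclideanSpace.norm_sq_eq]
  refine sum_congr rfl fun j _ => ?_
  rw [pd, h1]; simp [coordVec, EuclideanSpace.inner_single_right]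

lemma IsClifford.norm_sq_sum {γ : Fin d → F →L[ℝ] F} (hγ : IsClifford γ) (a : Fin d → ℝ) (v : F) :
    ‖∑ j, a j • γ j v‖ ^ 2 = (∑ j, a j ^ 2) * ‖v‖ ^ 2 := by
  have hd : ∀ j k, ⟪γ j v, γ k v⟫ + ⟪γ k v, γ j v⟫ = if j = k then 2 * ‖v‖ ^ 2 else 0 := by
    intro j k; rw [hγ.skew j, hγ.skew k, ← neg_add, ← inner_add_right, hγ.anticomm]
    split_ifs <;> simp [real_inner_smul_right]
  have e : ‖∑ j, a j • γ j v‖ ^ 2 = ∑ j, ∑ k, a j * a k * ⟪γ j v, γ k v⟫ := by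
    rw [← real_inner_self_eq_norm_sq, sum_inner]
    refine sum_congr rfl fun j _ => ?_
    rw [inner_sum]
    refine sum_congr rfl fun k _ => ?_
    rw [real_inner_smul_left, real_inner_smul_right]; ring
  have e' : ‖∑ j, a j • γ j v‖ ^ 2 = ∑ j, ∑ k, a j * a k * ⟪γ k v, γ j v⟫ := by
    rw [e, sum_comm]; refine sum_congr rfl fun j _ => sum_congr rfl fun k _ => by ring
  have : 2 * ‖∑ j, a j • γ j v‖ ^ 2 = 2 * ((∑ j, a j ^ 2) * ‖v‖ ^ 2) := by
    rw [two_mul]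
    nth_rw 1 [e]; rw [e', ← sum_add_distrib]; simp only [← sum_add_distrib, ← mul_add, hd]
    simp only [mul_ite, mul_zero, sum_ite_eq, mem_univ, if_true]; rw [sum_mul, mul_sum]
    refine sum_congr rfl fun j _ => by ring
  linarith

lemma H1Approx.smul_bdd
    (h : H1Approx φ ψ g) {m : Space d → ℝ} (hm : ContDiff ℝ ∞ m) {C : ℝ} (h1 : ∀ x, |m x| ≤ C)
    (h2 : ∀ x, ‖fderiv ℝ m x‖ ≤ C) :
    H1Approx (fun n x => m x • φ n x) (fun x => m x • ψ x)
      (fun j x => m x • g j x + pd j m x • ψ x) := by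
  refine ⟨fun n => (h.test n).smul_left hm, h.conv.smul_bdd hm.continuous.aestronglyMeasurable h1,
    fun j => ?_⟩
  have e : (fun n => pd j (fun x => m x • φ n x)) =
      fun n x => m x • pd j (φ n) x + pd j m x • φ n x := by
    funext n x
    exact pd_smul j (hm.differentiable (by simp) x) ((h.test n).differentiable x)
  have c : Continuous (pd j m) := (hm.continuous_fderiv (by simp)).clm_apply continuous_const
  rw [e]
  exact ((h.conv_pd j).smul_bdd hm.continuous.aestronglyMeasurable h1).add
    (h.conv.smul_bdd c.aestronglyMeasurable fun x => (abs_pd_le m j x).trans (h2 x))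

lemma H1Approx.weighted_hardy
    (h : H1Approx φ ψ g) (hd : 3 ≤ d) {γ : Fin d → F →L[ℝ] F} (hγ : IsClifford γ) {m : Space d → ℝ}
    (hm : ContDiff ℝ ∞ m) {C : ℝ} (h1 : ∀ x, |m x| ≤ C)
    (h2 : ∀ x, ‖fderiv ℝ m x‖ ≤ C) (h3 : ∀ x, ‖fderiv ℝ m x‖ * ‖x‖ ≤ |m x| / 2) :
    (κ[d] - 1 / 2) * √(∫ x, ‖‖x‖⁻¹ • m x • ψ x‖ ^ 2) ≤ √(∫ x, ‖m x • diracG γ g x‖ ^ 2) := by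
  have hc : 0 ≤ κ[d] := by
    have : (3 : ℝ) ≤ d := by exact_mod_cast hd
    linarith
  have k := h.smul_bdd hm h1 h2
  have a1 := k.hardy_norm hd; rw [← k.integral_dirac_sq hγ] at a1
  have e : ∀ x, diracG γ (fun j x => m x • g j x + pd j m x • ψ x) x =
      m x • diracG γ g x + ∑ j, pd j m x • γ j (ψ x) := by
    intro x; simp [diracG, sum_add_distrib, smul_sum]
  simp only [e] at a1
  have c1 := ((h.conv_dirac γ).smul_bdd hm.continuous.aestronglyMeasurable h1).memLp_lim
  have c2 : MemLp (fun x => ∑ j, pd j m x • γ j (ψ x)) 2 := by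
    refine memLp_finsetSum _ fun j _ => ?_
    have c : Continuous (pd j m) := (hm.continuous_fderiv (by simp)).clm_apply continuous_const
    exact ((h.conv.clm (γ j)).smul_bdd c.aestronglyMeasurable
      fun x => (abs_pd_le m j x).trans (h2 x)).memLp_lim
  have a2 := sqrt_integral_norm_add_sq_le c1 c2
  have hH := k.memLp_inv_smul hd
  have a3 : ∫ x, ‖∑ j, pd j m x • γ j (ψ x)‖ ^ 2 ≤ (1 / 2) ^ 2 * ∫ x, ‖‖x‖⁻¹ • m x • ψ x‖ ^ 2 := by
    rw [← integral_const_mul]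
    refine integral_mono_ae (integrable_norm_sq c2) ((integrable_norm_sq hH).const_mul _) ?_
    filter_upwards [ae_ne_zero (d := d) (by omega)] with x hx
    have hx' : 0 < ‖x‖ := norm_pos_iff.2 hx
    rw [hγ.norm_sq_sum, sum_pd_sq, ← mul_pow, ← mul_pow, norm_smul, norm_smul, norm_inv, norm_norm,
      norm_eq_abs]
    refine pow_le_pow_left₀ (by positivity) ?_ 2
    rw [← mul_assoc, ← mul_assoc]; refine mul_le_mul_of_nonneg_right ?_ (norm_nonneg _)
    have := h3 x; rw [← le_div_iff₀ hx'] at this; refine this.trans (le_of_eq ?_)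
    field_simp
  have a4 := sqrt_le_sqrt a3; rw [sqrt_mul (by norm_num), sqrt_sq (by norm_num)] at a4
  have a5 := sqrt_le_sqrt a1; rw [sqrt_mul (by positivity), sqrt_sq hc] at a5; linarith

/-- A bounded smooth substitute for `√|x|`. -/
def sqrtWeight (d : ℕ) (ε : ℝ) (x : Space d) : ℝ := √√((‖x‖ ^ 2 + ε) / (1 + ε * (‖x‖ ^ 2 + ε)))

lemma sqrtWeight_contDiff (hε : 0 < ε) : ContDiff ℝ ∞ (sqrtWeight d ε) := by
  have h : ContDiff ℝ ∞ (fun x : Space d => ‖x‖ ^ 2 + ε) := (contDiff_norm_sq ℝ).add contDiff_const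
  have hk : ContDiff ℝ ∞ (fun x : Space d => (‖x‖ ^ 2 + ε) / (1 + ε * (‖x‖ ^ 2 + ε))) :=
    h.div (contDiff_const.add (contDiff_const.mul h)) fun x => by positivity
  refine (hk.sqrt fun x => ?_).sqrt fun x => ?_
  · positivity
  · have : 0 < (‖x‖ ^ 2 + ε) / (1 + ε * (‖x‖ ^ 2 + ε)) := by positivity
    exact (Real.sqrt_pos.2 this).ne'

lemma sqrtWeight_pos (hε : 0 < ε) (x : Space d) : 0 < sqrtWeight d ε x := by
  have : 0 < (‖x‖ ^ 2 + ε) / (1 + ε * (‖x‖ ^ 2 + ε)) := by positivity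
  exact Real.sqrt_pos.2 (Real.sqrt_pos.2 this)

lemma sqrtWeight_sq (ε : ℝ) (x : Space d) : sqrtWeight d ε x ^ 2 =
    √((‖x‖ ^ 2 + ε) / (1 + ε * (‖x‖ ^ 2 + ε))) := sq_sqrt (sqrt_nonneg _)

lemma sqrtWeight_pow_four (hε : 0 < ε) (x : Space d) : sqrtWeight d ε x ^ 4 =
    (‖x‖ ^ 2 + ε) / (1 + ε * (‖x‖ ^ 2 + ε)) := by
  have : sqrtWeight d ε x ^ 4 = (sqrtWeight d ε x ^ 2) ^ 2 := by ring
  rw [this, sqrtWeight_sq, sq_sqrt (by positivity)]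

lemma norm_fderiv_sqrtWeight (hε : 0 < ε) (x : Space d) :
    ‖fderiv ℝ (sqrtWeight d ε) x‖ * (2 * ((‖x‖ ^ 2 + ε) * (1 + ε * (‖x‖ ^ 2 + ε)))) =
      sqrtWeight d ε x * ‖x‖ := by
  set s := ‖x‖ ^ 2 + ε with hs
  have hs0 : 0 < s := by positivity
  have hg := sqrtWeight_pos hε x
  have h4 := sqrtWeight_pow_four hε x
  have hd : DifferentiableAt ℝ (sqrtWeight d ε) x := (sqrtWeight_contDiff hε).differentiable (by simp) x
  have d1 : HasFDerivAt (fun x : Space d => ‖x‖ ^ 2 + ε) ((2 : ℝ) • (innerSL ℝ x)) x := by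
    have := (hasStrictFDerivAt_norm_sq x).hasFDerivAt
    rw [← Nat.cast_smul_eq_nsmul ℝ] at this; exact this.add_const ε
  have d2 : HasDerivAt (fun s : ℝ => s / (1 + ε * s)) (1 / (1 + ε * s) ^ 2) s := by
    have h0 : (1 + ε * s) ≠ 0 := by positivity
    have := (hasDerivAt_id s).div (((hasDerivAt_id s).const_mul ε).const_add 1) h0
    have el : (1 * (1 + ε * id s) - id s * (ε * 1)) / (1 + ε * id s) ^ 2 = 1 / (1 + ε * s) ^ 2 := by
      simp only [id]; ring
    rw [← el]; exact this
  have d3 : HasFDerivAt (fun x : Space d => sqrtWeight d ε x ^ 4)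
      ((1 / (1 + ε * s) ^ 2) • ((2 : ℝ) • (innerSL ℝ x))) x := by
    have := d2.comp_hasFDerivAt x d1
    refine this.congr_of_eventuallyEq (.of_forall fun y => ?_)
    simp [sqrtWeight_pow_four hε]
  have d4 := hd.hasFDerivAt.pow 4
  have e := d4.unique d3
  have e2 := congrArg (fun L => ‖L‖) e
  simp only [norm_smul, innerSL_apply_norm] at e2; rw [← hs] at h4
  have hq : 0 < 1 + ε * s := by positivity
  simp only [← Nat.cast_smul_eq_nsmul ℝ, norm_smul, norm_eq_abs] at e2
  rw [abs_of_pos (by positivity), abs_of_pos (by positivity)] at e2; norm_num at e2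
  rw [eq_div_iff hq.ne'] at h4
  have hk : (4 * sqrtWeight d ε x ^ 3 * ‖fderiv ℝ (sqrtWeight d ε) x‖) * (1 + ε * s) ^ 2 = 2 * ‖x‖ := by
    rw [e2]; field_simp
  have : 2 * (‖fderiv ℝ (sqrtWeight d ε) x‖ * (2 * (s * (1 + ε * s)))) =
      2 * (sqrtWeight d ε x * ‖x‖) := by
    linear_combination sqrtWeight d ε x * hk - 4 * ‖fderiv ℝ (sqrtWeight d ε) x‖ * (1 + ε * s) * h4
  linarith

lemma norm_fderiv_sqrtWeight_mul_le (hε : 0 < ε) (x : Space d) :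
    ‖fderiv ℝ (sqrtWeight d ε) x‖ * ‖x‖ ≤ |sqrtWeight d ε x| / 2 := by
  have h := norm_fderiv_sqrtWeight hε x
  have hg := sqrtWeight_pos hε x; rw [abs_of_pos hg]
  have hs : 0 < ‖x‖ ^ 2 + ε := by positivity
  have hb := norm_nonneg (fderiv ℝ (sqrtWeight d ε) x)
  set N := ‖fderiv ℝ (sqrtWeight d ε) x‖
  rcases eq_or_ne x 0 with rfl | hx
  · simp; positivity
  · have hx' : 0 < ‖x‖ := norm_pos_iff.2 hx
    have h1 : N * (2 * ‖x‖ ^ 2) ≤ sqrtWeight d ε x * ‖x‖ := by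
      rw [← h]; gcongr
      nlinarith [mul_pos hε hs, sq_nonneg ‖x‖, mul_pos (mul_pos hε hs) hs]
    have h2 : (N * ‖x‖) * ‖x‖ ≤ (sqrtWeight d ε x / 2) * ‖x‖ := by nlinarith
    exact le_of_mul_le_mul_right h2 hx'

lemma exists_sqrtWeight_bound (hε : 0 < ε) :
    ∃ C : ℝ, ∀ x : Space d, |sqrtWeight d ε x| ≤ C ∧ ‖fderiv ℝ (sqrtWeight d ε) x‖ ≤ C := by
  have b1 : ∀ x : Space d, sqrtWeight d ε x ≤ √√(1 / ε) := by
    intro x; refine sqrt_le_sqrt (sqrt_le_sqrt ?_)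
    rw [div_le_div_iff₀ (by positivity) hε]; nlinarith
  refine ⟨√√(1 / ε) * (1 + 1 / ε), fun x => ?_⟩
  have hg := sqrtWeight_pos hε x
  have hS : 0 ≤ √√(1 / ε) := sqrt_nonneg _
  constructor
  · rw [abs_of_pos hg]
    exact (b1 x).trans (le_mul_of_one_le_right hS (by have : 0 < 1 / ε := by positivity
                                                      linarith))
  · have h := norm_fderiv_sqrtWeight hε x
    have hb := norm_nonneg (fderiv ℝ (sqrtWeight d ε) x)
    set N := ‖fderiv ℝ (sqrtWeight d ε) x‖
    set s := ‖x‖ ^ 2 + ε with hs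
    have hs0 : 0 < s := by positivity
    have hxs : ‖x‖ ≤ 2 * s * (1 + 1 / ε) := by
      have : ‖x‖ ≤ ‖x‖ ^ 2 + 1 := by nlinarith [sq_nonneg (‖x‖ - 1)]
      have e : 2 * s * (1 + 1 / ε) = 2 * s + 2 * (s * (1 / ε)) := by ring
      have : 1 ≤ s * (1 / ε) := by rw [mul_one_div, le_div_iff₀ hε]; nlinarith [sq_nonneg ‖x‖]
      nlinarith [sq_nonneg ‖x‖]
    have h1 : N * (2 * s) ≤ sqrtWeight d ε x * ‖x‖ := by
      rw [← h]; gcongr; nlinarith [mul_pos hε hs0, mul_pos (mul_pos hε hs0) hs0]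
    have h2 : N * (2 * s) ≤ (√√(1 / ε) * (1 + 1 / ε)) * (2 * s) := by
      refine h1.trans ?_
      calc _ ≤ √√(1 / ε) * (2 * s * (1 + 1 / ε)) := by gcongr; exact b1 x
        _ = _ := by ring
    exact le_of_mul_le_mul_right h2 (by positivity)

lemma tendsto_integral_sqrtWeight (h : H1Approx φ ψ g) (hd : 3 ≤ d) :
    Integrable (fun x => ‖x‖⁻¹ * ‖ψ x‖ ^ 2) ∧
    Tendsto (fun n : ℕ => ∫ x, ‖‖x‖⁻¹ • sqrtWeight d ε[n] x • ψ x‖ ^ 2) atTop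
      (𝓝 (∫ x, ‖x‖⁻¹ * ‖ψ x‖ ^ 2)) := by
  have hp : ∀ n : ℕ, (0 : ℝ) < ε[n] := fun n => by positivity
  have hp1 : ∀ n : ℕ, ε[n] ≤ 1 := fun n => by
    rw [div_le_one (by positivity)]; linarith [(Nat.cast_nonneg n : (0 : ℝ) ≤ n)]
  have e : ∀ (ε : ℝ) (x : Space d), ‖‖x‖⁻¹ • sqrtWeight d ε x • ψ x‖ ^ 2 =
      (‖x‖ ^ 2)⁻¹ * √((‖x‖ ^ 2 + ε) / (1 + ε * (‖x‖ ^ 2 + ε))) * ‖ψ x‖ ^ 2 := by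
    intro ε x
    rw [norm_smul, norm_smul, mul_pow, mul_pow, norm_eq_abs, norm_eq_abs, sq_abs, sq_abs,
      sqrtWeight_sq, inv_pow]
    ring
  have hdom : Integrable (fun x => ‖ψ x‖ ^ 2 + 2 * ((‖x‖ ^ 2)⁻¹ * ‖ψ x‖ ^ 2)) :=
    (integrable_norm_sq h.conv.memLp_lim).add ((h.hardy hd).1.const_mul 2)
  have hmψ := (h.conv.memLp_lim.1.norm.pow 2)
  constructor
  · refine hdom.mono' (measurable_norm.inv.aestronglyMeasurable.mul hmψ) (.of_forall fun x => ?_)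
    rw [norm_eq_abs, abs_of_nonneg (by positivity)]
    have h1 : ‖x‖⁻¹ ≤ 1 + 2 * (‖x‖ ^ 2)⁻¹ := by
      rw [← inv_pow]; nlinarith [sq_nonneg (‖x‖⁻¹ - 1), sq_nonneg (‖x‖⁻¹)]
    nlinarith [mul_le_mul_of_nonneg_right h1 (sq_nonneg ‖ψ x‖)]
  · refine tendsto_integral_of_dominated_convergence _ (fun n => ?_) hdom (fun n => ?_) ?_
    · have := (sqrtWeight_contDiff (d := d) (hp n)).continuous.aestronglyMeasurable (μ := (volume : Measure (Space d)))
      exact ((measurable_norm.inv.aestronglyMeasurable).smul (this.smul h.conv.memLp_lim.1)).norm.pow 2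
    · filter_upwards [ae_ne_zero (d := d) (by omega)] with x hx
      have hx' : 0 < ‖x‖ := norm_pos_iff.2 hx
      rw [norm_eq_abs, abs_of_nonneg (by positivity), e]
      set ε := ε[n]
      have hε := hp n
      have hε1 := hp1 n
      have h1 : √((‖x‖ ^ 2 + ε) / (1 + ε * (‖x‖ ^ 2 + ε))) ≤ ‖x‖ ^ 2 + 2 := by
        refine Real.sqrt_le_iff.2 ⟨by positivity, ?_⟩
        rw [div_le_iff₀ (by positivity)]
        have : 0 ≤ ε * (‖x‖ ^ 2 + ε) := by positivity
        nlinarith [sq_nonneg ‖x‖, mul_nonneg this (sq_nonneg (‖x‖ ^ 2 + 2))]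
      calc _ ≤ (‖x‖ ^ 2)⁻¹ * (‖x‖ ^ 2 + 2) * ‖ψ x‖ ^ 2 := by gcongr
        _ = _ := by field_simp
    · filter_upwards [ae_ne_zero (d := d) (by omega)] with x hx
      have hx' : 0 < ‖x‖ := norm_pos_iff.2 hx; simp only [e]
      have t0 := tendsto_one_div_add_atTop_nhds_zero_nat (𝕜 := ℝ)
      have t1 : Tendsto (fun n : ℕ => ‖x‖ ^ 2 + ε[n]) atTop (𝓝 (‖x‖ ^ 2 + 0)) :=
        tendsto_const_nhds.add t0
      have t2 : Tendsto (fun n : ℕ => 1 + ε[n] * (‖x‖ ^ 2 + ε[n])) atTop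
        (𝓝 (1 + 0 * (‖x‖ ^ 2 + 0))) := tendsto_const_nhds.add (t0.mul t1)
      have t3 := (((t1.div t2 (by norm_num)).sqrt).const_mul ((‖x‖ ^ 2)⁻¹)).mul_const (‖ψ x‖ ^ 2)
      have el : (‖x‖ ^ 2)⁻¹ * √((‖x‖ ^ 2 + 0) / (1 + 0 * (‖x‖ ^ 2 + 0))) * ‖ψ x‖ ^ 2 =
          ‖x‖⁻¹ * ‖ψ x‖ ^ 2 := by
        rw [add_zero, zero_mul, add_zero, div_one, sqrt_sq hx'.le]; field_simp
      rw [← el]; exact t3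

lemma virial_constant_lt {t T s L k l κ : ℝ} (ht0 : 0 ≤ t) (htT : t ≤ T) (hs0 : 0 ≤ s)
    (hs : 1 + 3 * T ^ 2 ≤ s ^ 2) (hl0 : 0 ≤ l) (hl : l ≤ L) (hκ0 : 0 ≤ κ) (hκ : κ ≤ k)
    (hlt : (T * s + L * T + 2 * T * k) ^ 2 + T ^ 2 < 1) :
    (t * √(1 + 3 * t ^ 2) + l * t + 2 * t * κ) ^ 2 + t ^ 2 < 1 := by
  have h1 : √(1 + 3 * t ^ 2) ≤ s := by
    refine Real.sqrt_le_iff.2 ⟨hs0, ?_⟩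
    nlinarith [pow_le_pow_left₀ ht0 htT 2]
  have hT : 0 ≤ T := ht0.trans htT
  have hL : 0 ≤ L := hl0.trans hl
  have hk : 0 ≤ k := hκ0.trans hκ
  have h2 : t * √(1 + 3 * t ^ 2) + l * t + 2 * t * κ ≤ T * s + L * T + 2 * T * k := by
    have h0 := sqrt_nonneg (1 + 3 * t ^ 2); gcongr
  have h3 : 0 ≤ t * √(1 + 3 * t ^ 2) + l * t + 2 * t * κ := by positivity
  have h4 := pow_le_pow_left₀ h3 h2 2
  have h5 := pow_le_pow_left₀ ht0 htT 2; linarith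

lemma virial_three {t Λ C₂ : ℝ} (ht0 : 0 ≤ t) (hΛ0 : 0 ≤ Λ) (h1 : Λ ≤ t / 2)
    (h2 : Λ ≤ 3 / 2 * C₂) (hC : 2 * t + C₂ < 1) :
    (t * √(1 + 3 * t ^ 2) + 4 * Λ * t) ^ 2 + t ^ 2 < 1 := by
  have h0 := sqrt_nonneg (1 + 3 * t ^ 2)
  have ht : t ≤ 1 / 2 := by linarith
  have hpos : 0 ≤ t * √(1 + 3 * t ^ 2) + 4 * Λ * t := by positivity
  rcases le_total t (3 / 7) with h | h
  · have := virial_constant_lt (s := 1.2455) (L := 6 / 7) (k := 0) (κ := 0) ht0 h (by norm_num)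
      (by norm_num) (l := 4 * Λ) (by positivity) (by linarith) le_rfl le_rfl (by norm_num)
    simpa using this
  · have hs : √(1 + 3 * t ^ 2) ≤ (1 + 3 * t ^ 2 + 1.2454 ^ 2) / (2 * 1.2454) := by
      rw [le_div_iff₀ (by norm_num)]
      nlinarith [sq_nonneg (√(1 + 3 * t ^ 2) - 1.2454),
        sq_sqrt (show 0 ≤ 1 + 3 * t ^ 2 by positivity)]
    have hm : t * √(1 + 3 * t ^ 2) + 4 * Λ * t ≤ 0.9012 - 5 / 2 * (t - 3 / 7) := by
      have e1 : t * √(1 + 3 * t ^ 2) ≤ t * ((1 + 3 * t ^ 2 + 1.2454 ^ 2) / (2 * 1.2454)) := by gcongr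
      have e2 : Λ * t ≤ 3 / 2 * (1 - 2 * t) * t := by gcongr; linarith
      have hτ : 0 ≤ t - 3 / 7 := by linarith
      have hτ2 : t - 3 / 7 ≤ 1 / 14 := by linarith
      have e3 : t * ((1 + 3 * t ^ 2 + 1.2454 ^ 2) / (2 * 1.2454)) =
        (t * (1 + 1.2454 ^ 2) + 3 * t ^ 3) / (2 * 1.2454) := by ring
      have e4 : (t * (1 + 1.2454 ^ 2) + 3 * t ^ 3) / (2 * 1.2454) + 6 * (1 - 2 * t) * t ≤
          0.9012 - 5 / 2 * (t - 3 / 7) := by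
        rw [← le_sub_iff_add_le, div_le_iff₀ (by norm_num)]
        obtain ⟨τ, rfl⟩ : ∃ τ, t = τ + 3 / 7 := ⟨t - 3 / 7, by ring⟩
        ring_nf at hτ hτ2 ⊢
        nlinarith [mul_nonneg hτ hτ, mul_nonneg hτ (by linarith : 0 ≤ 1 / 14 - τ), mul_nonneg (mul_nonneg hτ hτ) (by linarith : 0 ≤ 1 / 14 - τ)]
      linarith
    have := pow_le_pow_left₀ hpos hm 2; nlinarith

lemma virial_five {t Λ C₂ : ℝ} (ht0 : 0 ≤ t) (hΛ0 : 0 ≤ Λ) (h1 : Λ ≤ 3 / 2 * t)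
    (h2 : Λ ≤ 5 / 2 * C₂) (hC : 2 * t + C₂ < 1) :
    (t * √(1 + 3 * t ^ 2) + 2 * Λ * t) ^ 2 + t ^ 2 < 1 := by
  have h0 := sqrt_nonneg (1 + 3 * t ^ 2)
  have ht : t ≤ 1 / 2 := by linarith
  have hpos : 0 ≤ t * √(1 + 3 * t ^ 2) + 2 * Λ * t := by positivity
  rcases le_total t (5 / 13) with h | h
  · have := virial_constant_lt (s := 1.202) (L := 15 / 13) (k := 0) (κ := 0) ht0 h (by norm_num)
      (by norm_num) (l := 2 * Λ) (by positivity) (by linarith) le_rfl le_rfl (by norm_num)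
    simpa using this
  · have hs : √(1 + 3 * t ^ 2) ≤ (1 + 3 * t ^ 2 + 1.2016 ^ 2) / (2 * 1.2016) := by
      rw [le_div_iff₀ (by norm_num)]
      nlinarith [sq_nonneg (√(1 + 3 * t ^ 2) - 1.2016),
        sq_sqrt (show 0 ≤ 1 + 3 * t ^ 2 by positivity)]
    have hm : t * √(1 + 3 * t ^ 2) + 2 * Λ * t ≤ 0.908 - 1 * (t - 5 / 13) := by
      have e1 : t * √(1 + 3 * t ^ 2) ≤ t * ((1 + 3 * t ^ 2 + 1.2016 ^ 2) / (2 * 1.2016)) := by gcongr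
      have e2 : Λ * t ≤ 5 / 2 * (1 - 2 * t) * t := by gcongr; linarith
      have hτ : 0 ≤ t - 5 / 13 := by linarith
      have hτ2 : t - 5 / 13 ≤ 3 / 26 := by linarith
      have e3 : t * ((1 + 3 * t ^ 2 + 1.2016 ^ 2) / (2 * 1.2016)) =
        (t * (1 + 1.2016 ^ 2) + 3 * t ^ 3) / (2 * 1.2016) := by ring
      have e4 : (t * (1 + 1.2016 ^ 2) + 3 * t ^ 3) / (2 * 1.2016) + 5 * (1 - 2 * t) * t ≤
          0.908 - 1 * (t - 5 / 13) := by
        rw [← le_sub_iff_add_le, div_le_iff₀ (by norm_num)]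
        obtain ⟨τ, rfl⟩ : ∃ τ, t = τ + 5 / 13 := ⟨t - 5 / 13, by ring⟩
        ring_nf at hτ hτ2 ⊢
        nlinarith [mul_nonneg hτ hτ, mul_nonneg hτ (by linarith : 0 ≤ 3 / 26 - τ), mul_nonneg (mul_nonneg hτ hτ) (by linarith : 0 ≤ 3 / 26 - τ)]
      linarith
    have := pow_le_pow_left₀ hpos hm 2; nlinarith

lemma sqrt_le_of_hardy {c t A p U κ S : ℝ} (hc : 0 < c) (ht : 0 ≤ t) (hA : 0 ≤ A) (hp : 0 ≤ p)
    (a1 : c ^ 2 * A ≤ p) (a2 : p ≤ t ^ 2 * U) (hκ1 : 1 ≤ κ) (hκ2 : 1 ≤ κ * c)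
    (hS : S ≤ p + (1 - c ^ 2) * A) : √S ≤ κ * t * √U := by
  have hAp : p + (1 - c ^ 2) * A ≤ κ ^ 2 * p := by
    have hk2 : 1 ≤ κ ^ 2 := by nlinarith
    rcases le_total 1 c with h1 | h1
    · nlinarith [mul_nonneg (by nlinarith : 0 ≤ c ^ 2 - 1) hA]
    · have hk3 : 1 ≤ κ ^ 2 * c ^ 2 := by nlinarith
      have : (1 - c ^ 2) * A * c ^ 2 ≤ (1 - c ^ 2) * p := by
        nlinarith [mul_le_mul_of_nonneg_left a1 (by nlinarith : 0 ≤ 1 - c ^ 2)]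
      have h2 : (p + (1 - c ^ 2) * A) * c ^ 2 ≤ (κ ^ 2 * p) * c ^ 2 := by nlinarith
      exact le_of_mul_le_mul_right h2 (by positivity)
  rw [← sqrt_sq (show 0 ≤ κ * t by positivity), ← sqrt_mul (by positivity)]
  refine sqrt_le_sqrt (hS.trans (hAp.trans ?_))
  rw [mul_pow]; nlinarith [mul_le_mul_of_nonneg_left a2 (sq_nonneg κ)]

lemma abs_integral_le_mul_sqrt {G H : Type*} [NormedAddCommGroup G] [NormedAddCommGroup H]
    {f : Space d → ℝ} {a : Space d → G} {b : Space d → H} {K : ℝ} (hK : 0 ≤ K)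
    (ha : MemLp a 2) (hb : MemLp b 2) (h : ∀ᵐ x, |f x| ≤ K * (‖a x‖ * ‖b x‖)) :
    |∫ x, f x| ≤ K * (√(∫ x, ‖a x‖ ^ 2) * √(∫ x, ‖b x‖ ^ 2)) := by
  have h1 := abs_integral_inner_le ha.norm hb.norm
  have e : ∀ x, inner ℝ ‖a x‖ ‖b x‖ = ‖a x‖ * ‖b x‖ := fun x => by simp [mul_comm]
  have hi : Integrable (fun x => ‖a x‖ * ‖b x‖) := by
    simpa only [e] using integrable_inner ha.norm hb.norm
  simp only [e, norm_norm] at h1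
  calc |∫ x, f x| ≤ ∫ x, K * (‖a x‖ * ‖b x‖) := by
        rw [← norm_eq_abs]; exact norm_integral_le_of_norm_le (hi.const_mul K) h
    _ = K * ∫ x, ‖a x‖ * ‖b x‖ := integral_const_mul _ _
    _ ≤ _ := by gcongr; exact (le_abs_self _).trans h1

lemma IsDecaying.rd_symm {W : Space d → F →L[ℝ] F} {C : ℝ} (hW : IsDecaying W C) {x : Space d}
    (hx : x ≠ 0) (u v : F) : ⟪rd W x u, v⟫ = ⟪u, rd W x v⟫ := by
  set L : (F →L[ℝ] F) →L[ℝ] ℝ := (innerSL ℝ v).comp (ContinuousLinearMap.apply ℝ F u) -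
    (innerSL ℝ u).comp (ContinuousLinearMap.apply ℝ F v) with hL
  have hz : ∀ y, L (W y) = 0 := by
    intro y
    simp only [hL, sub_apply, ContinuousLinearMap.comp_apply, ContinuousLinearMap.apply_apply,
      innerSL_apply_apply]
    rw [← hW.symm, real_inner_comm, sub_self]
  have hd : DifferentiableAt ℝ W x :=
    (hW.smooth.contDiffAt (compl_singleton_mem_nhds hx)).differentiableAt (by simp)
  have h1 : fderiv ℝ (fun y => L (W y)) x x = L (rd W x) := by
    rw [fderiv_fun_comp x L.differentiableAt hd]
    simp [rd]
  simp only [hz, fderiv_fun_const] at h1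
  simp only [hL, sub_apply, ContinuousLinearMap.comp_apply, ContinuousLinearMap.apply_apply,
      innerSL_apply_apply] at h1
  rw [real_inner_comm]; simp at h1; linarith

/-- An `H¹` solution of `D ψ = (μ Q - W) ψ` for an invariant projection `Q`. -/
structure IsProjSolution (γ : Fin d → F →L[ℝ] F) (W : Space d → F →L[ℝ] F) (C : ℝ)
    (Q : F →L[ℝ] F) (μ : ℝ) (φ : ℕ → Space d → F) (ψ : Space d → F)
    (g : Fin d → Space d → F) : Prop where
  clifford : IsClifford γ
  decaying : IsDecaying W C
  invariant : CommutesClifford γ Q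
  proj : ∀ v, Q (Q v) = Q v
  approx : H1Approx φ ψ g
  eqn : ∀ᵐ x, diracG γ g x = μ • Q (ψ x) - W x (ψ x)
  dim : 3 ≤ d
  nonneg : 0 ≤ C

namespace IsProjSolution

variable {γ : Fin d → F →L[ℝ] F} {W : Space d → F →L[ℝ] F} {C : ℝ} {Q : F →L[ℝ] F} {μ : ℝ}
  {φ : ℕ → Space d → F} {ψ : Space d → F} {g : Fin d → Space d → F}
  (h : IsProjSolution γ W C Q μ φ ψ g)

include h

lemma inner_proj (u v : F) : ⟪Q u, v - Q v⟫ = 0 := by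
  rw [inner_sub_right, ← h.invariant.symm (Q u) v, h.proj, sub_self]

lemma norm_sq_split (v : F) : ‖v‖ ^ 2 = ‖Q v‖ ^ 2 + ‖v - Q v‖ ^ 2 := by
  have : v = Q v + (v - Q v) := by abel
  conv_lhs => rw [this]
  rw [norm_add_sq_real, h.inner_proj]; ring

lemma norm_compl_le (v : F) : ‖v - Q v‖ ≤ ‖v‖ := by
  refine le_of_sq_le_sq ?_ (norm_nonneg _)
  rw [h.norm_sq_split v]; nlinarith [sq_nonneg ‖Q v‖]

lemma const_pos : 0 < κ[d] := by
  have : (3 : ℝ) ≤ d := by exact_mod_cast h.dim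
  linarith

lemma pos : 0 < d := by have := h.dim; omega

lemma memLp_u : MemLp (diracG γ g) 2 := (h.approx.conv_dirac γ).memLp_lim

lemma memLp_y : MemLp (fun x => μ • Q (ψ x)) 2 := ((h.approx.conv.clm Q).const_smul μ).memLp_lim

lemma approx_compl :
    H1Approx (fun n x => φ n x - Q (φ n x)) (fun x => ψ x - Q (ψ x)) (fun j x => g j x - Q (g j x)) :=
  h.approx.clm (ContinuousLinearMap.id ℝ F - Q)

lemma dirac_compl (x : Space d) :
    diracG γ (fun j x => g j x - Q (g j x)) x = diracG γ g x - Q (diracG γ g x) := by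
  simp [diracG, h.invariant.comm, sum_sub_distrib]

lemma hardy_le : κ[d] ^ 2 * ∫ x, ‖‖x‖⁻¹ • ψ x‖ ^ 2 ≤ ∫ x, ‖diracG γ g x‖ ^ 2 := by
  rw [h.approx.integral_dirac_sq h.clifford]; exact h.approx.hardy_norm h.dim

lemma memLp_w : MemLp (fun x => W x (ψ x)) 2 ∧
    ∫ x, ‖W x (ψ x)‖ ^ 2 ≤ C ^ 2 * ∫ x, ‖‖x‖⁻¹ • ψ x‖ ^ 2 :=
  memLp_apply_of_bound h.pos (aesm_of_contDiffOn h.pos h.decaying.smooth)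
    h.decaying.bound h.approx.conv.memLp_lim.1 (h.approx.memLp_inv_smul h.dim)

lemma integral_w_le : ∫ x, ‖W x (ψ x)‖ ^ 2 ≤ (C / κ[d]) ^ 2 * ∫ x, ‖diracG γ g x‖ ^ 2 := by
  have hc := h.const_pos
  refine h.memLp_w.2.trans ?_
  rw [div_pow, div_mul_eq_mul_div, le_div_iff₀ (by positivity)]
  nlinarith [mul_le_mul_of_nonneg_left h.hardy_le (sq_nonneg C)]

lemma compl_u_eq : ∀ᵐ x, diracG γ g x - Q (diracG γ g x) = -(W x (ψ x) - Q (W x (ψ x))) := by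
  filter_upwards [h.eqn] with x hx; rw [hx, map_sub, map_smul, h.proj]; abel

lemma integral_compl_u_le :
    ∫ x, ‖diracG γ g x - Q (diracG γ g x)‖ ^ 2 ≤ (C / κ[d]) ^ 2 * ∫ x, ‖diracG γ g x‖ ^ 2 := by
  refine le_trans ?_ h.integral_w_le
  refine integral_mono_ae (integrable_norm_sq (h.memLp_u.sub
    ((h.approx.conv_dirac γ).clm Q).memLp_lim)) (integrable_norm_sq h.memLp_w.1) ?_
  filter_upwards [h.compl_u_eq] with x hx; rw [hx, norm_neg]; gcongr
  exact h.norm_compl_le _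

lemma hardy_compl_le :
    κ[d] ^ 2 * ∫ x, ‖‖x‖⁻¹ • (ψ x - Q (ψ x))‖ ^ 2 ≤ ∫ x, ‖diracG γ g x - Q (diracG γ g x)‖ ^ 2 := by
  simp only [← h.dirac_compl]; rw [h.approx_compl.integral_dirac_sq h.clifford]
  exact h.approx_compl.hardy_norm h.dim

lemma integral_inner_y : 2 * ∫ x, ⟪diracG γ g x, μ • Q (ψ x)⟫ = (∫ x, ‖diracG γ g x‖ ^ 2) -
      (∫ x, ‖W x (ψ x)‖ ^ 2) + ∫ x, ‖μ • Q (ψ x)‖ ^ 2 := by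
  rw [← integral_sub (integrable_norm_sq h.memLp_u) (integrable_norm_sq h.memLp_w.1),
    ← integral_add (integrable_fun_sub (integrable_norm_sq h.memLp_u)
      (integrable_norm_sq h.memLp_w.1)) (integrable_norm_sq h.memLp_y),
    ← integral_const_mul]
  refine integral_congr_ae ?_
  filter_upwards [h.eqn] with x hx
  have e : W x (ψ x) = μ • Q (ψ x) - diracG γ g x := by rw [hx]; abel
  rw [e, norm_sub_sq_real, real_inner_comm]; ring

lemma eq_zero_of_inner_le {m : ℝ} (hm : ∫ x, ⟪diracG γ g x, μ • Q (ψ x)⟫ ≤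
      m * (√(∫ x, ‖diracG γ g x‖ ^ 2) * √(∫ x, ‖μ • Q (ψ x)‖ ^ 2)))
    (hlt : m ^ 2 + (C / κ[d]) ^ 2 < 1) : ψ =ᵐ[volume] 0 := by
  set U2 := ∫ x, ‖diracG γ g x‖ ^ 2 with hU
  set Y2 := ∫ x, ‖μ • Q (ψ x)‖ ^ 2 with hY
  have hU0 : 0 ≤ U2 := integral_nonneg fun x => by positivity
  have hY0 : 0 ≤ Y2 := integral_nonneg fun x => by positivity
  have e := h.integral_inner_y
  have w := h.integral_w_le
  have hc := h.const_pos
  have key : U2 * (1 - (C / κ[d]) ^ 2 - m ^ 2) ≤ 0 := by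
    have hs1 := sq_sqrt hU0
    have hs2 := sq_sqrt hY0; nlinarith [sq_nonneg (m * √U2 - √Y2)]
  have hU00 : U2 = 0 := by nlinarith
  have hA : ∫ x, ‖‖x‖⁻¹ • ψ x‖ ^ 2 = 0 := by
    have := h.hardy_le; rw [← hU, hU00] at this
    have h2 : 0 ≤ ∫ x, ‖‖x‖⁻¹ • ψ x‖ ^ 2 := integral_nonneg fun x => by positivity
    have h3 : 0 < κ[d] ^ 2 := by positivity
    nlinarith
  rw [integral_eq_zero_iff_of_nonneg (fun x => by positivity)
    (integrable_norm_sq (h.approx.memLp_inv_smul h.dim))] at hA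
  filter_upwards [hA, ae_ne_zero h.pos] with x hx hx0; simpa [hx0] using hx

lemma rd_measurable : AEStronglyMeasurable (rd W) := aesm_of_contDiffOn h.pos h.decaying.smooth.rd

lemma memLp_mix : MemLp (fun x => ‖x‖⁻¹ • (Q (ψ x) + (2 : ℝ) • (ψ x - Q (ψ x)))) 2 volume ∧
    C * √(∫ x, ‖‖x‖⁻¹ • (Q (ψ x) + (2 : ℝ) • (ψ x - Q (ψ x)))‖ ^ 2) ≤
      (C / κ[d]) * √(1 + 3 * (C / κ[d]) ^ 2) * √(∫ x, ‖diracG γ g x‖ ^ 2) := by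
  have m1 := (h.approx.clm Q).memLp_inv_smul h.dim
  have m2 := h.approx_compl.memLp_inv_smul h.dim
  have m3 := h.approx.memLp_inv_smul h.dim
  have e : (fun x => ‖x‖⁻¹ • (Q (ψ x) + (2 : ℝ) • (ψ x - Q (ψ x)))) =
      (fun x => ‖x‖⁻¹ • Q (ψ x)) + (2 : ℝ) • (fun x => ‖x‖⁻¹ • (ψ x - Q (ψ x))) := by
    funext x; simp [smul_comm (2 : ℝ)]
  refine ⟨by rw [e]; exact m1.add (m2.const_smul _), ?_⟩
  have e2 : ∀ x, ‖‖x‖⁻¹ • (Q (ψ x) + (2 : ℝ) • (ψ x - Q (ψ x)))‖ ^ 2 =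
      ‖‖x‖⁻¹ • ψ x‖ ^ 2 + 3 * ‖‖x‖⁻¹ • (ψ x - Q (ψ x))‖ ^ 2 := by
    intro x; simp only [norm_smul, mul_pow]
    rw [norm_add_sq_real, real_inner_smul_right, h.inner_proj, h.norm_sq_split (ψ x), norm_smul]
    norm_num; ring
  simp only [e2]
  rw [integral_add (integrable_norm_sq m3) ((integrable_norm_sq m2).const_mul 3),
    integral_const_mul]
  have hc := h.const_pos
  have hC := h.nonneg
  have a1 := h.hardy_le
  have a2 := h.hardy_compl_le.trans h.integral_compl_u_le
  set c := κ[d]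
  set U2 := ∫ x, ‖diracG γ g x‖ ^ 2
  have hU0 : 0 ≤ U2 := integral_nonneg fun x => by positivity
  have ht : 0 ≤ C / c := div_nonneg h.nonneg hc.le
  calc _ ≤ C * √((1 + 3 * (C / c) ^ 2) * U2 / c ^ 2) := by
        refine mul_le_mul_of_nonneg_left (sqrt_le_sqrt ?_) h.nonneg
        rw [le_div_iff₀ (by positivity)]; nlinarith
    _ = _ := by
        rw [Real.sqrt_div (by positivity), sqrt_sq hc.le, sqrt_mul (by positivity)]
        field_simp

lemma commutes_smul : CommutesClifford γ (μ • Q) :=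
  ⟨fun u v => by simp [real_inner_smul_left, real_inner_smul_right, h.invariant.symm], fun j u => by
    simp [h.invariant.comm]⟩

lemma integrable_mix :
    Integrable (fun x => ⟪μ • Q (ψ x), rd W x (Q (ψ x) + (2 : ℝ) • (ψ x - Q (ψ x)))⟫) :=
  integrable_inner h.memLp_y (memLp_apply_of_bound
    (v := fun x => Q (ψ x) + (2 : ℝ) • (ψ x - Q (ψ x))) h.pos h.rd_measurable h.decaying.bound_rd
    ((h.approx.conv.clm Q).add (h.approx_compl.conv.const_smul 2)).memLp_lim.1 h.memLp_mix.1).1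

lemma integral_mix_le : ∫ x, ⟪μ • Q (ψ x), rd W x (Q (ψ x) + (2 : ℝ) • (ψ x - Q (ψ x)))⟫ ≤
    (C / κ[d]) * √(1 + 3 * (C / κ[d]) ^ 2) *
      (√(∫ x, ‖diracG γ g x‖ ^ 2) * √(∫ x, ‖μ • Q (ψ x)‖ ^ 2)) := by
  obtain ⟨mx, bx⟩ := h.memLp_mix
  refine (le_abs_self _).trans ((abs_integral_le_mul_sqrt h.nonneg h.memLp_y mx ?_).trans ?_)
  · filter_upwards [ae_ne_zero h.pos] with x hx
    refine (abs_real_inner_le_norm _ _).trans ?_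
    have := (rd W x).le_of_opNorm_le (h.decaying.bound_rd x hx)
      (Q (ψ x) + (2 : ℝ) • (ψ x - Q (ψ x)))
    calc _ ≤ ‖μ • Q (ψ x)‖ * (C / ‖x‖ * ‖Q (ψ x) + (2 : ℝ) • (ψ x - Q (ψ x))‖) := by gcongr
      _ = _ := by rw [norm_smul (‖x‖⁻¹), norm_inv, norm_norm]; ring
  · linarith [mul_le_mul_of_nonneg_left bx (sqrt_nonneg (∫ x, ‖μ • Q (ψ x)‖ ^ 2))]

lemma inner_le_of_virial {Λ κ : ℝ} (hΛ0 : 0 ≤ Λ)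
    (hΛ : ∀ x ≠ 0, ∀ a b, |inner ℝ (Q a) (W x (b - Q b))| ≤ Λ / ‖x‖ * (‖Q a‖ * ‖b - Q b‖))
    (hκ1 : 1 ≤ κ) (hκ2 : 1 ≤ κ * κ[d]) :
    ∫ x, ⟪diracG γ g x, μ • Q (ψ x)⟫ ≤ ((C / κ[d]) * √(1 + 3 * (C / κ[d]) ^ 2) +
        2 * Λ * κ * (C / κ[d])) *
      (√(∫ x, ‖diracG γ g x‖ ^ 2) * √(∫ x, ‖μ • Q (ψ x)‖ ^ 2)) := by
  have hc := h.const_pos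
  have v := h.approx.virial h.dim h.clifford h.decaying h.commutes_smul h.invariant h.proj
    (fun v => by simp) (by simpa using h.eqn)
  obtain ⟨mT, bT⟩ := h.approx_compl.dilation_bound h.dim
  have rP : ∀ x, rdG (fun j x => g j x - Q (g j x)) x = rdG g x - Q (rdG g x) := fun x => by
    simp [rdG, smul_sub, sum_sub_distrib]
  simp only [rP] at mT bT
  have mT1 : AEStronglyMeasurable (fun x => (rdG g x - Q (rdG g x)) + ((d : ℝ) / 2) • (ψ x - Q (ψ x))) volume := by
    have := (measurable_norm.aestronglyMeasurable (μ := (volume : Measure (Space d)))).smul mT.1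
    refine this.congr ?_
    filter_upwards [ae_ne_zero h.pos] with x hx; simp [smul_smul, hx]
  have mW := memLp_apply_of_bound h.pos
    (aesm_of_contDiffOn h.pos h.decaying.smooth) h.decaying.bound mT1 mT
  have i1 : Integrable (fun x => ⟪diracG γ g x, μ • Q (ψ x)⟫) :=
    integrable_inner h.memLp_u h.memLp_y
  have i2 := h.integrable_mix
  have i3 := integrable_inner h.memLp_y mW.1
  have e : ∫ x, ⟪diracG γ g x, μ • Q (ψ x)⟫ =
      (∫ x, ⟪μ • Q (ψ x), rd W x (Q (ψ x) + (2 : ℝ) • (ψ x - Q (ψ x)))⟫) +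
      2 * ∫ x, ⟪μ • Q (ψ x), W x ((rdG g x - Q (rdG g x)) + ((d : ℝ) / 2) • (ψ x - Q (ψ x)))⟫ := by
    have : μ * ∫ x, (⟪Q (ψ x), diracG γ g x⟫
      - ⟪Q (ψ x), rd W x (Q (ψ x) + (2 : ℝ) • (ψ x - Q (ψ x)))⟫
      - 2 * inner ℝ (Q (ψ x)) (W x ((rdG g x - Q (rdG g x)) +
        ((d : ℝ) / 2) • (ψ x - Q (ψ x))))) = 0 := by rw [v, mul_zero]
    rw [← integral_const_mul] at this
    rw [← sub_eq_zero, ← this, ← integral_const_mul, ← integral_add i2 (i3.const_mul 2),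
      ← integral_sub i1 (i2.fun_add (i3.const_mul 2))]
    congr 1; funext x
    rw [real_inner_comm]; simp only [real_inner_smul_left]; ring
  have b2 : |∫ x, inner ℝ (μ • Q (ψ x)) (W x ((rdG g x - Q (rdG g x)) + ((d : ℝ) / 2) • (ψ x - Q (ψ x))))|
      ≤ Λ * (√(∫ x, ‖μ • Q (ψ x)‖ ^ 2) *
        √(∫ x, ‖‖x‖⁻¹ • ((rdG g x - Q (rdG g x)) + ((d : ℝ) / 2) • (ψ x - Q (ψ x)))‖ ^ 2)) := by
    refine abs_integral_le_mul_sqrt hΛ0 h.memLp_y mT ?_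
    filter_upwards [ae_ne_zero h.pos] with x hx
    have e1 : (rdG g x - Q (rdG g x)) + ((d : ℝ) / 2) • (ψ x - Q (ψ x)) =
      (rdG g x + ((d : ℝ) / 2) • ψ x) - Q (rdG g x + ((d : ℝ) / 2) • ψ x) := by
      simp only [map_add, map_smul, smul_sub]; abel
    rw [e1, real_inner_smul_left, abs_mul, norm_smul μ, norm_smul (‖x‖⁻¹), norm_inv, norm_norm,
      norm_eq_abs]
    refine (mul_le_mul_of_nonneg_left (hΛ x hx _ _) (abs_nonneg μ)).trans (le_of_eq ?_)
    ring
  have b3 : √(∫ x, ‖‖x‖⁻¹ • ((rdG g x - Q (rdG g x)) + ((d : ℝ) / 2) • (ψ x - Q (ψ x)))‖ ^ 2) ≤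
      κ * (C / κ[d]) * √(∫ x, ‖diracG γ g x‖ ^ 2) := by
    rw [← h.approx_compl.integral_dirac_sq h.clifford] at bT
    simp only [h.dirac_compl] at bT
    exact sqrt_le_of_hardy hc (div_nonneg h.nonneg hc.le)
      (integral_nonneg fun x => by positivity) (integral_nonneg fun x => by positivity) h.hardy_compl_le h.integral_compl_u_le hκ1 hκ2 bT
  rw [e]
  have hY := sqrt_nonneg (∫ x, ‖μ • Q (ψ x)‖ ^ 2)
  have c1 := h.integral_mix_le
  have c2 := (le_abs_self _).trans b2
  have c4 := mul_le_mul_of_nonneg_left b3 (mul_nonneg hΛ0 hY); linarith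

lemma norm_proj_le (v : F) : ‖Q v‖ ≤ ‖v‖ := by
  refine le_of_sq_le_sq ?_ (norm_nonneg _)
  rw [h.norm_sq_split v]; nlinarith [sq_nonneg ‖v - Q v‖]

lemma sqrt_hardy_le : √(∫ x, ‖‖x‖⁻¹ • ψ x‖ ^ 2) ≤ √(∫ x, ‖diracG γ g x‖ ^ 2) / κ[d] := by
  have hc := h.const_pos
  have := sqrt_le_sqrt h.hardy_le; rw [sqrt_mul (by positivity), sqrt_sq hc.le] at this
  rwa [le_div_iff₀' hc]

lemma sqrt_hardy_compl_le :
    √(∫ x, ‖‖x‖⁻¹ • (ψ x - Q (ψ x))‖ ^ 2) ≤ (C / κ[d]) * √(∫ x, ‖diracG γ g x‖ ^ 2) / κ[d] := by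
  have hc := h.const_pos
  have := sqrt_le_sqrt (h.hardy_compl_le.trans h.integral_compl_u_le)
  rw [sqrt_mul (by positivity), sqrt_sq hc.le, sqrt_mul (by positivity),
    sqrt_sq (div_nonneg h.nonneg hc.le)] at this
  rwa [le_div_iff₀' hc]

lemma inner_le_of_virial_id {Λ κ : ℝ} (hΛ0 : 0 ≤ Λ)
    (hΛ : ∀ x ≠ 0, ∀ a b, |inner ℝ (Q a) (W x (b - Q b))| ≤ Λ / ‖x‖ * (‖Q a‖ * ‖b - Q b‖))
    (hκ0 : 0 ≤ κ)
    (hκ : ∫ x, ‖x‖⁻¹ * ‖ψ x - Q (ψ x)‖ ^ 2 ≤ κ * ∫ x, ‖x‖⁻¹ * ‖Q (ψ x)‖ ^ 2) :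
    ∫ x, ⟪diracG γ g x, μ • Q (ψ x)⟫ ≤ ((C / κ[d]) * √(1 + 3 * (C / κ[d]) ^ 2) +
        (Λ / κ[d]) * (C / κ[d]) +
        2 * (C / κ[d]) * κ) *
      (√(∫ x, ‖diracG γ g x‖ ^ 2) * √(∫ x, ‖μ • Q (ψ x)‖ ^ 2)) := by
  have hc := h.const_pos
  have hC := h.nonneg
  have v := h.approx.virial h.dim h.clifford h.decaying h.commutes_smul
    (M := ContinuousLinearMap.id ℝ F) ⟨fun u v => rfl, fun j u => rfl⟩ (fun v => rfl)
    (fun v => rfl) (by simpa using h.eqn)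
  simp only [ContinuousLinearMap.id_apply, sub_self, smul_zero, add_zero, map_zero, inner_zero_right,
    mul_zero, sub_zero] at v
  have mP := h.approx_compl.memLp_inv_smul h.dim
  have mψ := h.approx.memLp_inv_smul h.dim
  have mWm := aesm_of_contDiffOn h.pos h.decaying.smooth
  have mWP := memLp_apply_of_bound h.pos mWm h.decaying.bound h.approx_compl.conv.memLp_lim.1 mP
  have mZP := memLp_apply_of_bound h.pos h.rd_measurable h.decaying.bound_rd
    h.approx_compl.conv.memLp_lim.1 mP
  have mZψ := memLp_apply_of_bound h.pos h.rd_measurable h.decaying.bound_rd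
    h.approx.conv.memLp_lim.1 mψ
  have i1 : Integrable (fun x => ⟪diracG γ g x, μ • Q (ψ x)⟫) :=
    integrable_inner h.memLp_u h.memLp_y
  have i0 := integrable_fun_sub (integrable_inner h.approx.conv.memLp_lim h.memLp_u)
    (integrable_inner h.approx.conv.memLp_lim mZψ.1)
  have i2 := h.integrable_mix
  have i3 := integrable_inner h.memLp_y mWP.1
  have i4 := (integrable_inner h.approx_compl.conv.memLp_lim mZP.1).fun_add
    (integrable_inner h.approx_compl.conv.memLp_lim mWP.1)
  have e : ∫ x, ⟪diracG γ g x, μ • Q (ψ x)⟫ =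
      (∫ x, ⟪μ • Q (ψ x), rd W x (Q (ψ x) + (2 : ℝ) • (ψ x - Q (ψ x)))⟫) +
      (∫ x, ⟪μ • Q (ψ x), W x (ψ x - Q (ψ x))⟫) +
      μ * ∫ x, (⟪ψ x - Q (ψ x), rd W x (ψ x - Q (ψ x))⟫ +
        ⟪ψ x - Q (ψ x), W x (ψ x - Q (ψ x))⟫) := by
    have e1 : ∫ x, ⟪diracG γ g x, μ • Q (ψ x)⟫ = ∫ x, (⟪diracG γ g x, μ • Q (ψ x)⟫ -
          μ * (⟪ψ x, diracG γ g x⟫ - ⟪ψ x, rd W x (ψ x)⟫)) := by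
      rw [integral_sub i1 (i0.const_mul μ), integral_const_mul, v]; ring
    rw [e1, ← integral_add i2 i3, ← integral_const_mul,
      ← integral_add (i2.fun_add i3) (i4.const_mul μ)]
    refine integral_congr_ae ?_
    filter_upwards [h.eqn, ae_ne_zero h.pos] with x hx hx0
    have a1 : ⟪Q (ψ x), ψ x - Q (ψ x)⟫ = 0 := h.inner_proj _ _
    have a2 : ⟪diracG γ g x, ψ x - Q (ψ x)⟫ = -⟪W x (ψ x), ψ x - Q (ψ x)⟫ := by
      rw [hx, inner_sub_left, real_inner_smul_left, a1]; ring
    have a3 : ⟪diracG γ g x, μ • Q (ψ x)⟫ - μ * ⟪ψ x, diracG γ g x⟫ =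
        μ * ⟪W x (ψ x), ψ x - Q (ψ x)⟫ := by
      have : ⟪diracG γ g x, ψ x - Q (ψ x)⟫ =
        ⟪diracG γ g x, ψ x⟫ - ⟪diracG γ g x, Q (ψ x)⟫ := inner_sub_right _ _ _
      rw [real_inner_smul_right, real_inner_comm (diracG γ g x) (ψ x)]
      linear_combination μ * this - μ * a2
    set q := Q (ψ x)
    set p := ψ x - Q (ψ x) with hp
    have hψ : ψ x = q + p := by rw [hp]; abel
    have a4 : ⟪ψ x, rd W x (ψ x)⟫ = ⟪q, rd W x (q + (2 : ℝ) • p)⟫ + ⟪p, rd W x p⟫ := by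
      have s : ⟪p, rd W x q⟫ = ⟪q, rd W x p⟫ := by rw [← h.decaying.rd_symm hx0, real_inner_comm]
      rw [hψ]
      simp only [map_add, map_smul, inner_add_left, inner_add_right, real_inner_smul_right, s]
      ring
    have a5 : ⟪W x (ψ x), p⟫ = ⟪q, W x p⟫ + ⟪p, W x p⟫ := by
      rw [h.decaying.symm, hψ, inner_add_left]
    rw [a5] at a3; simp only [real_inner_smul_left]
    linear_combination a3 + μ * a4
  have b2 : |∫ x, inner ℝ (μ • Q (ψ x)) (W x (ψ x - Q (ψ x)))|
      ≤ Λ * (√(∫ x, ‖μ • Q (ψ x)‖ ^ 2) * √(∫ x, ‖‖x‖⁻¹ • (ψ x - Q (ψ x))‖ ^ 2)) := by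
    refine abs_integral_le_mul_sqrt hΛ0 h.memLp_y mP ?_
    filter_upwards [ae_ne_zero h.pos] with x hx
    rw [real_inner_smul_left, abs_mul, norm_smul μ, norm_smul (‖x‖⁻¹), norm_inv, norm_norm,
      norm_eq_abs]
    refine (mul_le_mul_of_nonneg_left (hΛ x hx _ _) (abs_nonneg μ)).trans (le_of_eq ?_)
    ring
  have j1 := (tendsto_integral_sqrtWeight h.approx_compl h.dim).1
  have b3 : |∫ x, (⟪ψ x - Q (ψ x), rd W x (ψ x - Q (ψ x))⟫ +
        ⟪ψ x - Q (ψ x), W x (ψ x - Q (ψ x))⟫)| ≤ 2 * C * ∫ x, ‖x‖⁻¹ * ‖ψ x - Q (ψ x)‖ ^ 2 := by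
    rw [← integral_const_mul, ← norm_eq_abs]
    refine norm_integral_le_of_norm_le (j1.const_mul _) ?_
    filter_upwards [ae_ne_zero h.pos] with x hx
    set p := ψ x - Q (ψ x)
    rw [norm_eq_abs]
    have k1 := (rd W x).le_of_opNorm_le (h.decaying.bound_rd x hx) p
    have k2 := (W x).le_of_opNorm_le (h.decaying.bound x hx) p
    calc _ ≤ ‖p‖ * (C / ‖x‖ * ‖p‖) + ‖p‖ * (C / ‖x‖ * ‖p‖) := by
          refine (abs_add_le _ _).trans (add_le_add ?_ ?_)
          · exact (abs_real_inner_le_norm _ _).trans (by gcongr)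
          · exact (abs_real_inner_le_norm _ _).trans (by gcongr)
      _ = _ := by ring
  have b4 : |μ| * ∫ x, ‖x‖⁻¹ * ‖Q (ψ x)‖ ^ 2 ≤
      √(∫ x, ‖μ • Q (ψ x)‖ ^ 2) * √(∫ x, ‖‖x‖⁻¹ • ψ x‖ ^ 2) := by
    have := abs_integral_le_mul_sqrt (f := fun x => |μ| * (‖x‖⁻¹ * ‖Q (ψ x)‖ ^ 2)) zero_le_one
      h.memLp_y mψ (.of_forall fun x => ?_)
    · rw [one_mul, integral_const_mul] at this; exact (le_abs_self _).trans this
    · rw [abs_of_nonneg (by positivity), one_mul, norm_smul, norm_smul, norm_eq_abs, norm_inv,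
        norm_norm]
      have := h.norm_proj_le (ψ x)
      calc |μ| * (‖x‖⁻¹ * ‖Q (ψ x)‖ ^ 2) = |μ| * ‖Q (ψ x)‖ * (‖x‖⁻¹ * ‖Q (ψ x)‖) := by ring
        _ ≤ _ := by gcongr
  have f1 := h.integral_mix_le
  have s1 := h.sqrt_hardy_le
  have s2 := h.sqrt_hardy_compl_le
  set c := κ[d]
  set U := √(∫ x, ‖diracG γ g x‖ ^ 2)
  set Y := √(∫ x, ‖μ • Q (ψ x)‖ ^ 2)
  have hY : 0 ≤ Y := sqrt_nonneg _
  have hU : 0 ≤ U := sqrt_nonneg _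
  have f2 : ∫ x, ⟪μ • Q (ψ x), W x (ψ x - Q (ψ x))⟫ ≤ (Λ / c) * (C / c) * (U * Y) := by
    refine (le_abs_self _).trans (b2.trans ?_)
    have := mul_le_mul_of_nonneg_left s2 (mul_nonneg hΛ0 hY)
    refine (le_of_eq (by ring)).trans (this.trans (le_of_eq ?_))
    field_simp
  have f3 : μ * ∫ x, (⟪ψ x - Q (ψ x), rd W x (ψ x - Q (ψ x))⟫ +
        ⟪ψ x - Q (ψ x), W x (ψ x - Q (ψ x))⟫) ≤ 2 * (C / c) * κ * (U * Y) := by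
    refine (le_abs_self _).trans ?_
    rw [abs_mul]
    calc _ ≤ |μ| * (2 * C * (κ * ∫ x, ‖x‖⁻¹ * ‖Q (ψ x)‖ ^ 2)) := by
          gcongr; exact b3.trans (by gcongr)
      _ = 2 * C * κ * (|μ| * ∫ x, ‖x‖⁻¹ * ‖Q (ψ x)‖ ^ 2) := by ring
      _ ≤ 2 * C * κ * (Y * (U / c)) :=
          mul_le_mul_of_nonneg_left (b4.trans (mul_le_mul_of_nonneg_left s1 hY)) (by positivity)
      _ = _ := by field_simp
  rw [e]; linarith

lemma weighted_compl (hd : 5 ≤ d) {Λ : ℝ} (hΛ0 : 0 ≤ Λ)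
    (hΛ : ∀ x ≠ 0, ∀ a b, |inner ℝ (Q a) (W x (b - Q b))| ≤ Λ / ‖x‖ * (‖Q a‖ * ‖b - Q b‖)) :
    (κ[d] - 1 / 2) ^ 2 * ∫ x, ‖x‖⁻¹ * ‖ψ x - Q (ψ x)‖ ^ 2 ≤
      C ^ 2 * ((∫ x, ‖x‖⁻¹ * ‖ψ x - Q (ψ x)‖ ^ 2) + ∫ x, ‖x‖⁻¹ * ‖Q (ψ x)‖ ^ 2) ∧
    (κ[d] - 1 / 2) * √(∫ x, ‖x‖⁻¹ * ‖ψ x - Q (ψ x)‖ ^ 2) ≤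
      C * √(∫ x, ‖x‖⁻¹ * ‖ψ x - Q (ψ x)‖ ^ 2) + Λ * √(∫ x, ‖x‖⁻¹ * ‖Q (ψ x)‖ ^ 2) := by
  have hc : 0 ≤ κ[d] - 1 / 2 := by
    have : (5 : ℝ) ≤ d := by exact_mod_cast hd
    linarith
  have hC := h.nonneg
  have tP := (tendsto_integral_sqrtWeight h.approx_compl h.dim).2
  have tQ := (tendsto_integral_sqrtWeight (h.approx.clm Q) h.dim).2
  have hp : ∀ n : ℕ, (0 : ℝ) < ε[n] := fun n => by positivity
  have cross : ∀ x ≠ 0, ∀ v, ‖W x (Q v) - Q (W x (Q v))‖ ≤ Λ / ‖x‖ * ‖Q v‖ := by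
    intro x hx v
    set z := W x (Q v) - Q (W x (Q v)) with hz
    have z0 : Q z = 0 := by rw [hz, map_sub, h.proj, sub_self]
    have z1 := hΛ x hx v z; rw [z0, sub_zero] at z1
    have z2 : ⟪Q v, W x z⟫ = ‖z‖ ^ 2 := by
      rw [← h.decaying.symm, ← real_inner_self_eq_norm_sq]
      have : W x (Q v) = Q (W x (Q v)) + z := by rw [hz]; abel
      rw [this, inner_add_left, h.invariant.symm, z0, inner_zero_right, zero_add]
    rw [z2, abs_of_nonneg (sq_nonneg _)] at z1
    rcases eq_or_lt_of_le (norm_nonneg z) with h0 | h0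
    · rw [← h0]; positivity
    · have : ‖z‖ * ‖z‖ ≤ (Λ / ‖x‖ * ‖Q v‖) * ‖z‖ := by nlinarith
      exact le_of_mul_le_mul_right this h0
  have step : ∀ n : ℕ, (κ[d] - 1 / 2) ^ 2 *
      (∫ x, ‖‖x‖⁻¹ • sqrtWeight d ε[n] x • (ψ x - Q (ψ x))‖ ^ 2) ≤
      C ^ 2 * ((∫ x, ‖‖x‖⁻¹ • sqrtWeight d ε[n] x • (ψ x - Q (ψ x))‖ ^ 2) +
        ∫ x, ‖‖x‖⁻¹ • sqrtWeight d ε[n] x • Q (ψ x)‖ ^ 2) ∧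
      (κ[d] - 1 / 2) *
      √(∫ x, ‖‖x‖⁻¹ • sqrtWeight d ε[n] x • (ψ x - Q (ψ x))‖ ^ 2) ≤
      C * √(∫ x, ‖‖x‖⁻¹ • sqrtWeight d ε[n] x • (ψ x - Q (ψ x))‖ ^ 2) +
        Λ * √(∫ x, ‖‖x‖⁻¹ • sqrtWeight d ε[n] x • Q (ψ x)‖ ^ 2) := by
    intro n
    set m := sqrtWeight d ε[n] with hm
    have hms : ContDiff ℝ ∞ m := sqrtWeight_contDiff (hp n)
    obtain ⟨K, hK⟩ := exists_sqrtWeight_bound (d := d) (hp n)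
    have a1 := h.approx_compl.weighted_hardy h.dim h.clifford hms (fun x => (hK x).1)
      (fun x => (hK x).2) (norm_fderiv_sqrtWeight_mul_le (hp n))
    simp only [h.dirac_compl] at a1
    have mP := (h.approx_compl.smul_bdd hms (fun x => (hK x).1) (fun x => (hK x).2)).memLp_inv_smul h.dim
    have mQ := ((h.approx.clm Q).smul_bdd hms (fun x => (hK x).1) (fun x => (hK x).2)).memLp_inv_smul h.dim
    have mψ := (h.approx.smul_bdd hms (fun x => (hK x).1) (fun x => (hK x).2)).memLp_inv_smul h.dim
    have mu := (((h.approx_compl.conv_dirac γ).smul_bdd hms.continuous.aestronglyMeasurable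
      (fun x => (hK x).1))).memLp_lim
    simp only [h.dirac_compl] at mu
    have split : ∫ x, ‖‖x‖⁻¹ • m x • ψ x‖ ^ 2 = (∫ x, ‖‖x‖⁻¹ • m x • (ψ x - Q (ψ x))‖ ^ 2) +
        ∫ x, ‖‖x‖⁻¹ • m x • Q (ψ x)‖ ^ 2 := by
      rw [← integral_add (integrable_norm_sq mP) (integrable_norm_sq mQ)]
      congr 1; funext x
      simp only [norm_smul, mul_pow]; rw [h.norm_sq_split (ψ x)]; ring
    constructor
    · have b1 : ∫ x, ‖m x • (diracG γ g x - Q (diracG γ g x))‖ ^ 2 ≤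
          C ^ 2 * ∫ x, ‖‖x‖⁻¹ • m x • ψ x‖ ^ 2 := by
        rw [← integral_const_mul]
        refine integral_mono_ae (integrable_norm_sq mu) ((integrable_norm_sq mψ).const_mul _) ?_
        filter_upwards [h.compl_u_eq, ae_ne_zero h.pos] with x hx hx0; rw [hx, ← mul_pow]
        refine pow_le_pow_left₀ (norm_nonneg _) ?_ 2
        rw [norm_smul, norm_neg, norm_smul, norm_smul, norm_inv, norm_norm]
        have := (h.norm_compl_le (W x (ψ x))).trans
          ((W x).le_of_opNorm_le (h.decaying.bound x hx0) (ψ x))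
        calc _ ≤ ‖m x‖ * (C / ‖x‖ * ‖ψ x‖) := by gcongr
          _ = _ := by ring
      rw [split] at b1
      have b2 := pow_le_pow_left₀ (mul_nonneg hc (sqrt_nonneg _)) a1 2
      rw [mul_pow, sq_sqrt (integral_nonneg fun x => by positivity),
        sq_sqrt (integral_nonneg fun x => by positivity)] at b2
      exact b2.trans b1
    · refine a1.trans ?_
      have hle : ∫ x, ‖m x • (diracG γ g x - Q (diracG γ g x))‖ ^ 2 ≤
          ∫ x, ‖C * ‖‖x‖⁻¹ • m x • (ψ x - Q (ψ x))‖ + Λ * ‖‖x‖⁻¹ • m x • Q (ψ x)‖‖ ^ 2 := by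
        refine integral_mono_ae (integrable_norm_sq mu)
          (integrable_norm_sq ((mP.norm.const_mul C).add (mQ.norm.const_mul Λ))) ?_
        filter_upwards [h.compl_u_eq, ae_ne_zero h.pos] with x hx hx0; rw [hx]
        refine pow_le_pow_left₀ (norm_nonneg _) ?_ 2
        refine le_trans ?_ (le_abs_self _)
        rw [norm_smul, norm_neg, norm_smul, norm_smul, norm_inv, norm_norm, norm_smul, norm_smul,
          norm_inv, norm_norm]
        set p := ψ x - Q (ψ x) with hpdef
        have e1 : W x (ψ x) - Q (W x (ψ x)) =
            (W x p - Q (W x p)) + (W x (Q (ψ x)) - Q (W x (Q (ψ x)))) := by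
          have : ψ x = p + Q (ψ x) := by rw [hpdef]; abel
          conv_lhs => rw [this]
          simp only [map_add]; abel
        have e2 := (h.norm_compl_le (W x p)).trans
          ((W x).le_of_opNorm_le (h.decaying.bound x hx0) p)
        have e3 := cross x hx0 (ψ x)
        calc _ ≤ ‖m x‖ * (C / ‖x‖ * ‖p‖ + Λ / ‖x‖ * ‖Q (ψ x)‖) := by
              gcongr; rw [e1]; exact (norm_add_le _ _).trans (add_le_add e2 e3)
          _ = _ := by ring
      refine (sqrt_le_sqrt hle).trans ?_
      refine (sqrt_integral_norm_add_sq_le (mP.norm.const_mul C) (mQ.norm.const_mul Λ)).trans ?_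
      simp only [norm_mul, mul_pow, norm_norm]
      rw [integral_const_mul, integral_const_mul, sqrt_mul (by positivity),
        sqrt_mul (by positivity), norm_of_nonneg hC, norm_of_nonneg hΛ0,
        sqrt_sq hC, sqrt_sq hΛ0]
  constructor
  · exact le_of_tendsto_of_tendsto' (tP.const_mul _) ((tP.add tQ).const_mul _) fun n => (step n).1
  · exact le_of_tendsto_of_tendsto' (tP.sqrt.const_mul _)
      ((tP.sqrt.const_mul _).add (tQ.sqrt.const_mul _)) fun n => (step n).2

lemma cross_bound {x : Space d} (hx : x ≠ 0) (a b : F) :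
    |inner ℝ (Q a) (W x (b - Q b))| ≤ C / ‖x‖ * (‖Q a‖ * ‖b - Q b‖) := by
  refine (abs_real_inner_le_norm _ _).trans ?_
  have := (W x).le_of_opNorm_le (h.decaying.bound x hx) (b - Q b)
  calc _ ≤ ‖Q a‖ * (C / ‖x‖ * ‖b - Q b‖) := by gcongr
    _ = _ := by ring

lemma eq_zero_of_trivial (hC : C / κ[d] < 1 / 2) (hQ : ∀ a b, ∀ x, ⟪Q a, W x (b - Q b)⟫ = 0) :
    ψ =ᵐ[volume] 0 := by
  have hc := h.const_pos
  have hd : (3 : ℝ) ≤ d := by exact_mod_cast h.dim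
  have := h.inner_le_of_virial (Λ := 0) (κ := 2) le_rfl
    (fun x hx a b => by rw [hQ, abs_zero]; positivity) (by norm_num) (by linarith)
  refine h.eq_zero_of_inner_le this ?_
  have := virial_constant_lt (l := 0) (L := 0) (κ := 0) (k := 0) (s := 1.4)
    (div_nonneg h.nonneg hc.le) hC.le (by norm_num) (by norm_num) le_rfl le_rfl le_rfl le_rfl
    (by norm_num)
  simpa using this

/-- Absence of solutions when the limit of the potential is `E - μ Q`. -/
theorem eq_zero (hodd : Odd d) {C₂ Λ : ℝ}
    (hC : 2 * (C / κ[d]) + C₂ < 1) (hC₂ : 0 ≤ C₂) (hΛ0 : 0 ≤ Λ)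
    (hΛ : ∀ x ≠ 0, ∀ a b, |inner ℝ (Q a) (W x (b - Q b))| ≤ Λ / ‖x‖ * (‖Q a‖ * ‖b - Q b‖))
    (hΛd : Λ ≤ d / 2 * C₂) (hΛs : 7 ≤ d → Λ ≤ √d * C₂) : ψ =ᵐ[volume] 0 := by
  have hc := h.const_pos
  have hC0 := h.nonneg
  set t := C / κ[d] with ht
  have ht0 : 0 ≤ t := div_nonneg h.nonneg hc.le
  have hmin : ∀ x ≠ 0, ∀ a b, |inner ℝ (Q a) (W x (b - Q b))| ≤
      min Λ C / ‖x‖ * (‖Q a‖ * ‖b - Q b‖) := by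
    intro x hx a b
    rcases min_choice Λ C with e | e <;> rw [e]
    · exact hΛ x hx a b
    · exact h.cross_bound hx a b
  have hmin0 : 0 ≤ min Λ C := le_min hΛ0 hC0
  obtain hd3 | hd5 | hd7 : d = 3 ∨ d = 5 ∨ 7 ≤ d := by
    have := h.dim
    obtain ⟨k, hk⟩ := hodd
    omega
  · have hdr : (d : ℝ) = 3 := by rw [hd3]; norm_num
    have := h.inner_le_of_virial (κ := 2) hmin0 hmin (by norm_num) (by rw [hdr]; norm_num)
    refine h.eq_zero_of_inner_le this ?_
    have hCt : C = t / 2 := by rw [ht, hdr]; ring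
    have := virial_three ht0 hmin0 ((min_le_right _ _).trans hCt.le)
      ((min_le_left _ _).trans (hΛd.trans (le_of_eq (by rw [hdr])))) hC
    rw [← ht]
    convert this using 3
    ring
  · have hdr : (d : ℝ) = 5 := by rw [hd5]; norm_num
    have := h.inner_le_of_virial (κ := 1) hmin0 hmin le_rfl (by rw [hdr]; norm_num)
    refine h.eq_zero_of_inner_le this ?_
    have hCt : C = 3 / 2 * t := by rw [ht, hdr]; ring
    have := virial_five ht0 hmin0 ((min_le_right _ _).trans hCt.le)
      ((min_le_left _ _).trans (hΛd.trans (le_of_eq (by rw [hdr])))) hC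
    rw [← ht]
    convert this using 3
    ring
  · have hdr : (7 : ℝ) ≤ d := by exact_mod_cast hd7
    set c := κ[d] with hcdef
    have hc5 : 5 / 2 ≤ c := by rw [hcdef]; linarith
    have hCt : C = t * c := by rw [ht]; field_simp
    obtain ⟨w1, w2⟩ := h.weighted_compl (by omega) hΛ0 hΛ
    rw [← hcdef] at w1 w2
    set X := ∫ x, ‖x‖⁻¹ * ‖ψ x - Q (ψ x)‖ ^ 2
    set V := ∫ x, ‖x‖⁻¹ * ‖Q (ψ x)‖ ^ 2
    have hX0 : 0 ≤ X := integral_nonneg fun x => by positivity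
    have hV0 : 0 ≤ V := integral_nonneg fun x => by positivity
    rcases le_total t (2 / 5) with h25 | h25
    · have hκ : X ≤ 1 / 3 * V := by
        have h1 : (4 / 5 * c) ^ 2 ≤ (c - 1 / 2) ^ 2 := pow_le_pow_left₀ (by positivity) (by linarith) 2
        have h2 : C ^ 2 ≤ (2 / 5 * c) ^ 2 := by
          rw [hCt]; exact pow_le_pow_left₀ (by positivity) (by gcongr) 2
        have h3 : (4 / 5 * c) ^ 2 * X ≤ (2 / 5 * c) ^ 2 * (X + V) :=
          (mul_le_mul_of_nonneg_right h1 hX0).trans (w1.trans (by gcongr))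
        have h4 : c ^ 2 * (3 * X) ≤ c ^ 2 * V := by nlinarith
        have := le_of_mul_le_mul_left h4 (by positivity); linarith
      have := h.inner_le_of_virial_id hC0 (fun x hx a b => h.cross_bound hx a b) (by norm_num) hκ
      refine h.eq_zero_of_inner_le this ?_
      rw [← hcdef, ← ht]
      exact virial_constant_lt (s := 1.2166) ht0 h25 (by norm_num) (by norm_num) ht0 h25
        (by norm_num) le_rfl (by norm_num)
    · have hC₂t : C₂ ≤ 1 - 2 * t := by linarith
      have ht2 : t < 1 / 2 := by linarith
      have hΛb : Λ ≤ 1.0584 * (1 - 2 * t) * c := by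
        have h1 : √(d : ℝ) ≤ 1.0584 * c := by
          refine Real.sqrt_le_iff.2 ⟨by positivity, ?_⟩
          have : (d : ℝ) = 2 * c + 2 := by rw [hcdef]; ring
          rw [this]; nlinarith
        calc Λ ≤ √d * C₂ := hΛs hd7
          _ ≤ (1.0584 * c) * (1 - 2 * t) := by gcongr
          _ = _ := by ring
      have hden : 0 < 4 / 5 - t := by linarith
      have hκ : X ≤ (1.0584 * (1 - 2 * t) / (4 / 5 - t)) ^ 2 * V := by
        have h1 : (c * (4 / 5 - t)) * √X ≤ (1.0584 * (1 - 2 * t) * c) * √V := by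
          have hx := sqrt_nonneg X
          have hv := sqrt_nonneg V
          have e1 : (c * (4 / 5 - t)) * √X ≤ (c - 1 / 2 - C) * √X := by gcongr; rw [hCt]; nlinarith
          have e2 : Λ * √V ≤ (1.0584 * (1 - 2 * t) * c) * √V := by gcongr
          linarith
        have h2 : √X ≤ 1.0584 * (1 - 2 * t) / (4 / 5 - t) * √V := by
          rw [div_mul_eq_mul_div, le_div_iff₀ hden]
          have h3 : c * (√X * (4 / 5 - t)) ≤ c * (1.0584 * (1 - 2 * t) * √V) := by linarith
          exact le_of_mul_le_mul_left h3 (by positivity)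
        have h3 := pow_le_pow_left₀ (sqrt_nonneg X) h2 2
        rwa [mul_pow, sq_sqrt hX0, sq_sqrt hV0] at h3
      have := h.inner_le_of_virial_id hΛ0 hΛ (sq_nonneg _) hκ
      refine h.eq_zero_of_inner_le this ?_
      rw [← hcdef, ← ht]
      have hl0 : 0 ≤ Λ / c := by positivity
      have hl : Λ / c ≤ 1.0584 * (1 - 2 * t) := by rwa [div_le_iff₀ hc]
      have hk0 : 0 ≤ 1.0584 * (1 - 2 * t) / (4 / 5 - t) := by
        have : 0 ≤ 1 - 2 * t := by linarith
        positivity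
      rcases le_total t (11 / 25) with h44 | h44
      · have hk : 1.0584 * (1 - 2 * t) / (4 / 5 - t) ≤ 0.5292 := by rw [div_le_iff₀ hden]; linarith
        exact virial_constant_lt (s := 1.2574) (L := 0.2117) (k := 0.5292 ^ 2) ht0 h44 (by norm_num)
          (by norm_num) hl0 (by linarith) (sq_nonneg _) (pow_le_pow_left₀ hk0 hk 2) (by norm_num)
      · have hk : 1.0584 * (1 - 2 * t) / (4 / 5 - t) ≤ 0.3529 := by rw [div_le_iff₀ hden]; linarith
        exact virial_constant_lt (s := 1.323) (L := 0.1271) (k := 0.3529 ^ 2) ht0 ht2.le (by norm_num)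
          (by norm_num) hl0 (by linarith) (sq_nonneg _) (pow_le_pow_left₀ hk0 hk 2) (by norm_num)

end IsProjSolution
end DiracVirial

section Helmholtz

variable {d : ℕ} {F G : Type*} [NormedAddCommGroup F] [InnerProductSpace ℝ F]
  [NormedAddCommGroup G] [InnerProductSpace ℝ G]
  {φ u f w ξ : Space d → F} {γ : Fin d → F →L[ℝ] F} {J : F →L[ℝ] F}

/-- The Laplacian. -/
def lap (φ : Space d → F) (x : Space d) : F := ∑ j, pd j (pd j φ) x

lemma IsTest.lap (h : IsTest φ) : IsTest (lap φ) :=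
  IsTest.sum (φ := fun j x => _root_.pd j (_root_.pd j φ) x) fun j _ => (h.pd j).pd j

open SchwartzMap Laplacian LineDeriv in
lemma exists_schwartz_helmholtz (g : SchwartzMap (Space d) ℂ) :
    ∃ h : SchwartzMap (Space d) ℂ, ∀ x, h x - lap h x = g x := by
  set q : Space d → ℝ := fun x => 1 + ‖(2 * Real.pi) • x‖ ^ 2 with hq
  have hq0 : ∀ x, q x ≠ 0 := fun x => by positivity
  have hqg : q.HasTemperateGrowth := by
    have h1 : (fun x : Space d => 1 + ‖x‖ ^ 2).HasTemperateGrowth := by fun_prop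
    exact h1.comp ((2 * Real.pi) • ContinuousLinearMap.id ℝ (Space d)).hasTemperateGrowth
  have hqi : (fun x => (q x)⁻¹).HasTemperateGrowth := by
    have h1 : (fun x : Space d => (1 + ‖x‖ ^ 2) ^ (-1 : ℝ)).HasTemperateGrowth := by fun_prop
    have h2 := h1.comp ((2 * Real.pi) • ContinuousLinearMap.id ℝ (Space d)).hasTemperateGrowth
    convert h2 using 2 with x
    simp [hq, Real.rpow_neg_one]
  refine ⟨fourierMultiplierCLM ℂ (fun x => (q x)⁻¹) g, fun x => ?_⟩
  set h := fourierMultiplierCLM ℂ (fun x => (q x)⁻¹) g with hh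
  have e1 : fourierMultiplierCLM ℂ q h = g := by
    rw [hh, fourierMultiplierCLM_fourierMultiplierCLM_apply hqg hqi]
    have : q * (fun x => (q x)⁻¹) = fun _ => (1 : ℝ) := by funext x; simp [hq0 x]
    rw [this, fourierMultiplierCLM_const]; simp
  have e2 : fourierMultiplierCLM ℂ q h = h - Δ h := by
    rw [laplacian_eq_fourierMultiplierCLM, neg_smul, sub_neg_eq_add]
    have hp : (fun x : Space d => ‖x‖ ^ 2).HasTemperateGrowth := by fun_prop
    have : q = fun x => ∑ i : Bool, (bif i then (fun _ : Space d => (1 : ℝ)) else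
        ((2 * Real.pi) ^ 2 • fun x : Space d => ‖x‖ ^ 2)) x := by
      funext x
      simp [hq, norm_smul, mul_pow]
    rw [this, fourierMultiplierCLM_sum]
    · simp only [Fintype.univ_bool, Finset.mem_singleton, Bool.true_eq_false, not_false_eq_true,
        sum_insert, Finset.sum_singleton, cond_true, cond_false, add_apply,
        fourierMultiplierCLM_const, fourierMultiplierCLM_smul hp, smul_apply, one_smul]
      rfl
    · intro i _
      cases i
      · exact (Function.HasTemperateGrowth.const _).mul hp
      · exact Function.HasTemperateGrowth.const _
  have e3 : Δ h x = lap h x := by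
    rw [laplacian_eq_sum (EuclideanSpace.basisFun (Fin d) ℝ), _root_.sum_apply]
    refine sum_congr rfl fun j _ => ?_
    have : EuclideanSpace.basisFun (Fin d) ℝ j = coordVec j := by simp [coordVec]
    rw [this]; rfl
  rw [← e3, ← e1, e2]; rfl

lemma L2Conv.of_pointwise (hu : MemLp u 2) {m : ℕ → Space d → ℝ}
    {m' : Space d → ℝ} (hm : ∀ n, AEStronglyMeasurable (m n)) {C : ℝ}
    (hC : ∀ n x, |m n x| ≤ C) (ht : ∀ x, Tendsto (fun n => m n x) atTop (𝓝 (m' x))) :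
    L2Conv (fun n x => m n x • u x) (fun x => m' x • u x) := by
  have hC' : ∀ x, |m' x| ≤ C := fun x =>
    le_of_tendsto (ht x).abs (.of_forall fun n => hC n x)
  have hm' : AEStronglyMeasurable m' := aestronglyMeasurable_of_tendsto_ae atTop hm (.of_forall ht)
  have hbd : ∀ k : Space d → ℝ, AEStronglyMeasurable k → (∀ x, |k x| ≤ C) →
      MemLp (fun x => k x • u x) 2 := fun k hk hb =>
    ((L2Conv.const hu).smul_bdd hk hb).memLp_lim
  have h1 := fun n => hbd _ (hm n) (hC n)
  have h2 := hbd _ hm' hC'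
  refine L2Conv.of_tendsto_toLp h1 h2 ?_
  rw [tendsto_iff_norm_sub_tendsto_zero]
  have e : ∀ n, ‖(h1 n).toLp _ - h2.toLp _‖ = √(∫ x, ‖(m n x - m' x) • u x‖ ^ 2) := by
    intro n; rw [← MemLp.toLp_sub, ← sqrt_sq (norm_nonneg _), L2Conv.toLp_norm_sq]
    simp [sub_smul]
  simp only [e]; rw [← Real.sqrt_zero]
  refine (Real.continuous_sqrt.tendsto 0).comp ?_
  have : (0 : ℝ) = ∫ x : Space d, (0 : ℝ) := by simp
  rw [this]
  refine tendsto_integral_of_dominated_convergence (fun x => (2 * C) ^ 2 * ‖u x‖ ^ 2)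
    (fun n => ((((hm n).sub hm').smul hu.1).norm.pow 2)) ((integrable_norm_sq hu).const_mul _)
    (fun n => .of_forall fun x => ?_) (.of_forall fun x => ?_)
  · rw [norm_of_nonneg (by positivity), norm_smul, mul_pow, norm_eq_abs]
    have : |m n x - m' x| ≤ 2 * C := (abs_sub _ _).trans (by linarith [hC n x, hC' x])
    gcongr
  · have h3 : Tendsto (fun n => ‖(m n x - m' x) • u x‖ ^ 2) atTop (𝓝 (‖(m' x - m' x) • u x‖ ^ 2)) :=
      ((((ht x).sub_const (m' x)).smul_const (u x)).norm.pow 2)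
    simpa using h3

lemma pd_comp_smul (φ : Space d → F) (c : ℝ) (j : Fin d) (x : Space d) :
    pd j (fun y => φ (c • y)) x = c • pd j φ (c • x) := by
  simp only [pd]; rw [fderiv_comp_smul]; rfl

lemma pd_const_smul (φ : Space d → F) (c : ℝ) (j : Fin d) (x : Space d) :
    pd j (fun y => c • φ y) x = c • pd j φ x := by
  simp only [pd]
  rw [show (fun y => c • φ y) = c • φ from rfl, fderiv_const_smul_field (𝕜 := ℝ) (R := ℝ) (f := φ) c]
  rfl

lemma bump_eq_comp (c : ℝ) : bump d c = fun x => bump d 1 (c • x) := by funext x; simp [bump]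

lemma pd_bump (c : ℝ) (j : Fin d) (x : Space d) : pd j (bump d c) x = c * pd j (bump d 1) (c • x) := by
  rw [bump_eq_comp, pd_comp_smul, smul_eq_mul]

lemma pd_pd_bump (c : ℝ) (k j : Fin d) (x : Space d) :
    pd k (pd j (bump d c)) x = c ^ 2 * pd k (pd j (bump d 1)) (c • x) := by
  have : pd j (bump d c) = fun y => c • pd j (bump d 1) (c • y) := by
    funext y; rw [pd_bump, smul_eq_mul]
  rw [this, pd_const_smul (fun y => pd j (bump d 1) (c • y)), pd_comp_smul]
  simp only [smul_eq_mul]; ring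

lemma bump_one_isTest : IsTest (bump d 1) := ⟨bump_contDiff 1, bump_compact one_ne_zero⟩

lemma bump_isTest {c : ℝ} (hc : c ≠ 0) : IsTest (bump d c) := ⟨bump_contDiff c, bump_compact hc⟩

lemma tendsto_bump_eventually (x : Space d) :
    ∀ᶠ n : ℕ in atTop, bump d ε[n] =ᶠ[𝓝 x] fun _ => 1 := by
  obtain ⟨N, hN⟩ := exists_nat_gt (‖x‖ + 1)
  filter_upwards [eventually_ge_atTop N] with n hn
  filter_upwards [Metric.ball_mem_nhds x one_pos] with y hy
  refine bump_eq_one ?_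
  have hn' : (N : ℝ) ≤ n := by exact_mod_cast hn
  have hy' : ‖y‖ ≤ ‖x‖ + 1 := by
    have := norm_le_norm_add_norm_sub' y x; rw [Metric.mem_ball, dist_eq_norm] at hy
    linarith
  rw [abs_of_nonneg (by positivity), one_div, inv_mul_le_iff₀ (by positivity)]; linarith

lemma L2Conv.bump_smul (hu : MemLp u 2) : L2Conv (fun n x => bump d ε[n] x • u x) u := by
  have := L2Conv.of_pointwise hu (m := fun n => bump d ε[n]) (m' := fun _ => 1)
    (fun n => (bump_contDiff _).continuous.aestronglyMeasurable) (C := 1)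
    (fun n x => by rw [abs_of_nonneg (bump_nonneg _ _)]; exact bump_le_one _ _)
    (fun x => tendsto_const_nhds.congr' (by
      filter_upwards [tendsto_bump_eventually x] with n hn using hn.eq_of_nhds.symm))
  simpa using this

lemma inv_succ_le_one (n : ℕ) : |ε[n]| ≤ 1 := by
  rw [abs_of_nonneg (by positivity), div_le_one (by positivity)]
  linarith [(Nat.cast_nonneg n : (0 : ℝ) ≤ n)]

lemma L2Conv.pd_bump_smul (hu : MemLp u 2) (j : Fin d) :
    L2Conv (fun n x => pd j (bump d ε[n]) x • u x) (fun _ => 0) := by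
  have ht := (bump_one_isTest (d := d)).pd j
  obtain ⟨K, hK⟩ := ht.compact.exists_bound_of_continuous ht.continuous
  have := L2Conv.of_pointwise hu (m := fun n => pd j (bump d ε[n])) (m' := fun _ => 0)
    (fun n => ((bump_isTest (by positivity)).pd j).continuous.aestronglyMeasurable) (C := K)
    (fun n x => by
      rw [pd_bump, abs_mul]
      refine (mul_le_of_le_one_left (abs_nonneg _) (inv_succ_le_one n)).trans (hK _))
    (fun x => tendsto_const_nhds.congr' (by
      filter_upwards [tendsto_bump_eventually x] with n hn
      rw [pd, hn.fderiv_eq]; simp))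
  simpa using this

lemma L2Conv.pd_pd_bump_smul (hu : MemLp u 2) (j : Fin d) :
    L2Conv (fun n x => pd j (pd j (bump d ε[n])) x • u x) (fun _ => 0) := by
  have ht := ((bump_one_isTest (d := d)).pd j).pd j
  obtain ⟨K, hK⟩ := ht.compact.exists_bound_of_continuous ht.continuous
  have := L2Conv.of_pointwise hu (m := fun n => pd j (pd j (bump d ε[n]))) (m' := fun _ => 0)
    (fun n => (((bump_isTest (by positivity)).pd j).pd j).continuous.aestronglyMeasurable) (C := K)
    (fun n x => by
      rw [pd_pd_bump, abs_mul, abs_pow]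
      refine (mul_le_of_le_one_left (abs_nonneg _)
        (pow_le_one₀ (abs_nonneg _) (inv_succ_le_one n))).trans (hK _))
    (fun x => tendsto_const_nhds.congr' (by
      filter_upwards [tendsto_bump_eventually x] with n hn
      have : pd j (bump d ε[n]) =ᶠ[𝓝 x] fun _ => 0 := by
        filter_upwards [hn.eventuallyEq_nhds] with y hy; rw [pd, hy.fderiv_eq]; simp
      rw [pd, this.fderiv_eq]; simp))
  simpa using this

lemma ContDiff.pd (h : ContDiff ℝ ∞ φ) (j : Fin d) : ContDiff ℝ ∞ (pd j φ) :=
  (h.fderiv_right (m := ∞) (by simp)).clm_apply contDiff_const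

lemma lap_smul {m : Space d → ℝ} (hm : ContDiff ℝ ∞ m) (hφ : ContDiff ℝ ∞ φ)
    (x : Space d) : lap (fun y => m y • φ y) x = m x • lap φ x +
      ∑ j, ((2 : ℝ) • (pd j m x • pd j φ x) + pd j (pd j m) x • φ x) := by
  have hmd : Differentiable ℝ m := hm.differentiable (by simp)
  have hφd : Differentiable ℝ φ := hφ.differentiable (by simp)
  have hmd' := fun j => (hm.pd j).differentiable (by simp)
  have hφd' := fun j => (hφ.pd j).differentiable (by simp)
  simp only [lap, smul_sum, ← sum_add_distrib]
  refine sum_congr rfl fun j _ => ?_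
  have e : pd j (fun y => m y • φ y) = fun y => m y • pd j φ y + pd j m y • φ y := by
    funext y; exact pd_smul j (hmd y) (hφd y)
  rw [e, pd_add j ((hmd x).fun_smul (hφd' j x)) ((hmd' j x).fun_smul (hφd x)), pd_smul j (hmd x) (hφd' j x),
    pd_smul j (hmd' j x) (hφd x), two_smul]
  abel

lemma exists_test_helmholtz_of_smooth {h : Space d → F} (hs : ContDiff ℝ ∞ h)
    (h0 : MemLp h 2) (h1 : ∀ j, MemLp (pd j h) 2) (h2 : MemLp (lap h) 2) :
    ∃ w : ℕ → Space d → F, (∀ n, IsTest (w n)) ∧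
      L2Conv (fun n x => w n x - lap (w n) x) (fun x => h x - lap h x) := by
  refine ⟨fun n x => bump d ε[n] x • h x, fun n => ⟨(bump_contDiff _).smul hs,
    (bump_compact (by positivity)).smul_right⟩, ?_⟩
  have k := (L2Conv.bump_smul h0).sub ((L2Conv.bump_smul h2).add (L2Conv.sum (s := univ)
    fun j _ => ((L2Conv.pd_bump_smul (h1 j) j).const_smul 2).add (L2Conv.pd_pd_bump_smul h0 j)))
  refine k.congr (fun n => .of_forall fun x => ?_) (.of_forall fun x => ?_)
  · simp only [lap_smul (bump_contDiff _) hs]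
  · simp

lemma L2Conv.exists_seq {P : (Space d → F) → Prop} (hf : MemLp f 2) (hP : ∀ u, P u → MemLp u 2)
    (h : ∀ ε : ℝ, 0 < ε → ∃ u, P u ∧ eLpNorm (fun x => u x - f x) 2 volume ≤ ENNReal.ofReal ε) :
    ∃ u : ℕ → Space d → F, (∀ n, P (u n)) ∧ L2Conv u f := by
  choose u hu1 hu2 using fun n : ℕ => h ε[n] (by positivity)
  refine ⟨u, hu1, fun n => hP _ (hu1 n), hf, ?_⟩
  have ht : Tendsto (fun n : ℕ => ENNReal.ofReal ε[n]) atTop (𝓝 0) := by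
    rw [← ENNReal.ofReal_zero]
    exact ENNReal.tendsto_ofReal tendsto_one_div_add_atTop_nhds_zero_nat
  exact tendsto_of_tendsto_of_tendsto_of_le_of_le tendsto_const_nhds ht (fun _ => zero_le) hu2

lemma L2Conv.exists_test (hf : MemLp f 2) :
    ∃ u : ℕ → Space d → F, (∀ n, IsTest (u n)) ∧ L2Conv u f := by
  refine L2Conv.exists_seq hf (fun u hu => hu.memLp 2) fun ε hε => ?_
  obtain ⟨g, h1, h2, h3⟩ := MemLp.exist_eLpNorm_sub_le (by simp) (by simp) hf hε
  refine ⟨g, ⟨h2, h1⟩, ?_⟩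
  rw [eLpNorm_sub_comm] at h3; exact h3

lemma exists_helmholtz_scalar_of_isTest {g : Space d → ℝ} (hg : IsTest g) :
    ∃ w : ℕ → Space d → ℝ, (∀ n, IsTest (w n)) ∧ L2Conv (fun n x => w n x - lap (w n) x) g := by
  have hg' : IsTest (fun x => (g x : ℂ)) := hg.clm Complex.ofRealCLM
  obtain ⟨h, hh⟩ := exists_schwartz_helmholtz (hg'.compact.toSchwartzMap hg'.smooth)
  have hs : ContDiff ℝ ∞ (fun x => (h x).re) := Complex.reCLM.contDiff.comp h.smooth'
  have hp : ∀ j, pd j (fun x => (h x).re) = fun x => (LineDeriv.lineDerivOp (coordVec j) h x).re := by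
    intro j; funext x
    exact pd_const_clm Complex.reCLM j h.differentiableAt
  have hl : ∀ x, lap (fun x => (h x).re) x = (lap h x).re := by
    intro x; simp only [lap, Complex.re_sum]
    refine sum_congr rfl fun j _ => ?_
    rw [hp]
    exact pd_const_clm Complex.reCLM j (LineDeriv.lineDerivOp (coordVec j) h).differentiableAt
  have hm : ∀ k : SchwartzMap (Space d) ℂ, MemLp (fun x => (k x).re) 2 := fun k =>
    (k.memLp 2 volume).re
  have he : ∀ x, (h x).re - lap (fun x => (h x).re) x = g x := by
    intro x; rw [hl, ← Complex.sub_re, hh]; rfl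
  have hl2 : MemLp (lap (fun x => (h x).re)) 2 := by
    have : lap (fun x => (h x).re) = fun x => (h x).re - g x := by funext x; rw [← he x]; ring
    rw [this]; exact (hm h).sub (hg.memLp 2)
  obtain ⟨w, hw1, hw2⟩ := exists_test_helmholtz_of_smooth hs (hm h)
    (fun j => by rw [hp]; exact hm _) hl2
  simp only [he] at hw2; exact ⟨w, hw1, hw2⟩

lemma lap_sum {ι : Type*} {s : Finset ι} {φ : ι → Space d → F} (h : ∀ i ∈ s, IsTest (φ i))
    (x : Space d) : lap (fun y => ∑ i ∈ s, φ i y) x = ∑ i ∈ s, lap (φ i) x := by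
  simp only [lap]; rw [sum_comm]
  refine sum_congr rfl fun j _ => ?_
  have : pd j (fun y => ∑ i ∈ s, φ i y) = fun y => ∑ i ∈ s, pd j (φ i) y := by
    funext y; exact pd_sum j fun i hi => (h i hi).differentiable y
  rw [this, pd_sum j fun i hi => ((h i hi).pd j).differentiable x]

lemma lap_clm (A : F →L[ℝ] G) (h : IsTest φ) (x : Space d) :
    lap (fun y => A (φ y)) x = A (lap φ x) := by
  simp only [lap, map_sum]
  refine sum_congr rfl fun j _ => ?_
  have : pd j (fun y => A (φ y)) = fun y => A (pd j φ y) := by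
    funext y; exact pd_const_clm A j (h.differentiable y)
  rw [this, pd_const_clm A j ((h.pd j).differentiable x)]

lemma exists_helmholtz_of_isTest [FiniteDimensional ℝ F] {g : Space d → F} (hg : IsTest g) :
    ∃ w : ℕ → Space d → F, (∀ n, IsTest (w n)) ∧ L2Conv (fun n x => w n x - lap (w n) x) g := by
  set b := stdOrthonormalBasis ℝ F
  choose w hw1 hw2 using fun i => exists_helmholtz_scalar_of_isTest (hg.clm (innerSL ℝ (b i)))
  set A : F → ℝ →L[ℝ] F := fun v => (ContinuousLinearMap.id ℝ ℝ).smulRight v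
  refine ⟨fun n x => ∑ i, A (b i) (w i n x), fun n => IsTest.sum fun i _ => (hw1 i n).clm _, ?_⟩
  refine (L2Conv.sum (s := univ) fun i _ => (hw2 i).clm (A (b i))).congr
    (fun n => .of_forall fun x => ?_) (.of_forall fun x => ?_)
  · simp only; rw [lap_sum fun i _ => (hw1 i n).clm (A (b i)), ← sum_sub_distrib]
    refine sum_congr rfl fun i _ => ?_
    rw [lap_clm _ (hw1 i n), map_sub]
  · exact b.sum_repr' (g x)

lemma L2Conv.exists_helmholtz [FiniteDimensional ℝ F] (hf : MemLp f 2) :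
    ∃ w : ℕ → Space d → F, (∀ n, IsTest (w n)) ∧ L2Conv (fun n x => w n x - lap (w n) x) f := by
  have := L2Conv.exists_seq (P := fun u => ∃ w, IsTest w ∧ u = fun x => w x - lap w x) hf ?_ ?_
  · obtain ⟨u, hu1, hu2⟩ := this
    choose w hw1 hw2 using hu1; refine ⟨w, hw1, ?_⟩; simpa only [funext hw2] using hu2
  · rintro u ⟨w, hw, rfl⟩; exact (hw.memLp 2).sub (hw.lap.memLp 2)
  · intro ε hε
    obtain ⟨g, h1, h2, h3⟩ := MemLp.exist_eLpNorm_sub_le (by simp) (by simp) hf (half_pos hε)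
    obtain ⟨w, hw1, hw2⟩ := exists_helmholtz_of_isTest (g := g) ⟨h2, h1⟩
    have he : ENNReal.ofReal (ε / 2) ≠ 0 := by simpa using hε
    obtain ⟨n, hn⟩ := (hw2.tendsto.eventually_le_const (bot_lt_iff_ne_bot.2 he)).exists
    refine ⟨_, ⟨w n, hw1 n, rfl⟩, ?_⟩
    have hg : MemLp g 2 := hw2.memLp_lim
    calc eLpNorm (fun x => (w n x - lap (w n) x) - f x) 2 volume
        = eLpNorm ((fun x => (w n x - lap (w n) x) - g x) + (g - f)) 2 volume := by
          congr 1; funext x; simp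
      _ ≤ _ := eLpNorm_add_le (((hw2.memLp n).sub hg).1) (hg.sub hf).1 (by simp)
      _ ≤ ENNReal.ofReal (ε / 2) + ENNReal.ofReal (ε / 2) := by
          rw [eLpNorm_sub_comm] at h3; exact add_le_add hn h3
      _ = ENNReal.ofReal ε := by rw [← ENNReal.ofReal_add (by linarith) (by linarith), add_halves]

lemma eq_zero_of_inner_helmholtz [FiniteDimensional ℝ F]
    (hf : MemLp f 2) (h : ∀ ξ, IsTest ξ → ∫ x, ⟪f x, ξ x - lap ξ x⟫ = 0) :
    f =ᵐ[volume] 0 := by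
  obtain ⟨w, hw1, hw2⟩ := L2Conv.exists_helmholtz hf
  have h1 := (L2Conv.const hf).inner hw2; simp only [h _ (hw1 _)] at h1
  have h2 := tendsto_nhds_unique tendsto_const_nhds h1
  have h3 : ‖hf.toLp f‖ = 0 := by
    rw [← sq_eq_zero_iff, L2Conv.toLp_norm_sq, h2]; simp only [real_inner_self_eq_norm_sq]
  rw [norm_eq_zero, Lp.eq_zero_iff_ae_eq_zero] at h3; exact hf.coeFn_toLp.symm.trans h3

lemma integral_inner_lap (hw : IsTest w) (hξ : IsTest ξ) :
    ∫ x, ⟪w x, lap ξ x⟫ = ∫ x, ⟪lap w x, ξ x⟫ := by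
  have h1 := integral_inner_laplacian hw hξ
  have h2 := integral_inner_laplacian hξ hw
  simp only [inner_neg_left, integral_neg] at h1 h2
  change -∫ x, ⟪lap w x, ξ x⟫ = _ at h1
  change -∫ x, ⟪lap ξ x, w x⟫ = _ at h2
  have e3 : ∀ x, ⟪lap ξ x, w x⟫ = ⟪w x, lap ξ x⟫ := fun x => real_inner_comm _ _
  simp only [e3] at h2
  have : ∑ j, ∫ x, ⟪pd j w x, pd j ξ x⟫ = ∑ j, ∫ x, ⟪pd j ξ x, pd j w x⟫ := by
    simp only [real_inner_comm]
  linarith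

lemma integral_helmholtz_sq (hw : IsTest w) :
    ∫ x, ‖w x - lap w x‖ ^ 2 = (∫ x, ‖w x‖ ^ 2) + 2 * (∑ j, ∫ x, ‖pd j w x‖ ^ 2) +
      ∫ x, ‖lap w x‖ ^ 2 := by
  have h1 := integral_inner_laplacian hw hw
  simp only [inner_neg_left, integral_neg, real_inner_self_eq_norm_sq] at h1
  change -∫ x, ⟪lap w x, w x⟫ = _ at h1
  have e : ∀ x, ‖w x - lap w x‖ ^ 2 = ‖w x‖ ^ 2 + (-2) * ⟪lap w x, w x⟫ + ‖lap w x‖ ^ 2 := by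
    intro x; rw [norm_sub_sq_real, real_inner_comm]; ring
  have i1 := integrable_norm_sq (hw.memLp 2)
  have i2 := integrable_norm_sq (hw.lap.memLp 2)
  have i3 := (integrable_inner (hw.lap.memLp 2) (hw.memLp 2)).const_mul (-2)
  simp only [e]
  rw [integral_add (i1.fun_add i3) i2, integral_add i1 i3, integral_const_mul, ← h1]
  ring

lemma pd_sub_fun (hφ : Differentiable ℝ φ) (hξ : Differentiable ℝ ξ)
    (j : Fin d) : pd j (fun y => φ y - ξ y) = fun y => pd j φ y - pd j ξ y := by
  funext y
  simp only [pd]; rw [fderiv_fun_sub (hφ y) (hξ y)]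
  rfl

lemma IsTest.sub (hφ : IsTest φ) (hξ : IsTest ξ) : IsTest (fun x => φ x - ξ x) := by
  have : (fun x => φ x - ξ x) = fun x => φ x + (-1 : ℝ) • ξ x := by funext x; simp [sub_eq_add_neg]
  rw [this]; exact hφ.add (hξ.smul_left contDiff_const)

lemma lap_sub (hφ : IsTest φ) (hξ : IsTest ξ) (x : Space d) :
    lap (fun y => φ y - ξ y) x = lap φ x - lap ξ x := by
  simp only [lap, ← sum_sub_distrib]
  refine sum_congr rfl fun j _ => ?_
  rw [pd_sub_fun hφ.differentiable hξ.differentiable j,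
    pd_sub_fun (hφ.pd j).differentiable (hξ.pd j).differentiable j]

/-- An `L²` function with `L²` weak Laplacian is approximated by test functions in `H²`. -/
theorem exists_h2Approx [FiniteDimensional ℝ F] {v h : Space d → F} (hv : MemLp v 2)
    (hh : MemLp h 2)
    (hw : ∀ ξ, IsTest ξ → ∫ x, ⟪v x, lap ξ x⟫ = ∫ x, ⟪h x, ξ x⟫) :
    ∃ w g, H1Approx w v g ∧ L2Conv (fun n => lap (w n)) h := by
  obtain ⟨w, hw1, hw2⟩ := L2Conv.exists_helmholtz (hv.sub hh)
  have hc : ∀ m n x, (w m x - lap (w m) x) - (w n x - lap (w n) x) =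
      (w m x - w n x) - lap (fun y => w m y - w n y) x := by
    intro m n x; rw [lap_sub (hw1 m) (hw1 n)]; abel
  have hsq : ∀ m n, ∫ x, ‖(w m x - lap (w m) x) - (w n x - lap (w n) x)‖ ^ 2 =
      (∫ x, ‖w m x - w n x‖ ^ 2) + 2 * (∑ j, ∫ x, ‖pd j (w m) x - pd j (w n) x‖ ^ 2) +
        ∫ x, ‖lap (w m) x - lap (w n) x‖ ^ 2 := by
    intro m n; simp only [hc]; rw [integral_helmholtz_sq ((hw1 m).sub (hw1 n))]
    simp only [pd_sub_fun (hw1 m).differentiable (hw1 n).differentiable, lap_sub (hw1 m) (hw1 n)]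
  have n1 : ∀ m n, 0 ≤ ∫ x, ‖w m x - w n x‖ ^ 2 := fun m n =>
    integral_nonneg fun x => sq_nonneg _
  have n2 : ∀ m n j, 0 ≤ ∫ x, ‖pd j (w m) x - pd j (w n) x‖ ^ 2 := fun m n j =>
    integral_nonneg fun x => sq_nonneg _
  have n2s : ∀ m n, 0 ≤ ∑ j, ∫ x, ‖pd j (w m) x - pd j (w n) x‖ ^ 2 := fun m n =>
    sum_nonneg fun j _ => n2 m n j
  have n3 : ∀ m n, 0 ≤ ∫ x, ‖lap (w m) x - lap (w n) x‖ ^ 2 := fun m n =>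
    integral_nonneg fun x => sq_nonneg _
  obtain ⟨v', hv'⟩ := hw2.exists_of_le (fun n => (hw1 n).memLp 2) fun m n => by
    rw [hsq m n]; linarith [n2s m n, n3 m n]
  choose g hg using fun j => hw2.exists_of_le (f := fun n => pd j (w n))
    (fun n => ((hw1 n).pd j).memLp 2) fun m n => by
      rw [hsq m n]
      have := single_le_sum (fun j _ => n2 m n j) (mem_univ j)
      linarith [n1 m n, n3 m n, n2s m n]
  have hvv : v' =ᵐ[volume] v := by
    have hm : MemLp (fun x => v' x - v x) 2 := hv'.memLp_lim.sub hv
    have h0 := eq_zero_of_inner_helmholtz hm fun ξ hξ => by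
      have hm2 : MemLp (fun x => ξ x - lap ξ x) 2 := (hξ.memLp 2).sub (hξ.lap.memLp 2)
      have l1 := hv'.inner (L2Conv.const hm2)
      have l2 := hw2.inner (L2Conv.const (hξ.memLp 2))
      have e : ∀ n, ∫ x, ⟪w n x, ξ x - lap ξ x⟫ = ∫ x, ⟪w n x - lap (w n) x, ξ x⟫ := by
        intro n; simp only [inner_sub_left, inner_sub_right]
        rw [integral_sub, integral_sub, integral_inner_lap (hw1 n) hξ]
        · exact integrable_inner ((hw1 n).memLp 2) (hξ.memLp 2)
        · exact integrable_inner ((hw1 n).lap.memLp 2) (hξ.memLp 2)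
        · exact integrable_inner ((hw1 n).memLp 2) (hξ.memLp 2)
        · exact integrable_inner ((hw1 n).memLp 2) (hξ.lap.memLp 2)
      simp only [e] at l1
      have e1 := tendsto_nhds_unique l1 l2
      have e2 : ∫ x, ⟪v x, ξ x - lap ξ x⟫ = ∫ x, ⟪(v - h) x, ξ x⟫ := by
        simp only [inner_sub_left, inner_sub_right, Pi.sub_apply]
        rw [integral_sub, integral_sub, hw ξ hξ]
        · exact integrable_inner hv (hξ.memLp 2)
        · exact integrable_inner hh (hξ.memLp 2)
        · exact integrable_inner hv (hξ.memLp 2)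
        · exact integrable_inner hv (hξ.lap.memLp 2)
      simp only [inner_sub_left (v' _)]
      rw [integral_sub (integrable_inner hv'.memLp_lim hm2)
        (integrable_inner hv hm2), e1, e2, sub_self]
    filter_upwards [h0] with x hx; exact sub_eq_zero.1 hx
  have hv2 : L2Conv w v := hv'.congr (fun _ => ae_eq_rfl) hvv
  refine ⟨w, g, ⟨hw1, hv2, hg⟩, (hv2.sub hw2).congr (fun n => .of_forall fun x => ?_)
    (.of_forall fun x => ?_)⟩
  · simp
  · simp

lemma integral_dirac_add_sq (hγ : IsClifford γ)
    (hJ : ∀ u v, ⟪J u, v⟫ = -⟪u, J v⟫) (hJ2 : ∀ v, J (J v) = -v)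
    (hJγ : ∀ j v, J (γ j v) = γ j (J v)) (hw : IsTest w) :
    ∫ x, ‖dirac γ w x + J (w x)‖ ^ 2 = (∑ j, ∫ x, ‖pd j w x‖ ^ 2) + ∫ x, ‖w x‖ ^ 2 := by
  have hn : ∀ v, ‖J v‖ ^ 2 = ‖v‖ ^ 2 := by
    intro v
    rw [← real_inner_self_eq_norm_sq, hJ, hJ2, inner_neg_right, neg_neg, real_inner_self_eq_norm_sq]
  have hDJ : ∀ x, dirac γ (fun y => J (w y)) x = J (dirac γ w x) := by
    intro x; simp only [dirac, diracG, map_sum, hJγ]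
    refine sum_congr rfl fun j _ => ?_
    rw [pd_const_clm J j (hw.differentiable x)]
  have h1 := integral_inner_dirac hγ hw (hw.clm J).smooth
  simp only [hDJ, real_inner_comm (J (dirac γ w _)), hJ (dirac γ w _), integral_neg] at h1
  have h0 : ∫ x, ⟪dirac γ w x, J (w x)⟫ = 0 := by linarith
  have i1 := integrable_norm_sq ((hw.dirac γ).memLp 2)
  have i2 := integrable_norm_sq (hw.memLp 2)
  have i3 := (integrable_inner ((hw.dirac γ).memLp 2) ((hw.clm J).memLp 2)).const_mul 2
  simp only [norm_add_sq_real, hn]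
  rw [integral_add (i1.fun_add i3) i2, integral_add i1 i3, integral_const_mul, h0,
    integral_dirac_sq hγ hw]
  ring

lemma dirac_sub_fun (γ : Fin d → F →L[ℝ] F) (hφ : Differentiable ℝ φ)
    (hξ : Differentiable ℝ ξ) (x : Space d) :
    dirac γ (fun y => φ y - ξ y) x = dirac γ φ x - dirac γ ξ x := by
  simp only [dirac, diracG, ← sum_sub_distrib]
  exact sum_congr rfl fun j _ => by rw [pd_sub_fun hφ hξ, map_sub]

lemma dirac_clm (hJγ : ∀ j v, J (γ j v) = γ j (J v)) (hw : Differentiable ℝ w) (x : Space d) :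
    dirac γ (fun y => J (w y)) x = J (dirac γ w x) := by
  simp only [dirac, diracG, map_sum, hJγ]
  exact sum_congr rfl fun j _ => by rw [pd_const_clm J j (hw x)]

lemma dirac_add_sub (hγ : IsClifford γ)
    (hJ2 : ∀ v, J (J v) = -v) (hJγ : ∀ j v, J (γ j v) = γ j (J v))
    (hw : IsTest w) (x : Space d) :
    dirac γ (fun y => dirac γ w y - J (w y)) x + J (dirac γ w x - J (w x)) = w x - lap w x := by
  rw [dirac_sub_fun γ (hw.dirac γ).differentiable (hw.clm J).differentiable,
    dirac_dirac hγ hw, dirac_clm hJγ hw.differentiable, map_sub, hJ2]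
  simp only [lap]; abel

/-- An `L²` function `ψ` with `D ψ ∈ L²` weakly is approximated by test functions in `H¹`. -/
theorem exists_h1Approx [FiniteDimensional ℝ F] (hγ : IsClifford γ)
    (hJ : ∀ u v, ⟪J u, v⟫ = -⟪u, J v⟫) (hJ2 : ∀ v, J (J v) = -v)
    (hJγ : ∀ j v, J (γ j v) = γ j (J v)) {ψ : Space d → F} (hψ : MemLp ψ 2)
    (hu : MemLp u 2)
    (hw : ∀ ξ, IsTest ξ → ∫ x, ⟪ψ x, dirac γ ξ x⟫ = ∫ x, ⟪u x, ξ x⟫) :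
    ∃ w g, H1Approx w ψ g ∧ diracG γ g =ᵐ[volume] u := by
  have hJψ : MemLp (fun x => J (ψ x)) 2 := ((L2Conv.const hψ).clm J).memLp_lim
  obtain ⟨η, hη1, hη2⟩ := L2Conv.exists_helmholtz (hu.add hJψ)
  set w : ℕ → Space d → F := fun n x => dirac γ (η n) x - J (η n x) with hwdef
  have ht : ∀ n, IsTest (w n) := fun n => ((hη1 n).dirac γ).sub ((hη1 n).clm J)
  have hconv : L2Conv (fun n x => dirac γ (w n) x + J (w n x)) (fun x => u x + J (ψ x)) :=
    hη2.congr (fun n => .of_forall fun x =>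
      (dirac_add_sub hγ hJ2 hJγ (hη1 n) x).symm) ae_eq_rfl
  have hsq : ∀ m n, ∫ x, ‖(dirac γ (w m) x + J (w m x)) - (dirac γ (w n) x + J (w n x))‖ ^ 2 =
      (∑ j, ∫ x, ‖pd j (w m) x - pd j (w n) x‖ ^ 2) + ∫ x, ‖w m x - w n x‖ ^ 2 := by
    intro m n
    have := integral_dirac_add_sq hγ hJ hJ2 hJγ ((ht m).sub (ht n))
    simp only [pd_sub_fun (ht m).differentiable (ht n).differentiable,
      dirac_sub_fun γ (ht m).differentiable (ht n).differentiable, map_sub] at this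
    rw [← this]
    congr 1; funext x; congr 2; abel
  have n1 : ∀ m n, 0 ≤ ∫ x, ‖w m x - w n x‖ ^ 2 := fun m n =>
    integral_nonneg fun x => sq_nonneg _
  have n2 : ∀ m n j, 0 ≤ ∫ x, ‖pd j (w m) x - pd j (w n) x‖ ^ 2 := fun m n j =>
    integral_nonneg fun x => sq_nonneg _
  obtain ⟨v', hv'⟩ := hconv.exists_of_le (fun n => (ht n).memLp 2) fun m n => by
    rw [hsq m n]; linarith [sum_nonneg fun j (_ : j ∈ univ) => n2 m n j]
  choose g hg using fun j => hconv.exists_of_le (f := fun n => pd j (w n))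
    (fun n => ((ht n).pd j).memLp 2) fun m n => by
      rw [hsq m n]
      have := single_le_sum (fun j _ => n2 m n j) (mem_univ j)
      linarith [n1 m n]
  have hvv : v' =ᵐ[volume] ψ := by
    have hm : MemLp (fun x => v' x - ψ x) 2 := hv'.memLp_lim.sub hψ
    have h0 := eq_zero_of_inner_helmholtz hm fun ξ hξ => by
      set ζ : Space d → F := fun x => dirac γ ξ x - (-J) (ξ x) with hζ
      have tζ : IsTest ζ := (hξ.dirac γ).sub (hξ.clm (-J))
      have hid : ∀ x, ξ x - lap ξ x = dirac γ ζ x - J (ζ x) := by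
        intro x
        have := dirac_add_sub hγ (J := -J) (by simp [hJ2]) (by simp [hJγ]) hξ x
        rw [← this]; simp [hζ, sub_eq_add_neg]
      have hζ2 : MemLp (fun x => dirac γ ζ x - J (ζ x)) 2 := ((tζ.dirac γ).sub (tζ.clm J)).memLp 2
      simp only [hid]
      have l1 := hv'.inner (L2Conv.const hζ2)
      have l2 := hconv.inner (L2Conv.const (tζ.memLp 2))
      have key : ∀ a b : Space d → F, MemLp a 2 → MemLp b 2 →
          (∫ x, ⟪a x, dirac γ ζ x⟫ = ∫ x, ⟪b x, ζ x⟫) →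
          ∫ x, ⟪a x, dirac γ ζ x - J (ζ x)⟫ = ∫ x, ⟪b x + J (a x), ζ x⟫ := by
        intro a b ha hb hab
        have hJa : MemLp (fun x => J (a x)) 2 := ((L2Conv.const ha).clm J).memLp_lim
        have hJi := integrable_inner ha ((tζ.clm J).memLp 2)
        simp only [inner_sub_right, inner_add_left, hJ]
        rw [integral_sub (integrable_inner ha ((tζ.dirac γ).memLp 2)) hJi, integral_add
          (integrable_inner hb (tζ.memLp 2)) hJi.fun_neg, integral_neg, hab]
        ring
      have e := fun n => key (w n) (dirac γ (w n)) ((ht n).memLp 2) (((ht n).dirac γ).memLp 2)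
        (integral_inner_dirac hγ (ht n) tζ.smooth).symm
      simp only [e] at l1
      have e1 := tendsto_nhds_unique l1 l2
      have e2 := key ψ u hψ hu (hw ζ tζ); simp only [inner_sub_left (v' _)]
      rw [integral_sub (integrable_inner hv'.memLp_lim hζ2)
        (integrable_inner hψ hζ2), e1, e2, sub_self]
    filter_upwards [h0] with x hx; exact sub_eq_zero.1 hx
  have hv2 : L2Conv w ψ := hv'.congr (fun _ => ae_eq_rfl) hvv
  have hH : H1Approx w ψ g := ⟨ht, hv2, hg⟩; refine ⟨w, g, hH, ?_⟩
  have := (hH.conv_dirac γ).unique ((hconv.sub (hv2.clm J)).congr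
    (f' := fun n => dirac γ (w n)) (g' := u) (fun n => .of_forall fun x => by simp)
    (.of_forall fun x => by simp))
  exact this

end Helmholtz

section Radial

variable {d : ℕ}
  {f : ℝ → ℝ} {ε t : ℝ}

lemma hasFDerivAt_radial {f' : ℝ} {x : Space d} (hx : x ≠ 0) (hf : HasDerivAt f f' ‖x‖) :
    HasFDerivAt (fun y : Space d => f ‖y‖) ((f' / ‖x‖) • innerSL ℝ x) x := by
  have hx' : ‖x‖ ≠ 0 := norm_ne_zero_iff.2 hx
  have h1 : HasFDerivAt (fun y : Space d => ‖y‖) (‖x‖⁻¹ • innerSL ℝ x) x := by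
    have h2 : HasFDerivAt (fun x : Space d => ‖x‖ ^ 2) ((2 : ℝ) • (innerSL ℝ x)) x := by
      have := (hasStrictFDerivAt_norm_sq x).hasFDerivAt
      rwa [← Nat.cast_smul_eq_nsmul ℝ] at this
    have h3 := h2.sqrt (by positivity); simp only [sqrt_sq (norm_nonneg _)] at h3
    have el : (1 / (2 * ‖x‖)) • ((2 : ℝ) • innerSL ℝ x) = ‖x‖⁻¹ • innerSL ℝ x := by
      rw [smul_smul]; congr 1; field_simp
    rwa [el] at h3
  have h2 := hf.comp_hasFDerivAt x h1; rw [smul_smul] at h2; exact h2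

lemma rd_radial {f' : ℝ} {x : Space d} (hx : x ≠ 0) (hf : HasDerivAt f f' ‖x‖) :
    rd (fun y : Space d => f ‖y‖) x = ‖x‖ * f' := by
  have hx' : ‖x‖ ≠ 0 := norm_ne_zero_iff.2 hx
  simp only [rd, (hasFDerivAt_radial hx hf).fderiv, FunLike.coe_smul, Pi.smul_apply,
    innerSL_apply_apply, real_inner_self_eq_norm_sq, smul_eq_mul]
  field_simp

lemma pd_radial {f' : ℝ} {x : Space d} (hx : x ≠ 0) (hf : HasDerivAt f f' ‖x‖)
    (j : Fin d) : pd j (fun y : Space d => f ‖y‖) x = f' / ‖x‖ * x j := by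
  simp [pd, (hasFDerivAt_radial hx hf).fderiv, coordVec, EuclideanSpace.inner_single_right]

lemma contDiffOn_radial (hf : ContDiffOn ℝ ∞ f (Set.Ioi 0)) :
    ContDiffOn ℝ ∞ (fun y : Space d => f ‖y‖) {0}ᶜ := by
  intro x hx
  have h1 : ContDiffAt ℝ ∞ f ‖x‖ := hf.contDiffAt (Ioi_mem_nhds (norm_pos_iff.2 hx))
  exact (h1.comp x (contDiffAt_norm ℝ hx)).contDiffWithinAt

/-- The logarithmic derivative of the Carleman weight. -/
def carlemanS (l ε : ℝ) (t : ℝ) : ℝ := l * √t / (1 + ε ^ 2 * t)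

/-- The saturation of the Carleman weight. -/
def carlemanSigma (ε : ℝ) (t : ℝ) : ℝ := ε ^ 2 * t / (1 + ε ^ 2 * t)

/-- The coefficient of `x` in the gradient of the Carleman exponent. -/
def carlemanA (l ε : ℝ) (t : ℝ) : ℝ := carlemanS l ε t / t ^ 2

/-- The exponent of the Carleman weight. -/
def carlemanF (l ε : ℝ) (t : ℝ) : ℝ := 2 * l / ε * Real.arctan (ε * √t)

lemma carlemanS_nonneg {l : ℝ} (hl : 0 ≤ l) (ht : 0 ≤ t) : 0 ≤ carlemanS l ε t := by
  unfold carlemanS; positivity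

lemma carlemanSigma_mem (ht : 0 ≤ t) : 0 ≤ carlemanSigma ε t ∧ carlemanSigma ε t ≤ 1 := by
  unfold carlemanSigma
  exact ⟨by positivity, by rw [div_le_one (by positivity)]; linarith⟩

lemma hasDerivAt_carlemanS (l ε : ℝ) (ht : 0 < t) : HasDerivAt (carlemanS l ε)
    (carlemanS l ε t * (1 / 2 - carlemanSigma ε t) / t) t := by
  have h1 := ((hasDerivAt_sqrt ht.ne').const_mul l)
  have h2 : HasDerivAt (fun t => 1 + ε ^ 2 * t) (ε ^ 2) t := by
    simpa using ((hasDerivAt_id t).const_mul (ε ^ 2)).const_add 1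
  have h3 := h1.div h2 (by positivity)
  refine h3.congr_deriv ?_
  have hs : √t ≠ 0 := (Real.sqrt_pos.2 ht).ne'
  have hq : √t ^ 2 = t := sq_sqrt ht.le; unfold carlemanS carlemanSigma
  have hden : (1 + ε ^ 2 * t) ≠ 0 := by positivity
  obtain ⟨w, hw⟩ : ∃ w, w = √t := ⟨_, rfl⟩
  rw [← hw] at hs hq ⊢; rw [← hq] at hden ⊢; field_simp

lemma hasDerivAt_carlemanSigma (ε : ℝ) (ht : 0 < t) : HasDerivAt (carlemanSigma ε)
    (carlemanSigma ε t * (1 - carlemanSigma ε t) / t) t := by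
  have h1 : HasDerivAt (fun t => ε ^ 2 * t) (ε ^ 2) t := by
    simpa using ((hasDerivAt_id t).const_mul (ε ^ 2))
  have h3 := h1.div (h1.const_add 1) (by positivity)
  refine h3.congr_deriv ?_
  unfold carlemanSigma; field_simp

lemma hasDerivAt_carlemanA (l ε : ℝ) (ht : 0 < t) : HasDerivAt (carlemanA l ε)
    (-carlemanA l ε t * (3 / 2 + carlemanSigma ε t) / t) t := by
  have h3 := (hasDerivAt_carlemanS l ε ht).div (hasDerivAt_pow 2 t) (by positivity)
  refine h3.congr_deriv ?_
  unfold carlemanA; field_simp; ring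

lemma hasDerivAt_carlemanF (l : ℝ) (hε : 0 < ε) (ht : 0 < t) : HasDerivAt (carlemanF l ε)
    (carlemanS l ε t / t) t := by
  have h1 := ((hasDerivAt_sqrt ht.ne').const_mul ε)
  have h2 := (h1.arctan).const_mul (2 * l / ε)
  refine h2.congr_deriv ?_
  have hs : √t ≠ 0 := (Real.sqrt_pos.2 ht).ne'
  have hq : √t ^ 2 = t := sq_sqrt ht.le; unfold carlemanS
  have hden : (1 + ε ^ 2 * t) ≠ 0 := by positivity
  have ht' := ht.ne'
  obtain ⟨w, hw⟩ : ∃ w, w = √t := ⟨_, rfl⟩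
  rw [← hw] at hs hq ⊢; rw [← hq] at hden ht' ⊢; field_simp

lemma contDiffOn_carlemanS (l ε : ℝ) : ContDiffOn ℝ ∞ (carlemanS l ε) (Set.Ioi 0) := by
  intro t ht
  have ht' : (0 : ℝ) < t := ht
  refine ContDiffAt.contDiffWithinAt ?_
  refine (contDiffAt_const.mul (contDiffAt_sqrt ht'.ne')).div
    (contDiffAt_const.add (contDiffAt_const.mul contDiffAt_id)) ?_
  positivity

lemma contDiffOn_carlemanSigma (ε : ℝ) : ContDiffOn ℝ ∞ (carlemanSigma ε) (Set.Ioi 0) := by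
  intro t ht
  have ht' : (0 : ℝ) < t := ht
  refine ContDiffAt.contDiffWithinAt ?_
  refine (contDiffAt_const.mul contDiffAt_id).div
    (contDiffAt_const.add (contDiffAt_const.mul contDiffAt_id)) ?_
  positivity

lemma contDiffOn_carlemanA (l ε : ℝ) : ContDiffOn ℝ ∞ (carlemanA l ε) (Set.Ioi 0) :=
  (contDiffOn_carlemanS l ε).div (contDiffOn_id.pow 2) fun t ht => by
    have ht' : (0 : ℝ) < t := ht; positivity

lemma contDiffOn_carlemanF (l ε : ℝ) : ContDiffOn ℝ ∞ (carlemanF l ε) (Set.Ioi 0) := by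
  intro t ht
  have ht' : (0 : ℝ) < t := ht
  refine ContDiffAt.contDiffWithinAt ?_
  exact contDiffAt_const.mul ((Real.contDiff_arctan.contDiffAt).comp t
    (contDiffAt_const.mul (contDiffAt_sqrt ht'.ne')))

lemma carlemanF_le {l : ℝ} (hl : 0 ≤ l) (hε : 0 < ε) (t : ℝ) :
    carlemanF l ε t ≤ l / ε * Real.pi := by
  have := (Real.arctan_lt_pi_div_two (ε * √t)).le; unfold carlemanF
  calc 2 * l / ε * Real.arctan (ε * √t) ≤ 2 * l / ε * (Real.pi / 2) := by gcongr
    _ = _ := by ring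

lemma carlemanF_mono {l : ℝ} (hl : 0 ≤ l) (hε : 0 < ε) {u : ℝ} (h : t ≤ u) :
    carlemanF l ε t ≤ carlemanF l ε u := by
  unfold carlemanF
  have := Real.arctan_mono (mul_le_mul_of_nonneg_left (sqrt_le_sqrt h) hε.le); gcongr

lemma carlemanF_sub {l u : ℝ} (hl : 0 ≤ l) (hε : 0 < ε) (ht : 0 < t) (h : t ≤ u) :
    l / (√u * (1 + ε ^ 2 * u)) * (u - t) ≤ carlemanF l ε u - carlemanF l ε t := by
  have hu := ht.trans_le h
  refine (convex_Icc t u).mul_sub_le_image_sub_of_le_deriv ?_ ?_ ?_ t (Set.left_mem_Icc.2 h) u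
    (Set.right_mem_Icc.2 h) h
  · exact fun y hy => (hasDerivAt_carlemanF l hε (ht.trans_le hy.1)).continuousAt.continuousWithinAt
  · intro y hy; rw [interior_Icc] at hy
    exact (hasDerivAt_carlemanF l hε (ht.trans hy.1)).differentiableAt.differentiableWithinAt
  · intro y hy; rw [interior_Icc] at hy
    have hy0 := ht.trans hy.1; rw [(hasDerivAt_carlemanF l hε hy0).deriv]
    unfold carlemanS
    have hq : √y ^ 2 = y := sq_sqrt hy0.le
    have hy1 : 0 < √y := Real.sqrt_pos.2 hy0
    have e : l * √y / (1 + ε ^ 2 * y) / y = l / (√y * (1 + ε ^ 2 * y)) := by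
      nth_rw 3 [← hq]; field_simp
    rw [e]
    have h1 := sqrt_le_sqrt hy.2.le
    have h2 : 1 + ε ^ 2 * y ≤ 1 + ε ^ 2 * u := by have := hy.2.le; gcongr
    gcongr

lemma carlemanS_sq_mul_le (l ε : ℝ) (ht : 0 ≤ t) :
    carlemanS l ε t ^ 2 * carlemanSigma ε t ≤ (l * ε) ^ 2 * t ^ 2 := by
  unfold carlemanS carlemanSigma
  rw [div_pow, mul_pow, sq_sqrt ht, div_mul_div_comm, div_le_iff₀ (by positivity)]
  have h1 : 1 ≤ (1 + ε ^ 2 * t) ^ 2 * (1 + ε ^ 2 * t) := by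
    have : 1 ≤ 1 + ε ^ 2 * t := by nlinarith [mul_nonneg (sq_nonneg ε) ht]
    nlinarith [one_le_pow₀ this (n := 3)]
  calc l ^ 2 * t * (ε ^ 2 * t) = (l * ε) ^ 2 * t ^ 2 * 1 := by ring
    _ ≤ _ := by gcongr

lemma carlemanS_dominates {q c K R : ℝ} (hq : 0 < q) (hc : 0 < c) (hK : 0 < K) (hR : 0 < R) :
    ∃ l₀ : ℝ, 0 < l₀ ∧ ∀ l, l₀ ≤ l → ∀ t, R ≤ t →
      K * (1 + carlemanS l (q / l) t + t) ≤ carlemanS l (q / l) t ^ 2 + c * t ^ 2 := by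
  set A := K + K ^ 2 / 2 with hA
  set R₁ := (A + K) / c + 1 with hR₁
  have hA0 : 0 < A := by positivity
  have hR₁0 : 1 ≤ R₁ := by rw [hR₁]; have : 0 ≤ (A + K) / c := by positivity
                           linarith
  refine ⟨√(8 * (A + K * R₁) / R + q ^ 2 * R₁), Real.sqrt_pos.2 (by positivity), fun l hl t ht => ?_⟩
  have hl0 : 0 < l := lt_of_lt_of_le (Real.sqrt_pos.2 (by positivity)) hl
  have hl2 : 8 * (A + K * R₁) / R + q ^ 2 * R₁ ≤ l ^ 2 := by rwa [sqrt_le_left hl0.le] at hl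
  have ht0 := hR.trans_le ht
  set s := carlemanS l (q / l) t with hs
  have hKs : K * s ≤ s ^ 2 / 2 + K ^ 2 / 2 := by nlinarith [sq_nonneg (s - K)]
  suffices h : A + K * t ≤ s ^ 2 / 2 + c * t ^ 2 by rw [hA] at h; linarith
  rcases le_total R₁ t with h1 | h1
  · have h2 : A + K ≤ c * t := by
      have : (A + K) / c ≤ t := by rw [hR₁] at h1; linarith
      rwa [div_le_iff₀' hc] at this
    have h3 : 1 ≤ t := hR₁0.trans h1; nlinarith [sq_nonneg s]
  · have e : s ^ 2 = l ^ 2 * t / (1 + (q / l) ^ 2 * t) ^ 2 := by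
      rw [hs, carlemanS, div_pow, mul_pow, sq_sqrt ht0.le]
    have h2 : (q / l) ^ 2 * t ≤ 1 := by
      rw [div_pow, div_mul_eq_mul_div, div_le_one (by positivity)]
      have : 0 ≤ 8 * (A + K * R₁) / R := by positivity
      nlinarith [mul_le_mul_of_nonneg_left h1 (sq_nonneg q)]
    have h3 : (1 + (q / l) ^ 2 * t) ^ 2 ≤ 4 := by
      have : 0 ≤ (q / l) ^ 2 * t := by positivity
      nlinarith
    have h4 : l ^ 2 * t / 4 ≤ s ^ 2 := by rw [e]; gcongr
    have h5 : 8 * (A + K * R₁) ≤ l ^ 2 * R := by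
      have : 8 * (A + K * R₁) / R ≤ l ^ 2 := by nlinarith [mul_nonneg (sq_nonneg q) (by linarith : 0 ≤ R₁)]
      rwa [div_le_iff₀ hR] at this
    have h6 : l ^ 2 * R ≤ l ^ 2 * t := by gcongr
    have h7 : K * t ≤ K * R₁ := by gcongr
    nlinarith [mul_nonneg hc.le (sq_nonneg t)]

lemma carleman_quadratic {θ C₂ s X y : ℝ} (hC₂ : 0 ≤ C₂) (hθ : C₂ < θ) (hθ1 : θ < 1) (hs : 0 ≤ s)
    (hy : 0 ≤ y) (hyX : y ≤ X) :
    (θ - C₂) * (X ^ 2 / (1 + s) + s * y ^ 2) ≤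
      θ / (1 + s) * X ^ 2 + 2 * s * y ^ 2 - C₂ * X * y := by
  have hX := hy.trans hyX
  have key : C₂ * X * y ≤ C₂ * (X ^ 2 / (1 + s)) + C₂ * s * y ^ 2 := by
    have : X * y ≤ X ^ 2 / (1 + s) + s * y ^ 2 := by
      rw [← sub_le_iff_le_add, le_div_iff₀ (by linarith)]
      rcases le_total s 1 with h | h
      · nlinarith [mul_nonneg (sub_nonneg.2 hyX) (by nlinarith : 0 ≤ X - s * y), sq_nonneg (s * y)]
      · nlinarith [sq_nonneg (X - (1 + s) / 2 * y), mul_nonneg (by nlinarith : 0 ≤ (1 + s) * (3 * s - 1)) (sq_nonneg y)]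
    nlinarith [mul_le_mul_of_nonneg_left this hC₂]
  have e : θ / (1 + s) * X ^ 2 = θ * (X ^ 2 / (1 + s)) := by ring
  rw [e]
  have : 0 ≤ s * y ^ 2 := by positivity
  nlinarith

lemma carleman_pointwise {θ C₂ C₃ C₄ D c : ℝ} (hC₂ : 0 ≤ C₂) (hθ : C₂ < θ) (hθ1 : θ < 1) (hC₃ : 0 ≤ C₃)
    (hD : 0 ≤ D) (hC₄ : 0 ≤ C₄) :
    ∃ K : ℝ, 0 < K ∧ ∀ s X y p P r : ℝ, 0 ≤ s → 0 ≤ y → y ≤ X → 0 ≤ p → 0 ≤ P → 0 ≤ r →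
      K * (1 + s + r) ≤ s ^ 2 + c * r ^ 2 →
      c / 2 * (r * p) ^ 2 - (4 / (θ - C₂) + 1 / 2) * P ^ 2 ≤
        2 * (θ / (1 + s)) * X ^ 2 + 4 * s * (y ^ 2 - D * y * p) + (s ^ 2 - 9 * s + c * r ^ 2) * p ^ 2
          - y * p - 4 * s * (y * p + D / 2 * p ^ 2) - C₄ * (r + 1) * p ^ 2
          - (C₂ * (X + s * p) + C₃ * p + P) * (2 * y + (D + 2) * p) := by
  set c₀ := θ - C₂ with hc₀
  have hc₀' : 0 < c₀ := sub_pos.2 hθ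
  set A := 4 * D + 4 + 2 * C₂
  set B := C₂ * (D + 2)
  set E := 2 * C₃ + 1
  set K' := A ^ 2 / (2 * c₀) + B ^ 2 / (2 * c₀) + E ^ 2 / c₀ + (D + 2) ^ 2 / 2 + 9 + 2 * D + C₄ + B +
    C₃ * (D + 2) with hK'
  have hK0 : 0 < K' := by positivity
  refine ⟨2 * K', by positivity, fun s X y p P r hs hy hyX hp hP hr hdom => ?_⟩
  have hX := hy.trans hyX
  set Θ := X ^ 2 / (1 + s) with hΘ
  have q := carleman_quadratic hC₂ hθ hθ1 hs hy hyX; rw [← hc₀, ← hΘ] at q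
  have hXΘ : X ^ 2 = (1 + s) * Θ := by rw [hΘ]; field_simp
  have t1 : A * (s * y * p) ≤ c₀ / 2 * (s * y ^ 2) + A ^ 2 / (2 * c₀) * (s * p ^ 2) := by
    have : A * (y * p) ≤ c₀ / 2 * y ^ 2 + A ^ 2 / (2 * c₀) * p ^ 2 := by
      have h := sq_nonneg (c₀ * y - A * p)
      have e : c₀ / 2 * y ^ 2 + A ^ 2 / (2 * c₀) * p ^ 2 - A * (y * p) = (c₀ * y - A * p) ^ 2 / (2 * c₀) := by
        field_simp; ring
      have : 0 ≤ (c₀ * y - A * p) ^ 2 / (2 * c₀) := by positivity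
      linarith
    nlinarith [mul_le_mul_of_nonneg_left this hs]
  have t2 : B * (X * p) ≤ c₀ / 2 * Θ + B ^ 2 / (2 * c₀) * ((1 + s) * p ^ 2) := by
    have e : c₀ / 2 * Θ + B ^ 2 / (2 * c₀) * ((1 + s) * p ^ 2) - B * (X * p) =
        (c₀ * X - B * (1 + s) * p) ^ 2 / (2 * c₀ * (1 + s)) := by
      rw [hΘ]; field_simp; ring
    have : 0 ≤ (c₀ * X - B * (1 + s) * p) ^ 2 / (2 * c₀ * (1 + s)) := by positivity
    exact sub_nonneg.1 (e ▸ this)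
  have t3 : y * (E * p + 2 * P) ≤ c₀ / 2 * (Θ + s * y ^ 2) + E ^ 2 / c₀ * p ^ 2 + 4 / c₀ * P ^ 2 := by
    have h1 : y ^ 2 ≤ Θ + s * y ^ 2 := by
      have h2 : y ^ 2 / (1 + s) ≤ Θ := by rw [hΘ]; gcongr
      have h3 : y ^ 2 = y ^ 2 / (1 + s) + s * y ^ 2 / (1 + s) := by field_simp
      have h4 : s * y ^ 2 / (1 + s) ≤ s * y ^ 2 := div_le_self (by positivity) (by linarith)
      linarith
    have e : c₀ / 2 * y ^ 2 + E ^ 2 / c₀ * p ^ 2 + 4 / c₀ * P ^ 2 - y * (E * p + 2 * P) =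
        ((c₀ * y - (E * p + 2 * P)) ^ 2 + (E * p - 2 * P) ^ 2) / (2 * c₀) := by
      field_simp; ring
    have h2 : 0 ≤ ((c₀ * y - (E * p + 2 * P)) ^ 2 + (E * p - 2 * P) ^ 2) / (2 * c₀) := by positivity
    have h3 := mul_le_mul_of_nonneg_left h1 (half_pos hc₀').le; linarith
  have t4 : P * ((D + 2) * p) ≤ 1 / 2 * P ^ 2 + (D + 2) ^ 2 / 2 * p ^ 2 := by
    have := sq_nonneg (P - (D + 2) * p); linarith only [this]
  have t5 : K' * (1 + s + r) * p ^ 2 ≤ (s ^ 2 + c * r ^ 2) * p ^ 2 - c / 2 * (r * p) ^ 2 := by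
    have h1 : K' * (1 + s + r) ≤ s ^ 2 + c * r ^ 2 - c / 2 * r ^ 2 := by
      have := sq_nonneg s; linarith only [hdom, this]
    have h2 := mul_le_mul_of_nonneg_right h1 (sq_nonneg p); linarith only [h2]
  have a1 : 0 ≤ A ^ 2 / (2 * c₀) := by positivity
  have a2 : 0 ≤ B ^ 2 / (2 * c₀) := by positivity
  have a3 : 0 ≤ E ^ 2 / c₀ := by positivity
  have a4 : 0 ≤ B := by positivity
  have a5 : 0 ≤ C₃ * (D + 2) := by positivity
  have t6 : (A ^ 2 / (2 * c₀) * s + B ^ 2 / (2 * c₀) * (1 + s) + E ^ 2 / c₀ + (D + 2) ^ 2 / 2 + 9 * s +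
      2 * D * s + C₄ * (r + 1) + B * s + C₃ * (D + 2)) * p ^ 2 ≤ K' * (1 + s + r) * p ^ 2 := by
    refine mul_le_mul_of_nonneg_right ?_ (sq_nonneg p)
    have : ∀ a u : ℝ, 0 ≤ a → 0 ≤ u → u ≤ 1 + s + r → a * u ≤ a * (1 + s + r) := fun a u ha _ hu =>
      mul_le_mul_of_nonneg_left hu ha
    have b1 := this _ s a1 hs (by linarith)
    have b2 := this _ (1 + s) a2 (by linarith) (by linarith)
    have b3 := this _ 1 a3 (by linarith) (by linarith)
    have b4 := this ((D + 2) ^ 2 / 2) 1 (by positivity) (by linarith) (by linarith)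
    have b5 := this 9 s (by positivity) hs (by linarith)
    have b6 := this (2 * D) s (by positivity) hs (by linarith)
    have b7 := this C₄ (r + 1) hC₄ (by linarith) (by linarith)
    have b8 := this B s a4 hs (by linarith)
    have b9 := this _ 1 a5 (by linarith) (by linarith); rw [hK']; linarith
  have hΘ0 : 0 ≤ c₀ * Θ := by positivity
  have hsy : 0 ≤ c₀ * (s * y ^ 2) := by positivity
  have hid : (C₂ * (X + s * p) + C₃ * p + P) * (2 * y + (D + 2) * p) =
      2 * (C₂ * X * y) + 2 * C₂ * (s * y * p) + B * (X * p) + B * (s * p ^ 2) + 2 * C₃ * (y * p) +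
        C₃ * (D + 2) * p ^ 2 + 2 * (P * y) + P * ((D + 2) * p) := by
    simp only [B]; ring
  rw [hid]
  have hA : A * (s * y * p) = (4 * D + 4 + 2 * C₂) * (s * y * p) := rfl
  have hE : y * (E * p + 2 * P) = y * ((2 * C₃ + 1) * p + 2 * P) := rfl; rw [hA] at t1
  rw [hE] at t3
  have q2 : 2 * (c₀ * (Θ + s * y ^ 2)) ≤
    2 * (θ / (1 + s) * X ^ 2 + 2 * s * y ^ 2 - C₂ * X * y) := by linarith only [q]
  linarith only [q2, t1, t2, t3, t4, t5, t6, hΘ0, hsy]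

end Radial

lemma carleman_algebra {S i Dl n r s σ η b NN dN EZ RZ θ C₁ C₂ C₃ D κ ν P : ℝ} (hr : 0 < r)
    (hs : 0 ≤ s) (hσ0 : 0 ≤ σ) (hσ1 : σ ≤ 1) (hθ0 : 0 ≤ θ) (hθ1 : θ < 1)
    (hn : 0 ≤ n) (hD0 : 0 ≤ D) (hDl : 0 ≤ Dl) (hν : 0 ≤ ν) (hC₁ : 0 ≤ C₁)
    (hi : |i| ≤ Dl * n) (hη : η = 2 * (1 - θ / (1 + s))) (hb : |b| * r ^ 2 ≤ 1)
    (hNN : NN ≤ -(s / r ^ 2) * (3 / 2 + σ + s) * n ^ 2 - κ ^ 2 * n ^ 2 + 2 * ν * (C₁ / r) * n ^ 2)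
    (hdN : dN ≤ s / r ^ 2 * ((3 / 2 + σ) * (3 / 2 + σ + s) - (σ * (1 - σ) + s * (1 / 2 - σ))) * n ^ 2
      + 2 * (C₁ / r) * (ν + C₁ / r) * n ^ 2)
    (hsσ : s ^ 2 * σ ≤ (1 - θ) * κ ^ 2 / 2 * r ^ 2)
    (hEZ : -((C₂ * (√S + s * (n / r)) + C₃ * (n / r)) * (2 * (Dl / r) + (D + 2) * (n / r))) ≤ EZ)
    (hRZ : RZ ≤ P * (2 * (Dl / r) + (D + 2) * (n / r))) (hS : 0 ≤ S) {k₁ k₂ : ℝ}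
    (hpt : k₁ ≤ 2 * (θ / (1 + s)) * √S ^ 2 + 4 * s * ((Dl / r) ^ 2 - D * (Dl / r) * (n / r)) +
        (s ^ 2 - 9 * s + (1 - θ) * κ ^ 2 * r ^ 2) * (n / r) ^ 2
        - (Dl / r) * (n / r) - 4 * s * ((Dl / r) * (n / r) + D / 2 * (n / r) ^ 2)
        - (6 * ν * C₁ + 2 * C₁ ^ 2) * (r + 1) * (n / r) ^ 2
        - (C₂ * (√S + s * (n / r)) + C₃ * (n / r) + P) * (2 * (Dl / r) + (D + 2) * (n / r)))
    (hk : k₂ = 2 * S - η * S - b * i - dN - η * NN +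
      4 * (s / r ^ 2) * (Dl ^ 2 + D * i + D ^ 2 / 4 * n ^ 2) -
      2 * (s / r ^ 2) * η * (i + D / 2 * n ^ 2) + EZ - RZ) : k₁ ≤ k₂ := by
  refine hpt.trans ?_
  set p := n / r with hp
  set y := Dl / r with hy
  have hnp : n = r * p := by rw [hp]; field_simp
  have hDy : Dl = r * y := by rw [hy]; field_simp
  have hp0 : 0 ≤ p := by positivity
  have hy0 : 0 ≤ y := by positivity
  set I := i / r ^ 2 with hI
  have hiI : i = r ^ 2 * I := by rw [hI]; field_simp
  have hr2 : 0 < r ^ 2 := by positivity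
  have hIb : |I| ≤ y * p := by
    rw [hI, abs_div, abs_of_pos hr2, div_le_iff₀ hr2]; rw [hDy, hnp] at hi
    linarith only [hi]
  obtain ⟨hI1, hI2⟩ := abs_le.1 hIb
  have hyp : 0 ≤ y * p := by positivity
  set t := θ / (1 + s) with ht
  have ht0 : 0 ≤ t := by positivity
  have htθ : t ≤ θ := div_le_self hθ0 (by linarith)
  have hts : t * s ^ 2 ≤ s := by
    rw [ht, div_mul_eq_mul_div, div_le_iff₀ (by linarith)]
    have := mul_le_mul_of_nonneg_right hθ1.le (sq_nonneg s); linarith only [this, hs]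
  rw [sq_sqrt hS]
  have e1 : -(b * i) ≥ -(y * p) := by
    have : |b * i| ≤ y * p := by
      rw [hiI, abs_mul, abs_mul, abs_of_pos hr2]
      calc |b| * (r ^ 2 * |I|) = (|b| * r ^ 2) * |I| := by ring
        _ ≤ 1 * (y * p) := by gcongr
        _ = _ := one_mul _
    linarith only [le_abs_self (b * i), this]
  have e2 : dN ≤ s * ((3 / 2 + σ) * (3 / 2 + σ + s) - (σ * (1 - σ) + s * (1 / 2 - σ))) * p ^ 2 +
      (2 * ν * C₁ * r + 2 * C₁ ^ 2) * p ^ 2 := by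
    refine hdN.trans (le_of_eq ?_)
    rw [hnp]; field_simp
  have e3 : NN ≤ -(s * (3 / 2 + σ + s)) * p ^ 2 - κ ^ 2 * (r ^ 2 * p ^ 2) + 2 * ν * C₁ * r * p ^ 2 := by
    refine hNN.trans (le_of_eq ?_)
    rw [hnp]; field_simp
  have hη0 : 0 ≤ η := by rw [hη]; linarith only [htθ, hθ1]
  have hη2 : η ≤ 2 := by rw [hη]; linarith only [ht0]
  have e4 : η * NN ≤ η * (-(s * (3 / 2 + σ + s)) * p ^ 2 - κ ^ 2 * (r ^ 2 * p ^ 2) +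
      2 * ν * C₁ * r * p ^ 2) := mul_le_mul_of_nonneg_left e3 hη0
  have e5 : η * (2 * ν * C₁ * r * p ^ 2) ≤ 2 * (2 * ν * C₁ * r * p ^ 2) := by gcongr
  have e6 : 2 * (1 - θ) * (κ ^ 2 * (r ^ 2 * p ^ 2)) ≤ η * (κ ^ 2 * (r ^ 2 * p ^ 2)) := by
    gcongr; rw [hη]; linarith only [htθ]
  have e7 : 4 * (s / r ^ 2) * (Dl ^ 2 + D * i + D ^ 2 / 4 * n ^ 2) =
      4 * s * (y ^ 2 + D * I + D ^ 2 / 4 * p ^ 2) := by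
    rw [hnp, hDy, hiI]; field_simp
  have e8 : 2 * (s / r ^ 2) * η * (i + D / 2 * n ^ 2) = 2 * s * (η * (I + D / 2 * p ^ 2)) := by
    rw [hnp, hiI]; field_simp
  have e9 : η * (I + D / 2 * p ^ 2) ≤ 2 * (y * p + D / 2 * p ^ 2) := by
    have : I + D / 2 * p ^ 2 ≤ y * p + D / 2 * p ^ 2 := by linarith only [hI2]
    have h0 : 0 ≤ y * p + D / 2 * p ^ 2 := by positivity
    calc η * (I + D / 2 * p ^ 2) ≤ η * (y * p + D / 2 * p ^ 2) := by gcongr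
      _ ≤ _ := by gcongr
  have e9' := mul_le_mul_of_nonneg_left e9 (by linarith : 0 ≤ 2 * s)
  have e10 : 4 * s * (y ^ 2 - D * y * p) ≤ 4 * s * (y ^ 2 + D * I + D ^ 2 / 4 * p ^ 2) := by
    refine mul_le_mul_of_nonneg_left ?_ (by linarith)
    have h0 : 0 ≤ D ^ 2 / 4 * p ^ 2 := by positivity
    have h1 := mul_le_mul_of_nonneg_left hI1 hD0; linarith only [h0, h1]
  have e11 : s ^ 2 * σ * p ^ 2 ≤ (1 - θ) * κ ^ 2 / 2 * r ^ 2 * p ^ 2 :=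
    mul_le_mul_of_nonneg_right hsσ (sq_nonneg p)
  have e12 : t * s ^ 2 * p ^ 2 ≤ s * p ^ 2 := mul_le_mul_of_nonneg_right hts (sq_nonneg p)
  have e13 : η * (s * (3 / 2 + σ + s) * p ^ 2) =
      2 * (s * (3 / 2 + σ + s) * p ^ 2) - 2 * (t * s) * (3 / 2 + σ) * p ^ 2 - 2 * (t * s ^ 2 * p ^ 2) := by
    rw [hη]; ring
  have e14 : s * ((3 / 2 + σ) * (3 / 2 + σ + s) - (σ * (1 - σ) + s * (1 / 2 - σ))) * p ^ 2 =
      s * (9 / 4 + 2 * σ + 2 * σ ^ 2) * p ^ 2 + (s ^ 2 * p ^ 2) + 2 * (s ^ 2 * σ * p ^ 2) := by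
    ring
  have hsp : 0 ≤ s * p ^ 2 := by positivity
  have e15 : (s * p ^ 2) * (9 / 4 + 2 * σ + 2 * σ ^ 2) ≤ (s * p ^ 2) * (25 / 4) := by
    gcongr; nlinarith only [hσ0, hσ1]
  have e16 : (t * s) * (3 / 2 + σ) * p ^ 2 ≤ (s * p ^ 2) * (3 / 2 + σ) := by
    have : t * (s * p ^ 2 * (3 / 2 + σ)) ≤ 1 * (s * p ^ 2 * (3 / 2 + σ)) := by
      gcongr; linarith only [htθ, hθ1]
    linarith only [this]
  have e17 : 0 ≤ C₁ ^ 2 * r * p ^ 2 := by positivity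
  have e18 : 0 ≤ ν * C₁ * p ^ 2 := by positivity
  have e19 : η * S = 2 * S - 2 * t * S := by rw [hη]; ring
  rw [hk, e7, e8, e19]
  linarith only [e1, e2, e4, e5, e6, e9', e10, e11, e12, e13, e14, e15, e16, e17, e18, hEZ, hRZ, hsp]

section Punctured

variable {d : ℕ} {F : Type*} [NormedAddCommGroup F] [InnerProductSpace ℝ F]
  {m : Space d → ℝ} {φ : Space d → F}

lemma exists_cutoff {K : Set (Space d)} (hK : IsCompact K) (h0 : (0 : Space d) ∉ K) :
    ∃ k : Space d → ℝ, IsTest k ∧ (0 : Space d) ∉ tsupport k ∧ ∀ x ∈ K, k =ᶠ[𝓝 x] fun _ => 1 := by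
  obtain ⟨R, hR⟩ := hK.isBounded.exists_norm_le
  obtain ⟨δ, hδ, hδK⟩ : ∃ δ > 0, ∀ x ∈ K, δ ≤ ‖x‖ := by
    obtain ⟨δ, hδ, h⟩ := Metric.isOpen_iff.1 hK.isClosed.isOpen_compl 0 h0
    refine ⟨δ, hδ, fun x hx => ?_⟩
    by_contra hlt; exact h (by simpa using lt_of_not_ge hlt) hx
  obtain ⟨n, hn⟩ := exists_nat_gt (max (R + 1) (4 / δ))
  refine ⟨annulus d n, annulus_isTest n, annulus_notMem n, fun x hx => ?_⟩
  have h1 : R + 1 < n := (le_max_left _ _).trans_lt hn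
  have h2 : 4 / δ < n := (le_max_right _ _).trans_lt hn; rw [div_lt_iff₀ hδ] at h2
  have hp : (0 : ℝ) < (n : ℝ) + 1 := by positivity
  filter_upwards [Metric.ball_mem_nhds x (lt_min one_pos (half_pos hδ))] with y hy
  have hy' : ‖y - x‖ < min 1 (δ / 2) := by simpa [dist_eq_norm] using hy
  have u1 : ‖y‖ ≤ R + 1 := by
    have := norm_le_norm_add_norm_sub x y; rw [norm_sub_rev] at this
    linarith [hR x hx, min_le_left 1 (δ / 2)]
  have u2 : δ / 2 ≤ ‖y‖ := by
    have := norm_le_norm_add_norm_sub y x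
    have h3 : ‖x - y‖ < min 1 (δ / 2) := by rwa [norm_sub_rev]
    have := norm_le_norm_add_norm_sub' x y; linarith [hδK x hx, min_le_right 1 (δ / 2)]
  rw [annulus, bump_eq_one, bump_eq_zero]
  · simp
  · rw [abs_of_pos hp]; nlinarith
  · rw [abs_of_pos (by positivity), one_div, inv_mul_le_iff₀ hp]; linarith

lemma IsTest.smul_of_notMem {G : Type*} [NormedAddCommGroup G] [NormedSpace ℝ G]
    (hm : ContDiffOn ℝ ∞ m {0}ᶜ) {φ : Space d → G} (hφ : IsTest φ) (h0 : (0 : Space d) ∉ tsupport φ) :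
    IsTest (fun x => m x • φ x) := by
  refine ⟨contDiff_of_contDiffAt_tsupport fun x hx => ?_, hφ.compact.smul_left⟩
  have hx0 : x ≠ 0 := by rintro rfl; exact h0 (tsupport_smul_subset_right m φ hx)
  exact (hm.contDiffAt (compl_singleton_mem_nhds hx0)).smul hφ.smooth.contDiffAt

lemma pd_smul_of_notMem (hm : ContDiffOn ℝ ∞ m {0}ᶜ)
    (hφ : IsTest φ) (h0 : (0 : Space d) ∉ tsupport φ) (j : Fin d) (x : Space d) :
    pd j (fun y => m y • φ y) x = m x • pd j φ x + pd j m x • φ x := by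
  by_cases hx : x = 0
  · subst hx
    have h1 := notMem_tsupport_iff_eventuallyEq.mp h0
    have h2 : (fun y => m y • φ y) =ᶠ[𝓝 0] fun _ => 0 := by filter_upwards [h1] with y hy; simp [hy]
    simp [pd, h1.fderiv_eq, h2.fderiv_eq, h1.eq_of_nhds]
  · exact pd_smul j ((hm.contDiffAt (compl_singleton_mem_nhds hx)).differentiableAt (by simp))
      (hφ.differentiable x)

lemma ContDiffOn.pd {G : Type*} [NormedAddCommGroup G] [NormedSpace ℝ G]
    {W : Space d → G} (hW : ContDiffOn ℝ ∞ W {0}ᶜ) (j : Fin d) :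
    ContDiffOn ℝ ∞ (fun x => fderiv ℝ W x (coordVec j)) {0}ᶜ :=
  (hW.fderiv_of_isOpen isOpen_compl_singleton (m := ∞) (by simp)).clm_apply contDiffOn_const

lemma lap_smul_of_ne (hm : ContDiffOn ℝ ∞ m {0}ᶜ)
    (hφ : ContDiff ℝ ∞ φ) {x : Space d} (hx : x ≠ 0) : lap (fun y => m y • φ y) x = m x • lap φ x +
      ∑ j, ((2 : ℝ) • (pd j m x • pd j φ x) + pd j (pd j m) x • φ x) := by
  have hU : ({0}ᶜ : Set (Space d)) ∈ 𝓝 x := compl_singleton_mem_nhds hx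
  have hmd : ∀ y ≠ (0 : Space d), DifferentiableAt ℝ m y := fun y hy =>
    (hm.contDiffAt (compl_singleton_mem_nhds hy)).differentiableAt (by simp)
  have hφd : Differentiable ℝ φ := hφ.differentiable (by simp)
  have hmd' : ∀ j, DifferentiableAt ℝ (pd j m) x := fun j =>
    ((hm.pd j).contDiffAt hU).differentiableAt (by simp)
  have hφd' := fun j => (hφ.pd j).differentiable (by simp)
  simp only [lap, smul_sum, ← sum_add_distrib]
  refine sum_congr rfl fun j _ => ?_
  have e : pd j (fun y => m y • φ y) =ᶠ[𝓝 x] fun y => m y • pd j φ y + pd j m y • φ y := by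
    filter_upwards [hU] with y hy; exact pd_smul j (hmd y hy) (hφd y)
  have e' : pd j (pd j (fun y => m y • φ y)) x = pd j (fun y => m y • pd j φ y + pd j m y • φ y) x := by
    simp only [pd] at e ⊢; rw [e.fderiv_eq]
  rw [e', pd_add j ((hmd x hx).fun_smul (hφd' j x)) ((hmd' j).fun_smul (hφd x)),
    pd_smul j (hmd x hx) (hφd' j x), pd_smul j (hmd' j) (hφd x), two_smul]
  abel

lemma isTest_neg_lap (hφ : IsTest φ) : IsTest (fun x => -lap φ x) := by
  have := hφ.lap.smul_left (m := fun _ => (-1 : ℝ)) contDiff_const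
  simpa using this

lemma integral_lap_dilation (hφ : IsTest φ) :
    Integrable (fun x => ⟪-lap φ x, (2 : ℝ) • rd φ x + (d : ℝ) • φ x⟫ - 2 * ∑ j, ‖pd j φ x‖ ^ 2) ∧
    ∫ x, (⟪-lap φ x, (2 : ℝ) • rd φ x + (d : ℝ) • φ x⟫ - 2 * ∑ j, ‖pd j φ x‖ ^ 2) = 0 := by
  have tL := (isTest_neg_lap hφ)
  have i1 := tL.integrable_left hφ.rd.continuous
  have i2 := tL.integrable_left hφ.continuous
  have i3 : ∀ j, Integrable (fun x => ‖pd j φ x‖ ^ 2) := fun j =>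
    integrable_norm_sq ((hφ.pd j).memLp 2)
  have h1 : ∫ x, ⟪-lap φ x, rd φ x⟫ = _ := integral_inner_laplacian hφ hφ.rd
  have h2 : ∫ x, ⟪-lap φ x, φ x⟫ = _ := integral_inner_laplacian hφ hφ
  have h3 : ∀ j, ∫ x, ⟪pd j φ x, pd j (rd φ) x⟫ = (1 - d / 2) * ∫ x, ‖pd j φ x‖ ^ 2 := by
    intro j
    have t := hφ.pd j
    have h := integral_inner_rd (t.smooth.of_le (by simp)) (t.smooth.of_le (by simp)) (Or.inl t.compact)
    have c : ∀ x, ⟪rd (pd j φ) x, pd j φ x⟫ = ⟪pd j φ x, rd (pd j φ) x⟫ :=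
      fun x => real_inner_comm _ _
    simp only [c, real_inner_self_eq_norm_sq] at h
    simp only [pd_rd hφ, inner_add_right, real_inner_self_eq_norm_sq]
    rw [integral_add (t.integrable_left t.rd.continuous) (i3 j)]; linarith
  simp only [h3] at h1; simp only [real_inner_self_eq_norm_sq] at h2
  have is : Integrable (fun x => ∑ j, ‖pd j φ x‖ ^ 2) := integrable_finsetSum _ fun j _ => i3 j
  simp only [inner_add_right, real_inner_smul_right]
  refine ⟨((i1.const_mul 2).fun_add (i2.const_mul _)).sub (is.const_mul 2), ?_⟩
  rw [integral_sub ((i1.const_mul 2).fun_add (i2.const_mul _)) (is.const_mul 2),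
    integral_add (i1.const_mul 2) (i2.const_mul _), integral_const_mul, integral_const_mul,
    integral_const_mul, h1, h2, integral_finsetSum _ fun j _ => i3 j, ← mul_sum]
  ring

lemma integral_lap_weight (hφ : IsTest φ) (h0 : (0 : Space d) ∉ tsupport φ)
    {η b : Space d → ℝ} (hη : ContDiffOn ℝ ∞ η {0}ᶜ) (hb : ∀ x ≠ 0, ∀ j, pd j η x = b x * x j) :
    Integrable (fun x => ⟪-lap φ x, η x • φ x⟫ - η x * (∑ j, ‖pd j φ x‖ ^ 2) -
      b x * ⟪rd φ x, φ x⟫) ∧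
    ∫ x, (⟪-lap φ x, η x • φ x⟫ - η x * (∑ j, ‖pd j φ x‖ ^ 2) - b x * ⟪rd φ x, φ x⟫) = 0 := by
  have t := hφ.smul_of_notMem hη h0
  have h1 : ∫ x, ⟪-lap φ x, η x • φ x⟫ = _ := integral_inner_laplacian hφ t
  have e : ∀ x, η x * (∑ j, ‖pd j φ x‖ ^ 2) + b x * ⟪rd φ x, φ x⟫ =
      ∑ j, ⟪pd j φ x, pd j (fun y => η y • φ y) x⟫ := by
    intro x
    simp only [pd_smul_of_notMem hη hφ h0, inner_add_right, real_inner_smul_right,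
      real_inner_self_eq_norm_sq, sum_add_distrib, ← mul_sum]
    congr 1
    rcases eq_or_ne x 0 with rfl | hx
    · have : φ 0 = 0 := image_eq_zero_of_notMem_tsupport h0; simp [this]
    · simp only [hb x hx, rd_eq_sum, sum_inner, real_inner_smul_left, mul_sum, mul_assoc]
  have i1 := (isTest_neg_lap hφ).integrable_left t.continuous
  have i2 : ∀ j, Integrable (fun x => ⟪pd j φ x, pd j (fun y => η y • φ y) x⟫) := fun j =>
    (hφ.pd j).integrable_left (t.pd j).continuous
  have e2 : ∀ x, ⟪-lap φ x, η x • φ x⟫ - η x * (∑ j, ‖pd j φ x‖ ^ 2) -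
      b x * ⟪rd φ x, φ x⟫ = ⟪-lap φ x, η x • φ x⟫ -
      ∑ j, ⟪pd j φ x, pd j (fun y => η y • φ y) x⟫ := by
    intro x; rw [← e x]; ring
  simp only [e2]
  have is := integrable_finsetSum univ fun j _ => i2 j
  refine ⟨i1.sub is, ?_⟩
  rw [integral_sub i1 is, h1, integral_finsetSum _ fun j _ => i2 j, sub_self]

lemma integral_weight_dilation (hφ : IsTest φ) (h0 : (0 : Space d) ∉ tsupport φ)
    {N : Space d → F →L[ℝ] F} (hN : ContDiffOn ℝ ∞ N {0}ᶜ)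
    (hs : ∀ x u v, ⟪N x u, v⟫ = ⟪u, N x v⟫) :
    Integrable (fun x => ⟪N x (φ x), (2 : ℝ) • rd φ x + (d : ℝ) • φ x⟫ + ⟪φ x, rd N x (φ x)⟫) ∧
    ∫ x, (⟪N x (φ x), (2 : ℝ) • rd φ x + (d : ℝ) • φ x⟫ + ⟪φ x, rd N x (φ x)⟫) = 0 := by
  obtain ⟨k, hk, hk0, hk1⟩ := exists_cutoff hφ.compact h0
  have h := integral_potential_virial hφ hφ hk.smooth hN hk0
  have e : ∀ x, k x * ⟪rd φ x, N x (φ x)⟫ + k x * ⟪φ x, N x (rd φ x)⟫ +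
      k x * ⟪φ x, rd N x (φ x)⟫ + (d * k x + rd k x) * ⟪φ x, N x (φ x)⟫ =
      ⟪N x (φ x), (2 : ℝ) • rd φ x + (d : ℝ) • φ x⟫ + ⟪φ x, rd N x (φ x)⟫ := by
    intro x
    by_cases hx : x ∈ tsupport φ
    · have h1 : k x = 1 := (hk1 x hx).eq_of_nhds
      have h2 : rd k x = 0 := by simp [rd, (hk1 x hx).fderiv_eq]
      rw [h1, h2, inner_add_right, real_inner_smul_right, real_inner_smul_right, hs x (φ x) (φ x),
        ← hs x (φ x) (rd φ x), real_inner_comm (N x (φ x)) (rd φ x)]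
      ring
    · have h1 := notMem_tsupport_iff_eventuallyEq.mp hx
      simp [h1.eq_of_nhds, rd, h1.fderiv_eq]
  simp only [e] at h; refine ⟨?_, h⟩
  have c1 := contDiff_smul_of_notMem hk.smooth hN hk0
  have c2 := contDiff_smul_of_notMem hk.smooth hN.rd hk0
  have i1 := ((hφ.rd.smul_left contDiff_const).add (hφ.smul_left contDiff_const)).integrable_right (φ := fun x => (k x • N x) (φ x)) (ξ := fun x => (2 : ℝ) • rd φ x + (d : ℝ) • φ x) (c1.continuous.clm_apply hφ.continuous)
  have i2 := hφ.integrable_left (φ := φ) (ξ := fun x => (k x • rd N x) (φ x)) (c2.continuous.clm_apply hφ.continuous)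
  refine (i1.add i2).congr (.of_forall fun x => ?_)
  by_cases hx : x ∈ tsupport φ
  · have h1 : k x = 1 := (hk1 x hx).eq_of_nhds; simp [h1]
  · have h1 := notMem_tsupport_iff_eventuallyEq.mp hx; simp [h1.eq_of_nhds]

/-- A potential whose commutators with the Clifford generators are small, and an invertible limit
`e` commuting with the Clifford generators. -/
structure IsCarlemanPair (γ : Fin d → F →L[ℝ] F) (W : Space d → F →L[ℝ] F) (e : F →L[ℝ] F)
    (C₁ C₂ C₃ κ : ℝ) : Prop where
  clifford : IsClifford γ
  decaying : IsDecaying W C₁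
  invariant : CommutesClifford γ e
  bound_comm : ∀ x ≠ 0, ∀ a : Fin d → F,
    ‖∑ j, (γ j (W x (a j)) - W x (γ j (a j)))‖ ≤ C₂ / ‖x‖ * √(∑ j, ‖a j‖ ^ 2)
  bound_grad : ∀ x ≠ 0, ∀ v, ‖∑ j, γ j (fderiv ℝ W x (coordVec j) v)‖ ≤ C₃ / ‖x‖ ^ 2 * ‖v‖
  pos : 0 < κ
  le_norm : ∀ v, κ * ‖v‖ ≤ ‖e v‖
  nonneg₁ : 0 ≤ C₁
  nonneg₂ : 0 ≤ C₂
  lt_one : C₂ < 1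
  nonneg₃ : 0 ≤ C₃

/-- The operator `(D + e - W)(D - e + W)` in terms of the second order jet. -/
def jetOp (γ : Fin d → F →L[ℝ] F) (W : Space d → F →L[ℝ] F) (e : F →L[ℝ] F) (x : Space d) (v : F)
    (a : Fin d → F) (h : F) : F :=
  -h + ∑ j, (γ j (W x (a j)) - W x (γ j (a j))) + ∑ j, γ j (fderiv ℝ W x (coordVec j) v) -
    (e - W x) ((e - W x) v)

variable {l ε : ℝ} {x : Space d}

/-- The Carleman weight. -/
def carlemanE (d : ℕ) (l ε : ℝ) (x : Space d) : ℝ := Real.exp (carlemanF l ε ‖x‖)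

lemma contDiffOn_carlemanE (l ε : ℝ) : ContDiffOn ℝ ∞ (carlemanE d l ε) {0}ᶜ :=
  Real.contDiff_exp.comp_contDiffOn (contDiffOn_radial (contDiffOn_carlemanF l ε))

lemma pd_carlemanE (hε : 0 < ε) (hx : x ≠ 0) (j : Fin d) :
    pd j (carlemanE d l ε) x = carlemanE d l ε x * (carlemanA l ε ‖x‖ * x j) := by
  have hx' : 0 < ‖x‖ := norm_pos_iff.2 hx
  have := pd_radial hx (hasDerivAt_carlemanF l hε hx').exp j
  change pd j (carlemanE d l ε) x = _ at this; rw [this, carlemanE, carlemanA]; field_simp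

lemma rd_carlemanE (hε : 0 < ε) (hx : x ≠ 0) :
    rd (carlemanE d l ε) x = carlemanE d l ε x * carlemanS l ε ‖x‖ := by
  have hx' : 0 < ‖x‖ := norm_pos_iff.2 hx
  have := rd_radial hx (hasDerivAt_carlemanF l hε hx').exp
  change rd (carlemanE d l ε) x = _ at this; rw [this, carlemanE]; field_simp

lemma pd_pd_carlemanE (hε : 0 < ε) (hx : x ≠ 0) (j : Fin d) :
    pd j (pd j (carlemanE d l ε)) x = carlemanE d l ε x * (carlemanA l ε ‖x‖ +
      (carlemanA l ε ‖x‖ ^ 2 - carlemanA l ε ‖x‖ * (3 / 2 + carlemanSigma ε ‖x‖) / ‖x‖ ^ 2) * x j ^ 2) := by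
  have hx' : 0 < ‖x‖ := norm_pos_iff.2 hx
  have hU : ({0}ᶜ : Set (Space d)) ∈ 𝓝 x := compl_singleton_mem_nhds hx
  have e : pd j (carlemanE d l ε) =ᶠ[𝓝 x] fun y =>
      carlemanE d l ε y • (carlemanA l ε ‖y‖ • y j) := by
    filter_upwards [hU] with y hy; rw [pd_carlemanE hε hy]; rfl
  have e' : pd j (pd j (carlemanE d l ε)) x =
      pd j (fun y => carlemanE d l ε y • (carlemanA l ε ‖y‖ • y j)) x := by
    conv_lhs => unfold pd
    rw [show fderiv ℝ (fun x => fderiv ℝ (carlemanE d l ε) x (coordVec j)) x = _ from e.fderiv_eq]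
    rfl
  have dE : DifferentiableAt ℝ (carlemanE d l ε) x :=
    ((contDiffOn_carlemanE l ε).contDiffAt hU).differentiableAt (by simp)
  have dA : DifferentiableAt ℝ (fun y : Space d => carlemanA l ε ‖y‖) x :=
    ((contDiffOn_radial (contDiffOn_carlemanA l ε)).contDiffAt hU).differentiableAt (by simp)
  have dc : DifferentiableAt ℝ (fun y : Space d => y j) x := (hasFDerivAt_coord j x).differentiableAt
  rw [e', pd_smul j dE (dA.fun_smul dc), pd_smul j dA dc, pd_carlemanE hε hx, pd_coord,
    pd_radial hx (hasDerivAt_carlemanA l ε hx')]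
  simp only [if_true, smul_eq_mul]; field_simp; ring

lemma sum_coord_sq (x : Space d) : ∑ j, x j ^ 2 = ‖x‖ ^ 2 := by rw [EuclideanSpace.norm_sq_eq]; simp

lemma lap_carlemanE_smul (hε : 0 < ε) {u : Space d → F} (hu : IsTest u)
    (hx : x ≠ 0) : lap (fun y => carlemanE d l ε y • u y) x = carlemanE d l ε x • (lap u x +
      (2 * carlemanA l ε ‖x‖) • rd u x + (d * carlemanA l ε ‖x‖ + carlemanA l ε ‖x‖ *
        (carlemanS l ε ‖x‖ - (3 / 2 + carlemanSigma ε ‖x‖))) • u x) := by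
  have hx' : 0 < ‖x‖ := norm_pos_iff.2 hx
  rw [lap_smul_of_ne (contDiffOn_carlemanE l ε) hu.smooth hx]
  simp only [pd_carlemanE hε hx, pd_pd_carlemanE hε hx, sum_add_distrib, ← Finset.sum_smul,
    ← mul_sum, sum_coord_sq, sum_const, card_univ, Fintype.card_fin]
  have e1 : ∑ j, (2 : ℝ) • (carlemanE d l ε x * (carlemanA l ε ‖x‖ * x j)) • pd j u x =
      (carlemanE d l ε x * (2 * carlemanA l ε ‖x‖)) • rd u x := by
    rw [rd_eq_sum, smul_sum]
    refine sum_congr rfl fun j _ => ?_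
    rw [smul_smul, smul_smul]; congr 1; ring
  have e2 : carlemanE d l ε x * (d • carlemanA l ε ‖x‖ + (carlemanA l ε ‖x‖ ^ 2 -
      carlemanA l ε ‖x‖ * (3 / 2 + carlemanSigma ε ‖x‖) / ‖x‖ ^ 2) * ‖x‖ ^ 2) =
      carlemanE d l ε x * (d * carlemanA l ε ‖x‖ + carlemanA l ε ‖x‖ *
        (carlemanS l ε ‖x‖ - (3 / 2 + carlemanSigma ε ‖x‖))) := by
    have : carlemanS l ε ‖x‖ = carlemanA l ε ‖x‖ * ‖x‖ ^ 2 := by rw [carlemanA]; field_simp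
    rw [this, nsmul_eq_mul]; field_simp
  rw [e1, e2, smul_add, smul_add, smul_smul, smul_smul, add_assoc]

/-- The zeroth order symmetric part of the conjugated operator. -/
def carlemanN (W : Space d → F →L[ℝ] F) (e : F →L[ℝ] F) (l ε : ℝ) (x : Space d) : F →L[ℝ] F :=
  (-carlemanA l ε ‖x‖ * (3 / 2 + carlemanSigma ε ‖x‖ + carlemanS l ε ‖x‖)) •
    ContinuousLinearMap.id ℝ F - (e - W x).comp (e - W x)

/-- The error terms of the conjugated operator. -/
def carlemanErr (γ : Fin d → F →L[ℝ] F) (W : Space d → F →L[ℝ] F) (l ε : ℝ) (x : Space d) (v : F)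
    (a : Fin d → F) : F :=
  ∑ j, (γ j (W x (a j - (carlemanA l ε ‖x‖ * x j) • v)) -
    W x (γ j (a j - (carlemanA l ε ‖x‖ * x j) • v))) + ∑ j, γ j (fderiv ℝ W x (coordVec j) v)

lemma carleman_conjugate (γ : Fin d → F →L[ℝ] F) (W : Space d → F →L[ℝ] F) (e : F →L[ℝ] F)
    (hε : 0 < ε) {u : Space d → F} (hu : IsTest u) (hx : x ≠ 0)
    {φ : Space d → F} (hφ : φ = fun y => carlemanE d l ε y • u y) :
    carlemanE d l ε x • jetOp γ W e x (u x) (fun j => pd j u x) (lap u x) =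
      -lap φ x + carlemanA l ε ‖x‖ • ((2 : ℝ) • rd φ x + (d : ℝ) • φ x) + carlemanN W e l ε x (φ x) +
        carlemanErr γ W l ε x (φ x) (fun j => pd j φ x) := by
  have hU : ({0}ᶜ : Set (Space d)) ∈ 𝓝 x := compl_singleton_mem_nhds hx
  have dE : DifferentiableAt ℝ (carlemanE d l ε) x :=
    ((contDiffOn_carlemanE l ε).contDiffAt hU).differentiableAt (by simp)
  have h1 := lap_carlemanE_smul (l := l) hε hu hx; rw [← hφ] at h1
  have h2 : rd φ x = carlemanE d l ε x • (rd u x + carlemanS l ε ‖x‖ • u x) := by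
    rw [hφ, rd_smul dE (hu.differentiable x), rd_carlemanE hε hx, smul_add, smul_smul]
  have h3 : ∀ j, pd j φ x - (carlemanA l ε ‖x‖ * x j) • φ x = carlemanE d l ε x • pd j u x := by
    intro j
    rw [hφ, pd_smul j dE (hu.differentiable x), pd_carlemanE hε hx, smul_smul, mul_comm (_ * x j)]
    abel
  have h4 : φ x = carlemanE d l ε x • u x := by rw [hφ]
  have h5 : carlemanErr γ W l ε x (φ x) (fun j => pd j φ x) = carlemanE d l ε x •
      (∑ j, (γ j (W x (pd j u x)) - W x (γ j (pd j u x))) +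
        ∑ j, γ j (fderiv ℝ W x (coordVec j) (u x))) := by
    simp only [carlemanErr, h3, smul_add, smul_sum, smul_sub, map_smul]; rw [h4]
    simp only [map_smul]
  rw [h5]
  simp only [carlemanN, jetOp, h1, h2, h4, map_smul, sub_apply, FunLike.coe_smul, Pi.smul_apply,
    ContinuousLinearMap.id_apply, ContinuousLinearMap.comp_apply]
  module

lemma contDiffOn_carlemanN {W : Space d → F →L[ℝ] F} (hW : ContDiffOn ℝ ∞ W {0}ᶜ) (e : F →L[ℝ] F)
    (l ε : ℝ) : ContDiffOn ℝ ∞ (carlemanN W e l ε) {0}ᶜ := by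
  have hA := contDiffOn_radial (d := d) (contDiffOn_carlemanA l ε)
  have hS := contDiffOn_radial (d := d) (contDiffOn_carlemanS l ε)
  have hG := contDiffOn_radial (d := d) (contDiffOn_carlemanSigma ε)
  have hB : ContDiffOn ℝ ∞ (fun x => e - W x) {0}ᶜ := contDiffOn_const.sub hW
  exact ((hA.neg.mul ((contDiffOn_const.add hG).add hS)).smul contDiffOn_const).sub (hB.clm_comp hB)

lemma rd_carlemanN {W : Space d → F →L[ℝ] F} (hW : ContDiffOn ℝ ∞ W {0}ᶜ) (e : F →L[ℝ] F)
    (l ε : ℝ) (hx : x ≠ 0) (v : F) : rd (carlemanN W e l ε) x v =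
      (carlemanA l ε ‖x‖ * ((3 / 2 + carlemanSigma ε ‖x‖) *
        (3 / 2 + carlemanSigma ε ‖x‖ + carlemanS l ε ‖x‖) -
        (carlemanSigma ε ‖x‖ * (1 - carlemanSigma ε ‖x‖) +
          carlemanS l ε ‖x‖ * (1 / 2 - carlemanSigma ε ‖x‖)))) • v +
      (rd W x ((e - W x) v) + (e - W x) (rd W x v)) := by
  have hx' : 0 < ‖x‖ := norm_pos_iff.2 hx
  have hU : ({0}ᶜ : Set (Space d)) ∈ 𝓝 x := compl_singleton_mem_nhds hx
  have hA := hasDerivAt_carlemanA l ε hx'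
  have hS := hasDerivAt_carlemanS l ε hx'
  have hG := hasDerivAt_carlemanSigma ε hx'
  have hc := hA.neg.mul ((hG.const_add (3 / 2)).add hS)
  have hcF := hasFDerivAt_radial hx hc
  have dW : HasFDerivAt W (fderiv ℝ W x) x :=
    ((hW.contDiffAt hU).differentiableAt (by simp)).hasFDerivAt
  have hB : HasFDerivAt (fun y => e - W y) (-fderiv ℝ W x) x := dW.const_sub e
  have h1 := (hcF.smul_const (ContinuousLinearMap.id ℝ F)).sub (hB.clm_comp hB)
  have h2 : rd (carlemanN W e l ε) x = _ := congrArg (fun L => L x) h1.fderiv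
  rw [h2]
  simp only [sub_apply, add_apply, ContinuousLinearMap.smulRight_apply, FunLike.coe_smul,
    Pi.smul_apply, ContinuousLinearMap.comp_apply, ContinuousLinearMap.compL_apply,
    ContinuousLinearMap.flip_apply, neg_apply, ContinuousLinearMap.id_apply, innerSL_apply_apply,
    real_inner_self_eq_norm_sq, map_neg]
  have hr : rd W x = fderiv ℝ W x x := rfl
  rw [hr, smul_eq_mul, div_mul_eq_mul_div, sq, ← mul_assoc, mul_div_assoc, div_self hx'.ne', mul_one,
    sub_eq_add_neg]
  congr 1
  · congr 1; simp only [Pi.add_apply, Pi.neg_apply]; field_simp; ring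
  · abel

variable {C₁ : ℝ} {γ : Fin d → F →L[ℝ] F} {W : Space d → F →L[ℝ] F} {e : F →L[ℝ] F}
  {u : Space d → F}

/-- The multiplier weight of the Carleman estimate. -/
def carlemanEta (d : ℕ) (θ l ε : ℝ) (x : Space d) : ℝ := 2 * (1 - θ / (1 + carlemanS l ε ‖x‖))

/-- The radial derivative of `carlemanEta`, divided by `‖x‖²`. -/
def carlemanB (d : ℕ) (θ l ε : ℝ) (x : Space d) : ℝ :=
  2 * θ * carlemanS l ε ‖x‖ * (1 / 2 - carlemanSigma ε ‖x‖) / (1 + carlemanS l ε ‖x‖) ^ 2 / ‖x‖ ^ 2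

lemma pd_carlemanEta (θ ε : ℝ) (hl : 0 ≤ l) (hx : x ≠ 0) (j : Fin d) :
    pd j (carlemanEta d θ l ε) x = carlemanB d θ l ε x * x j := by
  have hx' : 0 < ‖x‖ := norm_pos_iff.2 hx
  have hs : 0 ≤ carlemanS l ε ‖x‖ := carlemanS_nonneg hl hx'.le
  have h := (((hasDerivAt_const ‖x‖ θ).fun_div ((hasDerivAt_carlemanS l ε hx').const_add 1)
    (by positivity)).const_sub 1).const_mul 2
  have := pd_radial hx h j
  change pd j (carlemanEta d θ l ε) x = _ at this; rw [this, carlemanB]; field_simp; ring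

lemma contDiffOn_carlemanEta (θ ε : ℝ) (hl : 0 ≤ l) :
    ContDiffOn ℝ ∞ (carlemanEta d θ l ε) {0}ᶜ := by
  have hS := contDiffOn_radial (d := d) (contDiffOn_carlemanS l ε)
  refine contDiffOn_const.mul (contDiffOn_const.sub (contDiffOn_const.div
    (contDiffOn_const.add hS) fun x hx => ?_))
  have := carlemanS_nonneg (ε := ε) hl (norm_nonneg x); positivity

lemma abs_carlemanB_le {θ ε : ℝ} (hθ : 0 ≤ θ) (hθ1 : θ ≤ 1) (hl : 0 ≤ l) (x : Space d) :
    |carlemanB d θ l ε x| * ‖x‖ ^ 2 ≤ 1 := by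
  rcases eq_or_ne x 0 with rfl | hx
  · simp
  have hx' : 0 < ‖x‖ := norm_pos_iff.2 hx
  have hs : 0 ≤ carlemanS l ε ‖x‖ := carlemanS_nonneg hl hx'.le
  obtain ⟨h0, h1⟩ := carlemanSigma_mem (ε := ε) hx'.le
  rw [carlemanB, abs_div, abs_of_pos (pow_pos hx' 2), div_mul_cancel₀ _ (pow_pos hx' 2).ne', abs_div,
    abs_of_nonneg (sq_nonneg (1 + carlemanS l ε ‖x‖)), div_le_one (by positivity), abs_mul,
    abs_of_nonneg (by positivity : 0 ≤ 2 * θ * carlemanS l ε ‖x‖)]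
  have h2 : |1 / 2 - carlemanSigma ε ‖x‖| ≤ 1 := abs_le.2 ⟨by linarith, by linarith⟩
  calc 2 * θ * carlemanS l ε ‖x‖ * |1 / 2 - carlemanSigma ε ‖x‖|
      ≤ 2 * 1 * carlemanS l ε ‖x‖ * 1 := by gcongr
    _ ≤ _ := by nlinarith

lemma sqrt_sum_norm_sub_sq_le {ι : Type*} [Fintype ι] (a b : ι → F) :
    √(∑ j, ‖a j - b j‖ ^ 2) ≤ √(∑ j, ‖a j‖ ^ 2) + √(∑ j, ‖b j‖ ^ 2) := by
  have := norm_sub_le (WithLp.toLp 2 a) (WithLp.toLp 2 b)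
  simpa [PiLp.norm_eq_of_L2] using this

lemma IsCarlemanPair.norm_carlemanErr_le
    {C₂ C₃ κ : ℝ} (h : IsCarlemanPair γ W e C₁ C₂ C₃ κ) (hl : 0 ≤ l) (ε : ℝ)
    (hx : x ≠ 0) (v : F) (a : Fin d → F) :
    ‖carlemanErr γ W l ε x v a‖ ≤ (C₂ * (√(∑ j, ‖a j‖ ^ 2) + carlemanS l ε ‖x‖ * (‖v‖ / ‖x‖)) +
      C₃ * (‖v‖ / ‖x‖)) / ‖x‖ := by
  have hx' : 0 < ‖x‖ := norm_pos_iff.2 hx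
  have hs : 0 ≤ carlemanS l ε ‖x‖ := carlemanS_nonneg hl hx'.le
  have h2 := h.nonneg₂
  have e1 : √(∑ j, ‖(carlemanA l ε ‖x‖ * x j) • v‖ ^ 2) = carlemanS l ε ‖x‖ * (‖v‖ / ‖x‖) := by
    simp only [norm_smul, norm_mul, mul_pow, ← sum_mul, ← mul_sum, norm_eq_abs,
      sq_abs, sum_coord_sq]
    rw [← mul_pow, ← mul_pow, sqrt_sq, carlemanA]
    · field_simp
    · rw [carlemanA]; positivity
  calc ‖carlemanErr γ W l ε x v a‖ ≤ _ := norm_add_le _ _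
    _ ≤ C₂ / ‖x‖ * (√(∑ j, ‖a j‖ ^ 2) + carlemanS l ε ‖x‖ * (‖v‖ / ‖x‖)) + C₃ / ‖x‖ ^ 2 * ‖v‖ := by
      refine add_le_add ((h.bound_comm x hx _).trans ?_) (h.bound_grad x hx v)
      rw [← e1]; gcongr; exact sqrt_sum_norm_sub_sq_le _ _
    _ = _ := by field_simp

lemma inner_carlemanN_le {κ : ℝ}
    (hW : IsDecaying W C₁) (he : ∀ u v, ⟪e u, v⟫ = ⟪u, e v⟫) (hκ : 0 ≤ κ)
    (hle : ∀ v, κ * ‖v‖ ≤ ‖e v‖) (l ε : ℝ) (hx : x ≠ 0) (v : F) :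
    ⟪carlemanN W e l ε x v, v⟫ ≤ -(carlemanS l ε ‖x‖ / ‖x‖ ^ 2) *
      (3 / 2 + carlemanSigma ε ‖x‖ + carlemanS l ε ‖x‖) * ‖v‖ ^ 2 - κ ^ 2 * ‖v‖ ^ 2 +
        2 * ‖e‖ * (C₁ / ‖x‖) * ‖v‖ ^ 2 := by
  have hx' : 0 < ‖x‖ := norm_pos_iff.2 hx
  have hB : ∀ u w, ⟪(e - W x) u, w⟫ = ⟪u, (e - W x) w⟫ := fun u w => by
    simp only [sub_apply, inner_sub_left, inner_sub_right, he, hW.symm]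
  have e1 : ⟪(e - W x) ((e - W x) v), v⟫ = ‖e v - W x v‖ ^ 2 := by
    rw [hB, real_inner_self_eq_norm_sq, sub_apply]
  have hWv : ‖W x v‖ ≤ C₁ / ‖x‖ * ‖v‖ := (W x).le_of_opNorm_le (hW.bound x hx) v
  have e2 : κ ^ 2 * ‖v‖ ^ 2 - 2 * ‖e‖ * (C₁ / ‖x‖) * ‖v‖ ^ 2 ≤ ‖e v - W x v‖ ^ 2 := by
    rw [norm_sub_sq_real]
    have h1 : (κ * ‖v‖) ^ 2 ≤ ‖e v‖ ^ 2 := by gcongr; exact hle v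
    have h2 : ⟪e v, W x v⟫ ≤ (‖e‖ * ‖v‖) * (C₁ / ‖x‖ * ‖v‖) :=
      (real_inner_le_norm _ _).trans (mul_le_mul (e.le_opNorm v) hWv (norm_nonneg _) (by positivity))
    nlinarith [sq_nonneg ‖W x v‖]
  rw [carlemanN, sub_apply, inner_sub_left, ContinuousLinearMap.comp_apply, e1, FunLike.coe_smul,
    Pi.smul_apply, ContinuousLinearMap.id_apply, real_inner_smul_left, real_inner_self_eq_norm_sq,
    carlemanA]
  linarith

lemma inner_rd_carlemanN_le (hC₁ : 0 ≤ C₁)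
    (hW : IsDecaying W C₁) (he : ∀ u v, ⟪e u, v⟫ = ⟪u, e v⟫) (l ε : ℝ)
    (hx : x ≠ 0) (v : F) : ⟪v, rd (carlemanN W e l ε) x v⟫ ≤ carlemanS l ε ‖x‖ / ‖x‖ ^ 2 *
      ((3 / 2 + carlemanSigma ε ‖x‖) * (3 / 2 + carlemanSigma ε ‖x‖ + carlemanS l ε ‖x‖) -
        (carlemanSigma ε ‖x‖ * (1 - carlemanSigma ε ‖x‖) +
          carlemanS l ε ‖x‖ * (1 / 2 - carlemanSigma ε ‖x‖))) * ‖v‖ ^ 2 +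
      2 * (C₁ / ‖x‖) * (‖e‖ + C₁ / ‖x‖) * ‖v‖ ^ 2 := by
  have hx' : 0 < ‖x‖ := norm_pos_iff.2 hx
  rw [rd_carlemanN hW.smooth e l ε hx, inner_add_right, real_inner_smul_right,
    real_inner_self_eq_norm_sq, carlemanA]
  refine add_le_add_right ?_ _
  have e1 : ⟪v, (e - W x) (rd W x v)⟫ = ⟪rd W x v, (e - W x) v⟫ := by
    rw [real_inner_comm]
    simp only [sub_apply, inner_sub_right, inner_sub_left, he, hW.symm]
  rw [inner_add_right, e1, ← hW.rd_symm hx, ← two_mul]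
  have h1 : ‖rd W x v‖ ≤ C₁ / ‖x‖ * ‖v‖ := (rd W x).le_of_opNorm_le (hW.bound_rd x hx) v
  have h2 : ‖(e - W x) v‖ ≤ (‖e‖ + C₁ / ‖x‖) * ‖v‖ := (e - W x).le_of_opNorm_le
    ((norm_sub_le _ _).trans (by gcongr; exact hW.bound x hx)) v
  have := (real_inner_le_norm (rd W x v) ((e - W x) v)).trans
    (mul_le_mul h1 h2 (norm_nonneg _) (by positivity))
  linarith

lemma IsCarlemanPair.pointwise
    {C₂ C₃ κ θ q K : ℝ} (h : IsCarlemanPair γ W e C₁ C₂ C₃ κ) (hθ0 : 0 ≤ θ)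
    (hθ1 : θ < 1) (hq : 0 < q) (hq2 : q ^ 2 = (1 - θ) * κ ^ 2 / 2)
    (hK : ∀ s X y p P r : ℝ, 0 ≤ s → 0 ≤ y → y ≤ X → 0 ≤ p → 0 ≤ P → 0 ≤ r →
      K * (1 + s + r) ≤ s ^ 2 + (1 - θ) * κ ^ 2 * r ^ 2 →
      (1 - θ) * κ ^ 2 / 2 * (r * p) ^ 2 - (4 / (θ - C₂) + 1 / 2) * P ^ 2 ≤
        2 * (θ / (1 + s)) * X ^ 2 + 4 * s * (y ^ 2 - d * y * p) +
          (s ^ 2 - 9 * s + (1 - θ) * κ ^ 2 * r ^ 2) * p ^ 2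
          - y * p - 4 * s * (y * p + d / 2 * p ^ 2) - (6 * ‖e‖ * C₁ + 2 * C₁ ^ 2) * (r + 1) * p ^ 2
          - (C₂ * (X + s * p) + C₃ * p + P) * (2 * y + (d + 2) * p)) (hl : 0 < l)
    (hu : IsTest u) (hx : x ≠ 0)
    (hdom : K * (1 + carlemanS l (q / l) ‖x‖ + ‖x‖) ≤
      carlemanS l (q / l) ‖x‖ ^ 2 + (1 - θ) * κ ^ 2 * ‖x‖ ^ 2)
    {φ : Space d → F} (hφ : φ = fun y => carlemanE d l (q / l) y • u y) :
    (1 - θ) * κ ^ 2 / 2 * ‖φ x‖ ^ 2 - (4 / (θ - C₂) + 1 / 2) *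
      (‖x‖ * ‖carlemanE d l (q / l) x • jetOp γ W e x (u x) (fun j => pd j u x) (lap u x)‖) ^ 2 ≤
    (⟪-lap φ x, carlemanEta d θ l (q / l) x • φ x⟫ -
      carlemanEta d θ l (q / l) x * (∑ j, ‖pd j φ x‖ ^ 2) -
      carlemanB d θ l (q / l) x * ⟪rd φ x, φ x⟫) -
    (⟪-lap φ x, (2 : ℝ) • rd φ x + (d : ℝ) • φ x⟫ - 2 * ∑ j, ‖pd j φ x‖ ^ 2) -
    (⟪carlemanN W e l (q / l) x (φ x), (2 : ℝ) • rd φ x + (d : ℝ) • φ x⟫ +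
      ⟪φ x, rd (carlemanN W e l (q / l)) x (φ x)⟫) := by
  have hr : 0 < ‖x‖ := norm_pos_iff.2 hx
  have hε : 0 < q / l := by positivity
  have hs : 0 ≤ carlemanS l (q / l) ‖x‖ := carlemanS_nonneg hl.le hr.le
  obtain ⟨hσ0, hσ1⟩ := carlemanSigma_mem (ε := q / l) hr.le
  have hS : 0 ≤ ∑ j, ‖pd j φ x‖ ^ 2 := by positivity
  have hconj := carleman_conjugate γ W e hε hu hx hφ
  have hErr := h.norm_carlemanErr_le hl.le (q / l) hx (φ x) (fun j => pd j φ x)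
  have hNN := inner_carlemanN_le h.decaying h.invariant.symm h.pos.le h.le_norm l (q / l) hx (φ x)
  have hdN := inner_rd_carlemanN_le h.nonneg₁ h.decaying h.invariant.symm l (q / l) hx (φ x)
  have hsσ := carlemanS_sq_mul_le l (q / l) hr.le
  rw [mul_div_cancel₀ _ hl.ne', hq2] at hsσ
  have hy : ‖rd φ x‖ / ‖x‖ ≤ √(∑ j, ‖pd j φ x‖ ^ 2) := by
    rw [div_le_iff₀ hr]; refine le_of_sq_le_sq ?_ (by positivity)
    rw [mul_pow, sq_sqrt hS, mul_comm]; exact rd_norm_le φ x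
  set ρ := carlemanE d l (q / l) x • jetOp γ W e x (u x) (fun j => pd j u x) (lap u x) with hρ
  set err := carlemanErr γ W l (q / l) x (φ x) (fun j => pd j φ x) with herr
  have hpt := hK (carlemanS l (q / l) ‖x‖) (√(∑ j, ‖pd j φ x‖ ^ 2)) (‖rd φ x‖ / ‖x‖) (‖φ x‖ / ‖x‖)
    (‖x‖ * ‖ρ‖) ‖x‖ hs (by positivity) hy (by positivity) (by positivity) hr.le hdom
  rw [mul_div_cancel₀ _ hr.ne'] at hpt
  have hη : carlemanEta d θ l (q / l) x = 2 * (1 - θ / (1 + carlemanS l (q / l) ‖x‖)) := rfl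
  have hη0 : 0 ≤ carlemanEta d θ l (q / l) x ∧ carlemanEta d θ l (q / l) x ≤ 2 := by
    have h0 : θ / (1 + carlemanS l (q / l) ‖x‖) ≤ 1 := (div_le_one (by positivity)).2 (by linarith)
    have h1 : 0 ≤ θ / (1 + carlemanS l (q / l) ‖x‖) := by positivity
    rw [hη]; constructor <;> linarith
  have hb := abs_carlemanB_le (ε := q / l) hθ0 hθ1.le hl.le x
  have hdN' := inner_carlemanN_le h.decaying h.invariant.symm h.pos.le h.le_norm l (q / l) hx (φ x)
  set η := carlemanEta d θ l (q / l) x with hηd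
  set b := carlemanB d θ l (q / l) x
  set Nφ := carlemanN W e l (q / l) x (φ x)
  set dN := ⟪φ x, rd (carlemanN W e l (q / l)) x (φ x)⟫
  set S := ∑ j, ‖pd j φ x‖ ^ 2
  set L := -lap φ x
  have hA : carlemanA l (q / l) ‖x‖ = carlemanS l (q / l) ‖x‖ / ‖x‖ ^ 2 := rfl
  set s := carlemanS l (q / l) ‖x‖
  set σ := carlemanSigma (q / l) ‖x‖
  set r := ‖x‖
  rw [hA] at hconj
  set Z := (2 : ℝ) • rd φ x + ((d : ℝ) - η) • φ x with hZ
  have hZn : ‖Z‖ ≤ r * (2 * (‖rd φ x‖ / r) + (d + 2) * (‖φ x‖ / r)) := by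
    have : r * (2 * (‖rd φ x‖ / r) + (d + 2) * (‖φ x‖ / r)) = 2 * ‖rd φ x‖ + (d + 2) * ‖φ x‖ := by
      field_simp
    rw [this]
    refine (norm_add_le _ _).trans ?_
    rw [norm_smul, norm_smul, Real.norm_two]; gcongr; rw [norm_eq_abs, abs_le]
    have : (0 : ℝ) ≤ d := by positivity
    constructor <;> linarith [hη0.1, hη0.2]
  have h2 := h.nonneg₂
  have h3 := h.nonneg₃
  have hEZ : -((C₂ * (√S + s * (‖φ x‖ / r)) + C₃ * (‖φ x‖ / r)) *
      (2 * (‖rd φ x‖ / r) + (d + 2) * (‖φ x‖ / r))) ≤ ⟪err, Z⟫ := by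
    refine (abs_le.1 ((abs_real_inner_le_norm _ _).trans ((mul_le_mul hErr hZn (norm_nonneg _)
      (by positivity)).trans (le_of_eq ?_)))).1
    field_simp
  have hRZ : ⟪ρ, Z⟫ ≤ r * ‖ρ‖ * (2 * (‖rd φ x‖ / r) + (d + 2) * (‖φ x‖ / r)) := by
    refine (real_inner_le_norm _ _).trans ((mul_le_mul_of_nonneg_left hZn (norm_nonneg _)).trans
      (le_of_eq ?_))
    ring
  have hi := abs_real_inner_le_norm (rd φ x) (φ x)
  have key := carleman_algebra (i := ⟪rd φ x, φ x⟫) (S := S) hr hs hσ0 hσ1 hθ0 hθ1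
    (norm_nonneg (φ x)) (Nat.cast_nonneg d) (norm_nonneg (rd φ x)) (norm_nonneg e) h.nonneg₁ hi hη hb
    hNN hdN hsσ hEZ hRZ hS hpt rfl
  refine key.trans (le_of_eq ?_)
  rw [hconj, hZ]
  have c1 : ⟪φ x, rd φ x⟫ = ⟪rd φ x, φ x⟫ := real_inner_comm _ _
  simp only [inner_add_left, inner_add_right, real_inner_smul_left, real_inner_smul_right, c1,
    real_inner_self_eq_norm_sq]
  ring

lemma jetOp_eq_zero (hx : x ∉ tsupport u) :
    jetOp γ W e x (u x) (fun j => pd j u x) (lap u x) = 0 := by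
  have h := notMem_tsupport_iff_eventuallyEq.mp hx
  have h1 : ∀ j, pd j u =ᶠ[𝓝 x] fun _ => 0 := fun j => by
    filter_upwards [h.eventuallyEq_nhds] with y hy; simp [pd, hy.fderiv_eq]
  have h2 : ∀ j, pd j (pd j u) x = 0 := fun j => by
    have := (h1 j).fderiv_eq (𝕜 := ℝ)
    change fderiv ℝ (pd j u) x (coordVec j) = 0; simp [this]
  simp [jetOp, lap, h.eq_of_nhds, fun j => (h1 j).eq_of_nhds, h2]

lemma memLp_smul_jetOp (hW : ContDiffOn ℝ ∞ W {0}ᶜ) {m : Space d → ℝ} (hm : ContDiffOn ℝ ∞ m {0}ᶜ)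
    (hu : IsTest u) (h0 : (0 : Space d) ∉ tsupport u) :
    MemLp (fun x => m x • jetOp γ W e x (u x) (fun j => pd j u x) (lap u x)) 2 := by
  have hz : ∀ x ∉ tsupport u, m x • jetOp γ W e x (u x) (fun j => pd j u x) (lap u x) = 0 :=
    fun x hx => by rw [jetOp_eq_zero hx, smul_zero]
  have hc : Continuous fun x => m x • jetOp γ W e x (u x) (fun j => pd j u x) (lap u x) := by
    refine continuous_iff_continuousAt.2 fun x => ?_
    by_cases hx : x ∈ tsupport u
    · have hU : ({0}ᶜ : Set (Space d)) ∈ 𝓝 x := compl_singleton_mem_nhds fun hx0 => by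
        exact h0 (hx0 ▸ hx)
      have cm := (hm.contDiffAt hU).continuousAt
      have cW := (hW.contDiffAt hU).continuousAt
      have cW' := fun j => ((hW.pd j).contDiffAt hU).continuousAt
      have cu := hu.continuous.continuousAt (x := x)
      have cp := fun j => (hu.pd j).continuous.continuousAt (x := x)
      have cl := hu.lap.continuous.continuousAt (x := x)
      have cg : ∀ j, ContinuousAt (fun x => γ j (W x (pd j u x)) - W x (γ j (pd j u x))) x :=
        fun j => ((γ j).continuous.continuousAt.comp (cW.clm_apply (cp j))).sub
          (cW.clm_apply ((γ j).continuous.continuousAt.comp (cp j)))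
      have cd : ∀ j, ContinuousAt (fun x => γ j (fderiv ℝ W x (coordVec j) (u x))) x :=
        fun j => (γ j).continuous.continuousAt.comp ((cW' j).clm_apply cu)
      have cB : ContinuousAt (fun x => e - W x) x := continuousAt_const.sub cW
      exact cm.smul (((cl.neg.add (tendsto_finsetSum _ fun j _ => cg j)).add
        (tendsto_finsetSum _ fun j _ => cd j)).sub (cB.clm_apply (cB.clm_apply cu)))
    · have : (fun x => m x • jetOp γ W e x (u x) (fun j => pd j u x) (lap u x)) =ᶠ[𝓝 x]
          fun _ => 0 := by
        filter_upwards [(isClosed_tsupport u).isOpen_compl.mem_nhds hx] with y hy using hz y hy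
      exact this.continuousAt
  exact hc.memLp_of_hasCompactSupport (HasCompactSupport.intro hu.compact hz)

/-- The Carleman estimate. -/
theorem IsCarlemanPair.carleman
    {C₂ C₃ κ : ℝ} (h : IsCarlemanPair γ W e C₁ C₂ C₃ κ) {R : ℝ} (hR : 0 < R) :
    ∃ C q l₀ : ℝ, 0 ≤ C ∧ 0 < q ∧ 0 < l₀ ∧ ∀ l, l₀ ≤ l → ∀ u : Space d → F, IsTest u →
      (∀ x ∈ tsupport u, R ≤ ‖x‖) → ∫ x, ‖carlemanE d l (q / l) x • u x‖ ^ 2 ≤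
        C * ∫ x, ‖(‖x‖ * carlemanE d l (q / l) x) •
          jetOp γ W e x (u x) (fun j => pd j u x) (lap u x)‖ ^ 2 := by
  set θ := (1 + C₂) / 2 with hθ
  have h2 := h.nonneg₂
  have hlt := h.lt_one
  have hκ := h.pos
  have hθC : C₂ < θ := by rw [hθ]; linarith
  have hθ1 : θ < 1 := by rw [hθ]; linarith
  have hθ0 : 0 ≤ θ := by linarith
  set c := (1 - θ) * κ ^ 2 with hc
  have hθ1' : 0 < 1 - θ := sub_pos.2 hθ1
  have hc0 : 0 < c := by positivity
  obtain ⟨K, hK0, hK⟩ := carleman_pointwise (D := d) (c := c) (C₄ := 6 * ‖e‖ * C₁ + 2 * C₁ ^ 2) h2 hθC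
    hθ1 h.nonneg₃ (by positivity) (by have := h.nonneg₁; positivity)
  have hq0 : 0 < √(c / 2) := Real.sqrt_pos.2 (by positivity)
  obtain ⟨l₀, hl₀, hdom⟩ := carlemanS_dominates hq0 hc0 hK0 hR
  have hK' : 0 ≤ 4 / (θ - C₂) + 1 / 2 := by have := sub_pos.2 hθC; positivity
  refine ⟨(4 / (θ - C₂) + 1 / 2) / (c / 2), √(c / 2), l₀, by positivity, hq0, hl₀,
    fun l hl u hu hsupp => ?_⟩
  have hl0 : 0 < l := hl₀.trans_le hl
  set q := √(c / 2) with hq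
  have h0 : (0 : Space d) ∉ tsupport u := fun h0 => by
    have := hsupp 0 h0; rw [norm_zero] at this; linarith
  set φ : Space d → F := fun y => carlemanE d l (q / l) y • u y with hφ
  have tφ : IsTest φ := hu.smul_of_notMem (contDiffOn_carlemanE l (q / l)) h0
  have h0φ : (0 : Space d) ∉ tsupport φ := fun hx => h0 (tsupport_smul_subset_right _ u hx)
  have hNs : ∀ x u v, ⟪carlemanN W e l (q / l) x u, v⟫ =
      ⟪u, carlemanN W e l (q / l) x v⟫ := fun x u v => by
    have hB : ∀ u w, ⟪(e - W x) u, w⟫ = ⟪u, (e - W x) w⟫ := fun u w => by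
      simp only [sub_apply, inner_sub_left, inner_sub_right, h.invariant.symm, h.decaying.symm]
    rw [carlemanN, sub_apply, sub_apply, ContinuousLinearMap.comp_apply,
      ContinuousLinearMap.comp_apply, inner_sub_left, inner_sub_right, hB, hB, FunLike.coe_smul,
      Pi.smul_apply, Pi.smul_apply, ContinuousLinearMap.id_apply, ContinuousLinearMap.id_apply,
      real_inner_smul_left, real_inner_smul_right]
  obtain ⟨i1, z1⟩ := integral_lap_dilation tφ
  obtain ⟨i2, z2⟩ := integral_lap_weight tφ h0φ (contDiffOn_carlemanEta θ (q / l) hl0.le)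
    (fun x hx j => pd_carlemanEta θ (q / l) hl0.le hx j)
  obtain ⟨i3, z3⟩ := integral_weight_dilation tφ h0φ
    (contDiffOn_carlemanN h.decaying.smooth e l (q / l)) hNs
  have hm : ContDiffOn ℝ ∞ (fun x : Space d => ‖x‖ * carlemanE d l (q / l) x) {0}ᶜ :=
    (contDiffOn_id.norm ℝ fun x hx => hx).mul (contDiffOn_carlemanE l (q / l))
  have iR := integrable_norm_sq (memLp_smul_jetOp (γ := γ) (e := e) h.decaying.smooth hm hu h0)
  have iL := integrable_norm_sq (tφ.memLp 2)
  have pw := integral_mono ((iL.const_mul (c / 2)).sub (iR.const_mul (4 / (θ - C₂) + 1 / 2)))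
    ((i2.sub i1).sub i3) fun x => ?_
  · rw [integral_sub' (i2.sub i1) i3, integral_sub' i2 i1, z1, z2, z3,
      integral_sub' (iL.const_mul _) (iR.const_mul _), integral_const_mul, integral_const_mul] at pw
    rw [div_mul_eq_mul_div, le_div_iff₀ (by positivity)]; linarith
  · by_cases hx : x ∈ tsupport u
    · have hx0 : x ≠ 0 := by rintro rfl; exact h0 hx
      have := h.pointwise hθ0 hθ1 hq0 (by rw [hq, sq_sqrt (by positivity), hc]) hK hl0 hu hx0
        (hdom l hl _ (hsupp x hx)) hφ
      have e1 : ‖(‖x‖ * carlemanE d l (q / l) x) •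
          jetOp γ W e x (u x) (fun j => pd j u x) (lap u x)‖ = ‖x‖ * ‖carlemanE d l (q / l) x •
          jetOp γ W e x (u x) (fun j => pd j u x) (lap u x)‖ := by
        rw [mul_smul, norm_smul, norm_norm]
      simp only [Pi.sub_apply, e1]; exact this
    · have hxφ : x ∉ tsupport φ := fun hx' => hx (tsupport_smul_subset_right _ u hx')
      have hev := notMem_tsupport_iff_eventuallyEq.mp hxφ
      have hp : ∀ j, pd j φ x = 0 := fun j => by simp [pd, hev.fderiv_eq]
      have hr : rd φ x = 0 := by simp [rd, hev.fderiv_eq]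
      simp [hev.eq_of_nhds, hp, hr, jetOp_eq_zero hx]

end Punctured

section CarlemanApplication

variable {d : ℕ} {F : Type*} [NormedAddCommGroup F] [InnerProductSpace ℝ F] [FiniteDimensional ℝ F]
  {w : ℕ → Space d → F} {ψ : Space d → F} {g : Fin d → Space d → F}

lemma hasCompactSupport_pd {G : Type*} [NormedAddCommGroup G] [NormedSpace ℝ G] {M : Space d → G}
    (hM : HasCompactSupport M) (j : Fin d) : HasCompactSupport (pd j M) :=
  hM.fderiv_apply (𝕜 := ℝ) (coordVec j)

lemma continuous_pd_of_contDiff {G : Type*} [NormedAddCommGroup G] [NormedSpace ℝ G] {M : Space d → G}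
    (hM : ContDiff ℝ ∞ M) (j : Fin d) : Continuous (pd j M) :=
  (hM.continuous_fderiv (by simp)).clm_apply continuous_const

lemma H1Approx.apply_compact
    (h : H1Approx w ψ g) {M : Space d → F →L[ℝ] F} (hM : ContDiff ℝ ∞ M) (hc : HasCompactSupport M) :
    H1Approx (fun n x => M x (w n x)) (fun x => M x (ψ x))
      (fun j x => M x (g j x) + pd j M x (ψ x)) := by
  refine ⟨fun n => (h.test n).apply_clm hM, h.conv.apply_compact hM.continuous hc, fun j => ?_⟩
  have e : (fun n => pd j fun x => M x (w n x)) = fun n x => M x (pd j (w n) x) + pd j M x (w n x) := by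
    funext n x
    exact pd_clm_apply j (hM.differentiable (by simp) x) ((h.test n).differentiable x)
  rw [e]
  exact ((h.conv_pd j).apply_compact hM.continuous hc).add
    (h.conv.apply_compact (continuous_pd_of_contDiff hM j) (hasCompactSupport_pd hc j))

lemma H1Approx.smul_test (h : H1Approx w ψ g) {χ : Space d → ℝ} (hχ : IsTest χ) :
    H1Approx (fun n x => χ x • w n x) (fun x => χ x • ψ x)
      (fun j x => χ x • g j x + pd j χ x • ψ x) := by
  refine ⟨fun n => (h.test n).smul_left hχ.smooth, h.conv.smul_compact hχ.continuous hχ.compact,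
    fun j => ?_⟩
  have e : (fun n => pd j fun x => χ x • w n x) = fun n x => χ x • pd j (w n) x + pd j χ x • w n x := by
    funext n x
    exact pd_smul j (hχ.differentiable x) ((h.test n).differentiable x)
  rw [e]
  exact ((h.conv_pd j).smul_compact hχ.continuous hχ.compact).add
    (h.conv.smul_compact (hχ.pd j).continuous (hχ.pd j).compact)

lemma H1Approx.integral_inner_diracG
    (h : H1Approx w ψ g) {γ : Fin d → F →L[ℝ] F} (hγ : IsClifford γ)
    {ξ : Space d → F} (hξ : IsTest ξ) :
    ∫ x, ⟪diracG γ g x, ξ x⟫ = ∫ x, ⟪ψ x, dirac γ ξ x⟫ := by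
  have h1 := (h.conv_dirac γ).inner (L2Conv.const (hξ.memLp 2))
  have h2 := h.conv.inner (L2Conv.const ((hξ.dirac γ).memLp 2))
  refine tendsto_nhds_unique h1 (h2.congr fun n => ?_)
  exact (integral_inner_dirac hγ (h.test n) hξ.smooth).symm

lemma H1Approx.integral_inner_pd
    (h : H1Approx w ψ g) {ξ : Space d → F} (hξ : IsTest ξ) (j : Fin d) :
    ∫ x, ⟪g j x, ξ x⟫ = -∫ x, ⟪ψ x, _root_.pd j ξ x⟫ := by
  have h1 := (h.conv_pd j).inner (L2Conv.const (hξ.memLp 2))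
  have h2 := (h.conv.inner (L2Conv.const ((hξ.pd j).memLp 2))).neg
  refine tendsto_nhds_unique h1 (h2.congr fun n => ?_)
  rw [_root_.integral_inner_pd ((h.test n).smooth.of_le (by simp)) (hξ.smooth.of_le (by simp))
    (Or.inl (h.test n).compact) j]
  simp

lemma H1Approx.ae_unique {w' : ℕ → Space d → F} {g' : Fin d → Space d → F}
    (h : H1Approx w ψ g) (h' : H1Approx w' ψ g') (j : Fin d) : g j =ᵐ[volume] g' j := by
  have m := (h.conv_pd j).memLp_lim
  have m' := (h'.conv_pd j).memLp_lim
  have := eq_zero_of_inner_helmholtz (m.sub m') fun ξ hξ => ?_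
  · filter_upwards [this] with x hx; simpa [sub_eq_zero] using hx
  · have t := hξ.sub hξ.lap; simp only [Pi.sub_apply, inner_sub_left]
    rw [integral_sub (integrable_inner m (t.memLp 2))
      (integrable_inner m' (t.memLp 2)), h.integral_inner_pd t, h'.integral_inner_pd t, sub_self]

/-- The source of the equation satisfied by a cut-off solution. -/
def cutoffSource (γ : Fin d → F →L[ℝ] F) (B : Space d → F →L[ℝ] F) (χ : Space d → ℝ) (ψ : Space d → F)
    (g : Fin d → Space d → F) (x : Space d) : F :=
  ∑ k, ∑ j, (pd k (pd j χ) x • γ k (γ j (ψ x)) + pd j χ x • γ k (γ j (g k x))) +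
    ∑ j, pd j χ x • B x (γ j (ψ x))

lemma H1Approx.exists_jet
    (h : H1Approx w ψ g) {γ : Fin d → F →L[ℝ] F} {W : Space d → F →L[ℝ] F} {e : F →L[ℝ] F}
    (hγ : IsClifford γ) (hW : ContDiffOn ℝ ∞ W {0}ᶜ) (he : CommutesClifford γ e)
    (heq : ∀ᵐ x, diracG γ g x = e (ψ x) - W x (ψ x)) {χ : Space d → ℝ} (hχ : IsTest χ)
    (h0 : (0 : Space d) ∉ tsupport χ) :
    ∃ w' a f, H1Approx w' (fun x => χ x • ψ x) a ∧ L2Conv (fun n => lap (w' n)) f ∧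
      ∀ᵐ x, (x ∉ tsupport χ → χ x • ψ x = 0 ∧ (∀ j, a j x = 0) ∧ f x = 0) ∧
        (x ≠ 0 → jetOp γ W e x (χ x • ψ x) (fun j => a j x) (f x) =
          cutoffSource γ (fun x => e - W x) χ ψ g x) := by
  have hB : ContDiffOn ℝ ∞ (fun x => e - W x) {0}ᶜ := contDiffOn_const.sub hW
  set M : Space d → F →L[ℝ] F := fun x => χ x • (e - W x) + ∑ j, pd j χ x • γ j with hMdef
  have hM1 := contDiff_smul_of_notMem hχ.smooth hB h0
  have hM2 : ContDiff ℝ ∞ fun x => ∑ j, pd j χ x • γ j :=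
    ContDiff.sum fun j _ => (hχ.pd j).smooth.smul contDiff_const
  have hM : ContDiff ℝ ∞ M := hM1.add hM2
  have hMs : ∀ x ∉ tsupport χ, M =ᶠ[𝓝 x] fun _ => 0 := fun x hx => by
    filter_upwards [(notMem_tsupport_iff_eventuallyEq.mp hx).eventuallyEq_nhds] with y hy
    have : ∀ j, pd j χ y = 0 := fun j => by simp [pd, hy.fderiv_eq]
    simp [hMdef, hy.eq_of_nhds, this]
  have hMc : HasCompactSupport M := HasCompactSupport.intro hχ.compact fun x hx => (hMs x hx).eq_of_nhds
  have hv := h.smul_test hχ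
  have hMψ := h.apply_compact hM hMc
  have hDv : diracG γ (fun j x => χ x • g j x + pd j χ x • ψ x) =ᵐ[volume] fun x => M x (ψ x) := by
    filter_upwards [heq] with x hx; simp only [diracG] at hx
    simp only [diracG, hMdef, map_add, map_smul, sum_add_distrib, ← smul_sum, hx,
      add_apply, sum_apply, FunLike.coe_smul, Pi.smul_apply, sub_apply]
  set b : Fin d → Space d → F := fun j x => M x (g j x) + pd j M x (ψ x) with hb
  have hf : MemLp (fun x => -diracG γ b x) 2 := (hMψ.conv_dirac γ).memLp_lim.neg
  obtain ⟨w', a', hw', hl⟩ := exists_h2Approx hv.conv.memLp_lim hf fun ξ hξ => by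
    have e1 : ∀ x, lap ξ x = -dirac γ (dirac γ ξ) x := fun x => by
      rw [dirac_dirac hγ hξ, neg_neg]; rfl
    simp only [e1, inner_neg_right, inner_neg_left, integral_neg]
    rw [hMψ.integral_inner_diracG hγ hξ, ← hv.integral_inner_diracG hγ (hξ.dirac γ)]
    congr 1
    refine integral_congr_ae ?_
    filter_upwards [hDv] with x hx; rw [hx]
  refine ⟨w', a', _, hw', hl, ?_⟩
  filter_upwards [ae_all_iff.2 fun j => hw'.ae_unique hv j, heq] with x hx hxe
  constructor
  · intro hxs
    have h1 := notMem_tsupport_iff_eventuallyEq.mp hxs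
    have h2 : ∀ j, pd j χ x = 0 := fun j => by simp [pd, h1.fderiv_eq]
    have h3 : ∀ j, pd j M x = 0 := fun j => by simp [pd, (hMs x hxs).fderiv_eq]
    refine ⟨by simp [h1.eq_of_nhds], fun j => by rw [hx j]; simp [h1.eq_of_nhds, h2], ?_⟩
    simp [diracG, hb, h3, (hMs x hxs).eq_of_nhds]
  · intro hx0
    have hU : ({0}ᶜ : Set (Space d)) ∈ 𝓝 x := compl_singleton_mem_nhds hx0
    have dW : DifferentiableAt ℝ W x := (hW.contDiffAt hU).differentiableAt (by simp)
    have hpM : ∀ k, pd k M x = χ x • (-fderiv ℝ W x (coordVec k)) + pd k χ x • (e - W x) +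
        ∑ j, pd k (pd j χ) x • γ j := by
      intro k
      have d1 : DifferentiableAt ℝ (fun x => χ x • (e - W x)) x := hM1.differentiable (by simp) x
      have d2 : ∀ j, DifferentiableAt ℝ (fun x => pd j χ x • γ j) x := fun j =>
        ((hχ.pd j).differentiable x).smul_const _
      rw [hMdef, pd_add k d1 (hM2.differentiable (by simp) x), pd_sum k fun j _ => d2 j,
        pd_smul k (hχ.differentiable x) (dW.const_sub e)]
      congr 1
      · simp only [pd]; rw [fderiv_const_sub, neg_apply]
      · refine sum_congr rfl fun j _ => ?_
        rw [pd_smul k ((hχ.pd j).differentiable x) (differentiableAt_const _)]; simp [pd]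
    have hMx : M x = χ x • (e - W x) + ∑ j, pd j χ x • γ j := rfl
    have key : -(-diracG γ b x) = χ x • (∑ k, γ k ((e - W x) (g k x))) -
        χ x • (∑ k, γ k (fderiv ℝ W x (coordVec k) (ψ x))) + ∑ k, pd k χ x • γ k ((e - W x) (ψ x)) +
        ∑ k, ∑ j, (pd k (pd j χ) x • γ k (γ j (ψ x)) + pd j χ x • γ k (γ j (g k x))) := by
      simp only [neg_neg, diracG, hb, hpM, hMx, add_apply, FunLike.coe_smul, Pi.smul_apply,
        sum_apply, neg_apply, map_add, map_smul, map_sum, map_neg, smul_neg, smul_sum,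
        sum_add_distrib, sum_neg_distrib]
      abel
    simp only [diracG] at hxe
    have q1 : ∑ j, e (γ j (g j x)) = e (e (ψ x)) - e (W x (ψ x)) := by rw [← map_sum, hxe, map_sub]
    have q2 : ∑ j, W x (γ j (g j x)) = W x (e (ψ x)) - W x (W x (ψ x)) := by
      rw [← map_sum, hxe, map_sub]
    rw [jetOp, key]
    simp only [hx, cutoffSource, map_add, map_smul, map_sub, sub_apply, sum_add_distrib,
      sum_sub_distrib, smul_sub, ← smul_sum, ← he.comm, q1, q2]
    module

lemma exists_cutoff_of_le {K : Set (Space d)} (hK : IsCompact K) {R : ℝ} (hR : 0 < R)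
    (hKR : ∀ x ∈ K, R ≤ ‖x‖) : ∃ k : Space d → ℝ, IsTest k ∧ (∀ x ∈ tsupport k, R / 4 ≤ ‖x‖) ∧
      ∀ x ∈ K, k =ᶠ[𝓝 x] fun _ => 1 := by
  obtain ⟨k, hk, -, hk1⟩ := exists_cutoff hK fun h => by
    have := hKR 0 h; rw [norm_zero] at this; linarith
  have hc : |4 / R| = 4 / R := abs_of_pos (by positivity)
  refine ⟨fun x => (1 - bump d (4 / R) x) • k x,
    hk.smul_left (contDiff_const.sub (bump_contDiff _)), fun x hx => ?_, fun x hx => ?_⟩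
  · refine closure_minimal (t := {x : Space d | R / 4 ≤ ‖x‖}) (fun y hy => ?_)
      (isClosed_le continuous_const continuous_norm) hx
    by_contra hlt
    refine hy ?_
    have hlt' : ‖y‖ < R / 4 := not_le.1 hlt
    change (1 - bump d (4 / R) y) • k y = 0; rw [bump_eq_one, sub_self, zero_smul]
    rw [hc, div_mul_eq_mul_div, div_le_one hR]; linarith
  · have : {y : Space d | R / 2 < ‖y‖} ∈ 𝓝 x := by
      refine (isOpen_lt continuous_const continuous_norm).mem_nhds ?_
      have := hKR x hx
      change R / 2 < ‖x‖; linarith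
    filter_upwards [this, hk1 x hx] with y hy hy1
    rw [hy1, bump_eq_zero]
    · simp
    · rw [hc, div_mul_eq_mul_div, le_div_iff₀ hR]
      change R / 2 < ‖y‖ at hy; linarith

lemma IsCarlemanPair.carleman_limit {γ : Fin d → F →L[ℝ] F} {W : Space d → F →L[ℝ] F}
    {e : F →L[ℝ] F} {C₁ C₂ C₃ κ : ℝ} (h : IsCarlemanPair γ W e C₁ C₂ C₃ κ) {R : ℝ} (hR : 0 < R) :
    ∃ C q l₀ : ℝ, 0 ≤ C ∧ 0 < q ∧ 0 < l₀ ∧ ∀ l, l₀ ≤ l → ∀ (w : ℕ → Space d → F) (v f : Space d → F)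
      (a : Fin d → Space d → F) (K : Set (Space d)), H1Approx w v a → L2Conv (fun n => lap (w n)) f →
      IsCompact K → (∀ x ∈ K, R ≤ ‖x‖) →
      (∀ᵐ x, x ∉ K → v x = 0 ∧ (∀ j, a j x = 0) ∧ f x = 0) →
      ∫ x, ‖carlemanE d l (q / l) x • v x‖ ^ 2 ≤ C * ∫ x, ‖(‖x‖ * carlemanE d l (q / l) x) •
          jetOp γ W e x (v x) (fun j => a j x) (f x)‖ ^ 2 := by
  obtain ⟨C, q, l₀, hC, hq, hl₀, hmain⟩ := h.carleman (R := R / 4) (by positivity)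
  refine ⟨C, q, l₀, hC, hq, hl₀, fun l hl w v f a K hw hf hK hKR hsupp => ?_⟩
  obtain ⟨k, hk, hkR, hk1⟩ := exists_cutoff_of_le hK hR hKR
  have hk0 : (0 : Space d) ∉ tsupport k := fun h0 => by
    have := hkR 0 h0; rw [norm_zero] at this; linarith
  obtain ⟨k₂, hk₂, hk₂0, hk₂1⟩ := exists_cutoff hk.compact hk0
  have hW := h.decaying.smooth
  set E := carlemanE d l (q / l) with hE
  have hEs : ContDiffOn ℝ ∞ E {0}ᶜ := contDiffOn_carlemanE l (q / l)
  set p : Space d → ℝ := fun x => ‖x‖ * E x with hp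
  have hps : ContDiffOn ℝ ∞ p {0}ᶜ := (contDiffOn_id.norm ℝ fun x hx => hx).mul hEs
  set P : Space d → ℝ := fun x => p x • k₂ x with hP
  have tP : IsTest P := hk₂.smul_of_notMem hps hk₂0
  have hP0 : (0 : Space d) ∉ tsupport P := fun hx => hk₂0 (tsupport_smul_subset_right p k₂ hx)
  set T₀ : Space d → F →L[ℝ] F := fun x =>
    ∑ j, (γ j).comp (fderiv ℝ W x (coordVec j)) - (e - W x).comp (e - W x) with hT₀
  set T : Fin d → Space d → F →L[ℝ] F := fun j x => (γ j).comp (W x) - (W x).comp (γ j) with hT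
  have sB : ContDiffOn ℝ ∞ (fun x => e - W x) {0}ᶜ := contDiffOn_const.sub hW
  have sT₀ : ContDiffOn ℝ ∞ T₀ {0}ᶜ :=
    (ContDiffOn.sum fun j _ => contDiffOn_const.clm_comp (hW.pd j)).sub (sB.clm_comp sB)
  have sT : ∀ j, ContDiffOn ℝ ∞ (T j) {0}ᶜ := fun j =>
    (contDiffOn_const.clm_comp hW).sub (hW.clm_comp contDiffOn_const)
  have cT₀ := contDiff_smul_of_notMem tP.smooth sT₀ hP0
  have cT := fun j => contDiff_smul_of_notMem tP.smooth (sT j) hP0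
  have ej : ∀ x v (a : Fin d → F) f, P x • jetOp γ W e x v a f =
      -(P x • f) + ∑ j, (P x • T j x) (a j) + (P x • T₀ x) v := by
    intro x v a f
    simp only [jetOp, hT, hT₀, smul_sub, smul_add, smul_neg, sub_apply, FunLike.coe_smul, Pi.smul_apply,
      sum_apply, ContinuousLinearMap.comp_apply, smul_sum, sum_sub_distrib]
    abel
  have hu := hw.smul_test hk
  have hlu : L2Conv (fun n => lap fun x => k x • w n x) (fun x => k x • f x +
      ∑ j, ((2 : ℝ) • (pd j k x • a j x) + pd j (pd j k) x • v x)) := by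
    have e1 : (fun n => lap fun x => k x • w n x) = fun n x => k x • lap (w n) x +
        ∑ j, ((2 : ℝ) • (pd j k x • pd j (w n) x) + pd j (pd j k) x • w n x) := by
      funext n x
      exact lap_smul hk.smooth (hw.test n).smooth x
    rw [e1]
    exact (hf.smul_compact hk.continuous hk.compact).add (L2Conv.sum fun j _ =>
      (((hw.conv_pd j).smul_compact (hk.pd j).continuous (hk.pd j).compact).const_smul 2).add
        (hw.conv.smul_compact ((hk.pd j).pd j).continuous ((hk.pd j).pd j).compact))
  have hlim := (((hlu.smul_compact tP.continuous tP.compact).neg.add (L2Conv.sum (s := univ)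
    fun j _ => (hu.conv_pd j).apply_compact (cT j).continuous tP.compact.smul_right)).add
      (hu.conv.apply_compact cT₀.continuous tP.compact.smul_right)).norm_sq
  simp only [← ej] at hlim
  have tE : IsTest fun x => E x • k x := hk.smul_of_notMem hEs hk0
  have hL := (hw.conv.smul_compact tE.continuous tE.compact).norm_sq
  have hle := le_of_tendsto_of_tendsto' hL (hlim.const_mul C) fun n => ?_
  · refine Eq.trans_le (integral_congr_ae ?_) (hle.trans (mul_le_mul_of_nonneg_left
      (integral_congr_ae ?_).le hC))
    · filter_upwards [hsupp] with x hx
      by_cases hxK : x ∈ K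
      · simp [(hk1 x hxK).eq_of_nhds]
      · simp [(hx hxK).1]
    · filter_upwards [hsupp] with x hx
      by_cases hxK : x ∈ K
      · have e1 := hk1 x hxK
        have e2 : ∀ j, pd j k =ᶠ[𝓝 x] fun _ => 0 := fun j => by
          filter_upwards [e1.eventuallyEq_nhds] with y hy; simp [pd, hy.fderiv_eq]
        have e3 : ∀ j, pd j (pd j k) x = 0 := fun j => by
          have := (e2 j).fderiv_eq (𝕜 := ℝ)
          change fderiv ℝ (pd j k) x (coordVec j) = 0; simp [this]
        have hxk : x ∈ tsupport k := subset_tsupport _ (by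
          rw [Function.mem_support, e1.eq_of_nhds]; exact one_ne_zero)
        simp [hP, hp, e1.eq_of_nhds, fun j => (e2 j).eq_of_nhds, e3, (hk₂1 x hxk).eq_of_nhds]
      · obtain ⟨h1, h2, h3⟩ := hx hxK; simp [h1, h2, h3, jetOp]
  · have hsub : tsupport (fun x => k x • w n x) ⊆ tsupport k := tsupport_smul_subset_left k (w n)
    have := hmain l hl _ (hu.test n) fun x hx => hkR x (hsub hx)
    refine Eq.trans_le (integral_congr_ae (.of_forall fun x => ?_)) (this.trans
      (mul_le_mul_of_nonneg_left (integral_congr_ae (.of_forall fun x => ?_)).le hC))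
    · simp only [smul_smul, smul_eq_mul]; rfl
    · by_cases hx : x ∈ tsupport fun x => k x • w n x
      · simp [hP, hp, (hk₂1 x (hsub hx)).eq_of_nhds]; rfl
      · rw [jetOp_eq_zero hx, smul_zero, smul_zero]

variable {γ : Fin d → F →L[ℝ] F} {W : Space d → F →L[ℝ] F} {e : F →L[ℝ] F} {u : Space d → F} {R : ℝ}
  {x : Space d} {m : Space d → ℝ}

lemma IsCarlemanPair.carleman_cutoff (hd : 0 < d)
    {C₁ C₂ C₃ κ : ℝ} (h : IsCarlemanPair γ W e C₁ C₂ C₃ κ)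
    (hψ : H1Approx w ψ g)
    (heq : ∀ᵐ x, diracG γ g x = e (ψ x) - W x (ψ x)) (hR : 0 < R) :
    ∃ C q l₀ : ℝ, 0 ≤ C ∧ 0 < q ∧ 0 < l₀ ∧ ∀ l, l₀ ≤ l → ∀ χ : Space d → ℝ, IsTest χ →
      (∀ x ∈ tsupport χ, R ≤ ‖x‖) → ∫ x, ‖(carlemanE d l (q / l) x * χ x) • ψ x‖ ^ 2 ≤
        C * ∫ x, ‖(‖x‖ * carlemanE d l (q / l) x) • cutoffSource γ (fun x => e - W x) χ ψ g x‖ ^ 2 := by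
  obtain ⟨C, q, l₀, hC, hq, hl₀, hmain⟩ := h.carleman_limit hR
  refine ⟨C, q, l₀, hC, hq, hl₀, fun l hl χ hχ hsupp => ?_⟩
  have h0 : (0 : Space d) ∉ tsupport χ := fun h0 => by
    have := hsupp 0 h0; rw [norm_zero] at this; linarith
  obtain ⟨w', a, f, hw', hf, hae⟩ :=
    hψ.exists_jet h.clifford h.decaying.smooth h.invariant heq hχ h0
  have := hmain l hl w' _ f a (tsupport χ) hw' hf hχ.compact hsupp (hae.mono fun x hx => hx.1)
  simp only [smul_smul] at this ⊢
  refine this.trans (mul_le_mul_of_nonneg_left (integral_congr_ae ?_).le hC)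
  filter_upwards [hae, ae_ne_zero hd] with x hx hx0; rw [hx.2 hx0]

lemma exists_pd_pd_bump_bound (d : ℕ) (k j : Fin d) :
    ∃ K : ℝ, ∀ (c : ℝ) (x : Space d), |pd k (pd j (bump d c)) x| * ‖x‖ ≤ |c| * K := by
  have ht := ((bump_one_isTest (d := d)).pd j).pd k
  obtain ⟨K, hK⟩ := (ht.compact.mul_right (f' := fun x => ‖x‖)).exists_bound_of_continuous
    (ht.continuous.mul continuous_norm)
  refine ⟨K, fun c x => ?_⟩
  have := mul_le_mul_of_nonneg_left (hK (c • x)) (abs_nonneg c)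
  refine le_trans (le_of_eq ?_) this
  simp only [Pi.mul_apply, norm_mul, norm_smul, norm_eq_abs, pd_pd_bump c k j x,
    abs_mul, abs_pow, abs_abs, abs_norm]
  ring

/-- Cut-offs vanishing on the ball of radius `R`. -/
def exterior (d : ℕ) (R : ℝ) (n : ℕ) (x : Space d) : ℝ := bump d ε[n] x - bump d (1 / R) x

lemma exterior_isTest (hR : 0 < R) (n : ℕ) : IsTest (exterior d R n) :=
  (bump_isTest (by positivity)).sub (bump_isTest (by positivity))

lemma exterior_eq_zero (hR : 0 < R) {n : ℕ} (hn : R ≤ (n : ℝ) + 1)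
    (hx : ‖x‖ ≤ R) : exterior d R n x = 0 := by
  have hn' : (0 : ℝ) < (n : ℝ) + 1 := by positivity
  rw [exterior, bump_eq_one, bump_eq_one, sub_self]
  · rw [abs_of_pos (by positivity), div_mul_eq_mul_div, one_mul, div_le_one hR]; exact hx
  · rw [abs_of_pos (by positivity), div_mul_eq_mul_div, one_mul, div_le_one hn']
    exact hx.trans hn

lemma le_norm_of_mem_tsupport_exterior (hR : 0 < R) {n : ℕ} (hn : R ≤ (n : ℝ) + 1)
    (hx : x ∈ tsupport (exterior d R n)) : R ≤ ‖x‖ :=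
  closure_minimal (t := {x : Space d | R ≤ ‖x‖}) (fun y hy => by
    by_contra hlt
    exact hy (exterior_eq_zero hR hn (not_le.1 hlt).le))
    (isClosed_le continuous_const continuous_norm) hx

lemma exterior_eventually (R : ℝ) (x : Space d) : ∀ᶠ n : ℕ in atTop,
    exterior d R n =ᶠ[𝓝 x] fun y => 1 - bump d (1 / R) y := by
  filter_upwards [tendsto_bump_eventually x] with n hn
  filter_upwards [hn] with y hy; rw [exterior, hy]

lemma pd_eventuallyEq {G : Type*} [NormedAddCommGroup G] [NormedSpace ℝ G] {u v : Space d → G}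
    (h : u =ᶠ[𝓝 x] v) (j : Fin d) : pd j u =ᶠ[𝓝 x] pd j v := by
  filter_upwards [h.eventuallyEq_nhds] with y hy; simp only [pd, hy.fderiv_eq]

lemma pd_exterior (hR : 0 < R) (n : ℕ) (j : Fin d) : pd j (exterior d R n) =
    fun x => pd j (bump d ε[n]) x - pd j (bump d (1 / R)) x :=
  pd_sub_fun (bump_isTest (by positivity)).differentiable (bump_isTest (by positivity)).differentiable j

lemma pd_pd_exterior (hR : 0 < R) (n : ℕ) (k j : Fin d) : pd k (pd j (exterior d R n)) =
      fun x => pd k (pd j (bump d ε[n])) x - pd k (pd j (bump d (1 / R))) x := by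
  rw [pd_exterior hR]
  exact pd_sub_fun ((bump_isTest (by positivity)).pd j).differentiable
    ((bump_isTest (by positivity)).pd j).differentiable k

lemma L2Conv.exterior_smul (hR : 0 < R) (hm : AEStronglyMeasurable m) {Q : ℝ} (hQ : ∀ x, |m x| ≤ Q)
    (hu : MemLp u 2) : L2Conv (fun n x => (m x * exterior d R n x) • u x)
      (fun x => (m x * (1 - bump d (1 / R) x)) • u x) := by
  refine L2Conv.of_pointwise hu (fun n => hm.mul
    (exterior_isTest hR n).continuous.aestronglyMeasurable) (C := Q * 1) (fun n x => ?_)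
    fun x => tendsto_const_nhds.congr' ?_
  · rw [abs_mul]
    have h1 := bump_nonneg (d := d) ε[n] x
    have h2 := bump_le_one (d := d) ε[n] x
    have h3 := bump_nonneg (d := d) (1 / R) x
    have h4 := bump_le_one (d := d) (1 / R) x
    exact mul_le_mul (hQ x) (abs_le.2 ⟨by rw [exterior]; linarith, by
      rw [exterior]; linarith⟩) (abs_nonneg _) ((abs_nonneg _).trans (hQ x))
  · filter_upwards [exterior_eventually R x] with n hn; rw [hn.eq_of_nhds]

lemma L2Conv.pd_exterior_smul (hR : 0 < R)
    (hm : AEStronglyMeasurable m) {Q : ℝ} (hQ : ∀ x, |m x| ≤ Q)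
    (hu : MemLp u 2) (j : Fin d) :
    L2Conv (fun n x => (‖x‖ * m x * pd j (exterior d R n) x) • u x)
      (fun x => (‖x‖ * m x * pd j (fun x => 1 - bump d (1 / R) x) x) • u x) := by
  obtain ⟨K, hK⟩ := exists_fderiv_bump_bound d
  refine L2Conv.of_pointwise hu (fun n => (continuous_norm.aestronglyMeasurable.mul hm).mul
    ((exterior_isTest hR n).pd j).continuous.aestronglyMeasurable) (C := Q * (K + K))
    (fun n x => ?_) fun x => tendsto_const_nhds.congr' ?_
  · rw [pd_exterior hR, abs_mul, abs_mul, abs_norm, mul_comm ‖x‖, mul_assoc]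
    refine mul_le_mul (hQ x) ?_ (by positivity) ((abs_nonneg _).trans (hQ x))
    have b : ∀ c : ℝ, |pd j (bump d c) x| * ‖x‖ ≤ K := fun c =>
      (mul_le_mul_of_nonneg_right (abs_pd_le _ j x) (norm_nonneg x)).trans (hK c x)
    calc ‖x‖ * |_| ≤ ‖x‖ * (|_| + |_|) := mul_le_mul_of_nonneg_left (abs_sub _ _) (norm_nonneg x)
      _ = _ := by rw [mul_add, mul_comm, mul_comm ‖x‖]
      _ ≤ K + K := add_le_add (b _) (b _)
  · filter_upwards [exterior_eventually R x] with n hn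
    rw [(pd_eventuallyEq hn j).eq_of_nhds]

lemma L2Conv.pd_pd_exterior_smul (hR : 0 < R)
    (hm : AEStronglyMeasurable m) {Q : ℝ} (hQ : ∀ x, |m x| ≤ Q)
    (hu : MemLp u 2) (k j : Fin d) :
    L2Conv (fun n x => (‖x‖ * m x * pd k (pd j (exterior d R n)) x) • u x)
      (fun x => (‖x‖ * m x * pd k (pd j (fun x => 1 - bump d (1 / R) x)) x) • u x) := by
  obtain ⟨K, hK⟩ := exists_pd_pd_bump_bound d k j
  have hK0 : 0 ≤ K := by have := hK 1 0; simpa using this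
  refine L2Conv.of_pointwise hu (fun n => (continuous_norm.aestronglyMeasurable.mul hm).mul
    (((exterior_isTest hR n).pd j).pd k).continuous.aestronglyMeasurable)
    (C := Q * (1 * K + |1 / R| * K)) (fun n x => ?_) fun x => tendsto_const_nhds.congr' ?_
  · rw [pd_pd_exterior hR, abs_mul, abs_mul, abs_norm, mul_comm ‖x‖, mul_assoc]
    refine mul_le_mul (hQ x) ?_ (by positivity) ((abs_nonneg _).trans (hQ x))
    calc ‖x‖ * |_| ≤ ‖x‖ * (|_| + |_|) := mul_le_mul_of_nonneg_left (abs_sub _ _) (norm_nonneg x)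
      _ = _ := by rw [mul_add, mul_comm, mul_comm ‖x‖]
      _ ≤ |ε[n]| * K + |1 / R| * K := add_le_add (hK _ _) (hK _ _)
      _ ≤ _ := by gcongr; exact inv_succ_le_one n
  · filter_upwards [exterior_eventually R x] with n hn
    rw [(pd_eventuallyEq (pd_eventuallyEq hn j) k).eq_of_nhds]

lemma pd_exterior_eq_zero (hR : 0 < R) (j : Fin d) (hx : ‖x‖ < R) :
    pd j (fun x => 1 - bump d (1 / R) x) x = 0 := by
  have : (fun x => 1 - bump d (1 / R) x) =ᶠ[𝓝 x] fun _ => 0 := by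
    filter_upwards [(isOpen_lt continuous_norm continuous_const).mem_nhds hx] with y hy
    rw [bump_eq_one, sub_self]
    rw [abs_of_pos (by positivity), div_mul_eq_mul_div, one_mul, div_le_one hR]
    exact (show ‖y‖ < R from hy).le
  rw [(pd_eventuallyEq this j).eq_of_nhds]; simp [pd]

lemma L2Conv.cutoffSource (hd : 0 < d)
    (e : F →L[ℝ] F) {C₁ : ℝ} (hC₁ : 0 ≤ C₁) (hW : IsDecaying W C₁)
    (hψ : MemLp ψ 2) (hg : ∀ j, MemLp (g j) 2)
    (hR : 0 < R) {N : ℕ} (hN : R ≤ N) (hm : AEStronglyMeasurable m) {Q : ℝ}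
    (hQ : ∀ x, |m x| ≤ Q) :
    L2Conv (fun n x => (‖x‖ * m x) • cutoffSource γ (fun x => e - W x) (exterior d R (n + N)) ψ g x)
      (fun x => (‖x‖ * m x) •
        cutoffSource γ (fun x => e - W x) (fun x => 1 - bump d (1 / R) x) ψ g x) := by
  set B : Space d → F →L[ℝ] F := {x : Space d | R ≤ ‖x‖}.indicator fun x => e - W x with hB
  have hset : MeasurableSet {x : Space d | R ≤ ‖x‖} :=
    (isClosed_le continuous_const continuous_norm).measurableSet
  have hBm : AEStronglyMeasurable B :=
    (aestronglyMeasurable_const.sub (aesm_of_contDiffOn hd hW.smooth)).indicator hset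
  have hBb : ∀ x, ‖B x‖ ≤ ‖e‖ + C₁ / R := by
    intro x
    by_cases hx : R ≤ ‖x‖
    · rw [hB, Set.indicator_of_mem (show x ∈ {x : Space d | R ≤ ‖x‖} from hx)]
      have hx0 : x ≠ 0 := norm_pos_iff.1 (hR.trans_le hx)
      refine (norm_sub_le _ _).trans (add_le_add_right ((hW.bound x hx0).trans ?_) _)
      gcongr
    · rw [hB, Set.indicator_of_notMem (show x ∉ {x : Space d | R ≤ ‖x‖} from hx), norm_zero]
      positivity
  have hBu : ∀ {u : Space d → F}, MemLp u 2 → MemLp (fun x => B x (u x)) 2 :=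
    fun hu => ((L2Conv.const hu).apply_bdd hBm hBb).memLp_lim
  have hγ : ∀ j, MemLp (fun x => γ j (ψ x)) 2 := fun j =>
    ((L2Conv.const hψ).clm (γ j)).memLp_lim
  have hγγ : ∀ k j, MemLp (fun x => γ k (γ j (ψ x))) 2 := fun k j =>
    ((L2Conv.const (hγ j)).clm (γ k)).memLp_lim
  have hγg : ∀ k j, MemLp (fun x => γ k (γ j (g k x))) 2 := fun k j =>
    ((L2Conv.const (hg k)).clm ((γ k).comp (γ j))).memLp_lim
  have hconv := ((L2Conv.sum (s := univ) fun k _ => L2Conv.sum (s := univ) fun j _ =>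
    (L2Conv.pd_pd_exterior_smul hR hm hQ (hγγ k j) k j).add
      (L2Conv.pd_exterior_smul hR hm hQ (hγg k j) j)).add
    (L2Conv.sum (s := univ) fun j _ =>
      L2Conv.pd_exterior_smul hR hm hQ (hBu (hγ j)) j)).comp (tendsto_add_atTop_nat N)
  have key : ∀ (χ : Space d → ℝ) (x : Space d), (∀ j, ‖x‖ < R → pd j χ x = 0) →
      ∑ k, ∑ j, ((‖x‖ * m x * pd k (pd j χ) x) • γ k (γ j (ψ x)) +
        (‖x‖ * m x * pd j χ x) • γ k (γ j (g k x))) +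
        ∑ j, (‖x‖ * m x * pd j χ x) • B x (γ j (ψ x)) =
      (‖x‖ * m x) • _root_.cutoffSource γ (fun x => e - W x) χ ψ g x := by
    intro χ x hx
    have e1 : ∀ j, (‖x‖ * m x * pd j χ x) • B x (γ j (ψ x)) =
        (‖x‖ * m x * pd j χ x) • (e - W x) (γ j (ψ x)) := by
      intro j
      by_cases hxR : R ≤ ‖x‖
      · rw [hB, Set.indicator_of_mem (show x ∈ {x : Space d | R ≤ ‖x‖} from hxR)]
      · rw [hx j (not_le.1 hxR), mul_zero, zero_smul, zero_smul]
    simp only [e1, _root_.cutoffSource, smul_add, smul_sum, smul_smul]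
  refine hconv.congr (fun n => .of_forall fun x => key _ x fun j hx => ?_)
    (.of_forall fun x => key _ x fun j hx => pd_exterior_eq_zero hR j hx)
  have hn : R ≤ ((n + N : ℕ) : ℝ) + 1 := by
    push_cast
    have : (0 : ℝ) ≤ n := by positivity
    linarith
  by_contra hne
  have := le_norm_of_mem_tsupport_exterior hR hn (x := x) (by
    by_contra hns
    refine hne ?_
    rw [(pd_eventuallyEq (notMem_tsupport_iff_eventuallyEq.mp hns) j).eq_of_nhds]
    simp [pd])
  linarith

lemma cutoffSource_exterior_eq_zero (γ : Fin d → F →L[ℝ] F) (B : Space d → F →L[ℝ] F)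
    (hR : 0 < R) (ψ : Space d → F) (g : Fin d → Space d → F) (hx : 2 * R < ‖x‖) :
    cutoffSource γ B (fun x => 1 - bump d (1 / R) x) ψ g x = 0 := by
  have h : (fun x => 1 - bump d (1 / R) x) =ᶠ[𝓝 x] fun _ => 1 := by
    filter_upwards [(isOpen_lt continuous_const continuous_norm).mem_nhds hx] with y hy
    rw [bump_eq_zero, sub_zero]
    rw [abs_of_pos (by positivity), div_mul_eq_mul_div, one_mul, le_div_iff₀ hR]
    exact (show 2 * R < ‖y‖ from hy).le
  have h1 : ∀ j, pd j (fun x => 1 - bump d (1 / R) x) =ᶠ[𝓝 x] fun _ => 0 := fun j =>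
    (pd_eventuallyEq h j).trans (.of_forall fun y => by simp [pd])
  have h2 : ∀ k j, pd k (pd j (fun x => 1 - bump d (1 / R) x)) x = 0 := fun k j => by
    rw [(pd_eventuallyEq (h1 j) k).eq_of_nhds]; simp [pd]
  simp only [cutoffSource, h2, fun j => (h1 j).eq_of_nhds, zero_smul, add_zero, sum_const_zero]

lemma IsCarlemanPair.integral_exterior_eq_zero (hd : 0 < d)
    {C₁ C₂ C₃ κ : ℝ} (h : IsCarlemanPair γ W e C₁ C₂ C₃ κ)
    (hψ : H1Approx w ψ g)
    (heq : ∀ᵐ x, diracG γ g x = e (ψ x) - W x (ψ x)) (hR : 0 < R) :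
    ∫ x in {x : Space d | 3 * R ≤ ‖x‖}, ‖ψ x‖ ^ 2 = 0 := by
  obtain ⟨C, q, l₀, hC, hq, hl₀, hmain⟩ := h.carleman_cutoff hd hψ heq hR
  obtain ⟨N, hN⟩ := exists_nat_ge R
  set S : Space d → F := cutoffSource γ (fun x => e - W x) (fun x => 1 - bump d (1 / R) x) ψ g with hS
  have hψ2 := hψ.conv.memLp_lim
  have hg2 := fun j => (hψ.conv_pd j).memLp_lim
  have hset : MeasurableSet {x : Space d | 3 * R ≤ ‖x‖} :=
    (isClosed_le continuous_const continuous_norm).measurableSet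
  have iψ := integrable_norm_sq hψ2
  have iS : Integrable (fun x => ‖‖x‖ • S x‖ ^ 2) := by
    have := L2Conv.cutoffSource hd (γ := γ) e h.nonneg₁ h.decaying hψ2 hg2 hR hN (m := fun _ => 1)
      aestronglyMeasurable_const (Q := 1) (fun _ => by simp)
    simp only [mul_one] at this; exact integrable_norm_sq this.memLp_lim
  have bound : ∀ l, l₀ ≤ l → ∫ x in {x : Space d | 3 * R ≤ ‖x‖}, ‖ψ x‖ ^ 2 ≤
      C * (∫ x, ‖‖x‖ • S x‖ ^ 2) *
        Real.exp (-(2 * (carlemanF l (q / l) (3 * R) - carlemanF l (q / l) (2 * R)))) := by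
    intro l hl
    have hl0 : 0 < l := hl₀.trans_le hl
    have hε : 0 < q / l := by positivity
    set E := carlemanE d l (q / l) with hE
    have hEm : AEStronglyMeasurable E := aesm_of_contDiffOn hd (contDiffOn_carlemanE l (q / l))
    have hEb : ∀ x, |E x| ≤ Real.exp (l / (q / l) * Real.pi) := fun x => by
      rw [hE, carlemanE, abs_exp]; exact Real.exp_le_exp.2 (carlemanF_le hl0.le hε _)
    have c1 := (L2Conv.exterior_smul hR hEm hEb hψ2).comp (tendsto_add_atTop_nat N)
    have c2 := L2Conv.cutoffSource hd (γ := γ) e h.nonneg₁ h.decaying hψ2 hg2 hR hN hEm hEb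
    have hle := le_of_tendsto_of_tendsto' c1.norm_sq (c2.norm_sq.const_mul C) fun n =>
      hmain l hl _ (exterior_isTest hR (n + N)) fun x hx =>
        le_norm_of_mem_tsupport_exterior hR (by
          push_cast
          have : (0 : ℝ) ≤ n := by positivity
          linarith) hx
    have lower : Real.exp (carlemanF l (q / l) (3 * R)) ^ 2 *
        ∫ x in {x : Space d | 3 * R ≤ ‖x‖}, ‖ψ x‖ ^ 2 ≤
        ∫ x, ‖(E x * (1 - bump d (1 / R) x)) • ψ x‖ ^ 2 := by
      rw [← integral_const_mul, ← integral_indicator hset]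
      refine integral_mono ((iψ.const_mul _).indicator hset)
        (integrable_norm_sq c1.memLp_lim) fun x => ?_
      by_cases hx : x ∈ {x : Space d | 3 * R ≤ ‖x‖}
      · have hx' : 3 * R ≤ ‖x‖ := hx
        rw [Set.indicator_of_mem hx, bump_eq_zero, sub_zero, mul_one, norm_smul, mul_pow, hE, carlemanE,
          norm_eq_abs, abs_exp]
        · have := Real.exp_le_exp.2 (carlemanF_mono hl0.le hε hx'); gcongr
        · rw [abs_of_pos (by positivity), div_mul_eq_mul_div, one_mul, le_div_iff₀ hR]
          linarith
      · rw [Set.indicator_of_notMem hx]; positivity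
    have upper : ∫ x, ‖(‖x‖ * E x) • S x‖ ^ 2 ≤
        Real.exp (carlemanF l (q / l) (2 * R)) ^ 2 * ∫ x, ‖‖x‖ • S x‖ ^ 2 := by
      rw [← integral_const_mul]
      refine integral_mono (integrable_norm_sq c2.memLp_lim) (iS.const_mul _) fun x => ?_
      by_cases hx : ‖x‖ ≤ 2 * R
      · have h1 := Real.exp_le_exp.2 (carlemanF_mono hl0.le hε hx)
        have h2 : ‖(‖x‖ * E x) • S x‖ = Real.exp (carlemanF l (q / l) ‖x‖) * ‖‖x‖ • S x‖ := by
          rw [mul_comm, mul_smul, norm_smul, hE, carlemanE, norm_eq_abs, abs_exp]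
        simp only [h2]; rw [mul_pow]; gcongr
      · have : S x = 0 := cutoffSource_exterior_eq_zero γ _ hR ψ g (not_le.1 hx)
        simp [this]
    have hall := lower.trans (hle.trans (mul_le_mul_of_nonneg_left upper hC))
    have e1 : Real.exp (-(2 * (carlemanF l (q / l) (3 * R) - carlemanF l (q / l) (2 * R)))) =
        Real.exp (carlemanF l (q / l) (2 * R)) ^ 2 / Real.exp (carlemanF l (q / l) (3 * R)) ^ 2 := by
      rw [← exp_nat_mul, ← exp_nat_mul, ← Real.exp_sub]
      congr 1; push_cast; ring
    rw [e1, ← mul_div_assoc, le_div_iff₀ (by positivity)]; linarith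
  refine le_antisymm ?_ (integral_nonneg fun x => by positivity)
  set c := R / (√(3 * R) * (1 + 3 * R)) with hc
  have hc0 : 0 < c := by positivity
  have ht : Tendsto (fun l => C * (∫ x, ‖‖x‖ • S x‖ ^ 2) * Real.exp (-(2 * (l * c)))) atTop
      (𝓝 (C * (∫ x, ‖‖x‖ • S x‖ ^ 2) * 0)) := by
    refine (Real.tendsto_exp_neg_atTop_nhds_zero.comp ?_).const_mul _
    exact (tendsto_id.atTop_mul_const hc0).const_mul_atTop two_pos
  rw [mul_zero] at ht
  refine ge_of_tendsto ht ?_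
  filter_upwards [eventually_ge_atTop (max l₀ q)] with l hl
  have hl1 := (le_max_left _ _).trans hl
  have hl2 := (le_max_right _ _).trans hl
  have hl0 : 0 < l := hl₀.trans_le hl1
  have hint : 0 ≤ ∫ x, ‖‖x‖ • S x‖ ^ 2 := integral_nonneg fun x => by positivity
  refine (bound l hl1).trans (mul_le_mul_of_nonneg_left (Real.exp_le_exp.2 ?_) (by positivity))
  have hF := carlemanF_sub hl0.le (by positivity : 0 < q / l) (by positivity : 0 < 2 * R)
    (by linarith : 2 * R ≤ 3 * R)
  have : l * c ≤ l / (√(3 * R) * (1 + (q / l) ^ 2 * (3 * R))) * (3 * R - 2 * R) := by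
    have h1 : (q / l) ^ 2 ≤ 1 := pow_le_one₀ (by positivity) ((div_le_one hl0).2 hl2)
    have h2 : 1 + (q / l) ^ 2 * (3 * R) ≤ 1 + 3 * R := by nlinarith
    calc l * c = l / (√(3 * R) * (1 + 3 * R)) * R := by rw [hc]; ring
      _ ≤ l / (√(3 * R) * (1 + (q / l) ^ 2 * (3 * R))) * R := by gcongr
      _ = _ := by ring
  linarith

/-- Absence of square integrable solutions when the limit at infinity is invertible. -/
theorem IsCarlemanPair.eq_zero (hd : 0 < d) {C₁ C₂ C₃ κ : ℝ} (h : IsCarlemanPair γ W e C₁ C₂ C₃ κ)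
    (hψ : H1Approx w ψ g)
    (heq : ∀ᵐ x, diracG γ g x = e (ψ x) - W x (ψ x)) : ψ =ᵐ[volume] 0 := by
  have h1 : ∀ n : ℕ, ∀ᵐ x, 3 * ε[n] ≤ ‖x‖ → ψ x = 0 := by
    intro n
    have hset : MeasurableSet {x : Space d | 3 * ε[n] ≤ ‖x‖} :=
      (isClosed_le continuous_const continuous_norm).measurableSet
    have h0 := h.integral_exterior_eq_zero hd hψ heq (by positivity : 0 < ε[n])
    rw [integral_eq_zero_iff_of_nonneg (fun x => by positivity)
      (integrable_norm_sq hψ.conv.memLp_lim).integrableOn] at h0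
    have h2 := (ae_restrict_iff' hset).1 h0
    filter_upwards [h2] with x hx hxn; simpa using hx hxn
  filter_upwards [ae_all_iff.2 h1, ae_ne_zero hd] with x hx hx0
  have hx' : 0 < ‖x‖ := norm_pos_iff.2 hx0
  obtain ⟨n, hn⟩ := exists_nat_one_div_lt (by positivity : 0 < ‖x‖ / 3)
  exact hx n (by linarith)

end CarlemanApplication

section CliffordModules

open Module

variable {V : Type*} [NormedAddCommGroup V] [InnerProductSpace ℂ V] [FiniteDimensional ℂ V]

lemma two_pow_le_finrank {a : ℕ → End ℂ V} {k : ℕ}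
    (ha : ∀ i j, i < 2 * k → j < 2 * k → a i * a j + a j * a i = if i = j then 2 else 0)
    {S : Submodule ℂ V} (hS : S ≠ ⊥) (inv : ∀ i < 2 * k, ∀ v ∈ S, a i v ∈ S) :
    2 ^ k ≤ finrank ℂ S := by
  induction k generalizing S with
  | zero =>
    have := Submodule.nontrivial_iff_ne_bot.2 hS; exact finrank_pos
  | succ k ih =>
    have sq : ∀ i < 2 * (k + 1), ∀ v, a i (a i v) = v := fun i hi v => by
      have := congrArg (fun L => L v) (ha i i hi hi)
      simp only [if_true, LinearMap.add_apply, Module.End.mul_apply, ← two_smul ℂ (a i (a i v))] at this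
      have h2 : (2 : End ℂ V) v = (2 : ℂ) • v := by rw [two_smul, ← one_add_one_eq_two]; rfl
      rw [h2] at this; exact smul_right_injective V (two_ne_zero) this
    have anti : ∀ i j, i < 2 * (k + 1) → j < 2 * (k + 1) → i ≠ j → ∀ v, a i (a j v) = -a j (a i v) := by
      intro i j hi hj hij v
      have := congrArg (fun L => L v) (ha i j hi hj)
      simp only [if_neg hij, LinearMap.add_apply, Module.End.mul_apply, LinearMap.zero_apply] at this
      exact eq_neg_of_add_eq_zero_left this
    set p := a (2 * k) with hp
    set q := a (2 * k + 1) with hq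
    have pp : ∀ v, p (p v) = v := sq _ (by lia)
    have qq : ∀ v, q (q v) = v := sq _ (by lia)
    have pq : ∀ v, q (p v) = -p (q v) := anti _ _ (by lia) (by lia) (by lia)
    set T : End ℂ V := Complex.I • (p * q) with hT
    have hTa : ∀ v, T v = Complex.I • p (q v) := fun v => rfl
    set P := S ⊓ LinearMap.ker (T - 1) with hP
    have mem : ∀ v, v ∈ P ↔ v ∈ S ∧ T v = v := fun v => by
      rw [hP, Submodule.mem_inf, LinearMap.mem_ker, LinearMap.sub_apply, sub_eq_zero]; rfl
    have TT : ∀ v, T (T v) = v := fun v => by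
      simp only [hTa, map_smul, pq, map_neg, pp, qq, smul_smul, Complex.I_mul_I, smul_neg, neg_smul,
        one_smul, neg_neg]
    have Tp : ∀ v, T (p v) = -p (T v) := fun v => by
      simp only [hTa, map_smul, pq, map_neg, smul_neg]
    have invp := inv (2 * k) (by lia)
    have invq := inv (2 * k + 1) (by lia)
    have hP0 : P ≠ ⊥ := by
      obtain ⟨v, hv, hv0⟩ := Submodule.exists_mem_ne_zero_of_ne_bot hS
      rw [Submodule.ne_bot_iff]
      by_cases h : v + T v = 0
      · have h' : T v = -v := eq_neg_of_add_eq_zero_right h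
        refine ⟨p v, (mem _).2 ⟨invp v hv, by rw [Tp, h', map_neg, neg_neg]⟩, fun h0 => hv0 ?_⟩
        rw [← pp v, h0, map_zero]
      · exact ⟨v + T v, (mem _).2 ⟨S.add_mem hv (S.smul_mem _ (invp _ (invq v hv))), by
          rw [map_add, TT, add_comm]⟩, h⟩
    have hle := ih (fun i j hi hj => ha i j (by lia) (by lia)) hP0 fun i hi v hv => by
      obtain ⟨h1, h2⟩ := (mem v).1 hv
      refine (mem _).2 ⟨inv i (by lia) v h1, ?_⟩
      have e : p (q (a i v)) = a i (p (q v)) := by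
        rw [anti (2 * k + 1) i (by lia) (by lia) (by lia), map_neg,
          anti (2 * k) i (by lia) (by lia) (by lia), neg_neg]
      rw [hTa, e, ← map_smul, ← hTa, h2]
    have hpinj : Function.Injective p := fun x y h => by rw [← pp x, h, pp]
    have h1 : finrank ℂ (P.map p) = finrank ℂ P := (Submodule.equivMapOfInjective p hpinj P).finrank_eq.symm
    have h2 : P ⊓ P.map p = ⊥ := by
      rw [eq_bot_iff]
      rintro x ⟨hx, y, hy, rfl⟩
      have e1 := ((mem _).1 hx).2; rw [Tp, ((mem _).1 hy).2] at e1
      have e2 : (2 : ℂ) • p y = 0 := by rw [two_smul]; nth_rw 1 [← e1]; exact neg_add_cancel _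
      exact (smul_eq_zero.1 e2).resolve_left two_ne_zero
    have h3 : P ⊔ P.map p ≤ S := sup_le inf_le_left (by
      rintro _ ⟨y, hy, rfl⟩
      exact invp y ((mem y).1 hy).1)
    have h4 := Submodule.finrank_sup_add_finrank_inf_eq P (P.map p)
    rw [h2, finrank_bot, h1, add_zero] at h4
    have h5 := Submodule.finrank_mono h3; rw [pow_succ]
    lia

lemma exists_eq_smul_of_commute {a : ℕ → End ℂ V} {k : ℕ}
    (ha : ∀ i j, i < 2 * k → j < 2 * k → a i * a j + a j * a i = if i = j then 2 else 0)
    (hV : finrank ℂ V = 2 ^ k) {X : End ℂ V} (hX : ∀ i < 2 * k, X * a i = a i * X) :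
    ∃ c : ℂ, X = c • 1 := by
  have : Nontrivial V := Module.nontrivial_of_finrank_pos (R := ℂ) (by rw [hV]; positivity)
  obtain ⟨c, hc⟩ := Module.End.exists_eigenvalue X
  refine ⟨c, ?_⟩
  have h := two_pow_le_finrank ha hc fun i hi v hv => by
    rw [Module.End.mem_eigenspace_iff] at hv ⊢
    have := congrArg (fun L => L v) (hX i hi)
    simp only [Module.End.mul_apply, hv, map_smul] at this; exact this
  have htop : End.eigenspace X c = ⊤ := Submodule.eq_top_of_finrank_eq
    (le_antisymm (Submodule.finrank_le _) (hV ▸ h))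
  ext v
  have : v ∈ End.eigenspace X c := htop ▸ Submodule.mem_top
  exact Module.End.mem_eigenspace_iff.1 this

variable {d : ℕ}

/-- Generators of a unitary representation of a Clifford algebra on the spinors. -/
structure IsSpinModule (a : Fin d → End ℂ V) (b : End ℂ V) : Prop where
  anticomm : ∀ i j, a i * a j + a j * a i = if i = j then 2 else 0
  anticomm_right : ∀ i, a i * b + b * a i = 0
  sq : b * b = 1
  norm : ∀ i v, ‖a i v‖ = ‖v‖
  finrank : finrank ℂ V = 2 ^ ((d + 1) / 2)

namespace IsSpinModule

variable {a : Fin d → End ℂ V} {b : End ℂ V}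

lemma eq_smul_of_even (h : IsSpinModule a b) (hd : Even d) {X : End ℂ V}
    (hX : ∀ i, X * a i = a i * X) : ∃ c : ℂ, X = c • 1 := by
  obtain ⟨k, rfl⟩ := hd
  refine exists_eq_smul_of_commute (a := fun i => if hi : i < k + k then a ⟨i, hi⟩ else 0) (k := k)
    (fun i j hi hj => ?_) (h.finrank.trans (by congr 1; lia)) fun i hi => ?_
  · rw [dif_pos (by lia), dif_pos (by lia), h.anticomm]; simp
  · rw [dif_pos (by lia), hX]

lemma eq_smul_of_odd (h : IsSpinModule a b) (hd : Odd d) {X : End ℂ V}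
    (hX : ∀ i, X * a i = a i * X) (hb : X * b = b * X) : ∃ c : ℂ, X = c • 1 := by
  obtain ⟨k, rfl⟩ := hd
  refine exists_eq_smul_of_commute (a := fun i => if hi : i < 2 * k + 1 then a ⟨i, hi⟩ else b)
    (k := k + 1) (fun i j hi hj => ?_) (h.finrank.trans (by congr 1; lia)) fun i hi => ?_
  · by_cases h1 : i < 2 * k + 1 <;> by_cases h2 : j < 2 * k + 1
    · rw [dif_pos h1, dif_pos h2, h.anticomm]; simp
    · rw [dif_pos h1, dif_neg h2, h.anticomm_right, if_neg (by lia)]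
    · rw [dif_neg h1, dif_pos h2, add_comm, h.anticomm_right, if_neg (by lia)]
    · rw [dif_neg h1, dif_neg h2, h.sq, if_pos (by lia), one_add_one_eq_two]
  · by_cases h1 : i < 2 * k + 1
    · rw [dif_pos h1, hX]
    · rw [dif_neg h1, hb]

/-- The product of the generators along a list. -/
def prod (a : Fin d → End ℂ V) (l : List (Fin d)) : End ℂ V := (l.map a).prod

lemma norm_prod (h : IsSpinModule a b) (l : List (Fin d)) (v : V) : ‖prod a l v‖ = ‖v‖ := by
  induction l with
  | nil => rfl
  | cons i l ih =>
    have : prod a (i :: l) v = a i (prod a l v) := by simp [prod]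
    rw [this, h.norm, ih]

lemma prod_mul_right (h : IsSpinModule a b) (l : List (Fin d)) :
    prod a l * b = (-1 : ℂ) ^ l.length • (b * prod a l) := by
  induction l with
  | nil => simp [prod]
  | cons i l ih =>
    have : prod a (i :: l) = a i * prod a l := by simp [prod]
    rw [this, mul_assoc, ih, mul_smul_comm, ← mul_assoc, eq_neg_of_add_eq_zero_left (h.anticomm_right i),
      List.length_cons, pow_succ, mul_neg_one, neg_smul, neg_mul, smul_neg, mul_assoc]

lemma prod_mul (h : IsSpinModule a b) (l : List (Fin d)) (j : Fin d) :
    prod a l * a j = (-1 : ℂ) ^ (l.countP (· ≠ j)) • (a j * prod a l) := by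
  induction l with
  | nil => simp [prod]
  | cons i l ih =>
    have : prod a (i :: l) = a i * prod a l := by simp [prod]
    rw [this, mul_assoc, ih, mul_smul_comm, ← mul_assoc]
    by_cases hij : i = j
    · subst hij; rw [List.countP_cons_of_neg (by simp), mul_assoc]
    · have := h.anticomm i j; rw [if_neg hij] at this
      rw [eq_neg_of_add_eq_zero_left this, List.countP_cons_of_pos (by simpa using hij), pow_succ,
        mul_neg_one, neg_smul, neg_mul, smul_neg, mul_assoc]

lemma prod_full (h : IsSpinModule a b) (hd : Odd d) {l : List (Fin d)} (hl : l.Nodup)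
    (hl' : l.toFinset = univ) :
    (∀ j, prod a l * a j = a j * prod a l) ∧ prod a l * b = -(b * prod a l) := by
  have hlen : l.length = d := by
    rw [← List.toFinset_card_of_nodup hl, hl', card_univ, Fintype.card_fin]
  constructor
  · intro j
    have hc : l.countP (· ≠ j) + 1 = d := by
      have h1 := List.length_eq_countP_add_countP (fun i => decide (i ≠ j)) (l := l)
      have h2 : l.countP (fun i => decide ¬(decide (i ≠ j)) = true) = 1 := by
        have : l.count j = 1 := List.count_eq_one_of_mem hl (by rw [← List.mem_toFinset, hl']; simp)
        rw [← this, List.count]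
        congr 1; funext i; simp [beq_eq_decide]
      lia
    have he : Even (l.countP (· ≠ j)) := by
      rw [← hc] at hd; exact (Nat.odd_add_one.1 hd) |> Nat.not_odd_iff_even.1
    rw [h.prod_mul, he.neg_one_pow, one_smul]
  · rw [h.prod_mul_right, hlen, hd.neg_one_pow, neg_one_smul]

variable {W : End ℂ V}

lemma exists_list (h : IsSpinModule a b) {c : ℕ → ℝ}
    (hW : ∀ s : Finset (Fin d), s.Nonempty → ∀ v, ∃ j ∈ s,
      ‖a j (W v) - W (a j v)‖ ≤ c s.card * ‖v‖) (n : ℕ) :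
    ∀ s : Finset (Fin d), s.card = n → ∀ v, ∃ l : List (Fin d), l.Nodup ∧ l.toFinset = s ∧
      ‖prod a l (W v) - W (prod a l v)‖ ≤ (∑ m ∈ Finset.range n, c (m + 1)) * ‖v‖ := by
  induction n with
  | zero =>
    intro s hs v
    exact ⟨[], List.nodup_nil, by simp [Finset.card_eq_zero.1 hs], by simp [prod]⟩
  | succ n ih =>
    intro s hs v
    obtain ⟨j, hj, hjv⟩ := hW s (Finset.card_pos.1 (by lia)) v
    obtain ⟨l, hl, hl', hlv⟩ := ih (s.erase j) (by rw [Finset.card_erase_of_mem hj, hs]; rfl) (a j v)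
    have hjl : j ∉ l := by rw [← List.mem_toFinset, hl']; simp
    have e : ∀ u, prod a (l ++ [j]) u = prod a l (a j u) := fun u => by simp [prod]
    refine ⟨l ++ [j], by simp [List.nodup_append, hl]; exact fun x hx hxj => hjl (hxj ▸ hx), ?_, ?_⟩
    · simp [hl', Finset.insert_erase hj]
    · rw [e, e, sum_range_succ, add_mul]
      have h1 : prod a l (a j (W v)) - W (prod a l (a j v)) =
          (prod a l (W (a j v)) - W (prod a l (a j v))) + prod a l (a j (W v) - W (a j v)) := by
        rw [map_sub]; abel
      rw [h1]
      refine (norm_add_le _ _).trans (add_le_add ?_ ?_)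
      · rwa [h.norm] at hlv
      · rw [h.norm_prod, ← hs]; exact hjv

lemma trichotomy (h : IsSpinModule a b) (hd : Odd d) {e : End ℂ V} (he : ∀ i, e * a i = a i * e)
    (hs : ∀ u v, inner ℂ (e u) v = inner ℂ u (e v)) : (∃ p : ℂ, e = p • 1) ∨ Function.Injective e ∨
      ∃ μ : ℝ, μ ≠ 0 ∧ (∀ v, e (e v) = (μ : ℂ) • e v) ∧ ∀ (W : End ℂ V) (c : ℕ → ℝ),
        (∀ s : Finset (Fin d), s.Nonempty → ∀ v, ∃ j ∈ s,
          ‖a j (W v) - W (a j v)‖ ≤ c s.card * ‖v‖) → ∀ v, e v = 0 →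
        ‖e (W v)‖ ≤ |μ| * ((∑ m ∈ Finset.range d, c (m + 1)) / 2 * ‖v‖) := by
  set l₀ := List.finRange d
  obtain ⟨wa, wb⟩ := h.prod_full hd (l := l₀) (List.nodup_finRange d) (by ext; simp [l₀])
  set Ω := prod a l₀
  have : Nontrivial V := Module.nontrivial_of_finrank_pos (R := ℂ) (by rw [h.finrank]; positivity)
  obtain ⟨v₀, hv₀⟩ := exists_ne (0 : V)
  have bb : ∀ v, b (b v) = v := fun v => congrArg (fun L => L v) h.sq
  have ba : ∀ i v, b (a i v) = -a i (b v) := fun i v =>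
    eq_neg_of_add_eq_zero_right (congrArg (fun L => L v) (h.anticomm_right i))
  have wb' : ∀ v, Ω (b v) = -b (Ω v) := fun v => congrArg (fun L => L v) wb
  have wa' : ∀ i v, Ω (a i v) = a i (Ω v) := fun i v => congrArg (fun L => L v) (wa i)
  have wn : ∀ v, ‖Ω v‖ = ‖v‖ := h.norm_prod l₀
  obtain ⟨s, hs2⟩ := h.eq_smul_of_odd hd (X := Ω * Ω) (fun i => by rw [mul_assoc, wa, ← mul_assoc, wa, mul_assoc])
    (by rw [mul_assoc, wb, mul_neg, ← mul_assoc, wb, neg_mul, neg_neg, mul_assoc])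
  have ww : ∀ v, Ω (Ω v) = s • v := fun v => congrArg (fun L => L v) hs2
  have sn : ‖s‖ = 1 := by
    have := wn (Ω v₀); rw [ww, wn, norm_smul] at this
    exact mul_right_cancel₀ (norm_ne_zero_iff.2 hv₀) (this.trans (one_mul _).symm)
  have s0 : s ≠ 0 := by rintro rfl; simp at sn
  have decomp : ∀ X : End ℂ V, (∀ i, X * a i = a i * X) →
      ∃ p q : ℂ, (∀ v, X v = p • v + q • Ω v) ∧ ∀ v, b (X (b v)) = p • v - q • Ω v := by
    intro X hX
    have Xa : ∀ i v, X (a i v) = a i (X v) := fun i v => congrArg (fun L => L v) (hX i)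
    obtain ⟨p, hp⟩ := h.eq_smul_of_odd hd (X := X + b * X * b) (fun i => by
        ext v; simp [ba, Xa]) (by ext v; simp [bb, add_comm])
    obtain ⟨q, hq⟩ := h.eq_smul_of_odd hd (X := Ω * (X - b * X * b)) (fun i => by
        ext v; simp [ba, Xa, wa']) (by ext v; simp [bb, wb']; abel)
    have hp' : ∀ v, X v + b (X (b v)) = p • v := fun v => congrArg (fun L => L v) hp
    have hq' : ∀ v, X v - b (X (b v)) = (q / s) • Ω v := fun v => by
      have h1 : Ω (X v - b (X (b v))) = q • v := congrArg (fun L => L v) hq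
      have h2 := congrArg (fun y => s⁻¹ • Ω y) h1
      simp only [ww, smul_smul, inv_mul_cancel₀ s0, one_smul, map_smul] at h2
      rw [h2, div_eq_inv_mul]
    refine ⟨p / 2, q / s / 2, fun v => ?_, fun v => ?_⟩
    · rw [div_eq_inv_mul, div_eq_inv_mul _ (2 : ℂ), mul_smul, mul_smul, ← hp', ← hq']
      module
    · rw [div_eq_inv_mul, div_eq_inv_mul _ (2 : ℂ), mul_smul, mul_smul, ← hp', ← hq']
      module
  obtain ⟨p, q, hpq, -⟩ := decomp e he
  by_cases hinj : Function.Injective e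
  · exact Or.inr (Or.inl hinj)
  have hee : ∀ v, e (e v) = (2 * p) • e v - (p ^ 2 - q ^ 2 * s) • v := fun v => by
    rw [hpq (e v), hpq v, map_add, map_smul, map_smul, ww]
    module
  obtain ⟨v₁, hv₁, hv₁0⟩ : ∃ v, e v = 0 ∧ v ≠ 0 := by
    by_contra hne
    push Not at hne; exact hinj ((injective_iff_map_eq_zero e).2 hne)
  have hdet : p ^ 2 - q ^ 2 * s = 0 := by
    have := hee v₁; rw [hv₁, map_zero, smul_zero, zero_sub, eq_comm, neg_eq_zero] at this
    exact (smul_eq_zero.1 this).resolve_right hv₁0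
  simp only [hdet, zero_smul, sub_zero] at hee
  by_cases he0 : e = 0
  · exact Or.inl ⟨0, by rw [he0, zero_smul]⟩
  obtain ⟨v₂, hv₂⟩ : ∃ v, e v ≠ 0 := by
    by_contra hne
    push Not at hne; exact he0 (LinearMap.ext hne)
  refine Or.inr (Or.inr ?_)
  have hreal : ∃ μ : ℝ, (μ : ℂ) = 2 * p := by
    have h1 := hs (e v₂) (e v₂); rw [hee, inner_smul_left, inner_smul_right] at h1
    exact Complex.conj_eq_iff_real.1 (mul_right_cancel₀ (inner_self_ne_zero.2 hv₂) h1) |>.imp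
      fun _ h => h.symm
  obtain ⟨μ, hμ⟩ := hreal
  have hμ0 : μ ≠ 0 := by
    rintro rfl
    have h1 := hs v₂ (e v₂)
    rw [hee, ← hμ, Complex.ofReal_zero, zero_smul, inner_zero_right, inner_self_eq_zero] at h1
    exact hv₂ h1
  have hqn : ‖q‖ = |μ| / 2 := by
    have h1 : ‖p‖ = |μ| / 2 := by
      have := congrArg (fun z : ℂ => ‖z‖) hμ
      rw [norm_mul, Complex.norm_real, Complex.norm_two, norm_eq_abs] at this; linarith
    have h2 : ‖p‖ ^ 2 = ‖q‖ ^ 2 := by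
      rw [← norm_pow, ← norm_pow, sub_eq_zero.1 hdet, norm_mul, sn, mul_one]
    rw [← h1]
    exact ((pow_left_inj₀ (norm_nonneg _) (norm_nonneg _) two_ne_zero).1 h2).symm
  refine ⟨μ, hμ0, fun v => by rw [hμ, hee], fun W c hW v hv => ?_⟩
  obtain ⟨l, hl, hl', hlv⟩ := h.exists_list hW d univ (by simp) v
  obtain ⟨la, lb⟩ := h.prod_full hd hl hl'
  obtain ⟨p', q', h1, h2⟩ := decomp _ la
  have lb' : ∀ v, prod a l v = -b (prod a l (b v)) := fun v => by
    have := congrArg (fun L => L (b v)) lb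
    simp only [Module.End.mul_apply, bb, LinearMap.neg_apply] at this; exact this
  have h3 : ∀ v, prod a l v = q' • Ω v := fun v => by
    have e1 := h1 v
    have e2 := lb' v; rw [h2] at e2
    have e3 : (2 : ℂ) • prod a l v = (2 : ℂ) • q' • Ω v := by
      rw [two_smul]; nth_rw 1 [e1]; rw [e2]; module
    exact smul_right_injective V two_ne_zero e3
  have hq' : ‖q'‖ = 1 := by
    have := h.norm_prod l v₀; rw [h3, norm_smul, wn] at this
    exact mul_right_cancel₀ (norm_ne_zero_iff.2 hv₀) (this.trans (one_mul _).symm)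
  rw [h3, h3, map_smul, ← smul_sub, norm_smul, hq', one_mul] at hlv
  have e1 : e (W v) = q • (Ω (W v) - W (Ω v)) := by
    have : W (e v) = 0 := by rw [hv, map_zero]
    rw [← sub_zero (e (W v)), ← this, hpq, hpq, map_add, map_smul, map_smul]
    module
  rw [e1, norm_smul, hqn]; nlinarith [abs_nonneg μ]

end IsSpinModule

end CliffordModules

section LimitAtInfinity

variable {d : ℕ} {G : Type*} [NormedAddCommGroup G] [NormedSpace ℝ G]

lemma inversion_ne_zero {x : Space d} (hx : x ≠ 0) :
    EuclideanGeometry.inversion (0 : Space d) 1 x ≠ 0 :=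
  mt (EuclideanGeometry.inversion_eq_center one_ne_zero).1 hx

lemma norm_inversion (x : Space d) : ‖EuclideanGeometry.inversion (0 : Space d) 1 x‖ = 1 / ‖x‖ := by
  have := EuclideanGeometry.dist_inversion_center (0 : Space d) x 1; simpa using this

lemma norm_sub_le_of_inversion {V : Space d → G} (hV : ContDiffOn ℝ ∞ V {0}ᶜ) {C : ℝ}
    (hC : ∀ x ≠ 0, ‖fderiv ℝ V x‖ ≤ C / ‖x‖ ^ 2) {y z : Space d} (hyz : (0 : Space d) ∉ segment ℝ y z) :
    ‖V (EuclideanGeometry.inversion 0 1 z) - V (EuclideanGeometry.inversion 0 1 y)‖ ≤ C * ‖z - y‖ := by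
  refine (convex_segment y z).norm_image_sub_le_of_norm_hasFDerivWithin_le (𝕜 := ℝ)
    (f := fun x => V (EuclideanGeometry.inversion 0 1 x)) (fun x hx => ?_) (fun x hx => ?_)
    (left_mem_segment ℝ y z) (right_mem_segment ℝ y z) (f' := fun x =>
      (fderiv ℝ V (EuclideanGeometry.inversion 0 1 x)).comp
        ((1 / dist x 0) ^ 2 • ((ℝ ∙ (x - 0))ᗮ.reflection : Space d →L[ℝ] Space d)))
  all_goals have hx0 : x ≠ 0 := by rintro rfl; exact hyz hx
  all_goals have hi := inversion_ne_zero hx0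
  · exact ((((hV.contDiffAt (compl_singleton_mem_nhds hi)).differentiableAt
      (by simp)).hasFDerivAt).comp x (EuclideanGeometry.hasFDerivAt_inversion hx0)).hasFDerivWithinAt
  · have hx' : 0 < ‖x‖ := norm_pos_iff.2 hx0
    have h1 := hC _ hi; rw [norm_inversion] at h1
    have hr : ‖((ℝ ∙ (x - 0))ᗮ.reflection : Space d →L[ℝ] Space d)‖ ≤ 1 :=
      ContinuousLinearMap.opNorm_le_bound _ zero_le_one fun v => by simp
    refine (ContinuousLinearMap.opNorm_comp_le _ _).trans ?_
    rw [norm_smul, dist_zero_right, norm_of_nonneg (by positivity)]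
    calc _ ≤ C / (1 / ‖x‖) ^ 2 * ((1 / ‖x‖) ^ 2 * 1) := by
          refine mul_le_mul h1 ?_ (by positivity) ((norm_nonneg _).trans h1)
          gcongr
      _ = C := by field_simp

lemma zero_notMem_segment {y z : Space d} (hy : y ≠ 0) (hz : z ∉ Submodule.span ℝ {y}) :
    (0 : Space d) ∉ segment ℝ y z := by
  rintro ⟨s, t, hs, ht, hst, h⟩
  rcases eq_or_ne t 0 with rfl | ht0
  · rw [add_zero] at hst; rw [zero_smul, add_zero, hst, one_smul] at h; exact hy h
  · refine hz (Submodule.mem_span_singleton.2 ⟨-(s / t), ?_⟩)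
    have h2 : z = t⁻¹ • (t • z) := by rw [smul_smul, inv_mul_cancel₀ ht0, one_smul]
    rw [h2, eq_neg_of_add_eq_zero_right h, smul_neg, smul_smul, neg_smul, div_eq_inv_mul]

lemma exists_limit_at_infinity [CompleteSpace G] (hd : 2 ≤ d) {V : Space d → G}
    (hV : ContDiffOn ℝ ∞ V {0}ᶜ) {C : ℝ} (hC : ∀ x ≠ 0, ‖fderiv ℝ V x‖ ≤ C / ‖x‖ ^ 2) :
    ∃ L : G, ∀ x ≠ 0, ‖V x - L‖ ≤ C / ‖x‖ := by
  set I : Space d → Space d := EuclideanGeometry.inversion 0 1 with hI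
  have hray : ∀ y : Space d, y ≠ 0 → ∀ s t : ℝ, 0 < s → 0 < t →
      ‖V (I (t • y)) - V (I (s • y))‖ ≤ C * ‖y‖ * |t - s| := by
    intro y hy s t hs ht
    refine (norm_sub_le_of_inversion hV hC ?_).trans (le_of_eq ?_)
    · rintro ⟨p, q, hp, hq, hpq, h⟩
      rw [smul_smul, smul_smul, ← add_smul, smul_eq_zero, or_iff_left hy] at h
      have h1 : p * s = 0 := by nlinarith [mul_nonneg hp hs.le, mul_nonneg hq ht.le]
      have h2 : q * t = 0 := by nlinarith [mul_nonneg hp hs.le, mul_nonneg hq ht.le]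
      rw [(mul_eq_zero.1 h1).resolve_right hs.ne', (mul_eq_zero.1 h2).resolve_right ht.ne'] at hpq
      norm_num at hpq
    · rw [← sub_smul, norm_smul, norm_eq_abs]; ring
  have hu : Tendsto (fun n : ℕ => ε[n]) atTop (𝓝 0) := tendsto_one_div_add_atTop_nhds_zero_nat
  have hlim : ∀ y : Space d, y ≠ 0 → ∃ L, Tendsto (fun n : ℕ => V (I (ε[n] • y))) atTop (𝓝 L) := by
    intro y hy
    refine cauchySeq_tendsto_of_complete (cauchySeq_of_le_tendsto_0
      (fun N : ℕ => |C * ‖y‖| * (1 / ((N : ℝ) + 1))) (fun n m N hn hm => ?_) (by simpa using hu.const_mul _))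
    rw [dist_eq_norm]
    refine (hray y hy _ _ (by positivity) (by positivity)).trans
      (mul_le_mul (le_abs_self _) ?_ (abs_nonneg _) (abs_nonneg _))
    have h1 := one_div_le_one_div_of_le (by positivity) (by gcongr : (N : ℝ) + 1 ≤ n + 1)
    have h2 := one_div_le_one_div_of_le (by positivity) (by gcongr : (N : ℝ) + 1 ≤ m + 1)
    have h3 : 0 < ε[n] := by positivity
    have h4 : 0 < 1 / ((m : ℝ) + 1) := by positivity
    exact abs_le.2 ⟨by linarith, by linarith⟩
  choose! L hL using hlim
  have hdir : ∀ y z : Space d, y ≠ 0 → z ∉ Submodule.span ℝ {y} → L y = L z := by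
    intro y z hy hz
    have hz0 : z ≠ 0 := by rintro rfl; exact hz (Submodule.zero_mem _)
    have hb : ∀ n : ℕ, ‖V (I (ε[n] • z)) - V (I (ε[n] • y))‖ ≤ C * ‖z - y‖ * ε[n] := by
      intro n
      have hn : (0 : ℝ) < ε[n] := by positivity
      refine (norm_sub_le_of_inversion hV hC ?_).trans (le_of_eq ?_)
      · rintro ⟨p, q, hp, hq, hpq, h⟩
        refine zero_notMem_segment hy hz ⟨p, q, hp, hq, hpq, ?_⟩
        rw [smul_comm p, smul_comm q, ← smul_add] at h
        exact (smul_eq_zero.1 h).resolve_left hn.ne'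
      · rw [← smul_sub, norm_smul, norm_of_nonneg hn.le]; ring
    have h0 := squeeze_zero_norm hb (by simpa using hu.const_mul (C * ‖z - y‖))
    exact (sub_eq_zero.1 (tendsto_nhds_unique ((hL z hz0).sub (hL y hy)) h0)).symm
  have hex : ∀ y : Space d, ∃ p, p ∉ Submodule.span ℝ {y} := by
    intro y
    by_contra hne
    push Not at hne
    have h1 := finrank_span_le_card (R := ℝ) ({y} : Set (Space d))
    rw [(Submodule.eq_top_iff'.2 hne), finrank_top, finrank_euclideanSpace_fin] at h1
    simp at h1
    lia
  have hconst : ∀ y z : Space d, y ≠ 0 → z ≠ 0 → L y = L z := by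
    intro y z hy hz
    by_cases h : z ∈ Submodule.span ℝ {y}
    · obtain ⟨p, hp⟩ := hex y
      rw [hdir y p hy hp, hdir z p hz fun h' => hp
        (Submodule.span_le.2 (Set.singleton_subset_iff.2 h) h')]
    · exact hdir y z hy h
  obtain ⟨y₀, hy₀⟩ := hex 0
  have hy₀' : y₀ ≠ 0 := by rintro rfl; exact hy₀ (Submodule.zero_mem _)
  refine ⟨L y₀, fun x hx => ?_⟩
  have hIx : I x ≠ 0 := inversion_ne_zero hx; rw [← hconst (I x) y₀ hIx hy₀']
  have h1 : Tendsto (fun n : ℕ => ‖V x - V (I (ε[n] • I x))‖) atTop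
      (𝓝 ‖V x - L (I x)‖) := (tendsto_const_nhds.sub (hL _ hIx)).norm
  have h2 := (hu.const_sub 1).abs.const_mul (C * ‖I x‖)
  rw [sub_zero, abs_one, mul_one, norm_inversion, mul_one_div] at h2
  refine le_of_tendsto_of_tendsto' h1 h2 fun n => ?_
  have := hray (I x) hIx ε[n] 1 (by positivity) one_pos
  rwa [one_smul, hI, EuclideanGeometry.inversion_inversion _ one_ne_zero, ← hI, norm_inversion, mul_one_div] at this

end LimitAtInfinity

section SpinOperators

variable {d : ℕ}

/-- A matrix as a real linear operator on spinors. -/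
def spinOp (A : SpinMatrix d) : Spinor d →L[ℝ] Spinor d :=
  (Matrix.toEuclideanCLM (𝕜 := ℂ) A).restrictScalars ℝ

lemma spinOp_apply (A : SpinMatrix d) (v : Spinor d) : spinOp A v = Matrix.toEuclideanLin A v := rfl

lemma spinOp_mul (A B : SpinMatrix d) (v : Spinor d) : spinOp (A * B) v = spinOp A (spinOp B v) := by
  change Matrix.toEuclideanCLM (𝕜 := ℂ) (A * B) v = _; rw [map_mul]; rfl

lemma spinOp_add (A B : SpinMatrix d) (v : Spinor d) : spinOp (A + B) v = spinOp A v + spinOp B v := by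
  simp only [spinOp_apply, map_add, LinearMap.add_apply]

lemma spinOp_sub (A B : SpinMatrix d) (v : Spinor d) : spinOp (A - B) v = spinOp A v - spinOp B v := by
  simp only [spinOp_apply, map_sub, LinearMap.sub_apply]

lemma spinOp_smul (c : ℂ) (A : SpinMatrix d) (v : Spinor d) : spinOp (c • A) v = c • spinOp A v := by
  simp only [spinOp_apply, map_smul, LinearMap.smul_apply]

lemma spinOp_one (v : Spinor d) : spinOp 1 v = v := by
  change Matrix.toEuclideanCLM (𝕜 := ℂ) 1 v = _; rw [map_one]; rfl

lemma spinOp_map_smul (A : SpinMatrix d) (c : ℂ) (v : Spinor d) : spinOp A (c • v) = c • spinOp A v := by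
  simp only [spinOp_apply, map_smul]

lemma real_inner_eq_re (u v : Spinor d) : ⟪u, v⟫ = (inner ℂ u v : ℂ).re := by
  simp [PiLp.inner_apply, Complex.inner]

lemma inner_smul_I (u v : Spinor d) : ⟪Complex.I • u, v⟫ = -⟪u, Complex.I • v⟫ := by
  simp [real_inner_eq_re, inner_smul_left]

lemma nonpos_of_le_div_norm (hd : 0 < d) {r K : ℝ} (h : ∀ x : Space d, x ≠ 0 → r ≤ K / ‖x‖) : r ≤ 0 := by
  have h1 : ∀ n : ℕ, r ≤ K * ε[n] := fun n => by
    have hn : ‖((n : ℝ) + 1) • (coordVec (⟨0, hd⟩ : Fin d))‖ = n + 1 := by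
      rw [norm_smul, norm_of_nonneg (by positivity)]; simp [coordVec]
    refine (h (((n : ℝ) + 1) • coordVec ⟨0, hd⟩) (norm_pos_iff.1 (by rw [hn]; positivity))).trans ?_
    rw [hn, mul_one_div]
  exact ge_of_tendsto' (by simpa using tendsto_one_div_add_atTop_nhds_zero_nat.const_mul K) h1

lemma spinOp_symm {A : SpinMatrix d} (hA : A.IsHermitian) (u v : Spinor d) :
    ⟪spinOp A u, v⟫ = ⟪u, spinOp A v⟫ := by
  rw [real_inner_eq_re, real_inner_eq_re]
  exact congrArg Complex.re ((Matrix.isSymmetric_toEuclideanLin_iff.2 hA) u v)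

/-- The matrices as a function space of their entries act on spinors. -/
def spinOpCLM (d : ℕ) :
    (Fin (spinorDim d) → Fin (spinorDim d) → ℂ) →L[ℝ] (Spinor d →L[ℝ] Spinor d) :=
  LinearMap.toContinuousLinearMap
    { toFun := fun M => spinOp (Matrix.of M)
      map_add' := fun A B => ContinuousLinearMap.ext fun v => spinOp_add _ _ v
      map_smul' := fun c A => ContinuousLinearMap.ext fun v => by
        have := spinOp_smul (c : ℂ) (Matrix.of A) v; simpa using this }

lemma contDiffOn_spinOp {V : Space d → SpinMatrix d}
    (hV : ∀ i k, ContDiffOn ℝ ∞ (fun x => V x i k) {0}ᶜ) :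
    ContDiffOn ℝ ∞ (fun x => spinOp (V x)) {0}ᶜ :=
  (spinOpCLM d).contDiff.comp_contDiffOn (f := fun x i k => V x i k)
    (contDiffOn_pi.2 fun i => contDiffOn_pi.2 fun k => hV i k)

lemma fderiv_spinOp {V : Space d → SpinMatrix d}
    (hV : ∀ i k, ContDiffOn ℝ ∞ (fun x => V x i k) {0}ᶜ) {x : Space d} (hx : x ≠ 0) (j : Fin d) :
    fderiv ℝ (fun y => spinOp (V y)) x (coordVec j) = spinOp (gradMatrix V x j) := by
  have h1 : ∀ i k, HasFDerivAt (fun y => V y i k) (fderiv ℝ (fun y => V y i k) x) x := fun i k =>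
    (((hV i k).contDiffAt (compl_singleton_mem_nhds hx)).differentiableAt (by simp)).hasFDerivAt
  have h2 := (spinOpCLM d).hasFDerivAt.comp x
    (hasFDerivAt_pi.2 fun i => hasFDerivAt_pi.2 fun k => h1 i k)
  rw [show (fun y => spinOp (V y)) = spinOpCLM d ∘ fun y i k => V y i k from rfl, h2.fderiv]
  rfl

lemma norm_spinOp_le (A : SpinMatrix d) (v : Spinor d) : ‖spinOp A v‖ ≤ opNorm A * ‖v‖ :=
  (LinearMap.toContinuousLinearMap (Matrix.toEuclideanLin A)).le_opNorm v

lemma norm_tuple_sq (B : Fin d → SpinMatrix d) (v : Spinor d) :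
    ‖Matrix.toEuclideanLin (Matrix.of fun (p : Fin d × Fin (spinorDim d)) k => B p.1 p.2 k) v‖ ^ 2 =
      ∑ j, ‖spinOp (B j) v‖ ^ 2 := by
  rw [EuclideanSpace.norm_sq_eq, Fintype.sum_prod_type]
  refine sum_congr rfl fun j _ => ?_
  rw [EuclideanSpace.norm_sq_eq]; rfl

lemma sum_norm_sq_le_tupleNorm (B : Fin d → SpinMatrix d) (v : Spinor d) :
    ∑ j, ‖spinOp (B j) v‖ ^ 2 ≤ (tupleNorm B * ‖v‖) ^ 2 := by
  rw [← norm_tuple_sq]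
  exact pow_le_pow_left₀ (norm_nonneg _) ((LinearMap.toContinuousLinearMap (Matrix.toEuclideanLin
    (Matrix.of fun (p : Fin d × Fin (spinorDim d)) k => B p.1 p.2 k))).le_opNorm v) 2

lemma tupleNorm_le {B : Fin d → SpinMatrix d} {K : ℝ} (hK : 0 ≤ K)
    (h : ∀ v, ∑ j, ‖spinOp (B j) v‖ ^ 2 ≤ (K * ‖v‖) ^ 2) : tupleNorm B ≤ K :=
  ContinuousLinearMap.opNorm_le_bound _ hK fun v => abs_le_of_sq_le_sq'
    ((norm_tuple_sq B v).trans_le (h v)) (by positivity) |>.2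

namespace IsDiracMatrices

variable {d : ℕ} {α : Fin d → SpinMatrix d} {β : SpinMatrix d}

lemma spinOp_anticomm (h : IsDiracMatrices α β) (j k : Fin d) (v : Spinor d) :
    spinOp (α j) (spinOp (α k) v) + spinOp (α k) (spinOp (α j) v) = if j = k then (2 : ℝ) • v else 0 := by
  rw [← spinOp_mul, ← spinOp_mul, ← spinOp_add, h.anticomm]
  split_ifs
  · have := spinOp_add 1 1 v; rwa [one_add_one_eq_two, spinOp_one, ← two_smul ℝ v] at this
  · simp [spinOp_apply]

lemma norm_spinOp (h : IsDiracMatrices α β) (j : Fin d) (v : Spinor d) : ‖spinOp (α j) v‖ = ‖v‖ := by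
  have h1 := h.spinOp_anticomm j j v; rw [if_pos rfl, ← two_smul ℝ] at h1
  rw [← sq_eq_sq₀ (norm_nonneg _) (norm_nonneg _), ← real_inner_self_eq_norm_sq,
    spinOp_symm (h.hermitian_alpha j), smul_right_injective _ (two_ne_zero) h1, real_inner_self_eq_norm_sq]

/-- The skew generators `-i α_j`. -/
def skew (α : Fin d → SpinMatrix d) (j : Fin d) : Spinor d →L[ℝ] Spinor d := spinOp (-Complex.I • α j)

lemma skew_apply (j : Fin d) (v : Spinor d) : skew α j v = -(Complex.I • spinOp (α j) v) := by
  rw [skew, spinOp_smul, neg_smul]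

lemma norm_skew (h : IsDiracMatrices α β) (j : Fin d) (v : Spinor d) : ‖skew α j v‖ = ‖v‖ := by
  rw [skew_apply, norm_neg, norm_smul, Complex.norm_I, one_mul, h.norm_spinOp]

lemma isClifford (h : IsDiracMatrices α β) : IsClifford (skew α) where
  skew j x y := by
    rw [skew_apply, skew_apply, inner_neg_left, inner_neg_right, inner_smul_I,
      spinOp_symm (h.hermitian_alpha j), spinOp_map_smul]
  anticomm j k x := by
    have := h.spinOp_anticomm j k x
    simp only [skew_apply, map_neg, spinOp_map_smul, neg_neg, smul_smul, Complex.I_mul_I,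
      neg_smul, one_smul, ← neg_add, this]
    split_ifs <;> simp

lemma isSpinModule (h : IsDiracMatrices α β) : IsSpinModule
    (fun j => (Matrix.toEuclideanLin (α j) : Module.End ℂ (Spinor d))) (Matrix.toEuclideanLin β) where
  anticomm i j := by
    ext1 v
    refine (h.spinOp_anticomm i j v).trans ?_
    split_ifs
    · have : (1 + 1 : Module.End ℂ (Spinor d)) v = v + v := rfl
      rwa [one_add_one_eq_two, ← two_smul ℝ v, eq_comm] at this
    · rfl
  anticomm_right i := by
    ext1 v
    refine ((spinOp_mul (α i) β v).symm ▸ (spinOp_mul β (α i) v).symm ▸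
      (spinOp_add (α i * β) (β * α i) v).symm).trans ?_
    rw [h.anticomm_beta]; simp [spinOp_apply]
  sq := by ext1 v; exact (spinOp_mul β β v).symm.trans (by rw [h.beta_sq, spinOp_one]; rfl)
  norm i v := h.norm_spinOp i v
  finrank := by simp

lemma smul_I_skew (j : Fin d) (v : Spinor d) : Complex.I • skew α j v = skew α j (Complex.I • v) :=
  (spinOp_map_smul _ _ _).symm

end IsDiracMatrices

variable {α : Fin d → SpinMatrix d} {β : SpinMatrix d} {V : Space d → SpinMatrix d} {C₁ C₂ : ℝ}
  {L : Spinor d →L[ℝ] Spinor d}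

lemma spinOp_matrixComm (A B : SpinMatrix d) (v : Spinor d) :
    spinOp (matrixComm A B) v = spinOp A (spinOp B v) - spinOp B (spinOp A v) := by
  rw [matrixComm, spinOp_sub, spinOp_mul, spinOp_mul]

lemma norm_gradMatrix_le {x : Space d} {K : ℝ} (h : tupleNorm (gradMatrix V x) ≤ K) (v : Spinor d) :
    ∑ j, ‖spinOp (gradMatrix V x j) v‖ ^ 2 ≤ (K * ‖v‖) ^ 2 :=
  (sum_norm_sq_le_tupleNorm _ v).trans (pow_le_pow_left₀
    (mul_nonneg (norm_nonneg _) (norm_nonneg _)) (mul_le_mul_of_nonneg_right h (norm_nonneg _)) 2)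

lemma norm_fderiv_spinOp_le (hV : ∀ i k, ContDiffOn ℝ ∞ (fun x => V x i k) {0}ᶜ) {x : Space d}
    (hx : x ≠ 0) {K : ℝ} (h : tupleNorm (gradMatrix V x) ≤ K) :
    ‖fderiv ℝ (fun y => spinOp (V y)) x‖ ≤ K := by
  have hK : 0 ≤ K := (norm_nonneg _).trans h
  refine ContinuousLinearMap.opNorm_le_bound _ hK fun u =>
    ContinuousLinearMap.opNorm_le_bound _ (by positivity) fun v => ?_
  have e : fderiv ℝ (fun y => spinOp (V y)) x u v = ∑ j, u j • spinOp (gradMatrix V x j) v := by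
    conv_lhs => rw [← sum_coordVec u]
    simp only [map_sum, map_smul, fderiv_spinOp hV hx, sum_apply, FunLike.coe_smul, Pi.smul_apply]
  have h1 : ∑ j, |u j| * ‖spinOp (gradMatrix V x j) v‖ ≤
      √(∑ j, |u j| ^ 2) * √(∑ j, ‖spinOp (gradMatrix V x j) v‖ ^ 2) :=
    sum_mul_le_sqrt_mul_sqrt _ _ _
  rw [e]
  refine (norm_sum_le _ _).trans ?_
  simp only [norm_smul, norm_eq_abs]
  refine h1.trans ?_
  have h2 : √(∑ j, |u j| ^ 2) = ‖u‖ := by simp [EuclideanSpace.norm_eq]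
  rw [h2, mul_comm K, mul_assoc]; gcongr
  exact Real.sqrt_le_iff.2 ⟨by positivity, norm_gradMatrix_le h v⟩

lemma limit_commutes (hd : 0 < d) (hL : ∀ x ≠ 0, ‖spinOp (V x) - L‖ ≤ C₁ / ‖x‖) {K : ℝ}
    {A : Spinor d →L[ℝ] Spinor d}
    (hA : ∀ x ≠ 0, ∀ v, ‖spinOp (V x) (A v) - A (spinOp (V x) v)‖ ≤ K / ‖x‖ * ‖v‖) (v : Spinor d) :
    L (A v) = A (L v) := by
  have hb : ∀ x ≠ 0, ∀ u, ‖spinOp (V x) u - L u‖ ≤ C₁ / ‖x‖ * ‖u‖ := fun x hx u =>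
    ((spinOp (V x) - L).le_opNorm u).trans (by gcongr; exact hL x hx)
  rw [← sub_eq_zero, ← norm_le_zero_iff]
  refine nonpos_of_le_div_norm hd (K := K * ‖v‖ + C₁ * ‖A v‖ + ‖A‖ * (C₁ * ‖v‖)) fun x hx => ?_
  have e : L (A v) - A (L v) = (spinOp (V x) (A v) - A (spinOp (V x) v)) -
      (spinOp (V x) (A v) - L (A v)) + A (spinOp (V x) v - L v) := by rw [map_sub]; abel
  rw [e]
  refine (norm_add_le _ _).trans ((add_le_add ((norm_sub_le _ _).trans
    (add_le_add (hA x hx v) (hb x hx _))) ((A.le_opNorm _).trans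
    (mul_le_mul_of_nonneg_left (hb x hx v) (norm_nonneg _)))).trans (le_of_eq ?_))
  ring

lemma exists_spinOp_limit (hd : 2 ≤ d) (hV : ∀ i k, ContDiffOn ℝ ∞ (fun x => V x i k) {0}ᶜ)
    (hH : ∀ x, (V x).IsHermitian)
    (hgrad : ∀ x, x ≠ 0 → tupleNorm (gradMatrix V x) ≤ C₁ / ‖x‖ ^ 2)
    (hcomm : ∀ x, x ≠ 0 → ∀ j, opNorm (matrixComm (α j) (V x)) ≤ C₂ / ‖x‖) :
    ∃ L : Spinor d →L[ℝ] Spinor d, IsDecaying (fun x => spinOp (V x) - L) C₁ ∧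
      (∀ u v, ⟪L u, v⟫ = ⟪u, L v⟫) ∧ (∀ (c : ℂ) v, L (c • v) = c • L v) ∧
      ∀ j v, L (spinOp (α j) v) = spinOp (α j) (L v) := by
  have hd0 : 0 < d := by lia
  have hg := fun x hx => norm_fderiv_spinOp_le hV hx (hgrad x hx)
  obtain ⟨L, hL⟩ := exists_limit_at_infinity hd (contDiffOn_spinOp hV) hg
  have hI : ∀ v, L (Complex.I • v) = Complex.I • L v := fun v => by
    have := limit_commutes hd0 hL (K := 0) (A := spinOp (Complex.I • 1)) (fun x hx v => by
      simp only [spinOp_smul, spinOp_one, spinOp_map_smul]; simp) v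
    simpa only [spinOp_smul, spinOp_one] using this
  have hsymm : ∀ u v, ⟪L u, v⟫ = ⟪u, L v⟫ := by
    intro u v; rw [← sub_eq_zero, ← abs_nonpos_iff]
    refine nonpos_of_le_div_norm hd0 (K := C₁ * ‖u‖ * ‖v‖ + ‖u‖ * (C₁ * ‖v‖)) fun x hx => ?_
    have hb : ∀ u, ‖spinOp (V x) u - L u‖ ≤ C₁ / ‖x‖ * ‖u‖ := fun u =>
      ((spinOp (V x) - L).le_opNorm u).trans (by gcongr; exact hL x hx)
    have e : ⟪L u, v⟫ - ⟪u, L v⟫ = ⟪u, spinOp (V x) v - L v⟫ - ⟪spinOp (V x) u - L u, v⟫ := by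
      rw [inner_sub_left, inner_sub_right, spinOp_symm (hH x)]; ring
    rw [e]
    refine (abs_sub _ _).trans ((add_le_add ((abs_real_inner_le_norm _ _).trans
      (mul_le_mul_of_nonneg_left (hb v) (norm_nonneg _))) ((abs_real_inner_le_norm _ _).trans
      (mul_le_mul_of_nonneg_right (hb u) (norm_nonneg _)))).trans (le_of_eq ?_))
    ring
  refine ⟨L, ⟨(contDiffOn_spinOp hV).sub contDiffOn_const, fun x u v => ?_, hL, fun x hx => ?_⟩, hsymm,
    fun c v => ?_, fun j v => ?_⟩
  · rw [sub_apply, sub_apply, inner_sub_left, inner_sub_right, spinOp_symm (hH x), hsymm]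
  · have hx' : 0 < ‖x‖ := norm_pos_iff.2 hx; rw [rd, fderiv_sub_const]
    refine (ContinuousLinearMap.le_opNorm _ _).trans
      ((mul_le_mul_of_nonneg_right (hg x hx) hx'.le).trans (le_of_eq ?_))
    field_simp
  · have e : ∀ w : Spinor d, c • w = c.re • w + c.im • Complex.I • w := fun w => by
      rw [← Complex.coe_smul c.re, ← Complex.coe_smul c.im, smul_smul, ← add_smul, Complex.re_add_im]
    rw [e, e, map_add, map_smul, map_smul, hI]
  · refine limit_commutes hd0 hL (K := C₂) (fun x hx v => ?_) v
    rw [norm_sub_rev, ← spinOp_matrixComm]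
    exact (norm_spinOp_le _ v).trans (by gcongr; exact hcomm x hx j)

/-- Data of a Dirac equation with a potential tending to the operator `L`. -/
structure IsDiracSolution (α : Fin d → SpinMatrix d) (V : Space d → SpinMatrix d) (C₁ : ℝ)
    (L : Spinor d →L[ℝ] Spinor d) (E : ℝ) (w : ℕ → Space d → Spinor d) (ψ : Space d → Spinor d)
    (g : Fin d → Space d → Spinor d) : Prop where
  decaying : IsDecaying (fun x => spinOp (V x) - L) C₁
  symm : ∀ u v, ⟪L u, v⟫ = ⟪u, L v⟫
  map_smul : ∀ (c : ℂ) v, L (c • v) = c • L v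
  comm : ∀ j v, L (spinOp (α j) v) = spinOp (α j) (L v)
  approx : H1Approx w ψ g
  eqn : ∀ᵐ x, diracG (IsDiracMatrices.skew α) g x = E • ψ x - spinOp (V x) (ψ x)
  dim : 3 ≤ d
  pos : 0 ≤ C₁

namespace IsDiracSolution

variable {E : ℝ} {w : ℕ → Space d → Spinor d} {ψ : Space d → Spinor d}
  {g : Fin d → Space d → Spinor d}

/-- The limit of `E - V` as a complex linear operator. -/
def limitOp (_ : IsDiracSolution α V C₁ L E w ψ g) : Module.End ℂ (Spinor d) where
  toFun v := E • v - L v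
  map_add' u v := by rw [smul_add, map_add]; abel
  map_smul' c v := by rename_i h; rw [h.map_smul, smul_comm E c, ← smul_sub]; rfl

variable (h : IsDiracSolution α V C₁ L E w ψ g)

include h

lemma limitOp_apply (v : Spinor d) : h.limitOp v = E • v - L v := rfl

lemma limitOp_inner (u v : Spinor d) : ⟪h.limitOp u, v⟫ = ⟪u, h.limitOp v⟫ := by
  simp only [limitOp_apply, inner_sub_left, inner_sub_right, h.symm, real_inner_smul_left,
    real_inner_smul_right]

lemma limitOp_inner_complex (u v : Spinor d) :
    inner ℂ (h.limitOp u) v = inner ℂ u (h.limitOp v) := by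
  have h1 := h.limitOp_inner u v
  have h2 := h.limitOp_inner (Complex.I • u) v
  rw [real_inner_eq_re, real_inner_eq_re] at h1
  rw [_root_.map_smul, real_inner_eq_re, real_inner_eq_re, inner_smul_left, inner_smul_left] at h2
  refine Complex.ext h1 ?_
  simpa using h2

lemma limitOp_comm (j : Fin d) (v : Spinor d) :
    h.limitOp (spinOp (α j) v) = spinOp (α j) (h.limitOp v) := by
  simp only [limitOp_apply, h.comm, map_sub, _root_.map_smul]

lemma commutes_smul_limitOp (r : ℝ) : CommutesClifford
    (IsDiracMatrices.skew α) (r • LinearMap.toContinuousLinearMap (h.limitOp.restrictScalars ℝ)) where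
  symm u v := by
    have := h.limitOp_inner u v
    simp only [FunLike.coe_smul, Pi.smul_apply, real_inner_smul_left, real_inner_smul_right]
    exact congrArg (r * ·) this
  comm j u := by
    have : h.limitOp (IsDiracMatrices.skew α j u) = IsDiracMatrices.skew α j (h.limitOp u) := by
      rw [IsDiracMatrices.skew_apply, IsDiracMatrices.skew_apply, map_neg, _root_.map_smul, h.limitOp_comm]
    simp only [FunLike.coe_smul, Pi.smul_apply, _root_.map_smul]
    exact congrArg (r • ·) this

lemma eqn_limitOp : ∀ᵐ x,
    diracG (IsDiracMatrices.skew α) g x = h.limitOp (ψ x) - (spinOp (V x) - L) (ψ x) := by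
  filter_upwards [h.eqn] with x hx; rw [hx, limitOp_apply, sub_apply]; abel

lemma eq_zero_of_scalar (hα : IsDiracMatrices α β)
    (hC : C₁ / κ[d] < 1 / 2) {p : ℂ} (hp : h.limitOp = p • 1) : ψ =ᵐ[volume] 0 := by
  obtain ⟨v, hv⟩ := exists_ne (0 : Spinor d)
  have hp' : ∀ v, h.limitOp v = p • v := fun v => by rw [hp]; rfl
  have hre : (p.re : ℂ) = p := by
    have := h.limitOp_inner_complex v v
    rw [hp', inner_smul_left, inner_smul_right] at this
    exact Complex.conj_eq_iff_re.1 (mul_right_cancel₀ (inner_self_ne_zero.2 hv) this)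
  refine IsProjSolution.eq_zero_of_trivial (γ := IsDiracMatrices.skew α) (φ := w) (g := g)
    (Q := ContinuousLinearMap.id ℝ _) (μ := p.re)
    ⟨hα.isClifford, h.decaying, ⟨fun u v => rfl, fun j u => rfl⟩, fun v => rfl, h.approx, ?_, h.dim, h.pos⟩ hC
    fun a b x => by simp
  filter_upwards [h.eqn_limitOp] with x hx
  rw [hx, hp', ContinuousLinearMap.id_apply, ← Complex.coe_smul, hre]

end IsDiracSolution

variable {E : ℝ} {w : ℕ → Space d → Spinor d} {ψ : Space d → Spinor d}
  {g : Fin d → Space d → Spinor d}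

lemma sum_inv_sqrt_le (n : ℕ) : ∑ m ∈ Finset.range n, 1 / √((m : ℝ) + 1) ≤ 2 * √n := by
  induction n with
  | zero => simp
  | succ n ih =>
    rw [sum_range_succ]
    have h1 : 0 < √((n : ℝ) + 1) := Real.sqrt_pos.2 (by positivity)
    have h2 := sq_sqrt (by positivity : (0 : ℝ) ≤ n + 1)
    have h3 := sq_sqrt (by positivity : (0 : ℝ) ≤ n)
    have h4 : 1 / √((n : ℝ) + 1) ≤ 2 * √((n : ℝ) + 1) - 2 * √n := by
      rw [div_le_iff₀ h1]; nlinarith [sq_nonneg (√((n : ℝ) + 1) - √n)]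
    push_cast; linarith

lemma norm_sum_le_of_symm {F : Type*} [NormedAddCommGroup F] [InnerProductSpace ℝ F]
    {B : Fin d → F → F} (hBs : ∀ j u v, ⟪B j u, v⟫ = ⟪u, B j v⟫) {K : ℝ} (hK : 0 ≤ K)
    (hBn : ∀ v, ∑ j, ‖B j v‖ ^ 2 ≤ (K * ‖v‖) ^ 2) (a : Fin d → F) :
    ‖∑ j, B j (a j)‖ ≤ K * √(∑ j, ‖a j‖ ^ 2) := by
  set u := ∑ j, B j (a j) with hu
  have h1 : ‖u‖ ^ 2 ≤ K * ‖u‖ * √(∑ j, ‖a j‖ ^ 2) := by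
    rw [← real_inner_self_eq_norm_sq]
    conv_lhs => rw [hu, sum_inner]
    calc _ ≤ ∑ j, ‖a j‖ * ‖B j u‖ :=
          sum_le_sum fun j _ => by rw [hBs]; exact real_inner_le_norm _ _
      _ ≤ √(∑ j, ‖a j‖ ^ 2) * √(∑ j, ‖B j u‖ ^ 2) := sum_mul_le_sqrt_mul_sqrt _ _ _
      _ ≤ √(∑ j, ‖a j‖ ^ 2) * (K * ‖u‖) := by
          gcongr; exact Real.sqrt_le_iff.2 ⟨by positivity, hBn u⟩
      _ = _ := mul_comm _ _
  rcases (norm_nonneg u).eq_or_lt with h0 | h0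
  · rw [← h0]; positivity
  · refine le_of_mul_le_mul_right ?_ h0
    rw [← sq]; exact h1.trans (le_of_eq (by ring))

namespace IsDiracSolution

variable (h : IsDiracSolution α V C₁ L E w ψ g)

include h

lemma skew_comm_spinOp (x : Space d) (j : Fin d) (v : Spinor d) :
    IsDiracMatrices.skew α j ((spinOp (V x) - L) v) - (spinOp (V x) - L) (IsDiracMatrices.skew α j v) =
      -(Complex.I • spinOp (matrixComm (α j) (V x)) v) := by
  simp only [IsDiracMatrices.skew_apply, sub_apply, map_neg, map_sub, spinOp_map_smul, h.map_smul,
    h.comm, spinOp_matrixComm, smul_sub]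
  abel

lemma eq_zero_of_injective (hα : IsDiracMatrices α β)
    (hV : ∀ i k, ContDiffOn ℝ ∞ (fun x => V x i k) {0}ᶜ)
    (hgrad : ∀ x, x ≠ 0 → tupleNorm (gradMatrix V x) ≤ C₁ / ‖x‖ ^ 2) {τ : ℝ} (hτ : 0 ≤ τ) (hτ1 : τ < 1)
    (hcomm : ∀ x ≠ 0, ∀ v, ∑ j, ‖spinOp (matrixComm (α j) (V x)) v‖ ^ 2 ≤ (τ / ‖x‖ * ‖v‖) ^ 2)
    (hinj : Function.Injective h.limitOp) : ψ =ᵐ[volume] 0 := by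
  obtain ⟨K, hK, hanti⟩ := h.limitOp.exists_antilipschitzWith (LinearMap.ker_eq_bot.2 hinj)
  set e := LinearMap.toContinuousLinearMap (h.limitOp.restrictScalars ℝ) with he
  have hK' : (0 : ℝ) < K := hK
  have hinv : CommutesClifford (IsDiracMatrices.skew α) e := by
    simpa only [one_smul] using h.commutes_smul_limitOp 1
  have hpair : IsCarlemanPair (IsDiracMatrices.skew α) (fun x => spinOp (V x) - L) e C₁ τ (d * C₁) (1 / K) := by
    refine ⟨hα.isClifford, h.decaying, hinv, fun x hx a => ?_, fun x hx v => ?_, by positivity,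
      fun v => ?_, h.pos, hτ, hτ1, mul_nonneg (Nat.cast_nonneg d) h.pos⟩
    · set B : Fin d → Spinor d → Spinor d := fun j v =>
        IsDiracMatrices.skew α j ((spinOp (V x) - L) v) - (spinOp (V x) - L) (IsDiracMatrices.skew α j v) with hB
      have hBn : ∀ v, ∑ j, ‖B j v‖ ^ 2 ≤ (τ / ‖x‖ * ‖v‖) ^ 2 := fun v => by
        simpa only [hB, h.skew_comm_spinOp, norm_neg, norm_smul, Complex.norm_I, one_mul] using hcomm x hx v
      have hBs : ∀ j u v, ⟪B j u, v⟫ = ⟪u, B j v⟫ := fun j u v => by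
        simp only [hB, inner_sub_left, inner_sub_right, hα.isClifford.skew, h.decaying.symm x]
        ring
      exact norm_sum_le_of_symm hBs (by positivity) hBn a
    · rw [fderiv_sub_const]
      have hC := h.pos
      refine (norm_sum_le _ _).trans ((sum_le_card_nsmul _ _ (C₁ / ‖x‖ ^ 2 * ‖v‖) fun j _ => ?_).trans
        (le_of_eq ?_))
      · rw [hα.norm_skew, fderiv_spinOp hV hx]
        exact abs_le_of_sq_le_sq' ((single_le_sum (f := fun j => ‖spinOp (gradMatrix V x j) v‖ ^ 2)
          (fun _ _ => sq_nonneg _) (mem_univ j)).trans (norm_gradMatrix_le (hgrad x hx) v))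
          (by positivity) |>.2
      · simp; ring
    · have := hanti.le_mul_dist v 0
      rw [map_zero, dist_zero_right, dist_zero_right] at this
      rw [one_div_mul_eq_div, div_le_iff₀' hK']; exact this
  exact hpair.eq_zero (by have := h.dim; lia) h.approx h.eqn_limitOp

lemma eq_zero_of_odd (hα : IsDiracMatrices α β) (hodd : Odd d)
    (hV : ∀ i k, ContDiffOn ℝ ∞ (fun x => V x i k) {0}ᶜ)
    (hgrad : ∀ x, x ≠ 0 → tupleNorm (gradMatrix V x) ≤ C₁ / ‖x‖ ^ 2) (hC₂ : 0 ≤ C₂)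
    (hC : 2 * (C₁ / κ[d]) + C₂ < 1) {τ : ℝ} (hτ : 0 ≤ τ) (hτ1 : τ < 1)
    (hcomm : ∀ x ≠ 0, ∀ v, ∑ j, ‖spinOp (matrixComm (α j) (V x)) v‖ ^ 2 ≤ (τ / ‖x‖ * ‖v‖) ^ 2)
    {c : ℕ → ℝ} (hc : ∀ x ≠ 0, ∀ s : Finset (Fin d), s.Nonempty → ∀ v,
      ∃ j ∈ s, ‖spinOp (matrixComm (α j) (V x)) v‖ ≤ c s.card / ‖x‖ * ‖v‖)
    (hc0 : 0 ≤ (∑ m ∈ Finset.range d, c (m + 1)) / 2)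
    (hcd : (∑ m ∈ Finset.range d, c (m + 1)) / 2 ≤ d / 2 * C₂)
    (hcs : 7 ≤ d → (∑ m ∈ Finset.range d, c (m + 1)) / 2 ≤ √d * C₂) : ψ =ᵐ[volume] 0 := by
  have hdim : (3 : ℝ) ≤ d := by exact_mod_cast h.dim
  have ht : 0 ≤ C₁ / κ[d] := div_nonneg h.pos (by linarith)
  obtain ⟨p, hp⟩ | hinj | ⟨μ, hμ, hsq, hW⟩ := hα.isSpinModule.trichotomy hodd (e := h.limitOp)
    (fun i => LinearMap.ext (h.limitOp_comm i)) h.limitOp_inner_complex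
  · exact h.eq_zero_of_scalar hα (by linarith) hp
  · exact h.eq_zero_of_injective hα hV hgrad hτ hτ1 hcomm hinj
  have hQa : ∀ v, (μ⁻¹ • LinearMap.toContinuousLinearMap (h.limitOp.restrictScalars ℝ)) v =
    μ⁻¹ • h.limitOp v := fun v => rfl
  set Q := μ⁻¹ • LinearMap.toContinuousLinearMap (h.limitOp.restrictScalars ℝ) with hQ
  have hQQ : ∀ v, Q (Q v) = Q v := fun v => by
    rw [hQa, hQa, LinearMap.map_smul_of_tower, hsq, Complex.coe_smul, inv_smul_smul₀ hμ]
  have hQc := h.commutes_smul_limitOp μ⁻¹; rw [← hQ] at hQc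
  refine IsProjSolution.eq_zero (γ := IsDiracMatrices.skew α) (φ := w) (g := g) (Q := Q) (μ := μ)
    ⟨hα.isClifford, h.decaying, hQc, hQQ, h.approx, ?_, h.dim, h.pos⟩ hodd hC hC₂ hc0
    (fun x hx a b => ?_) hcd hcs
  · filter_upwards [h.eqn_limitOp] with x hx; rw [hx, hQa, smul_inv_smul₀ hμ]
  · have hker : h.limitOp (b - Q b) = 0 := by
      have : Q (b - Q b) = 0 := by rw [map_sub, hQQ, sub_self]
      rw [hQa] at this; exact (smul_eq_zero.1 this).resolve_left (inv_ne_zero hμ)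
    set W : Module.End ℂ (Spinor d) := Matrix.toEuclideanLin (V x) - (E • 1 - h.limitOp) with hWdef
    have e : ∀ u, W u = (spinOp (V x) - L) u := fun u => by
      change spinOp (V x) u - (E • u - (E • u - L u)) = _; rw [sub_sub_cancel]; rfl
    have h1 := hW W (fun m => c m / ‖x‖) (fun s hs v => by
      obtain ⟨j, hj, hb⟩ := hc x hx s hs v
      refine ⟨j, hj, le_trans (le_of_eq ?_) hb⟩
      rw [e, e]
      change ‖spinOp (α j) (spinOp (V x) v - L v) - (spinOp (V x) (spinOp (α j) v) - L (spinOp (α j) v))‖ = _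
      rw [spinOp_matrixComm, map_sub, h.comm]
      congr 1; abel) _ hker
    rw [e, ← Finset.sum_div] at h1; rw [← hQQ a, hQc.symm]
    refine (abs_real_inner_le_norm _ _).trans ?_
    rw [hQQ, mul_left_comm]; refine mul_le_mul_of_nonneg_left ?_ (norm_nonneg _)
    rw [hQa ((spinOp (V x) - L) _), norm_smul, norm_inv, norm_eq_abs, inv_mul_le_iff₀ (abs_pos.2 hμ)]
    exact h1.trans (le_of_eq (by ring))

/-- Absence of solutions of the Dirac equation. -/
theorem eq_zero (hα : IsDiracMatrices α β) (hV : ∀ i k, ContDiffOn ℝ ∞ (fun x => V x i k) {0}ᶜ)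
    (hgrad : ∀ x, x ≠ 0 → tupleNorm (gradMatrix V x) ≤ C₁ / ‖x‖ ^ 2) (hC₂ : 0 ≤ C₂)
    (hcomm : ∀ x, x ≠ 0 → ∀ j, opNorm (matrixComm (α j) (V x)) ≤ C₂ / ‖x‖)
    (hodd : Odd d → 5 ≤ d → HasScalarLimit V ∨
      ∀ x, x ≠ 0 → tupleNorm (fun j => matrixComm (α j) (V x)) ≤ C₂ / ‖x‖)
    (hlt : 4 * C₁ / ((d : ℝ) - 2) + C₂ < 1) : ψ =ᵐ[volume] 0 := by
  have hdim : (3 : ℝ) ≤ d := by exact_mod_cast h.dim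
  have hC1 := h.pos
  have ht : 0 ≤ C₁ / κ[d] := div_nonneg h.pos (by linarith)
  have hC : 2 * (C₁ / κ[d]) + C₂ < 1 := by
    refine lt_of_eq_of_lt ?_ hlt
    have : (d : ℝ) - 2 ≠ 0 := by linarith
    field_simp; ring
  have hC' : C₁ / κ[d] < 1 / 2 := by linarith
  have hone : ∀ x ≠ 0, ∀ j v, ‖spinOp (matrixComm (α j) (V x)) v‖ ≤ C₂ / ‖x‖ * ‖v‖ := fun x hx j v =>
    (norm_spinOp_le _ v).trans (by gcongr; exact hcomm x hx j)
  rcases Nat.even_or_odd d with he | ho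
  · obtain ⟨p, hp⟩ := hα.isSpinModule.eq_smul_of_even he (X := h.limitOp)
      (fun i => LinearMap.ext (h.limitOp_comm i))
    exact h.eq_zero_of_scalar hα hC' hp
  rcases lt_or_ge d 5 with h5 | h5
  · obtain rfl : d = 3 := by have := h.dim; obtain ⟨k, rfl⟩ := ho; lia
    have hWb : ∀ x ≠ 0, ∀ v, ‖(spinOp (V x) - L) v‖ ≤ C₁ / ‖x‖ * ‖v‖ := fun x hx v =>
      ((spinOp (V x) - L).le_opNorm v).trans (by gcongr; exact h.decaying.bound x hx)
    have htwo : ∀ x ≠ 0, ∀ j v, ‖spinOp (matrixComm (α j) (V x)) v‖ ≤ 2 * C₁ / ‖x‖ * ‖v‖ := by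
      intro x hx j v
      have e := congrArg norm (h.skew_comm_spinOp x j v)
      rw [norm_neg, norm_smul, Complex.norm_I, one_mul] at e; rw [← e]
      refine (norm_sub_le _ _).trans ?_
      have h1 := hWb x hx (IsDiracMatrices.skew α j v); rw [hα.norm_skew] at h1 ⊢
      exact (add_le_add (hWb x hx v) h1).trans (le_of_eq (by ring))
    set m := min C₂ (2 * C₁)
    have hm : 0 ≤ m := by positivity
    have hm1 : m < 1 / 3 := by
      have h1 : m ≤ C₂ := min_le_left _ _
      have h2 : m ≤ 2 * C₁ := min_le_right _ _; norm_num at hlt; linarith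
    refine h.eq_zero_of_odd hα ho hV hgrad hC₂ hC (τ := √3 * m) (c := fun _ => C₂) (by positivity)
      ?_ (fun x hx v => ?_) (fun x hx s hs v => ?_) ?_ ?_ (fun h7 => by lia)
    · have : √3 < 2 := by rw [Real.sqrt_lt' two_pos]; norm_num
      nlinarith
    · have hx' : 0 < ‖x‖ := norm_pos_iff.2 hx
      refine (sum_le_card_nsmul _ _ ((m / ‖x‖ * ‖v‖) ^ 2) fun j _ => ?_).trans (le_of_eq ?_)
      · refine pow_le_pow_left₀ (norm_nonneg _) ?_ 2
        rcases min_choice C₂ (2 * C₁) with e | e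
        · simp only [m, e]; exact hone x hx j v
        · simp only [m, e]; exact htwo x hx j v
      · have := sq_sqrt (by norm_num : (0 : ℝ) ≤ 3)
        simp only [card_univ, Fintype.card_fin, nsmul_eq_mul, mul_pow, div_pow, this]
        push_cast; ring
    · obtain ⟨j, hj⟩ := hs; exact ⟨j, hj, hone x hx j v⟩
    · simp only [sum_const]; positivity
    · simp; linarith
  rcases hodd ho h5 with ⟨c, hc⟩ | htup
  · have hT : Tendsto (fun x => spinOp (V x)) (cobounded (Space d)) (𝓝 (spinOp (c • 1))) :=
      ((spinOpCLM d).continuous.tendsto (fun i k => (c • (1 : SpinMatrix d)) i k)).comp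
        (tendsto_pi_nhds.2 fun i => tendsto_pi_nhds.2 fun k => hc i k)
    have hT' : Tendsto (fun x => spinOp (V x) - L) (cobounded (Space d)) (𝓝 0) := by
      refine squeeze_zero_norm' (a := fun x => C₁ / ‖x‖) ?_
        (tendsto_const_nhds.div_atTop tendsto_norm_cobounded_atTop)
      filter_upwards [eventually_ne_cobounded 0] with x hx using h.decaying.bound x hx
    have : Nontrivial (Space d) := ⟨coordVec ⟨0, by lia⟩, 0, fun h0 => by
      simpa [coordVec] using congrArg norm h0⟩
    have hL : spinOp (c • 1) - L = 0 := tendsto_nhds_unique (hT.sub_const L) hT'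
    refine h.eq_zero_of_scalar hα hC' (p := E - c) (LinearMap.ext fun v => ?_)
    rw [h.limitOp_apply, ← sub_eq_zero.1 hL, spinOp_smul, spinOp_one, ← Complex.coe_smul, ← sub_smul]
    rfl
  · have htup' : ∀ x ≠ 0, ∀ v, ∑ j, ‖spinOp (matrixComm (α j) (V x)) v‖ ^ 2 ≤ (C₂ / ‖x‖ * ‖v‖) ^ 2 :=
      fun x hx v => (sum_norm_sq_le_tupleNorm _ v).trans (pow_le_pow_left₀
        (mul_nonneg (norm_nonneg _) (norm_nonneg _))
        (mul_le_mul_of_nonneg_right (htup x hx) (norm_nonneg _)) 2)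
    have hs2 : (∑ m ∈ Finset.range d, C₂ / √((m + 1 : ℕ) : ℝ)) / 2 ≤ √d * C₂ := by
      have := mul_le_mul_of_nonneg_left (sum_inv_sqrt_le d) hC₂
      simp only [mul_sum, mul_one_div] at this; push_cast; linarith
    refine h.eq_zero_of_odd hα ho hV hgrad hC₂ hC (τ := C₂) (c := fun m => C₂ / √m) hC₂
      (by linarith) htup' (fun x hx s hs v => ?_) (by positivity) (hs2.trans ?_) (fun _ => hs2)
    · have hs0 : (0 : ℝ) < s.card := by exact_mod_cast hs.card_pos
      obtain ⟨j, hj, hb⟩ := Finset.exists_le_of_sum_le hs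
        (f := fun j => ‖spinOp (matrixComm (α j) (V x)) v‖ ^ 2)
        (g := fun _ => (C₂ / ‖x‖ * ‖v‖) ^ 2 / s.card) (by
          rw [sum_const, nsmul_eq_mul, mul_div_cancel₀ _ hs0.ne']
          exact (Finset.sum_le_univ_sum_of_nonneg fun _ => sq_nonneg _).trans (htup' x hx v))
      refine ⟨j, hj, abs_le_of_sq_le_sq' (hb.trans (le_of_eq ?_)) (by positivity) |>.2⟩
      have := sq_sqrt hs0.le; simp only [mul_pow, div_pow, this]; ring
    · refine mul_le_mul_of_nonneg_right ?_ hC₂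
      rw [sqrt_le_left (by positivity)]
      have : (5 : ℝ) ≤ d := by exact_mod_cast h5
      nlinarith

end IsDiracSolution

lemma diracExpr_eq (α : Fin d → SpinMatrix d) (β : SpinMatrix d) (V : Space d → SpinMatrix d)
    (ξ : Space d → Spinor d) (x : Space d) :
    diracExpr α β 0 V ξ x = dirac (IsDiracMatrices.skew α) ξ x + spinOp (V x) (ξ x) := by
  simp only [diracExpr, dirac, diracG, pd, IsDiracMatrices.skew, map_smul, LinearMap.smul_apply,
    smul_sum, spinOp_apply, Complex.ofReal_zero, zero_smul, add_zero]

lemma re_inner_L2 (f g : SpinorL2 d) : (inner ℂ f g : ℂ).re = ∫ x, ⟪f x, g x⟫ := by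
  rw [L2.inner_def]; simp only [real_inner_eq_re]
  exact (integral_re (L2.integrable_inner (𝕜 := ℂ) f g)).symm

lemma integral_inner_eq_sum {F : Type*} [NormedAddCommGroup F] [InnerProductSpace ℝ F]
    [FiniteDimensional ℝ F] {f ζ : Space d → F} (hf : MemLp f 2) (hζ : IsTest ζ) :
    ∫ x, ⟪f x, ζ x⟫ = ∑ i, inner ℝ (stdOrthonormalBasis ℝ F i)
      (∫ x, (⟪stdOrthonormalBasis ℝ F i, ζ x⟫ : ℝ) • f x) := by
  set b := stdOrthonormalBasis ℝ F
  have hi : ∀ i, Integrable (fun x => (⟪b i, ζ x⟫ : ℝ) • f x) := fun i =>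
    memLp_one_iff_integrable.1 (hf.smul ((hζ.clm (innerSL ℝ (b i))).memLp 2))
  simp only [← integral_inner (hi _)]
  rw [← integral_finsetSum _ fun i _ => (hi i).const_inner (b i)]
  refine integral_congr_ae (.of_forall fun x => ?_)
  simp only [real_inner_smul_right]; rw [← b.sum_inner_mul_inner]
  refine sum_congr rfl fun i _ => ?_
  rw [mul_comm, real_inner_comm (f x)]

lemma MemH1.exists_weak_pd {f : SpinorL2 d} (h : MemH1 f) : ∃ g : Fin d → SpinorL2 d,
    ∀ j (ξ : Space d → Spinor d), IsTest ξ → ∫ x, ⟪f x, pd j ξ x⟫ = -∫ x, ⟪g j x, ξ x⟫ := by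
  choose g hg using h; refine ⟨g, fun j ξ hξ => ?_⟩
  rw [integral_inner_eq_sum (Lp.memLp f) (hξ.pd j), integral_inner_eq_sum (Lp.memLp (g j)) hξ,
    ← sum_neg_distrib]
  refine sum_congr rfl fun i _ => ?_
  set b := stdOrthonormalBasis ℝ (Spinor d) i
  have hη : IsTest (fun x => (⟪b, ξ x⟫ : ℝ)) := hξ.clm (innerSL ℝ b)
  have e : ∀ x, fderiv ℝ (fun x => ((⟪b, ξ x⟫ : ℝ) : ℂ)) x (coordVec j) =
      ((⟪b, pd j ξ x⟫ : ℝ) : ℂ) := fun x =>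
    (pd_const_clm Complex.ofRealCLM j (hη.differentiable x)).trans
      (congrArg _ (pd_const_clm (innerSL ℝ b) j (hξ.differentiable x)))
  have := hg j _ (Complex.ofRealCLM.contDiff.comp hη.smooth) (hη.compact.comp_left Complex.ofReal_zero)
  simp only [Function.comp_def, Complex.ofRealCLM_apply, e, Complex.coe_smul] at this
  rw [this, inner_neg_right]

lemma H1Approx.memH1 {w : ℕ → Space d → Spinor d} {f : SpinorL2 d} {g : Fin d → Space d → Spinor d}
    (h : H1Approx w f g) : MemH1 f := by
  intro j
  have hm := (h.conv_pd j).memLp_lim; refine ⟨hm.toLp (g j), fun η hη hηc => ?_⟩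
  have ht : IsTest η := ⟨hη, hηc⟩
  have hi : ∀ {ζ : Space d → ℂ} (F : SpinorL2 d), IsTest ζ → Integrable (fun x => ζ x • F x) :=
    fun F hζ => memLp_one_iff_integrable.1 ((Lp.memLp F).smul (hζ.memLp 2))
  refine ext_inner_left ℝ fun v => ?_
  have hζ : IsTest (fun x => star (η x) • v) :=
    ht.clm (((ContinuousLinearMap.id ℝ ℂ).smulRight v).comp Complex.conjCLE.toContinuousLinearMap)
  have e : ∀ (c : ℂ) (u : Spinor d), ⟪v, c • u⟫ = ⟪u, star c • v⟫ := fun c u => by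
    rw [real_inner_comm, real_inner_eq_re, real_inner_eq_re, inner_smul_left, inner_smul_right]
    rfl
  have hi' : Integrable (fun x => fderiv ℝ η x (coordVec j) • f x) := hi f (ht.pd j)
  rw [inner_neg_right, ← integral_inner hi', ← integral_inner (hi _ ht)]; simp only [e]
  have h1 := h.integral_inner_pd hζ j
  have hp : ∀ x, pd j (fun x => star (η x) • v) x = star (fderiv ℝ η x (coordVec j)) • v := fun x =>
    pd_const_clm (((ContinuousLinearMap.id ℝ ℂ).smulRight v).comp
      Complex.conjCLE.toContinuousLinearMap) j (ht.differentiable x)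
  simp only [hp] at h1; rw [← neg_eq_iff_eq_neg.2 h1]
  congr 1
  refine integral_congr_ae ?_
  filter_upwards [hm.coeFn_toLp] with x hx; rw [hx]

lemma diracMinimal_graph (α : Fin d → SpinMatrix d) (β : SpinMatrix d) (V : Space d → SpinMatrix d) :
    (diracMinimal α β 0 V).graph = diracMinimalGraph α β 0 V :=
  Submodule.toLinearPMap_graph_eq _ fun p hp h0 => diracMinimalGraph_functional α β 0 V p hp h0

lemma ae_eq_zero_of_inner_test {F : Type*} [NormedAddCommGroup F] [InnerProductSpace ℝ F]
    [FiniteDimensional ℝ F] {f : Space d → F} (hf : MemLp f 2)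
    (h : ∀ ξ, IsTest ξ → ∫ x, ⟪f x, ξ x⟫ = 0) : f =ᵐ[volume] 0 :=
  eq_zero_of_inner_helmholtz hf fun _ hξ => h _ (hξ.sub hξ.lap)

namespace StationaryAssumption

lemma inner_test (h : StationaryAssumption α β 0 V) {z : ℂ}
    {ψ : (diracHamiltonian α β 0 V).domain} (hz : diracHamiltonian α β 0 V ψ = z • (ψ : SpinorL2 d))
    {ξ : Space d → Spinor d} (hξ : IsTest ξ) :
    ∫ x, ⟪(ψ : SpinorL2 d) x, diracExpr α β 0 V ξ x⟫ = ∫ x, ⟪z • (ψ : SpinorL2 d) x, ξ x⟫ := by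
  have hm := h.maps_test ξ ⟨hξ.1, hξ.2⟩
  have hmem : ((hξ.memLp 2).toLp ξ, hm.toLp _) ∈ (diracHamiltonian α β 0 V).graph := by
    refine LinearPMap.le_graph_of_le (LinearPMap.le_closure _) ?_
    rw [diracMinimal_graph]
    exact ⟨ξ, ⟨hξ.1, hξ.2⟩, (hξ.memLp 2).coeFn_toLp, hm.coeFn_toLp⟩
  obtain ⟨y, hy1, hy2⟩ := (LinearPMap.mem_graph_iff _).1 hmem
  have hself := LinearPMap.adjoint_isFormalAdjoint h.selfAdjoint.dense_domain
  rw [LinearPMap.isSelfAdjoint_def.1 h.selfAdjoint] at hself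
  have h1 := congrArg Complex.re (hself ψ y)
  rw [hz, hy1, hy2, re_inner_L2, re_inner_L2] at h1
  refine (integral_congr_ae ?_).trans (h1.symm.trans (integral_congr_ae ?_))
  · filter_upwards [hm.coeFn_toLp] with x hx; rw [hx]
  · filter_upwards [(hξ.memLp 2).coeFn_toLp, Lp.coeFn_smul z (ψ : SpinorL2 d)] with x hx hx'
    rw [hx, hx', Pi.smul_apply]

/-- Absence of eigenvalues for potentials with small gradient and small commutators. -/
theorem pointSpectrum_eq_empty (h : StationaryAssumption α β 0 V) (hd : 3 ≤ d)
    (hα : IsDiracMatrices α β) {C₁ C₂ : ℝ} (hC₁ : 0 ≤ C₁) (hC₂ : 0 ≤ C₂)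
    (hgrad : ∀ x, x ≠ 0 → tupleNorm (gradMatrix V x) ≤ C₁ / ‖x‖ ^ 2)
    (hcomm : ∀ x, x ≠ 0 → ∀ j, opNorm (matrixComm (α j) (V x)) ≤ C₂ / ‖x‖)
    (hodd : Odd d → 5 ≤ d → HasScalarLimit V ∨
      ∀ x, x ≠ 0 → tupleNorm (fun j => matrixComm (α j) (V x)) ≤ C₂ / ‖x‖)
    (hlt : 4 * C₁ / ((d : ℝ) - 2) + C₂ < 1) : pointSpectrum (diracHamiltonian α β 0 V) = ∅ := by
  refine Set.eq_empty_of_forall_notMem fun z => ?_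
  rintro ⟨ψ, hψ0, hz⟩
  set f : SpinorL2 d := ψ.1
  have hf := Lp.memLp f
  have hzr : ((z.re : ℝ) : ℂ) = z := by
    have hself := LinearPMap.adjoint_isFormalAdjoint h.selfAdjoint.dense_domain
    rw [LinearPMap.isSelfAdjoint_def.1 h.selfAdjoint] at hself
    have := hself ψ ψ; rw [hz, inner_smul_left, inner_smul_right] at this
    exact Complex.conj_eq_iff_re.1 (mul_right_cancel₀ (inner_self_ne_zero.2 hψ0) this)
  obtain ⟨G, hG⟩ := (h.domain_le f ψ.2).exists_weak_pd
  have hGm : ∀ j, MemLp (fun x => IsDiracMatrices.skew α j (G j x)) 2 := fun j =>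
    (IsDiracMatrices.skew α j).comp_memLp' (Lp.memLp (G j))
  have hu : MemLp (diracG (IsDiracMatrices.skew α) fun j => G j) 2 :=
    memLp_finsetSum _ fun j _ => hGm j
  obtain ⟨w, g, hw, -⟩ := exists_h1Approx hα.isClifford (J := spinOp (Complex.I • 1))
    (fun u v => by simp only [spinOp_smul, spinOp_one]; exact inner_smul_I u v)
    (fun v => by simp only [spinOp_smul, spinOp_one, smul_smul, Complex.I_mul_I, neg_smul, one_smul])
    (fun j v => by simp only [spinOp_smul, spinOp_one, IsDiracMatrices.smul_I_skew]) hf hu fun ξ hξ => by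
      simp only [dirac, diracG, inner_sum, sum_inner]
      rw [integral_finsetSum _ fun j _ => integrable_inner hf (((hξ.pd j).clm _).memLp 2),
        integral_finsetSum _ fun j _ => integrable_inner (hGm j) (hξ.memLp 2)]
      refine sum_congr rfl fun j _ => ?_
      have := hG j _ (hξ.clm (IsDiracMatrices.skew α j))
      simp only [pd_const_clm _ _ (hξ.differentiable _)] at this
      simp only [hα.isClifford.skew, integral_neg, this]
  obtain ⟨L, hL, hLs, hLc, hLα⟩ := exists_spinOp_limit (by lia) h.smooth h.hermitian hgrad hcomm
  have hWf := (memLp_apply_of_bound (by lia) (aesm_of_contDiffOn (by lia) hL.smooth)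
    hL.bound hf.1 (hw.memLp_inv_smul hd)).1
  have hVf : MemLp (fun x => spinOp (V x) (f x)) 2 := by
    refine (hWf.add (L.comp_memLp' hf)).ae_eq (.of_forall fun x => ?_)
    simp
  have hD := (hw.conv_dirac (IsDiracMatrices.skew α)).memLp_lim
  have heq : ∀ᵐ x, diracG (IsDiracMatrices.skew α) g x = z.re • f x - spinOp (V x) (f x) := by
    have := ae_eq_zero_of_inner_test ((hD.add hVf).sub (hf.const_smul z.re)) fun ξ hξ => by
      have i1 := integrable_inner hD (hξ.memLp 2)
      have i2 := integrable_inner hVf (hξ.memLp 2)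
      have i3 := integrable_inner (hf.const_smul z.re) (hξ.memLp 2)
      have h1 := h.inner_test hz hξ
      have i4 := integrable_inner hf ((hξ.dirac (IsDiracMatrices.skew α)).memLp 2)
      simp only [diracExpr_eq, inner_add_right, ← spinOp_symm (h.hermitian _)] at h1
      rw [integral_add i4 i2, ← hw.integral_inner_diracG hα.isClifford hξ] at h1
      simp only [Pi.add_apply, Pi.sub_apply, inner_add_left, inner_sub_left]
      rw [integral_sub (i1.fun_add i2) i3, integral_add i1 i2, h1, sub_eq_zero]
      refine integral_congr_ae (.of_forall fun x => ?_)
      change ⟪z • f x, _⟫ = ⟪z.re • f x, _⟫; rw [← Complex.coe_smul, hzr]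
    filter_upwards [this] with x hx; rw [eq_sub_iff_add_eq]; exact sub_eq_zero.1 hx
  have hsol : IsDiracSolution α V C₁ L z.re w f g := ⟨hL, hLs, hLc, hLα, hw, heq, hd, hC₁⟩
  exact hψ0 (Lp.ext ((hsol.eq_zero hα h.smooth hgrad hC₂ hcomm hodd hlt).trans
    (Lp.coeFn_zero _ _ _).symm))

end StationaryAssumption

end SpinOperators

section SelfAdjointCriterion

variable {E : Type*} [NormedAddCommGroup E] [InnerProductSpace ℂ E] [CompleteSpace E]

lemma mem_topologicalClosure_iff_of_dense {G : Submodule ℂ (E × E)}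
    (hs : ∀ p ∈ G, ∀ q ∈ G, inner ℂ q.2 p.1 = inner ℂ q.1 p.2)
    (hd : ∀ c : ℂ, c * c = -1 → ∀ h : E, (∀ q ∈ G, inner ℂ h (q.2 + c • q.1) = 0) → h = 0) (p : E × E) :
    p ∈ G.topologicalClosure ↔ ∀ q ∈ G, inner ℂ q.2 p.1 = inner ℂ q.1 p.2 := by
  have hcl : ∀ q : E × E, IsClosed {p : E × E | inner ℂ q.2 p.1 = inner ℂ q.1 p.2} := fun q =>
    isClosed_eq (by fun_prop) (by fun_prop)
  have h1 : ∀ p ∈ G.topologicalClosure, ∀ q ∈ G, inner ℂ q.2 p.1 = inner ℂ q.1 p.2 := fun p hp q hq =>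
    closure_minimal (fun p hp => hs p hp q hq) (hcl q) hp
  have h2 : ∀ p ∈ G.topologicalClosure, inner ℂ p.2 p.1 = inner ℂ p.1 p.2 := fun p hp => by
    have : ∀ q ∈ G, inner ℂ p.2 q.1 = inner ℂ p.1 q.2 := fun q hq => by
      rw [← inner_conj_symm, ← h1 p hp q hq, inner_conj_symm]
    exact closure_minimal this (hcl p) hp
  refine ⟨h1 p, fun hp => ?_⟩
  set Φ : E × E →L[ℂ] E := ContinuousLinearMap.snd ℂ E E + Complex.I • ContinuousLinearMap.fst ℂ E E
  have hΦ : ∀ q, Φ q = q.2 + Complex.I • q.1 := fun q => rfl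
  have hn : ∀ q ∈ G.topologicalClosure, ‖q‖ ≤ ‖Φ q‖ := by
    intro q hq
    have h0 : (inner ℂ q.2 (Complex.I • q.1) : ℂ).re = 0 := by
      have := congrArg Complex.im (h2 q hq)
      rw [← inner_conj_symm q.1 q.2, Complex.conj_im] at this
      rw [inner_smul_right, Complex.I_mul_re, neg_eq_zero]; linarith
    have h3 : ‖Φ q‖ ^ 2 = ‖q.2‖ ^ 2 + ‖q.1‖ ^ 2 := by
      rw [hΦ, norm_add_sq (𝕜 := ℂ), RCLike.re_eq_complex_re, h0, norm_smul, Complex.norm_I]; ring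
    exact max_le (abs_le_of_sq_le_sq' (by nlinarith [sq_nonneg ‖q.2‖]) (norm_nonneg _)).2
      (abs_le_of_sq_le_sq' (by nlinarith [sq_nonneg ‖q.1‖]) (norm_nonneg _)).2
  set R := G.topologicalClosure.map (Φ : E × E →ₗ[ℂ] E) with hR
  have hRc : IsClosed (R : Set E) := by
    have : CompleteSpace G.topologicalClosure := G.isClosed_topologicalClosure.completeSpace_coe
    have ha : AntilipschitzWith 1 (Φ.comp G.topologicalClosure.subtypeL) :=
      (Φ.comp G.topologicalClosure.subtypeL).antilipschitz_of_bound fun q => by simpa using hn q q.2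
    have := ha.isClosed_range (Φ.comp G.topologicalClosure.subtypeL).uniformContinuous
    rwa [show (R : Set E) = Set.range (Φ.comp G.topologicalClosure.subtypeL) from by
      rw [hR, Submodule.map_coe, Set.image_eq_range]; rfl]
  have : CompleteSpace R := hRc.completeSpace_coe
  have hRt : R = ⊤ := by
    rw [← Submodule.orthogonal_eq_bot_iff, Submodule.eq_bot_iff]
    refine fun h hh => hd Complex.I Complex.I_mul_I h fun q hq => ?_
    rw [← inner_conj_symm]
    exact (congrArg _ ((Submodule.mem_orthogonal _ _).1 hh _
      ⟨q, G.le_topologicalClosure hq, rfl⟩)).trans (map_zero _)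
  obtain ⟨q, hq, hqe⟩ : p.2 + Complex.I • p.1 ∈ R := hRt ▸ Submodule.mem_top
  have hqe' : q.2 + Complex.I • q.1 = p.2 + Complex.I • p.1 := hqe
  have e2 : p.2 - q.2 = -(Complex.I • (p.1 - q.1)) := by
    rw [smul_sub, neg_sub, sub_eq_sub_iff_add_eq_add, hqe'.symm]; abel
  have e1 : p.1 - q.1 = 0 := hd (-Complex.I) (by simp) _ fun s hs => by
    have : inner ℂ s.2 (p.1 - q.1) = -(Complex.I * inner ℂ s.1 (p.1 - q.1)) := by
      rw [inner_sub_right, hp s hs, h1 q hq s hs, ← inner_sub_right, e2, inner_neg_right, inner_smul_right]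
    rw [← inner_conj_symm, inner_add_left, inner_smul_left, this]
    simp [inner_sub_left, mul_sub]
  rw [e1, smul_zero, neg_zero] at e2
  rwa [show p = q from Prod.ext (sub_eq_zero.1 e1) (sub_eq_zero.1 e2)]

lemma LinearPMap.isClosable_and_isSelfAdjoint_closure {T : E →ₗ.[ℂ] E} (hT : Dense (T.domain : Set E))
    (hs : ∀ p ∈ T.graph, ∀ q ∈ T.graph, inner ℂ q.2 p.1 = inner ℂ q.1 p.2)
    (hd : ∀ c : ℂ, c * c = -1 → ∀ h : E, (∀ q ∈ T.graph, inner ℂ h (q.2 + c • q.1) = 0) → h = 0) :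
    T.IsClosable ∧ IsSelfAdjoint T.closure := by
  have hmem := mem_topologicalClosure_iff_of_dense hs hd
  have hadj : ∀ {S : E →ₗ.[ℂ] E}, Dense (S.domain : Set E) → T.graph ≤ S.graph →
      S.graph ≤ T.graph.topologicalClosure → S.adjoint.graph = T.graph.topologicalClosure := by
    intro S hS h1 h2
    ext p
    rw [LinearPMap.adjoint_graph_eq_graph_adjoint hS, Submodule.mem_adjoint_iff, hmem]
    constructor
    · intro h q hq; exact sub_eq_zero.1 (h q.1 q.2 (h1 hq))
    · intro h a b hab
      have hcl : _root_.IsClosed {q : E × E | inner ℂ q.2 p.1 = inner ℂ q.1 p.2} :=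
        isClosed_eq (by fun_prop) (by fun_prop)
      exact sub_eq_zero.2 (closure_minimal (fun q hq => h q hq) hcl (h2 hab))
  have h1 := hadj hT le_rfl T.graph.le_topologicalClosure
  have hc : T.IsClosable := ⟨_, h1.symm⟩
  have h2 := hc.graph_closure_eq_closure_graph
  refine ⟨hc, LinearPMap.isSelfAdjoint_def.2 (LinearPMap.eq_of_eq_graph ?_)⟩
  rw [hadj (hT.mono (LinearPMap.le_closure T).1) (LinearPMap.le_graph_of_le (LinearPMap.le_closure T))
    h2.ge, h2]

end SelfAdjointCriterion

section Coulomb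

variable {d : ℕ} {α : Fin d → SpinMatrix d} {β : SpinMatrix d} {ν : ℝ}
  {ξ : Space d → Spinor d}

lemma spinOp_coulomb (x : Space d) (v : Spinor d) :
    spinOp (coulombPotential ν x) v = (-ν / ‖x‖) • v := by
  rw [coulombPotential, spinOp_smul, spinOp_one, Complex.coe_smul]

lemma coulomb_hermitian (x : Space d) : (coulombPotential ν x).IsHermitian := by
  rw [Matrix.IsHermitian, coulombPotential, Matrix.conjTranspose_smul, Matrix.conjTranspose_one]
  simp

lemma matrixComm_coulomb (A : SpinMatrix d) (x : Space d) : matrixComm A (coulombPotential ν x) = 0 := by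
  simp [matrixComm, coulombPotential]

lemma contDiffOn_coulomb (i k : Fin (spinorDim d)) :
    ContDiffOn ℝ ∞ (fun x => coulombPotential ν x i k) {0}ᶜ := by
  have h : ContDiffOn ℝ ∞ (fun x : Space d => -ν / ‖x‖) {0}ᶜ :=
    contDiffOn_const.div (fun x hx => (contDiffAt_norm ℝ hx).contDiffWithinAt)
      fun x hx => norm_ne_zero_iff.2 hx
  exact (Complex.ofRealCLM.contDiff.comp_contDiffOn h).mul contDiffOn_const

lemma norm_coulomb_le {r : ℝ} (hr : 0 < r) {x : Space d} (hx : r ≤ ‖x‖) (i k : Fin (spinorDim d)) :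
    ‖coulombPotential ν x i k‖ ≤ |ν| / r := by
  have h1 : ‖(1 : SpinMatrix d) i k‖ ≤ 1 := by rw [Matrix.one_apply]; split_ifs <;> simp
  have h2 : ‖((-ν / ‖x‖ : ℝ) : ℂ)‖ ≤ |ν| / r := by
    rw [Complex.norm_real, norm_div, norm_neg, norm_norm, norm_eq_abs]; gcongr
  rw [coulombPotential, Matrix.smul_apply, norm_smul]
  exact (mul_le_mul h2 h1 (norm_nonneg _) (by positivity)).trans_eq (mul_one _)

lemma sum_sq_apply_coordVec_le (A : Space d →L[ℝ] ℝ) : ∑ j, A (coordVec j) ^ 2 ≤ ‖A‖ ^ 2 := by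
  set u : Space d := ∑ j, A (coordVec j) • coordVec j with hu
  have h1 : A u = ∑ j, A (coordVec j) ^ 2 := by simp [hu, sq]
  have h2 : ‖u‖ ^ 2 = ∑ j, A (coordVec j) ^ 2 := by
    rw [EuclideanSpace.norm_sq_eq]; simp [hu, coordVec, Pi.single_apply]
  have h3 := (le_abs_self _).trans (A.le_opNorm u); rw [h1, ← h2] at h3; rw [← h2]
  nlinarith [norm_nonneg u, norm_nonneg A]

lemma tupleNorm_grad_coulomb {x : Space d} (hx : x ≠ 0) :
    tupleNorm (gradMatrix (coulombPotential ν) x) ≤ |ν| / ‖x‖ ^ 2 := by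
  have hx' : 0 < ‖x‖ := norm_pos_iff.2 hx
  have hN := ((contDiffAt_norm ℝ hx (n := 1)).differentiableAt (by simp)).hasFDerivAt
  have hN1 : ‖fderiv ℝ (fun y : Space d => ‖y‖) x‖ ≤ 1 := by
    simpa using norm_fderiv_le_of_lipschitz ℝ (lipschitzWith_one_norm (E := Space d)) (x₀ := x)
  have hs : HasFDerivAt (fun y : Space d => -ν / ‖y‖)
      ((-ν * -(‖x‖ ^ 2)⁻¹) • fderiv ℝ (fun y : Space d => ‖y‖) x) x :=
    ((hasDerivAt_inv hx'.ne').const_mul (-ν)).comp_hasFDerivAt x hN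
  set A := (-ν * -(‖x‖ ^ 2)⁻¹) • fderiv ℝ (fun y : Space d => ‖y‖) x
  have hA : ‖A‖ ≤ |ν| / ‖x‖ ^ 2 := by
    rw [norm_smul, norm_mul, norm_neg, norm_neg, norm_inv, norm_pow, norm_norm, ← div_eq_mul_inv]
    exact mul_le_of_le_one_right (by positivity) hN1
  have he : ∀ j v, spinOp (gradMatrix (coulombPotential ν) x j) v = A (coordVec j) • v := by
    intro j v
    have e : (fun y => spinOp (coulombPotential (d := d) ν y)) =
        fun y => (-ν / ‖y‖) • ContinuousLinearMap.id ℝ (Spinor d) := by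
      funext y; ext1 v; exact spinOp_coulomb y v
    rw [← fderiv_spinOp contDiffOn_coulomb hx, e,
      (hs.smul_const (ContinuousLinearMap.id ℝ (Spinor d))).fderiv]
    rfl
  refine tupleNorm_le (by positivity) fun v => ?_
  simp only [he, norm_smul, mul_pow, ← sum_mul, norm_eq_abs, sq_abs]; gcongr
  exact (sum_sq_apply_coordVec_le A).trans (by gcongr)

lemma coulomb_hardy (hd : 3 ≤ d) (hα : IsDiracMatrices α β) (hξ : IsTest ξ) :
    MemLp (fun x => spinOp (coulombPotential ν x) (ξ x)) 2 ∧
      √(∫ x, ‖spinOp (coulombPotential ν x) (ξ x)‖ ^ 2) ≤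
        2 * |ν| / ((d : ℝ) - 2) * √(∫ x, ‖dirac (IsDiracMatrices.skew α) ξ x‖ ^ 2) := by
  have hd' : (0 : ℝ) < d - 2 := by
    have : (3 : ℝ) ≤ d := by exact_mod_cast hd
    linarith
  have h : H1Approx (fun _ => ξ) ξ fun j => pd j ξ :=
    ⟨fun _ => hξ, L2Conv.const (hξ.memLp 2), fun j => L2Conv.const ((hξ.pd j).memLp 2)⟩
  have e : ∀ x, spinOp (coulombPotential ν x) (ξ x) = (-ν) • ‖x‖⁻¹ • ξ x := fun x => by
    rw [spinOp_coulomb, smul_smul, div_eq_mul_inv]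
  have e2 : ∀ x, ‖spinOp (coulombPotential ν x) (ξ x)‖ ^ 2 = ν ^ 2 * ((‖x‖ ^ 2)⁻¹ * ‖ξ x‖ ^ 2) := fun x => by
    rw [e, norm_smul, norm_smul, norm_inv, norm_norm, norm_neg, mul_pow, mul_pow, inv_pow,
      norm_eq_abs, sq_abs]
  have h1 := (h.hardy hd).2; rw [← integral_dirac_sq hα.isClifford hξ] at h1
  refine ⟨((h.memLp_inv_smul hd).const_smul (-ν)).ae_eq (.of_forall fun x => (e x).symm), ?_⟩
  simp only [e2]; rw [integral_const_mul]; refine Real.sqrt_le_iff.2 ⟨by positivity, ?_⟩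
  rw [mul_pow, sq_sqrt (integral_nonneg fun x => sq_nonneg _), div_pow, mul_pow, sq_abs]
  rw [div_mul_eq_mul_div, le_div_iff₀ (by positivity)]
  nlinarith [mul_le_mul_of_nonneg_left h1 (sq_nonneg ν)]

lemma coulomb_maps_test (hd : 3 ≤ d) (hα : IsDiracMatrices α β)
    (hξ : IsTest ξ) : MemLp (diracExpr α β 0 (coulombPotential ν) ξ) 2 := by
  refine (((hξ.dirac (IsDiracMatrices.skew α)).memLp 2).add (coulomb_hardy hd hα hξ).1).ae_eq
    (.of_forall fun x => (diracExpr_eq α β _ ξ x).symm)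

lemma coulomb_dense (hd : 3 ≤ d) (hα : IsDiracMatrices α β) (hν : 2 * |ν| / ((d : ℝ) - 2) < 1) {c : ℂ}
    (hc : c * c = -1) {h : Space d → Spinor d} (hh : MemLp h 2)
    (horth : ∀ ξ, IsTest ξ → ∫ x, ⟪h x, diracExpr α β 0 (coulombPotential ν) ξ x + c • ξ x⟫ = 0) :
    h =ᵐ[volume] 0 := by
  set γ := IsDiracMatrices.skew α
  have hγ : IsClifford γ := hα.isClifford
  set J : Spinor d →L[ℝ] Spinor d := spinOp (c • 1)
  have hJa : ∀ v, J v = c • v := fun v => by rw [spinOp_smul, spinOp_one]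
  have hJ2 : ∀ v, J (J v) = -v := fun v => by rw [hJa, hJa, smul_smul, hc, neg_one_smul]
  have hJγ : ∀ j v, J (γ j v) = γ j (J v) := fun j v => by
    rw [hJa, hJa]; exact (spinOp_map_smul _ _ _).symm
  have hJ : ∀ u v, ⟪J u, v⟫ = -⟪u, J v⟫ := by
    have hI : c = Complex.I ∨ c = -Complex.I := by
      rw [← sub_eq_zero, ← sub_eq_zero (a := c) (b := -Complex.I), ← mul_eq_zero]
      linear_combination hc - Complex.I_mul_I
    intro u v; rw [hJa, hJa]
    rcases hI with rfl | rfl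
    · exact inner_smul_I u v
    · rw [neg_smul, neg_smul, inner_neg_left, inner_neg_right, inner_smul_I]
  obtain ⟨η, hη, hconv⟩ := L2Conv.exists_helmholtz hh
  set w : ℕ → Space d → Spinor d := fun n x => dirac γ (η n) x - J (η n x)
  have hw : ∀ n, IsTest (w n) := fun n => ((hη n).dirac γ).sub ((hη n).clm J)
  have hconv' : L2Conv (fun n x => dirac γ (w n) x + J (w n x)) h :=
    hconv.congr (fun n => .of_forall fun x => (dirac_add_sub hγ hJ2 hJγ (hη n) x).symm) ae_eq_rfl
  set b := 2 * |ν| / ((d : ℝ) - 2)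
  have hb0 : 0 ≤ b := by
    have : (3 : ℝ) ≤ d := by exact_mod_cast hd
    exact div_nonneg (by positivity) (by linarith)
  have hle : ∀ n, ∫ x, ⟪h x, dirac γ (w n) x + J (w n x)⟫ ≤
      √(∫ x, ‖h x‖ ^ 2) * (b * √(∫ x, ‖dirac γ (w n) x + J (w n x)‖ ^ 2)) := by
    intro n
    obtain ⟨hm, hv⟩ := coulomb_hardy (ν := ν) hd hα (hw n)
    have hz := horth _ (hw n)
    have e : ∀ x, ⟪h x, diracExpr α β 0 (coulombPotential ν) (w n) x + c • w n x⟫ =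
        ⟪h x, dirac γ (w n) x + J (w n x)⟫ +
          ⟪h x, spinOp (coulombPotential ν x) (w n x)⟫ := fun x => by
      rw [diracExpr_eq, hJa, ← inner_add_right, add_right_comm]
    simp only [e] at hz
    rw [integral_add (integrable_inner hh (hconv'.memLp n)) (integrable_inner hh hm)] at hz
    have h1 := (abs_le.1 (abs_integral_inner_le hh hm)).1
    have h2 : √(∫ x, ‖dirac γ (w n) x‖ ^ 2) ≤ √(∫ x, ‖dirac γ (w n) x + J (w n x)‖ ^ 2) := by
      refine sqrt_le_sqrt ?_
      rw [integral_dirac_add_sq hγ hJ hJ2 hJγ (hw n), integral_dirac_sq hγ (hw n)]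
      exact le_add_of_nonneg_right (integral_nonneg fun x => sq_nonneg _)
    have h3 := mul_le_mul_of_nonneg_left (hv.trans (mul_le_mul_of_nonneg_left h2 hb0))
      (sqrt_nonneg (∫ x, ‖h x‖ ^ 2))
    linarith
  have hlim := le_of_tendsto_of_tendsto' ((L2Conv.const hh).inner hconv')
    ((hconv'.norm_sq.sqrt.const_mul b).const_mul _) hle
  simp only [real_inner_self_eq_norm_sq] at hlim
  have hN : 0 ≤ ∫ x, ‖h x‖ ^ 2 := integral_nonneg fun x => sq_nonneg _
  rw [mul_left_comm, Real.mul_self_sqrt hN] at hlim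
  have h0 : ∫ x, ‖h x‖ ^ 2 = 0 := by nlinarith
  rw [integral_eq_zero_iff_of_nonneg (fun x => sq_nonneg _) (integrable_norm_sq hh)] at h0
  filter_upwards [h0] with x hx; simpa using hx

lemma coulomb_integral_pd_le (hd : 3 ≤ d) (hα : IsDiracMatrices α β)
    (hν : 2 * |ν| / ((d : ℝ) - 2) < 1 / 2) (hξ : IsTest ξ) (j : Fin d) :
    ∫ x, ‖pd j ξ x‖ ^ 2 ≤ ∫ x, ‖(2 : ℝ) • diracExpr α β 0 (coulombPotential ν) ξ x‖ ^ 2 := by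
  obtain ⟨hm, hv⟩ := coulomb_hardy (ν := ν) hd hα hξ
  have h1 := sqrt_integral_norm_add_sq_le (coulomb_maps_test (ν := ν) hd hα hξ) hm.neg
  simp only [diracExpr_eq, Pi.neg_apply, add_neg_cancel_right, norm_neg] at h1
  simp only [← diracExpr_eq α β] at h1
  set D := √(∫ x, ‖dirac (IsDiracMatrices.skew α) ξ x‖ ^ 2) with hD
  have h2 : D ≤ 2 * √(∫ x, ‖diracExpr α β 0 (coulombPotential ν) ξ x‖ ^ 2) := by
    have := mul_le_mul_of_nonneg_right hν.le (sqrt_nonneg (∫ x, ‖dirac (IsDiracMatrices.skew α) ξ x‖ ^ 2))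
    rw [← hD] at this; linarith
  have h3 := pow_le_pow_left₀ (sqrt_nonneg _) h2 2
  rw [mul_pow, sq_sqrt (integral_nonneg fun x => sq_nonneg _),
    sq_sqrt (integral_nonneg fun x => sq_nonneg _), integral_dirac_sq hα.isClifford hξ] at h3
  simp only [norm_smul, mul_pow, norm_ofNat]; rw [integral_const_mul]
  exact (single_le_sum (f := fun j => ∫ x, ‖pd j ξ x‖ ^ 2)
    (fun j _ => integral_nonneg fun x => sq_nonneg _) (mem_univ j)).trans h3

variable {V : Space d → SpinMatrix d}

lemma mem_diracMinimalGraph {ξ : Space d → Spinor d} (hξ : IsTest ξ)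
    (hm : MemLp (diracExpr α β 0 V ξ) 2 volume) :
    ((hξ.memLp 2).toLp ξ, hm.toLp _) ∈ diracMinimalGraph α β 0 V :=
  ⟨ξ, ⟨hξ.1, hξ.2⟩, (hξ.memLp 2).coeFn_toLp, hm.coeFn_toLp⟩

lemma dense_diracMinimal_domain (hm : ∀ ξ, IsTest ξ → MemLp (diracExpr α β 0 V ξ) 2) :
    Dense ((diracMinimal α β 0 V).domain : Set (SpinorL2 d)) := by
  intro f
  obtain ⟨u, hu, hc⟩ := L2Conv.exists_test (Lp.memLp f)
  have := hc.tendsto_toLp; rw [Lp.toLp_coeFn] at this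
  refine mem_closure_of_tendsto this (.of_forall fun n => ?_)
  have h := mem_diracMinimalGraph (hu n) (hm _ (hu n)); rw [← diracMinimal_graph] at h
  exact LinearPMap.mem_domain_iff.2 ⟨_, h⟩

lemma diracMinimalGraph_symm (hα : IsDiracMatrices α β) (hH : ∀ x, (V x).IsHermitian)
    (hm : ∀ ξ, IsTest ξ → MemLp (fun x => spinOp (V x) (ξ x)) 2) {p q : SpinorL2 d × SpinorL2 d}
    (hp : p ∈ diracMinimalGraph α β 0 V) (hq : q ∈ diracMinimalGraph α β 0 V) :
    inner ℂ q.2 p.1 = inner ℂ q.1 p.2 := by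
  have key : ∀ q ∈ diracMinimalGraph α β 0 V, (inner ℂ q.2 p.1 : ℂ).re = (inner ℂ q.1 p.2 : ℂ).re := by
    rintro q ⟨ξ, hξ, hξ1, hξ2⟩
    obtain ⟨φ, hφ, hφ1, hφ2⟩ := hp
    have tξ : IsTest ξ := ⟨hξ.1, hξ.2⟩
    have tφ : IsTest φ := ⟨hφ.1, hφ.2⟩
    have h1 : ∫ x, ⟪q.2 x, p.1 x⟫ = ∫ x, ⟪diracExpr α β 0 V ξ x, φ x⟫ :=
      integral_congr_ae (by filter_upwards [hξ2, hφ1] with x h1 h2; rw [h1, h2])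
    have h2 : ∫ x, ⟪q.1 x, p.2 x⟫ = ∫ x, ⟪ξ x, diracExpr α β 0 V φ x⟫ :=
      integral_congr_ae (by filter_upwards [hξ1, hφ2] with x h1 h2; rw [h1, h2])
    rw [re_inner_L2, re_inner_L2, h1, h2]
    simp only [diracExpr_eq, inner_add_left, inner_add_right]
    rw [integral_add (integrable_inner ((tξ.dirac _).memLp 2) (tφ.memLp 2))
      (integrable_inner (hm ξ tξ) (tφ.memLp 2)),
      integral_add (integrable_inner (tξ.memLp 2) ((tφ.dirac _).memLp 2))
      (integrable_inner (tξ.memLp 2) (hm φ tφ)), integral_inner_dirac hα.isClifford tξ tφ.smooth]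
    simp only [spinOp_symm (hH _)]
  have h2 := key _ ((diracMinimalGraph α β 0 V).smul_mem Complex.I hq)
  rw [Prod.smul_fst, Prod.smul_snd, inner_smul_left, inner_smul_left] at h2
  refine Complex.ext (key q hq) ?_
  simpa using h2

theorem coulomb_stationaryAssumption (hd : 3 ≤ d) (hα : IsDiracMatrices α β)
    (hν : 2 * |ν| / ((d : ℝ) - 2) < 1 / 2) : StationaryAssumption α β 0 (coulombPotential ν) := by
  have hm : ∀ ξ, IsTest ξ → MemLp (diracExpr α β 0 (coulombPotential ν) ξ) 2 := fun ξ hξ =>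
    coulomb_maps_test hd hα hξ
  have hG := diracMinimal_graph α β (coulombPotential ν)
  obtain ⟨hc, hs⟩ := LinearPMap.isClosable_and_isSelfAdjoint_closure (dense_diracMinimal_domain hm)
    (fun p hp q hq => diracMinimalGraph_symm hα coulomb_hermitian (fun ξ hξ => (coulomb_hardy hd hα hξ).1)
      (hG ▸ hp) (hG ▸ hq))
    fun c hc h hh => by
      refine Lp.ext (Filter.EventuallyEq.trans ?_ (Lp.coeFn_zero _ _ _).symm)
      refine coulomb_dense hd hα (hν.trans (by norm_num)) hc (Lp.memLp h) fun ξ hξ => ?_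
      have := congrArg Complex.re (hh _ (hG ▸ mem_diracMinimalGraph hξ (hm ξ hξ)))
      rw [re_inner_L2] at this; refine (integral_congr_ae ?_).trans this
      filter_upwards [(hm ξ hξ).coeFn_toLp, (hξ.memLp 2).coeFn_toLp, Lp.coeFn_add ((hm ξ hξ).toLp _)
        (c • (hξ.memLp 2).toLp ξ), Lp.coeFn_smul c ((hξ.memLp 2).toLp ξ)] with x h1 h2 h3 h4
      rw [h3, Pi.add_apply, h4, Pi.smul_apply, h1, h2]
  refine ⟨coulomb_hermitian, contDiffOn_coulomb,
    fun r hr => ⟨|ν| / r, fun x hx i k => norm_coulomb_le hr hx i k⟩, fun ξ hξ => hm ξ ⟨hξ.1, hξ.2⟩, hc, hs,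
    fun f hf => ?_⟩
  obtain ⟨y, hmem⟩ := LinearPMap.mem_domain_iff.1 hf
  change _ ∈ (diracMinimal α β 0 (coulombPotential ν)).closure.graph at hmem
  rw [← hc.graph_closure_eq_closure_graph, hG] at hmem
  obtain ⟨p, hp, hlim⟩ := mem_closure_iff_seq_limit.1 hmem
  choose φ hφ hφ1 hφ2 using hp
  have tφ : ∀ n, IsTest (φ n) := fun n => ⟨(hφ n).1, (hφ n).2⟩
  have e1 : ∀ n, ((tφ n).memLp 2).toLp (φ n) = (p n).1 := fun n =>
    Lp.ext (((tφ n).memLp 2).coeFn_toLp.trans (hφ1 n).symm)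
  have e2 : ∀ n, (hm _ (tφ n)).toLp _ = (p n).2 := fun n =>
    Lp.ext ((hm _ (tφ n)).coeFn_toLp.trans (hφ2 n).symm)
  have c1 : L2Conv φ f := L2Conv.of_tendsto_toLp (fun n => (tφ n).memLp 2) (Lp.memLp f) (by
    simp only [e1, Lp.toLp_coeFn]
    exact (continuous_fst.tendsto _).comp hlim)
  have c2 : L2Conv (fun n => diracExpr α β 0 (coulombPotential ν) (φ n)) y :=
    L2Conv.of_tendsto_toLp (fun n => hm _ (tφ n)) (Lp.memLp _) (by
      simp only [e2, Lp.toLp_coeFn]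
      exact (continuous_snd.tendsto _).comp hlim)
  choose g hg using fun j => (c2.const_smul 2).exists_of_le (f := fun n => pd j (φ n))
    (fun n => ((tφ n).pd j).memLp 2) fun m n => by
      have := coulomb_integral_pd_le hd hα hν ((tφ m).sub (tφ n)) j
      simp only [pd_sub_fun (tφ m).differentiable (tφ n).differentiable, diracExpr_eq,
        dirac_sub_fun _ (tφ m).differentiable (tφ n).differentiable, map_sub] at this
      refine this.trans_eq (integral_congr_ae (.of_forall fun x => ?_))
      simp only [diracExpr_eq, ← smul_sub]
      congr 3; abel
  exact H1Approx.memH1 ⟨tφ, c1, hg⟩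

end Coulomb

theorem theorem1p2 (d : ℕ) (hd : 3 ≤ d) (α : Fin d → SpinMatrix d) (β : SpinMatrix d)
    (hαβ : IsDiracMatrices α β) :
    (∀ V : Space d → SpinMatrix d, StationaryAssumption α β 0 V → ∀ C₁ C₂ : ℝ, 0 < C₁ → 0 < C₂ →
        (∀ x, x ≠ 0 → tupleNorm (gradMatrix V x) ≤ C₁ / ‖x‖ ^ 2) →
        (∀ x, x ≠ 0 → ∀ j, opNorm (matrixComm (α j) (V x)) ≤ C₂ / ‖x‖) →
        (Odd d → 5 ≤ d → HasScalarLimit V ∨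
          ∀ x, x ≠ 0 → tupleNorm (fun j => matrixComm (α j) (V x)) ≤ C₂ / ‖x‖) →
        4 * C₁ / ((d : ℝ) - 2) + C₂ < 1 →
        pointSpectrum (diracHamiltonian α β 0 V) = ∅) ∧
    (∀ ν : ℝ, 4 * |ν| / ((d : ℝ) - 2) < 1 → StationaryAssumption α β 0 (coulombPotential ν) ∧
      (∀ x : Space d, x ≠ 0 → tupleNorm (gradMatrix (coulombPotential ν) x) ≤ |ν| / ‖x‖ ^ 2) ∧
      (∀ x : Space d, ∀ j, matrixComm (α j) (coulombPotential ν x) = 0) ∧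
      pointSpectrum (diracHamiltonian α β 0 (coulombPotential ν)) = ∅) := by
  refine ⟨fun V hV C₁ C₂ h1 h2 hgrad hcomm hodd hlt =>
    hV.pointSpectrum_eq_empty hd hαβ h1.le h2.le hgrad hcomm hodd hlt, fun ν hν => ?_⟩
  have hS : StationaryAssumption α β 0 (coulombPotential ν) :=
    coulomb_stationaryAssumption hd hαβ (by
      have : 4 * |ν| / ((d : ℝ) - 2) = 2 * (2 * |ν| / ((d : ℝ) - 2)) := by ring
      linarith)
  refine ⟨hS, fun x hx => tupleNorm_grad_coulomb hx, fun x j => matrixComm_coulomb _ x,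
    hS.pointSpectrum_eq_empty (C₁ := |ν|) (C₂ := 0) hd hαβ (abs_nonneg ν) le_rfl
      (fun x hx => tupleNorm_grad_coulomb hx) (fun x hx j => ?_) (fun _ _ => Or.inr fun x hx => ?_)
      (by rwa [add_zero])⟩
  · simp [matrixComm_coulomb, opNorm]
  · exact tupleNorm_le (by simp) fun v => by simp [matrixComm_coulomb, spinOp_apply]

end
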